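/- **Setting.** Let $d\ge 2$, let $\Omega\subset\mathbb R^d$ be open and bounded with $C^1$ boundary, outward unit normal $n(x)$ and surface measure $\pi$ on $\partial\Omega$. Let $m$ be a ($\sigma$-finite) nonnegative Borel measure on $\mathbb R^d$, invariant under the orthogonal group, with support $V$, such that $0\in V$, $m(\{0\})=0$ and $m(V\cap B(0,r))>0$ for all $r>0$. Put $\Gamma_\pm=\{(x,v)\in\partial\Omega\times V:\ \pm v\cdot n(x)>0\}$, $d\mu_\pm=|v\cdot n(x)|\,\pi(dx)\otimes m(dv)$ on $\Gamma_\pm$, $L^1_\pm=L^1(\Gamma_\pm,\mu_\pm)$, and for $s\in\mathbb N=\{0,1,\dots\}$ $$\mathbb X_s=L^1\big(\Omega\times V,\max(1,|v|^{-s})\,dx\otimes m(dv)\big),\qquad \mathbb Y^{\pm}_s=L^1\big(\Gamma_\pm,\max(1,|v|^{-s})\,d\mu_\pm\big)$$ (complex-valued functions). Let $t_-(x,v)=\inf\{s>0:\ x-sv\notin\Omega\}$ for $(x,v)\in\overline\Omega\times V$, and write $\tau_-=t_-$ on $\partial\Omega\times V$. For $\operatorname{Re}\lambda\ge0$ set $$M_\lambda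 u(x,v)=e^{-\lambda\tau_-(x,v)}u(x-\tau_-(x,v)v,v),\qquad G_\lambda\varphi(x,v)=\int_0^{\tau_-(x,v)}e^{-\lambda s}\varphi(x-sv,v)\,ds\qquad((x,v)\in\Gamma_+),$$ and for $\operatorname{Re}\lambda>0$ $$\Xi_\lambda u(x,v)=\mathbf 1_{\{t_-(x,v)<\infty\}}e^{-\lambda t_-(x,v)}u(x-t_-(x,v)v,v)\qquad((x,v)\in\Omega\times V),$$ so that $M_\lambda:L^1_-\to L^1_+$, $G_\lambda:\mathbb X_0\to L^1_+$, $\Xi_\lambda:L^1_-\to\mathbb X_0$. Let $H:L^1_+\to L^1_-$ be given by $$H\psi(x,v)=\int_{v'\cdot n(x)>0}k(x,v,v')\,\psi(x,v')\,|v'\cdot n(x)|\,m(dv')$$ with a measurable kernel $k\ge0$ such that $\int_{v\cdot n(x)<0}k(x,v,v')|v\cdot n(x)|\,m(dv)=1$ for ($\mu_+$-almost every) $(x,v')\in\Gamma_+$. Assume: 1. $H\in\mathscr B(L^1_+,\mathbb Y^-_{j+1})$ for some $j\in\mathbb N$, and $N_H:=\sup\{j\in\mathbb N:\ H\in\mathscr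 B(L^1_+,\mathbb Y^-_{j+1})\}<\infty$; 2. $HM_0H:L^1_+\to L^1_-$ is weakly compact; 3. $M_0H$ is irreducible on $L^1_+$ (its only invariant closed ideals are $\{0\}$ and $L^1_+$); 4. $p\in\mathbb N$ and $C>0$ are such that $\displaystyle\int_{\mathbb R}\big\|(M_{\varepsilon+i\eta}H)^{p}\big\|_{\mathscr B(L^1_+)}\,d\eta\le C$ for all $\varepsilon\ge0$. For $n\in\mathbb N$ and $\operatorname{Re}\lambda>0$ let $$\Upsilon_n(\lambda)f=\sum_{j=n}^\infty\Xi_\lambda H(M_\lambda H)^jG_\lambda f,\qquad f\in\mathbb X_0 .$$ For a Banach space $X$, $\mathscr C_0^{N}(\mathbb R,X)$ is the space of $C^N$ functions $h:\mathbb R\to X$ with $\lim_{|\eta|\to\infty}\|h^{(j)}(\eta)\|_X=0$ for all $j\le N$, normed by $\sup_\eta\max_{j\le N}\|h^{(j)}(\eta)\|_X$. **Theorem.** Let $f\in\mathbb X_{N_H+1}$ satisfy $\int_{\Omega\times V}f\,dx\otimes m(dv)=0$ and let $n\ge0$. Then the series defining $\Upsilon_n(\lambda)f$ converges in $\mathbb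 X_0$ whenever $\operatorname{Re}\lambda>0$; for every $\varepsilon>0$ the function $\eta\mapsto\Upsilon_n(\varepsilon+i\eta)f$ belongs to $\mathscr C_0^{N_H}(\mathbb R,\mathbb X_0)$; and, as $\varepsilon\to0^+$, these functions converge in $\mathscr C_0^{N_H}(\mathbb R,\mathbb X_0)$ to a limit $\eta\mapsto\Psi_n(\eta)f$. If moreover $n\ge2^{N_H}p$, then for every $0\le j\le N_H$ the derivative $\eta\mapsto\frac{d^j}{d\eta^j}\Psi_n(\eta)f\in\mathbb X_0$ is (Bochner) integrable on $\mathbb R$. -/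

import Mathlib

open Set Filter Topology MeasureTheory
open scoped NNReal ENNReal

namespace CollisionlessTransport

noncomputable section

/-! ### Generalities on maps between `L¹` spaces -/

/-- The element of `L¹(μ)` represented by an integrable function `g`. -/
def toL1 {α : Type*} [MeasurableSpace α] (μ : Measure α) (g : α → ℂ) : Lp ℂ 1 μ :=
  open Classical in if h : MemLp g 1 μ then h.toLp g else 0

/-- The operator norm `sup {‖T u‖ : ‖u‖ ≤ 1}` (of a linear map `T`), with values in `[0, ∞]`. -/
def opENorm {X Y : Type*} [NormedAddCommGroup X] [NormedAddCommGroup Y] (T : X → Y) : ℝ≥0∞ :=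
  ⨆ u ∈ Metric.closedBall (0 : X) 1, ‖T u‖ₑ

/-- `T` maps the unit ball to a relatively weakly compact set. -/
def WeaklyCompactMap {X Y : Type*} [NormedAddCommGroup X] [NormedAddCommGroup Y]
    [NormedSpace ℂ Y] (T : X → Y) : Prop :=
  IsCompact (closure (toWeakSpace ℂ Y '' (T '' Metric.closedBall 0 1)))

/-- Irreducibility of an operator on the Banach lattice `L¹(μ)`: the only closed (order) ideals
which are invariant under `T` are `{0}` and the whole space. -/
def IrreducibleOnL1 {α : Type*} [MeasurableSpace α] {μ : Measure α}
    (T : Lp ℂ 1 μ → Lp ℂ 1 μ) : Prop :=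
  ∀ I : Submodule ℂ (Lp ℂ 1 μ), IsClosed (I : Set (Lp ℂ 1 μ)) →
    (∀ g ∈ I, ∀ f : Lp ℂ 1 μ, (∀ᵐ z ∂μ, ‖f z‖ ≤ ‖g z‖) → f ∈ I) →
    (∀ f ∈ I, T f ∈ I) → I = ⊥ ∨ I = ⊤

/-- The space `C₀ᴺ(ℝ, X)`: functions of class `Cᴺ` which tend to `0` at infinity together with
their derivatives up to order `N`. -/
def MemC0 {X : Type*} [NormedAddCommGroup X] [NormedSpace ℝ X] (N : ℕ) (h : ℝ → X) : Prop :=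
  ContDiff ℝ N h ∧ ∀ j ≤ N, Tendsto (iteratedDeriv j h) (cocompact ℝ) (𝓝 0)

/-- Convergence `h ε → g` as `ε → 0⁺` for the norm `sup_η max_{j ≤ N} ‖(d/dη)ʲ h(η)‖`
of `C₀ᴺ(ℝ, X)`. -/
def TendstoInC0 {X : Type*} [NormedAddCommGroup X] [NormedSpace ℝ X] (N : ℕ)
    (h : ℝ → ℝ → X) (g : ℝ → X) : Prop :=
  (∀ ε > 0, MemC0 N (h ε)) ∧ MemC0 N g ∧
    ∀ j ≤ N, TendstoUniformly (fun ε => iteratedDeriv j (h ε)) (iteratedDeriv j g) (𝓝[>] 0)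

/-! ### Geometry of the phase space -/

/-- Position space and velocity space. -/
abbrev Vec (d : ℕ) : Type := EuclideanSpace ℝ (Fin d)

variable {d : ℕ}

/-- `ρ` is a local `C¹` defining function of `Ω` near `x`: near `x` the set `Ω` is `{ρ < 0}`, and
`∇ρ(x) ≠ 0`. -/
def IsDefiningFunctionAt (Ω : Set (Vec d)) (x : Vec d) (ρ : Vec d → ℝ) : Prop :=
  ContDiffAt ℝ 1 ρ x ∧ gradient ρ x ≠ 0 ∧ ∀ᶠ y in 𝓝 x, (y ∈ Ω ↔ ρ y < 0)

/-- `Ω` has a `C¹` boundary (and lies locally on one side of it). -/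
def HasC1Boundary (Ω : Set (Vec d)) : Prop :=
  ∀ x ∈ frontier Ω, ∃ ρ, IsDefiningFunctionAt Ω x ρ

/-- The outward unit normal `n(x) = ∇ρ(x) / |∇ρ(x)|` at `x ∈ ∂Ω`; it does not depend on the
defining function `ρ`. -/
def outwardNormal (Ω : Set (Vec d)) (x : Vec d) : Vec d :=
  open Classical in
  if h : x ∈ frontier Ω ∧ ∃ ρ, IsDefiningFunctionAt Ω x ρ then
    ‖gradient h.2.choose x‖⁻¹ • gradient h.2.choose x
  else 0

/-- The normal velocity `v · n(x)`. -/
def normalVelocity (Ω : Set (Vec d)) (x v : Vec d) : ℝ := inner ℝ v (outwardNormal Ω x)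

/-- The outgoing part `Γ₊ = {(x, v) ∈ ∂Ω × V : v · n(x) > 0}`, where `V = supp m`. -/
def GammaPlus (Ω : Set (Vec d)) (m : Measure (Vec d)) : Set (Vec d × Vec d) :=
  {z | z.1 ∈ frontier Ω ∧ z.2 ∈ m.support ∧ 0 < normalVelocity Ω z.1 z.2}

/-- The incoming part `Γ₋ = {(x, v) ∈ ∂Ω × V : v · n(x) < 0}`, where `V = supp m`. -/
def GammaMinus (Ω : Set (Vec d)) (m : Measure (Vec d)) : Set (Vec d × Vec d) :=
  {z | z.1 ∈ frontier Ω ∧ z.2 ∈ m.support ∧ normalVelocity Ω z.1 z.2 < 0}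

/-- The measure `|v · n(x)| π(dx) ⊗ m(dv)` on `∂Ω × ℝᵈ`, where `π` is the surface measure. -/
def fluxMeasure (Ω : Set (Vec d)) (m : Measure (Vec d)) : Measure (Vec d × Vec d) :=
  (((μHE[d - 1] : Measure (Vec d)).restrict (frontier Ω)).prod m).withDensity
    fun z => ENNReal.ofReal |normalVelocity Ω z.1 z.2|

/-- The measure `μ₊` on `Γ₊`. -/
def muPlus (Ω : Set (Vec d)) (m : Measure (Vec d)) : Measure (Vec d × Vec d) :=
  (fluxMeasure Ω m).restrict (GammaPlus Ω m)

/-- The measure `μ₋` on `Γ₋`. -/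
def muMinus (Ω : Set (Vec d)) (m : Measure (Vec d)) : Measure (Vec d × Vec d) :=
  (fluxMeasure Ω m).restrict (GammaMinus Ω m)

/-- The measure `dx ⊗ m(dv)` on `Ω × V`. -/
def phaseMeasure (Ω : Set (Vec d)) (m : Measure (Vec d)) : Measure (Vec d × Vec d) :=
  ((volume : Measure (Vec d)).prod m).restrict (Ω ×ˢ m.support)

/-- The trace space `L¹₊ = L¹(Γ₊, μ₊)`. -/
abbrev L1Plus (Ω : Set (Vec d)) (m : Measure (Vec d)) : Type := Lp ℂ 1 (muPlus Ω m)

/-- The trace space `L¹₋ = L¹(Γ₋, μ₋)`. -/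
abbrev L1Minus (Ω : Set (Vec d)) (m : Measure (Vec d)) : Type := Lp ℂ 1 (muMinus Ω m)

/-- The space `𝕏₀ = L¹(Ω × V, dx ⊗ m(dv))`. -/
abbrev X0 (Ω : Set (Vec d)) (m : Measure (Vec d)) : Type := Lp ℂ 1 (phaseMeasure Ω m)

/-- The weight `max(1, |v|⁻ˢ)`; its value at `v = 0` is irrelevant because `m {0} = 0`. -/
def velocityWeight (s : ℕ) (v : Vec d) : ℝ≥0∞ := ENNReal.ofReal (max 1 (‖v‖ ^ s)⁻¹)

/-- Membership of `f ∈ 𝕏₀` in `𝕏ₛ = L¹(Ω × V, max(1, |v|⁻ˢ) dx ⊗ m(dv))`. -/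
def MemX {Ω : Set (Vec d)} {m : Measure (Vec d)} (s : ℕ) (f : X0 Ω m) : Prop :=
  ∫⁻ z, velocityWeight s z.2 * ‖f z‖ₑ ∂(phaseMeasure Ω m) < ∞

/-- The backward travel time `t₋(x, v) = inf {s > 0 : x - s v ∉ Ω} ∈ [0, ∞]`. -/
def tMinus (Ω : Set (Vec d)) (x v : Vec d) : ℝ≥0∞ :=
  ⨅ (s : ℝ) (_ : 0 < s) (_ : x - s • v ∉ Ω), ENNReal.ofReal s

/-- The point `x - t₋(x, v) v` where the backward trajectory leaves `Ω`. -/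
def exitPoint (Ω : Set (Vec d)) (x v : Vec d) : Vec d := x - (tMinus Ω x v).toReal • v

/-! ### The operators -/

/-- `[M_λ u](x, v) = exp(-λ τ₋(x, v)) u(x - τ₋(x, v) v, v)` for `(x, v) ∈ Γ₊`. -/
def opM (Ω : Set (Vec d)) (m : Measure (Vec d)) (lam : ℂ) (u : L1Minus Ω m) : L1Plus Ω m :=
  toL1 _ fun z => Complex.exp (-lam * (tMinus Ω z.1 z.2).toReal) * u (exitPoint Ω z.1 z.2, z.2)

/-- `[G_λ f](x, v) = ∫₀^{τ₋(x, v)} exp(-λ s) f(x - s v, v) ds` for `(x, v) ∈ Γ₊`. -/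
def opG (Ω : Set (Vec d)) (m : Measure (Vec d)) (lam : ℂ) (f : X0 Ω m) : L1Plus Ω m :=
  toL1 _ fun z => ∫ s in {s : ℝ | 0 < s ∧ ENNReal.ofReal s < tMinus Ω z.1 z.2},
    Complex.exp (-lam * s) * f (z.1 - s • z.2, z.2)

/-- `[Ξ_λ u](x, v) = 1_{t₋(x, v) < ∞} exp(-λ t₋(x, v)) u(x - t₋(x, v) v, v)` on `Ω × V`. -/
def opXi (Ω : Set (Vec d)) (m : Measure (Vec d)) (lam : ℂ) (u : L1Minus Ω m) : X0 Ω m :=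
  toL1 _ <| indicator {z : Vec d × Vec d | tMinus Ω z.1 z.2 < ∞} fun z =>
    Complex.exp (-lam * (tMinus Ω z.1 z.2).toReal) * u (exitPoint Ω z.1 z.2, z.2)

/-- The diffuse boundary operator with kernel `k`,
`[H ψ](x, v) = ∫_{v' ∈ V, v' · n(x) > 0} k(x, v, v') ψ(x, v') |v' · n(x)| m(dv')` on `Γ₋`. -/
def opH (Ω : Set (Vec d)) (m : Measure (Vec d)) (k : Vec d → Vec d → Vec d → ℝ≥0)
    (ψ : L1Plus Ω m) : L1Minus Ω m :=
  toL1 _ fun z => ∫ w in {w | w ∈ m.support ∧ 0 < normalVelocity Ω z.1 w},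
    ((k z.1 z.2 w : ℝ) : ℂ) * ψ (z.1, w) * (|normalVelocity Ω z.1 w| : ℝ) ∂m

/-- The operator `M_λ H` on `L¹₊`. -/
def opMH (Ω : Set (Vec d)) (m : Measure (Vec d)) (k : Vec d → Vec d → Vec d → ℝ≥0) (lam : ℂ) :
    L1Plus Ω m → L1Plus Ω m :=
  fun ψ => opM Ω m lam (opH Ω m k ψ)

/-- `H ∈ 𝓑(L¹₊, 𝕐⁻ₛ)`, where `𝕐⁻ₛ = L¹(Γ₋, max(1, |v|⁻ˢ) dμ₋)`. -/
def GainsIntegrability (Ω : Set (Vec d)) (m : Measure (Vec d))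
    (k : Vec d → Vec d → Vec d → ℝ≥0) (s : ℕ) : Prop :=
  ∃ C : ℝ≥0, ∀ ψ : L1Plus Ω m,
    ∫⁻ z, velocityWeight s z.2 * ‖opH Ω m k ψ z‖ₑ ∂(muMinus Ω m) ≤ C * ‖ψ‖ₑ

/-- `N_H = sup {j ∈ ℕ : H ∈ 𝓑(L¹₊, 𝕐⁻_{j+1})}`. -/
def NH (Ω : Set (Vec d)) (m : Measure (Vec d)) (k : Vec d → Vec d → Vec d → ℝ≥0) : ℕ :=
  sSup {j : ℕ | GainsIntegrability Ω m k (j + 1)}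

/-- The terms `Ξ_λ H (M_λ H)ʲ G_λ f` of the Dyson–Phillips expansion of the resolvent. -/
def dysonTerm (Ω : Set (Vec d)) (m : Measure (Vec d)) (k : Vec d → Vec d → Vec d → ℝ≥0)
    (lam : ℂ) (f : X0 Ω m) (j : ℕ) : X0 Ω m :=
  opXi Ω m lam (opH Ω m k ((opMH Ω m k lam)^[j] (opG Ω m lam f)))

/-- `Υ_n(λ) f = ∑_{j ≥ n} Ξ_λ H (M_λ H)ʲ G_λ f`. -/
def Upsilon (Ω : Set (Vec d)) (m : Measure (Vec d)) (k : Vec d → Vec d → Vec d → ℝ≥0)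
    (n : ℕ) (lam : ℂ) (f : X0 Ω m) : X0 Ω m :=
  ∑' j : ℕ, dysonTerm Ω m k lam f (n + j)

/-! ### Standing assumptions -/

/-- Assumptions on the phase space `Ω × V`, with `V = supp m`. -/
structure PhaseSpaceAssumptions (Ω : Set (Vec d)) (m : Measure (Vec d)) : Prop where
  two_le_dim : 2 ≤ d
  isOpen : IsOpen Ω
  isBounded : Bornology.IsBounded Ω
  c1_boundary : HasC1Boundary Ω
  /-- `m` is invariant under the orthogonal group -/
  orthogonally_invariant : ∀ O : Vec d ≃ₗᵢ[ℝ] Vec d, m.map O = m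
  zero_mem : (0 : Vec d) ∈ m.support
  zero_null : m {0} = 0
  small_velocities : ∀ r > 0, 0 < m (m.support ∩ Metric.ball 0 r)

/-- Assumptions on the diffuse boundary operator `H` with kernel `k`, with exponent `p` in the
integrability condition. -/
structure BoundaryAssumptions (Ω : Set (Vec d)) (m : Measure (Vec d))
    (k : Vec d → Vec d → Vec d → ℝ≥0) (p : ℕ) : Prop where
  measurable_kernel : Measurable fun q : Vec d × Vec d × Vec d => k q.1 q.2.1 q.2.2
  /-- normalisation of the kernel, i.e. `H` is stochastic -/
  stochastic : ∀ᵐ z ∂(muPlus Ω m),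
    ∫⁻ v in {v | v ∈ m.support ∧ normalVelocity Ω z.1 v < 0},
      k z.1 v z.2 * ENNReal.ofReal |normalVelocity Ω z.1 v| ∂m = 1
  gain : ∃ j : ℕ, GainsIntegrability Ω m k (j + 1)
  /-- `N_H < ∞` -/
  gain_finite : BddAbove {j : ℕ | GainsIntegrability Ω m k (j + 1)}
  weakly_compact : WeaklyCompactMap fun ψ => opH Ω m k (opMH Ω m k 0 ψ)
  irreducible : IrreducibleOnL1 (opMH Ω m k 0)
  power_integrable : ∃ C : ℝ≥0, ∀ ε : ℝ, 0 ≤ ε →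
    ∫⁻ η : ℝ, opENorm ((opMH Ω m k (ε + η * Complex.I))^[p]) ≤ C

end

end CollisionlessTransport

namespace CollisionlessTransport

noncomputable section

/-! ### `L¹` toolkit: multiplication operators, the integral, modulus and real part. -/

section L1Tools

variable {α : Type*} [MeasurableSpace α] {μ : Measure α}

/-! Put K = M₀H, a positive mass preserving operator on L¹₊, and K_λ = M_λH = exp(-λτ)K. The series
is geometric: Υ_n(λ)f = Ξ_λ H K_λⁿ y(λ) with y(λ) = (1 - K_λ)⁻¹ G_λ f. So one has to extend y to the
closed half plane as a Cᴺ function, N = N_H, and to control it at infinity.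

Invertibility of 1 - K_λ. Weak compactness makes the image of the unit ball under K² uniformly
integrable. If Re λ > 0, at least half of the mass of K²ψ therefore sits where τ is bounded below,
and ‖K_λ²‖ < 1 (`norm_Kfam_sq_lt`). If λ = iη with η ≠ 0, an approximate eigenvector of K_{iη} for
the eigenvalue 1 would yield one of K_{ijη} for every j (`almost_eigen_mul`, the cyclicity of the
peripheral spectrum of positive operators), hence ‖K_{ijη}ᵖ‖ ≥ 1; but η ↦ ‖K_{iη}ᵖ‖ is integrable
and Lipschitz, so it tends to 0. Thus 1 - K_{iη} is bounded below and, being a norm limit of units 1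
- rK_{iη}, it is a unit.

At λ = 0 the kernel of 1 - K contains the invariant density φ, obtained from Cesàro means.
Irreducibility makes φ positive and kills fixed points of zero integral. The decisive estimate is
the gap `exists_gap`: 1 - K is bounded below on zero integrals. Almost fixed points violating it can
be truncated to g_n φ with bounded g_n; they tend weakly to 0, so a subsequence is almost
orthogonal, and `average_small` makes the average of ∫ g_i K²(g_i φ) small although each term is
about ∫ g_i² φ. This replaces the theorem that the square of a weakly compact operator on L¹ is
compact.

The singularity at 0 cancels (`ySol_eventuallyEq`). With e the integral, B = 1 - K_λ + φ ⊗ e is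
invertible near 0 and y = B⁻¹G_λf + e(y)B⁻¹φ. Mass balance reads λ J_λ(y) = e(G_λ f), and zero mean
of f makes the right side -λγ(λ) with γ regular. Dividing by λ determines e(y), since J₀(φ), the
mean travel time of φ, is not zero.

Regularity costs moments of the travel time, which are bounded by powers of 1/|v|. The gain of order
N + 1 for H gives N + 1 moments of K, so that K_λ is Cᴺ in operator norm and can be inverted in this
class; for Ξ_λH, integration along the chord uses up one moment and leaves N, which suffice for
strong Cᴺ regularity. The N + 1 moments of f serve for γ.

Decay at infinity: G_λ f obeys the Riemann–Lebesgue lemma, and differentiating y = K_λ y + G_λ f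
gives decay of the derivatives by induction on the order, because ‖K_λᵖ‖ is small far out.
Integrability: by the Leibniz rule each doubling of the exponent buys one more integrable
derivative, so K_{iη} to the power 2ᴺp has N of them.

Concretely, all of this rests on the change of variables (x, s) ↦ x - sv from Γ₊ to Ω with Jacobian
|v·n(x)|, proved on almost flat boundary pieces. It shows that the exit map preserves the flux
measures and that G preserves mass, and it yields the mass balance. The link between geometry and
functional analysis is the structure `TransportModel`. -/

lemma toL1_eq {g : α → ℂ} (hg : Integrable g μ) : toL1 μ g = hg.toL1 g := by
  have h : MemLp g 1 μ := memLp_one_iff_integrable.2 hg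
  simp only [toL1, dif_pos h]; rfl

lemma toL1_coeFn {g : α → ℂ} (hg : Integrable g μ) : toL1 μ g =ᵐ[μ] g := by
  rw [toL1_eq hg]; exact hg.coeFn_toL1

lemma Lp_int (ψ : Lp ℂ 1 μ) : Integrable ψ μ := L1.integrable_coeFn ψ

lemma Lp_norm (ψ : Lp ℂ 1 μ) : ‖ψ‖ = ∫ z, ‖ψ z‖ ∂μ := L1.norm_eq_integral_norm ψ

lemma norm_le_of_ae_le {ψ : Lp ℂ 1 μ} {g : α → ℝ} (hg : Integrable g μ)
    (h : ∀ᵐ z ∂μ, ‖ψ z‖ ≤ g z) : ‖ψ‖ ≤ ∫ z, g z ∂μ := by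
  rw [Lp_norm]; exact integral_mono_ae (Lp_int ψ).norm hg h

/-- Multiplication by a bounded measurable function on `L¹`. -/
def mulCLM (μ : Measure α) (b : α → ℂ) (hb : Measurable b) (C : ℝ) (hC : ∀ z, ‖b z‖ ≤ C) :
    Lp ℂ 1 μ →L[ℂ] Lp ℂ 1 μ :=
  have hi : ∀ ψ : Lp ℂ 1 μ, Integrable (fun z => b z * ψ z) μ := fun ψ =>
    (Lp_int ψ).bdd_mul hb.aestronglyMeasurable (Eventually.of_forall hC)
  LinearMap.mkContinuous
    { toFun := fun ψ => toL1 μ fun z => b z * ψ z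
      map_add' := fun ψ χ => by
        apply Lp.ext
        filter_upwards [toL1_coeFn (hi (ψ + χ)), toL1_coeFn (hi ψ), toL1_coeFn (hi χ),
          Lp.coeFn_add ψ χ, Lp.coeFn_add (toL1 μ fun z => b z * ψ z) (toL1 μ fun z => b z * χ z)]
          with z h1 h2 h3 h4 h5
        rw [h1, h5, Pi.add_apply, h2, h3, h4, Pi.add_apply, mul_add]
      map_smul' := fun c ψ => by
        apply Lp.ext
        filter_upwards [toL1_coeFn (hi (c • ψ)), toL1_coeFn (hi ψ), Lp.coeFn_smul c ψ,
          Lp.coeFn_smul c (toL1 μ fun z => b z * ψ z)] with z h1 h2 h3 h4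
        simp only [RingHom.id_apply]
        rw [h1, h4, Pi.smul_apply, h2, h3, Pi.smul_apply, smul_eq_mul, smul_eq_mul]; ring } C
    (fun ψ => by
      rw [Lp_norm ψ, ← integral_const_mul]
      refine norm_le_of_ae_le ((Lp_int ψ).norm.const_mul C) ?_
      filter_upwards [toL1_coeFn (hi ψ)] with z hz
      simp only [LinearMap.coe_mk, AddHom.coe_mk]
      rw [hz, norm_mul]
      exact mul_le_mul_of_nonneg_right (hC z) (norm_nonneg _))

section
variable {b : α → ℂ} {hb : Measurable b} {C : ℝ} {hC : ∀ z, ‖b z‖ ≤ C}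

lemma mul_int (hb : Measurable b) (hC : ∀ z, ‖b z‖ ≤ C) (ψ : Lp ℂ 1 μ) :
    Integrable (fun z => b z * ψ z) μ :=
  (Lp_int ψ).bdd_mul hb.aestronglyMeasurable (Eventually.of_forall hC)

lemma mulCLM_coeFn (ψ : Lp ℂ 1 μ) : mulCLM μ b hb C hC ψ =ᵐ[μ] fun z => b z * ψ z :=
  toL1_coeFn (mul_int hb hC ψ)

lemma mulCLM_norm_le (hC0 : 0 ≤ C) : ‖mulCLM μ b hb C hC‖ ≤ C :=
  (mulCLM μ b hb C hC).opNorm_le_bound hC0 fun ψ => by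
    rw [Lp_norm ψ, ← integral_const_mul]
    refine norm_le_of_ae_le ((Lp_int ψ).norm.const_mul C) ?_
    filter_upwards [mulCLM_coeFn (hb := hb) (hC := hC) ψ] with z hz
    rw [hz, norm_mul]
    exact mul_le_mul_of_nonneg_right (hC z) (norm_nonneg _)

end

/-- Integration as a functional on `L¹`. -/
def intCLM (μ : Measure α) : Lp ℂ 1 μ →L[ℂ] ℂ :=
  LinearMap.mkContinuous
    { toFun := fun ψ => ∫ z, ψ z ∂μ
      map_add' := fun ψ χ => by
        rw [integral_congr_ae (Lp.coeFn_add ψ χ)]; exact integral_add (Lp_int ψ) (Lp_int χ)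
      map_smul' := fun c ψ => by
        rw [integral_congr_ae (Lp.coeFn_smul c ψ)]; exact integral_const_mul c _ } 1
    (fun ψ => by
      rw [one_mul, Lp_norm]; exact norm_integral_le_integral_norm _)

lemma intCLM_apply (ψ : Lp ℂ 1 μ) : intCLM μ ψ = ∫ z, ψ z ∂μ := rfl

lemma intCLM_norm_le (ψ : Lp ℂ 1 μ) : ‖intCLM μ ψ‖ ≤ ‖ψ‖ := by
  rw [Lp_norm]; exact norm_integral_le_integral_norm _

lemma intCLM_mul {b : α → ℂ} {hb : Measurable b} {C : ℝ} {hC : ∀ z, ‖b z‖ ≤ C} (ψ : Lp ℂ 1 μ) :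
    intCLM μ (mulCLM μ b hb C hC ψ) = ∫ z, b z * ψ z ∂μ :=
  integral_congr_ae (mulCLM_coeFn ψ)

lemma lipschitz_normC : LipschitzWith 1 (fun z : ℂ => ((‖z‖ : ℝ) : ℂ)) := by
  refine LipschitzWith.of_dist_le_mul fun x y => ?_
  rw [dist_eq_norm, dist_eq_norm, ← Complex.ofReal_sub, Complex.norm_real]
  simpa using abs_norm_sub_norm_le x y

lemma lipschitz_reC : LipschitzWith 1 (fun z : ℂ => ((z.re : ℝ) : ℂ)) := by
  refine LipschitzWith.of_dist_le_mul fun x y => ?_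
  rw [dist_eq_norm, dist_eq_norm, ← Complex.ofReal_sub, Complex.norm_real, ← Complex.sub_re]
  simpa using Complex.abs_re_le_norm (x - y)

/-- The modulus on `L¹`. -/
def absL (ψ : Lp ℂ 1 μ) : Lp ℂ 1 μ := lipschitz_normC.compLp (by simp) ψ

/-- The real part on `L¹`. -/
def reL (ψ : Lp ℂ 1 μ) : Lp ℂ 1 μ := lipschitz_reC.compLp (by simp) ψ

lemma absL_coeFn (ψ : Lp ℂ 1 μ) : absL ψ =ᵐ[μ] fun z => ((‖ψ z‖ : ℝ) : ℂ) :=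
  lipschitz_normC.coeFn_compLp _ ψ

lemma reL_coeFn (ψ : Lp ℂ 1 μ) : reL ψ =ᵐ[μ] fun z => (((ψ z).re : ℝ) : ℂ) :=
  lipschitz_reC.coeFn_compLp _ ψ

lemma norm_absL (ψ : Lp ℂ 1 μ) : ‖absL ψ‖ = ‖ψ‖ := by
  rw [Lp_norm, Lp_norm]
  refine integral_congr_ae ?_
  filter_upwards [absL_coeFn ψ] with z hz
  simp [hz]

lemma absL_absL (ψ : Lp ℂ 1 μ) : absL (absL ψ) = absL ψ := by
  apply Lp.ext
  filter_upwards [absL_coeFn ψ, absL_coeFn (absL ψ)] with z h1 h2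
  rw [h2, h1]; simp

lemma norm_absL_ae (ψ : Lp ℂ 1 μ) : ∀ᵐ z ∂μ, ‖absL ψ z‖ = ‖ψ z‖ := by
  filter_upwards [absL_coeFn ψ] with z hz
  simp [hz]

lemma absL_eq_self_iff {ψ : Lp ℂ 1 μ} : absL ψ = ψ ↔ ∀ᵐ z ∂μ, ψ z = ((‖ψ z‖ : ℝ) : ℂ) := by
  constructor
  · intro h
    filter_upwards [absL_coeFn ψ] with z hz
    rw [← hz, h]
  · intro h
    apply Lp.ext
    filter_upwards [absL_coeFn ψ, h] with z h1 h2
    rw [h1, ← h2]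

/-- The integral of the modulus is the norm. -/
lemma intCLM_absL (ψ : Lp ℂ 1 μ) : intCLM μ (absL ψ) = ((‖ψ‖ : ℝ) : ℂ) := by
  rw [intCLM_apply, integral_congr_ae (absL_coeFn ψ), Lp_norm]
  exact integral_ofReal

lemma absL_eq_of_re_nonneg {ψ : Lp ℂ 1 μ} (h : ∀ᵐ z ∂μ, 0 ≤ (ψ z).re ∧ (ψ z).im = 0) :
    absL ψ = ψ := by
  rw [absL_eq_self_iff]
  filter_upwards [h] with z hz
  have : ψ z = (((ψ z).re : ℝ) : ℂ) := Complex.ext (by simp) (by simp [hz.2])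
  rw [this, Complex.norm_real, Real.norm_of_nonneg hz.1]

lemma re_of_absL_eq {ψ : Lp ℂ 1 μ} (h : absL ψ = ψ) :
    ∀ᵐ z ∂μ, 0 ≤ (ψ z).re ∧ (ψ z).im = 0 ∧ ‖ψ z‖ = (ψ z).re := by
  filter_upwards [absL_eq_self_iff.1 h] with z hz
  rw [hz]; simp

lemma coeFn_sub_ae (ψ χ : Lp ℂ 1 μ) : ∀ᵐ z ∂μ, (ψ - χ) z = ψ z - χ z := Lp.coeFn_sub ψ χ
lemma coeFn_add_ae (ψ χ : Lp ℂ 1 μ) : ∀ᵐ z ∂μ, (ψ + χ) z = ψ z + χ z := Lp.coeFn_add ψ χ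
lemma coeFn_smul_ae (c : ℂ) (ψ : Lp ℂ 1 μ) : ∀ᵐ z ∂μ, (c • ψ) z = c * ψ z := Lp.coeFn_smul c ψ

lemma norm_absL_sub_le (ψ χ : Lp ℂ 1 μ) : ‖absL ψ - absL χ‖ ≤ ‖ψ - χ‖ := by
  have := (lipschitz_normC.lipschitzWith_compLp (p := 1) (μ := μ) (by simp)).dist_le_mul ψ χ
  rwa [dist_eq_norm, dist_eq_norm, NNReal.coe_one, one_mul] at this

end L1Tools

/-! ### Markov operators on `L¹` -/

section Markov

variable {α : Type*} [MeasurableSpace α] {μ : Measure α}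

/-- A positive, mass preserving operator on `L¹(μ)`. -/
structure IsMarkov (K : Lp ℂ 1 μ →L[ℂ] Lp ℂ 1 μ) : Prop where
  dom : ∀ ψ, ∀ᵐ z ∂μ, ‖K ψ z‖ ≤ ‖K (absL ψ) z‖
  nonneg : ∀ ψ, absL (K (absL ψ)) = K (absL ψ)
  mass : ∀ ψ, intCLM μ (K ψ) = intCLM μ ψ

variable {K K' : Lp ℂ 1 μ →L[ℂ] Lp ℂ 1 μ}

namespace IsMarkov

/-- Complex `Lp` carries no order; here and below `absL ψ = ψ` encodes that ψ is nonnegative. -/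
lemma nonneg' (hK : IsMarkov K) {ψ : Lp ℂ 1 μ} (h : absL ψ = ψ) : absL (K ψ) = K ψ := by
  have := hK.nonneg ψ; rwa [h] at this

/-- K|ψ| is nonnegative, so its norm is its integral, and K preserves the integral. -/
lemma norm_abs (hK : IsMarkov K) (ψ : Lp ℂ 1 μ) : ‖K (absL ψ)‖ = ‖ψ‖ := by
  have h1 := intCLM_absL (K (absL ψ))
  rw [hK.nonneg, hK.mass, intCLM_absL] at h1
  exact_mod_cast h1.symm

lemma norm_apply_le (hK : IsMarkov K) (ψ : Lp ℂ 1 μ) : ‖K ψ‖ ≤ ‖ψ‖ := by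
  rw [← hK.norm_abs ψ, Lp_norm (K (absL ψ))]
  exact norm_le_of_ae_le (Lp_int _).norm (hK.dom ψ)

lemma norm_le (hK : IsMarkov K) : ‖K‖ ≤ 1 :=
  K.opNorm_le_bound zero_le_one fun ψ => by simpa using hK.norm_apply_le ψ

/-- Monotonicity on nonnegative elements. -/
lemma mono (hK : IsMarkov K) {ψ χ : Lp ℂ 1 μ} (hψ : absL ψ = ψ) (hχ : absL χ = χ)
    (h : ∀ᵐ z ∂μ, ‖ψ z‖ ≤ ‖χ z‖) : ∀ᵐ z ∂μ, ‖K ψ z‖ ≤ ‖K χ z‖ := by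
  have h1 : absL (χ - ψ) = χ - ψ := by
    apply absL_eq_of_re_nonneg
    filter_upwards [re_of_absL_eq hψ, re_of_absL_eq hχ, h, coeFn_sub_ae χ ψ] with z a b c e
    rw [e, Complex.sub_re, Complex.sub_im, a.2.1, b.2.1, ← a.2.2, ← b.2.2]
    exact ⟨by linarith, by simp⟩
  have h2 := hK.nonneg' h1
  rw [map_sub] at h2
  filter_upwards [re_of_absL_eq h2, re_of_absL_eq (hK.nonneg' hψ), re_of_absL_eq (hK.nonneg' hχ),
    coeFn_sub_ae (K χ) (K ψ)] with z a b c e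
  rw [e, Complex.sub_re] at a
  rw [b.2.2, c.2.2]; linarith [a.1]

lemma comp (hK : IsMarkov K) (hK' : IsMarkov K') : IsMarkov (K.comp K') where
  dom ψ := by
    have h1 := hK.dom (K' ψ)
    have h2 := hK.mono (absL_absL (K' ψ)) (hK'.nonneg ψ) (by
      filter_upwards [norm_absL_ae (K' ψ), hK'.dom ψ] with z a b
      rw [a]; exact b)
    filter_upwards [h1, h2] with z a b
    exact a.trans b
  nonneg ψ := hK.nonneg' (hK'.nonneg ψ)
  mass ψ := by simp [hK.mass, hK'.mass]

/-- Approximate fixed points are stable under the modulus. -/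
lemma norm_abs_sub_le (hK : IsMarkov K) (ψ : Lp ℂ 1 μ) :
    ‖K (absL ψ) - absL ψ‖ ≤ 2 * ‖K ψ - ψ‖ := by
  -- K|ψ| and |ψ| have equal norms, so the signed difference integrates to zero. It is at least -|Kψ
  -- - ψ| pointwise, since K|ψ| ≥ |Kψ|; hence its modulus is at most itself plus 2|Kψ - ψ|.
  have h1 : ∫ z, ((‖K (absL ψ) z‖ : ℝ) - ‖ψ z‖) ∂μ = 0 := by
    rw [integral_sub (Lp_int _).norm (Lp_int _).norm, ← Lp_norm, ← Lp_norm, hK.norm_abs, sub_self]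
  have h2 : ‖K (absL ψ) - absL ψ‖ ≤
      ∫ z, ((‖K (absL ψ) z‖ - ‖ψ z‖) + 2 * ‖(K ψ - ψ) z‖) ∂μ := by
    refine norm_le_of_ae_le (((Lp_int _).norm.sub (Lp_int _).norm).add
      ((Lp_int _).norm.const_mul 2)) ?_
    filter_upwards [hK.dom ψ, coeFn_sub_ae (K ψ) ψ, coeFn_sub_ae (K (absL ψ)) (absL ψ),
      absL_coeFn ψ, absL_eq_self_iff.1 (hK.nonneg ψ)] with z a b c d e
    have e1 : ‖ψ z‖ - ‖K ψ z‖ ≤ ‖K ψ z - ψ z‖ := by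
      rw [norm_sub_rev]; exact norm_sub_norm_le _ _
    rw [c, d, e, ← Complex.ofReal_sub, Complex.norm_real, Complex.norm_real, b, Real.norm_eq_abs,
      Real.norm_eq_abs, abs_norm]
    rw [abs_le]; constructor <;> linarith [norm_nonneg (K ψ z - ψ z)]
  have hi : Integrable (fun z => ‖K (absL ψ) z‖ - ‖ψ z‖) μ := (Lp_int _).norm.sub (Lp_int _).norm
  rw [integral_add hi ((Lp_int _).norm.const_mul 2), h1,
    integral_const_mul, zero_add, ← Lp_norm] at h2
  exact h2

/-- A Markov operator commutes with taking real parts. -/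
lemma map_reL (hK : IsMarkov K) (ψ : Lp ℂ 1 μ) : K (reL ψ) = reL (K ψ) := by
  -- A real χ equals |χ| - (|χ| - χ), a difference of nonnegative elements, so Kχ is real.
  have key : ∀ χ : Lp ℂ 1 μ, (∀ᵐ z ∂μ, (χ z).im = 0) → ∀ᵐ z ∂μ, (K χ z).im = 0 := by
    intro χ hχ
    have h1 : absL (absL χ - χ) = absL χ - χ := by
      apply absL_eq_of_re_nonneg
      filter_upwards [hχ, absL_coeFn χ, coeFn_sub_ae (absL χ) χ] with z a b c
      rw [c, b]
      exact ⟨by simpa using Complex.re_le_norm (χ z), by simp [a]⟩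
    have h2 := hK.nonneg' h1
    rw [map_sub] at h2
    filter_upwards [re_of_absL_eq h2, re_of_absL_eq (hK.nonneg χ),
      coeFn_sub_ae (K (absL χ)) (K χ)] with z a b c
    have := a.2.1
    rw [c, Complex.sub_im, b.2.1] at this
    linarith
  have h1 : ψ = reL ψ + Complex.I • reL (-Complex.I • ψ) := by
    apply Lp.ext
    filter_upwards [coeFn_add_ae (reL ψ) (Complex.I • reL (-Complex.I • ψ)), reL_coeFn ψ,
      coeFn_smul_ae Complex.I (reL (-Complex.I • ψ)), reL_coeFn (-Complex.I • ψ),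
      coeFn_smul_ae (-Complex.I) ψ] with z a b c d e
    rw [a, b, c, d, e]
    apply Complex.ext <;> simp
  have r1 := key (reL ψ) (by filter_upwards [reL_coeFn ψ] with z hz; simp [hz])
  have r2 := key (reL (-Complex.I • ψ))
    (by filter_upwards [reL_coeFn (-Complex.I • ψ)] with z hz; rw [hz, Complex.ofReal_im])
  have h2 : K ψ = K (reL ψ) + Complex.I • K (reL (-Complex.I • ψ)) := by
    conv_lhs => rw [h1]
    rw [map_add, map_smul]
  apply Lp.ext
  filter_upwards [r1, r2, reL_coeFn (K ψ), coeFn_smul_ae Complex.I (K (reL (-Complex.I • ψ))),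
    coeFn_add_ae (K (reL ψ)) (Complex.I • K (reL (-Complex.I • ψ)))] with z a b c d e
  rw [c, h2, e, d]
  apply Complex.ext
  · rw [Complex.ofReal_re, Complex.add_re, Complex.I_mul_re, b]; simp
  · rw [Complex.ofReal_im, a]

end IsMarkov

end Markov

/-! ### Uniform integrability, weak limits of almost fixed sequences, invariant densities. -/

section WeakCompactness

variable {α : Type*} [MeasurableSpace α] {μ : Measure α}

lemma continuous_weak_eval {X : Type*} [NormedAddCommGroup X] [NormedSpace ℂ X] (l : X →L[ℂ] ℂ) :
    Continuous fun w : WeakSpace ℂ X => l ((toWeakSpace ℂ X).symm w) :=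
  WeakBilin.eval_continuous (topDualPairing ℂ X).flip l

lemma setIntegral_of_absL_eq {ψ : Lp ℂ 1 μ} (h : absL ψ = ψ) (B : Set α) :
    ∫ z in B, ψ z ∂μ = ((∫ z in B, ‖ψ z‖ ∂μ : ℝ) : ℂ) :=
  (integral_congr_ae (ae_restrict_of_ae (absL_eq_self_iff.1 h))).trans integral_ofReal

omit [MeasurableSpace α] in
lemma norm_indicator_one_le (A : Set α) (z : α) : ‖A.indicator (fun _ => (1 : ℂ)) z‖ ≤ 1 := by
  by_cases h : z ∈ A <;> simp [h]

/-- Multiplication by the indicator function of a measurable set. -/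
def indCLM (μ : Measure α) (A : Set α) (hA : MeasurableSet A) : Lp ℂ 1 μ →L[ℂ] Lp ℂ 1 μ :=
  mulCLM μ (A.indicator fun _ => (1 : ℂ)) (measurable_const.indicator hA) 1
    (norm_indicator_one_le A)

lemma indCLM_coeFn {A : Set α} (hA : MeasurableSet A) (ψ : Lp ℂ 1 μ) :
    indCLM μ A hA ψ =ᵐ[μ] A.indicator ψ := by
  filter_upwards [mulCLM_coeFn (hb := measurable_const.indicator hA)
    (hC := norm_indicator_one_le A) ψ] with z hz
  rw [indCLM, hz]
  by_cases h : z ∈ A <;> simp [h]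

lemma intCLM_ind {A : Set α} (hA : MeasurableSet A) (ψ : Lp ℂ 1 μ) :
    intCLM μ (indCLM μ A hA ψ) = ∫ z in A, ψ z ∂μ := by
  rw [intCLM_apply, integral_congr_ae (indCLM_coeFn hA ψ), integral_indicator hA]

lemma norm_ind {A : Set α} (hA : MeasurableSet A) (ψ : Lp ℂ 1 μ) :
    ‖indCLM μ A hA ψ‖ = ∫ z in A, ‖ψ z‖ ∂μ := by
  rw [Lp_norm, ← integral_indicator hA]
  refine integral_congr_ae ?_
  filter_upwards [indCLM_coeFn hA ψ] with z hz
  rw [hz, norm_indicator_eq_indicator_norm]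

/-- A positive operator with values in a weakly compact set maps the unit ball to a uniformly
integrable set (for monotone sequences of sets). -/
lemma unif_small_antitone {T : Lp ℂ 1 μ →L[ℂ] Lp ℂ 1 μ} (hT : IsMarkov T)
    {C : Set (WeakSpace ℂ (Lp ℂ 1 μ))} (hC : IsCompact C)
    (hTC : ∀ ψ, ‖ψ‖ ≤ 1 → toWeakSpace ℂ _ (T ψ) ∈ C)
    {A : ℕ → Set α} (hA : ∀ k, MeasurableSet (A k)) (hanti : Antitone A)
    (hnull : ∀ᵐ z ∂μ, ∃ k, z ∉ A k) {ε : ℝ} (hε : 0 < ε) :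
    ∃ k, ∀ ψ, ‖ψ‖ ≤ 1 → ∫ z in A k, ‖T ψ z‖ ∂μ ≤ ε := by
  classical
  let ev : (B : Set α) → MeasurableSet B → WeakSpace ℂ (Lp ℂ 1 μ) → ℝ := fun B hB w =>
    (((intCLM μ).comp (indCLM μ B hB)) ((toWeakSpace ℂ _).symm w)).re
  have hev : ∀ B hB, Continuous (ev B hB) := fun B hB =>
    Complex.continuous_re.comp (continuous_weak_eval _)
  have hev' : ∀ B hB (w : Lp ℂ 1 μ), ev B hB (toWeakSpace ℂ _ w) = (∫ z in B, w z ∂μ).re := by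
    intro B hB w
    simp only [ev, LinearEquiv.symm_apply_apply, ContinuousLinearMap.comp_apply, intCLM_ind]
  -- On the nonnegative part of C, which is again weakly compact, the functions w ↦ ∫ w over A k
  -- decrease in k to zero and are weakly continuous; Dini's theorem makes the convergence uniform.
  let Cp : Set (WeakSpace ℂ (Lp ℂ 1 μ)) := C ∩ ⋂ (B) (hB : MeasurableSet B), {w | 0 ≤ ev B hB w}
  have hCp : IsCompact Cp := hC.inter_right <| isClosed_iInter fun B => isClosed_iInter fun hB =>
    isClosed_le continuous_const (hev B hB)
  have hsurj : ∀ w : WeakSpace ℂ (Lp ℂ 1 μ), ∃ u : Lp ℂ 1 μ, toWeakSpace ℂ _ u = w := fun w =>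
    ⟨(toWeakSpace ℂ _).symm w, LinearEquiv.apply_symm_apply _ w⟩
  have hunif := Antitone.tendstoUniformlyOn_of_forall_tendsto (F := fun k => ev (A k) (hA k))
    (f := fun _ => 0) hCp (fun k => (hev _ _).continuousOn) (by
      intro w hw i j hij
      obtain ⟨u, rfl⟩ := hsurj w
      have h0 : 0 ≤ ev (A i \ A j) ((hA i).diff (hA j)) (toWeakSpace ℂ _ u) := by
        have := hw.2; simp only [mem_iInter] at this; exact this _ ((hA i).diff (hA j))
      simp only [hev'] at h0 ⊢
      rw [setIntegral_sdiff (hA j) (Lp_int u).integrableOn (hanti hij)] at h0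
      rw [Complex.sub_re] at h0; linarith) continuousOn_const (by
      intro w hw
      obtain ⟨u, rfl⟩ := hsurj w
      simp only [hev']
      have h1 := tendsto_setIntegral_of_antitone (f := u) (μ := μ) hA hanti
        ⟨0, (Lp_int u).integrableOn⟩
      have h2 : μ (⋂ k, A k) = 0 := by
        refine measure_mono_null (fun z hz => ?_) hnull
        simp only [mem_iInter] at hz
        simpa using hz
      rw [Measure.restrict_eq_zero.2 h2, integral_zero_measure] at h1
      simpa [Function.comp_def] using (Complex.continuous_re.tendsto 0).comp h1)
  rw [Metric.tendstoUniformlyOn_iff] at hunif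
  obtain ⟨k, hk⟩ := (hunif ε hε).exists
  refine ⟨k, fun ψ hψ => ?_⟩
  have hnn := hT.nonneg ψ
  have hmem : toWeakSpace ℂ _ (T (absL ψ)) ∈ Cp := by
    refine ⟨hTC _ (by rwa [norm_absL]), ?_⟩
    simp only [mem_iInter, mem_ofPred_eq, hev']
    intro B hB
    rw [setIntegral_of_absL_eq hnn, Complex.ofReal_re]
    exact integral_nonneg fun _ => norm_nonneg _
  have h3 := hk _ hmem
  rw [hev', Real.dist_eq, zero_sub, abs_neg] at h3
  have h4 : (∫ z in A k, T (absL ψ) z ∂μ).re = ∫ z in A k, ‖T (absL ψ) z‖ ∂μ := by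
    rw [setIntegral_of_absL_eq hnn, Complex.ofReal_re]
  calc ∫ z in A k, ‖T ψ z‖ ∂μ ≤ ∫ z in A k, ‖T (absL ψ) z‖ ∂μ :=
        integral_mono_ae (Lp_int _).norm.integrableOn (Lp_int _).norm.integrableOn
          (ae_restrict_of_ae (hT.dom ψ))
    _ ≤ ε := by rw [← h4]; exact (le_abs_self _).trans h3.le

/-- The `ε`-`δ` form of uniform integrability, relative to the measure `φ μ`. -/
lemma unif_small {T : Lp ℂ 1 μ →L[ℂ] Lp ℂ 1 μ} (hT : IsMarkov T)
    {C : Set (WeakSpace ℂ (Lp ℂ 1 μ))} (hC : IsCompact C)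
    (hTC : ∀ ψ, ‖ψ‖ ≤ 1 → toWeakSpace ℂ _ (T ψ) ∈ C)
    {φ : Lp ℂ 1 μ} (hφ : ∀ᵐ z ∂μ, φ z ≠ 0) {ε : ℝ} (hε : 0 < ε) :
    ∃ δ > 0, ∀ A, MeasurableSet A → ∫ z in A, ‖φ z‖ ∂μ ≤ δ →
      ∀ ψ, ∫ z in A, ‖T ψ z‖ ∂μ ≤ ε * ‖ψ‖ := by
  suffices h : ∃ δ > 0, ∀ A, MeasurableSet A → ∫ z in A, ‖φ z‖ ∂μ ≤ δ →
      ∀ ψ, ‖ψ‖ ≤ 1 → ∫ z in A, ‖T ψ z‖ ∂μ ≤ ε by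
    obtain ⟨δ, hδ, h⟩ := h
    refine ⟨δ, hδ, fun A hA hAφ ψ => ?_⟩
    rcases eq_or_ne ψ 0 with rfl | hψ
    · rw [← norm_ind hA]; simp
    · have hn : 0 < ‖ψ‖ := norm_pos_iff.2 hψ
      have h1 := h A hA hAφ (((‖ψ‖⁻¹ : ℝ) : ℂ) • ψ) (by
        rw [norm_smul, Complex.norm_real, norm_inv, norm_norm, inv_mul_cancel₀ hn.ne'])
      rw [← norm_ind hA, map_smul, map_smul, norm_smul, Complex.norm_real, norm_inv, norm_norm,
        norm_ind hA, inv_mul_le_iff₀ hn] at h1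
      linarith
  by_contra! hcon
  have h2 : ∀ n : ℕ, ∃ A, MeasurableSet A ∧ ∫ z in A, ‖φ z‖ ∂μ ≤ (1 / 2) ^ n ∧
      ∃ ψ, ‖ψ‖ ≤ 1 ∧ ε < ∫ z in A, ‖T ψ z‖ ∂μ := fun n => by
    obtain ⟨A, hA, h, ψ, h', h''⟩ := hcon ((1 / 2) ^ n) (by positivity)
    exact ⟨A, hA, h, ψ, h', h''⟩
  choose A hA hAφ ψ hψ hlt using h2
  -- Borel–Cantelli for the finite measure |φ|μ: since ∑ 2⁻ⁿ converges, the sets ⋃_{n ≥ k} A n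
  -- shrink to a null set of |φ|μ, hence of μ because φ ≠ 0 almost everywhere. The monotone version
  -- then contradicts the choice of ψ k.
  let B : ℕ → Set α := fun k => ⋃ n ≥ k, A n
  have hB : ∀ k, MeasurableSet (B k) := fun k =>
    MeasurableSet.iUnion fun n => MeasurableSet.iUnion fun _ => hA n
  have hBanti : Antitone B := fun i j hij =>
    biUnion_subset_biUnion_left fun n (hn : n ≥ j) => hij.trans hn
  have hnull : ∀ᵐ z ∂μ, ∃ k, z ∉ B k := by
    let ν := μ.withDensity fun z => ‖φ z‖ₑ
    have hac : μ ≪ ν := withDensity_absolutelyContinuous'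
      (Lp.stronglyMeasurable φ).measurable.enorm.aemeasurable
      (hφ.mono fun z hz => by simpa using hz)
    have hν : ∀ n, ν (A n) ≤ ENNReal.ofReal ((1 / 2) ^ n) := fun n => by
      rw [withDensity_apply _ (hA n), ← ofReal_integral_norm_eq_lintegral_enorm
        (Lp_int φ).integrableOn]
      exact ENNReal.ofReal_le_ofReal (hAφ n)
    have hsum : ∑' n, ν (A n) ≠ ∞ := by
      refine ne_top_of_le_ne_top ?_ (ENNReal.tsum_le_tsum hν)
      rw [← ENNReal.ofReal_tsum_of_nonneg (fun n => by positivity)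
        (summable_geometric_of_lt_one (by norm_num) (by norm_num))]
      exact ENNReal.ofReal_ne_top
    filter_upwards [hac.ae_le (ae_eventually_notMem hsum)] with z hz
    obtain ⟨k, hk⟩ := eventually_atTop.1 hz
    exact ⟨k, by simpa [B] using hk⟩
  obtain ⟨k, hk⟩ := unif_small_antitone hT hC hTC hB hBanti hnull hε
  have h3 := hk (ψ k) (hψ k)
  have h4 : ∫ z in A k, ‖T (ψ k) z‖ ∂μ ≤ ∫ z in B k, ‖T (ψ k) z‖ ∂μ :=
    setIntegral_mono_set (Lp_int _).norm.integrableOn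
      (Eventually.of_forall fun _ => norm_nonneg _)
      (LE.le.eventuallyLE (subset_biUnion_of_mem (u := A) (le_refl k : k ≥ k)))
  linarith [hlt k]

/-- Almost fixed sequences of an operator with weakly compact square cluster weakly at a fixed
point. -/
lemma exists_weak_limit {K : Lp ℂ 1 μ →L[ℂ] Lp ℂ 1 μ}
    {C : Set (WeakSpace ℂ (Lp ℂ 1 μ))} (hC : IsCompact C)
    (hKC : ∀ ψ, ‖ψ‖ ≤ 1 → toWeakSpace ℂ _ (K (K ψ)) ∈ C)
    (U : Ultrafilter ℕ) {ψ : ℕ → Lp ℂ 1 μ} (hψ : ∀ n, ‖ψ n‖ ≤ 1)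
    (hfix : Tendsto (fun n => K (ψ n) - ψ n) U (𝓝 0)) :
    ∃ θ, K θ = θ ∧ ∀ l : Lp ℂ 1 μ →L[ℂ] ℂ, Tendsto (fun n => l (ψ n)) U (𝓝 (l θ)) := by
  have hu : ∃ w ∈ C, Tendsto (fun n => toWeakSpace ℂ (Lp ℂ 1 μ) (K (K (ψ n)))) U (𝓝 w) := by
    obtain ⟨w, hw, h⟩ := hC.ultrafilter_le_nhds
      (U.map fun n => toWeakSpace ℂ (Lp ℂ 1 μ) (K (K (ψ n)))) (by
        rw [le_principal_iff]
        exact Filter.mem_map.2 (univ_mem' fun n => hKC _ (hψ n)))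
    exact ⟨w, hw, h⟩
  obtain ⟨w, -, hw⟩ := hu
  have hlim : ∀ l : Lp ℂ 1 μ →L[ℂ] ℂ,
      Tendsto (fun n => l (ψ n)) U (𝓝 (l ((toWeakSpace ℂ _).symm w))) := by
    intro l
    have h1 := ((continuous_weak_eval l).tendsto w).comp hw
    -- K²ψ - ψ = K(Kψ - ψ) + (Kψ - ψ) tends to 0 in norm, so the weak limit of K²ψ_n is also that of
    -- ψ_n.
    have h2 : Tendsto (fun n => l (K (K (ψ n) - ψ n) + (K (ψ n) - ψ n))) U (𝓝 0) := by
      have h3 : Tendsto (fun n => K (K (ψ n) - ψ n) + (K (ψ n) - ψ n)) U (𝓝 (K 0 + 0)) :=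
        ((K.continuous.tendsto 0).comp hfix).add hfix
      have h4 := (l.continuous.tendsto (K 0 + 0)).comp h3
      simp only [map_zero, add_zero] at h4
      exact h4
    have h3 := h1.sub h2
    rw [sub_zero] at h3
    refine h3.congr fun n => ?_
    simp only [Function.comp, LinearEquiv.symm_apply_apply, map_add, map_sub]
    ring
  refine ⟨(toWeakSpace ℂ _).symm w, ?_, hlim⟩
  rw [← sub_eq_zero]
  refine (SeparatingDual.eq_zero_iff_forall_dual_eq_zero (R := ℂ) _).2 fun l => ?_
  have h1 := (hlim (l.comp K)).sub (hlim l)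
  have h2 : Tendsto (fun n => l (K (ψ n) - ψ n)) U (𝓝 0) := by
    have h3 := (l.continuous.tendsto 0).comp hfix
    rw [map_zero] at h3
    exact h3
  have h3 := tendsto_nhds_unique (h1.congr fun n => by simp) h2
  simpa using h3

/-- Existence of an invariant density. -/
lemma exists_invariant {K : Lp ℂ 1 μ →L[ℂ] Lp ℂ 1 μ} (hK : IsMarkov K)
    {C : Set (WeakSpace ℂ (Lp ℂ 1 μ))} (hC : IsCompact C)
    (hKC : ∀ ψ, ‖ψ‖ ≤ 1 → toWeakSpace ℂ _ (K (K ψ)) ∈ C) [Nontrivial (Lp ℂ 1 μ)] :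
    ∃ φ, K φ = φ ∧ absL φ = φ ∧ ‖φ‖ = 1 := by
  obtain ⟨χ₀, hχ₀⟩ := exists_ne (0 : Lp ℂ 1 μ)
  obtain ⟨χ, hχ1, hχ2⟩ : ∃ χ : Lp ℂ 1 μ, absL χ = χ ∧ ‖χ‖ = 1 := by
    have hn : ‖χ₀‖ ≠ 0 := norm_ne_zero_iff.2 hχ₀
    refine ⟨((‖χ₀‖⁻¹ : ℝ) : ℂ) • absL χ₀, ?_, ?_⟩
    · apply absL_eq_of_re_nonneg
      filter_upwards [coeFn_smul_ae ((‖χ₀‖⁻¹ : ℝ) : ℂ) (absL χ₀), absL_coeFn χ₀] with z h1 h2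
      rw [h1, h2, ← Complex.ofReal_mul, Complex.ofReal_re, Complex.ofReal_im]
      exact ⟨by positivity, rfl⟩
    · rw [norm_smul, norm_absL, Complex.norm_real, norm_inv, norm_norm, inv_mul_cancel₀ hn]
  have hpow : ∀ j : ℕ, absL ((K ^ j) χ) = (K ^ j) χ ∧ ‖(K ^ j) χ‖ ≤ 1 ∧
      intCLM μ ((K ^ j) χ) = 1 := by
    intro j
    induction j with
    | zero =>
      refine ⟨hχ1, hχ2.le, ?_⟩
      have := intCLM_absL χ
      rw [hχ1, hχ2] at this; simpa using this
    | succ j ih =>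
      rw [pow_succ']
      exact ⟨hK.nonneg' ih.1, (hK.norm_apply_le _).trans ih.2.1, by
        rw [mul_apply_eq_comp, hK.mass, ih.2.2]⟩
  -- The averages c n • S n are Cesàro means of the orbit of a density; telescoping bounds their
  -- defect by 2/(n + 1), so every weak cluster point is fixed.
  let S : ℕ → Lp ℂ 1 μ := fun n => ∑ j ∈ Finset.range (n + 1), (K ^ j) χ
  let c : ℕ → ℂ := fun n => (((n + 1 : ℕ) : ℝ)⁻¹ : ℝ)
  have hcn : ∀ n, ‖c n‖ = ((n + 1 : ℕ) : ℝ)⁻¹ := fun n => by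
    rw [Complex.norm_real, Real.norm_of_nonneg (by positivity)]
  have hKS : ∀ n, K (S n) - S n = (K ^ (n + 1)) χ - χ := by
    intro n
    have : K (S n) = ∑ j ∈ Finset.range (n + 1), (K ^ (j + 1)) χ := by
      simp only [S, map_sum, pow_succ', mul_apply_eq_comp]
    rw [this, ← Finset.sum_sub_distrib]
    exact Finset.sum_range_sub (fun j => (K ^ j) χ) (n + 1)
  have hS : ∀ n, ‖c n • S n‖ ≤ 1 := by
    intro n
    rw [norm_smul, hcn, inv_mul_le_iff₀ (by positivity), mul_one]
    calc ‖S n‖ ≤ ∑ j ∈ Finset.range (n + 1), ‖(K ^ j) χ‖ := norm_sum_le _ _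
      _ ≤ ∑ j ∈ Finset.range (n + 1), 1 := Finset.sum_le_sum fun j _ => (hpow j).2.1
      _ = ((n + 1 : ℕ) : ℝ) := by simp
  have hfix : Tendsto (fun n => K (c n • S n) - c n • S n) (hyperfilter ℕ) (𝓝 0) := by
    have : Tendsto (fun n : ℕ => 2 * ((n + 1 : ℕ) : ℝ)⁻¹) atTop (𝓝 0) := by
      have := ((tendsto_inv_atTop_nhds_zero_nat (𝕜 := ℝ)).comp (tendsto_add_atTop_nat 1)).const_mul 2
      simpa using this
    refine (squeeze_zero_norm (fun n => ?_) this).mono_left Nat.hyperfilter_le_atTop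
    rw [map_smul, ← smul_sub, norm_smul, hcn, hKS, mul_comm]
    gcongr
    calc ‖(K ^ (n + 1)) χ - χ‖ ≤ ‖(K ^ (n + 1)) χ‖ + ‖χ‖ := norm_sub_le _ _
      _ ≤ 2 := by linarith [(hpow (n + 1)).2.1]
  obtain ⟨φ, hφ, hlim⟩ := exists_weak_limit hC hKC (hyperfilter ℕ) hS hfix
  -- Nonnegativity survives the weak limit when tested on integrals over sets; the total mass 1
  -- survives too, which excludes φ = 0.
  have hset : ∀ B (hB : MeasurableSet B), 0 ≤ (∫ z in B, φ z ∂μ).re ∧ (∫ z in B, φ z ∂μ).im = 0 := by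
    intro B hB
    have h1 := hlim ((intCLM μ).comp (indCLM μ B hB))
    simp only [ContinuousLinearMap.comp_apply, intCLM_ind] at h1
    have h2 : ∀ n, ∃ r : ℝ, 0 ≤ r ∧ ∫ z in B, (c n • S n) z ∂μ = r := by
      intro n
      have hSn : ∫ z in B, (c n • S n) z ∂μ = c n * ∑ j ∈ Finset.range (n + 1),
          ∫ z in B, (K ^ j) χ z ∂μ := by
        rw [← intCLM_ind hB, map_smul, map_smul, smul_eq_mul, map_sum, map_sum]
        simp_rw [intCLM_ind hB]
      have h3 : ∀ j, ∫ z in B, (K ^ j) χ z ∂μ = ((∫ z in B, ‖(K ^ j) χ z‖ ∂μ : ℝ) : ℂ) :=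
        fun j => setIntegral_of_absL_eq (hpow j).1 B
      refine ⟨((n + 1 : ℕ) : ℝ)⁻¹ * ∑ j ∈ Finset.range (n + 1), ∫ z in B, ‖(K ^ j) χ z‖ ∂μ,
        mul_nonneg (by positivity)
          (Finset.sum_nonneg fun j _ => integral_nonneg fun _ => norm_nonneg _), ?_⟩
      rw [hSn]
      simp_rw [h3]
      push_cast [c]
      rfl
    have hr := (Complex.continuous_re.tendsto _).comp h1
    have hi := (Complex.continuous_im.tendsto _).comp h1
    constructor
    · refine ge_of_tendsto' hr fun n => ?_
      obtain ⟨r, h0, h3⟩ := h2 n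
      simp only [Function.comp, h3, Complex.ofReal_re, h0]
    · refine tendsto_nhds_unique hi (tendsto_const_nhds.congr fun n => ?_)
      obtain ⟨r, h0, h3⟩ := h2 n
      simp only [Function.comp, h3, Complex.ofReal_im]
  have hre : ∀ B, ∫ z in B, (φ z).re ∂μ = (∫ z in B, φ z ∂μ).re := fun B =>
    integral_re (Lp_int φ).integrableOn
  have him : ∀ B, ∫ z in B, (φ z).im ∂μ = (∫ z in B, φ z ∂μ).im := fun B =>
    integral_im (Lp_int φ).integrableOn
  have habs : absL φ = φ := by
    apply absL_eq_of_re_nonneg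
    have e1 := ae_nonneg_of_forall_setIntegral_nonneg (Lp_int φ).re fun B hB _ => by
      have := hre B; simp only [RCLike.re_eq_complex_re] at *
      rw [this]; exact (hset B hB).1
    have e2 := (Lp_int φ).im.ae_eq_zero_of_forall_setIntegral_eq_zero fun B hB _ => by
      have := him B; simp only [RCLike.im_eq_complex_im] at *
      rw [this]; exact (hset B hB).2
    filter_upwards [e1, e2] with z h1 h2
    exact ⟨h1, h2⟩
  refine ⟨φ, hφ, habs, ?_⟩
  have h1 := hlim (intCLM μ)
  have h2 : ∀ n, intCLM μ (c n • S n) = 1 := by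
    intro n
    rw [map_smul, map_sum, Finset.sum_congr rfl fun j _ => (hpow j).2.2]
    have : ((n : ℂ) + 1) ≠ 0 := by exact_mod_cast Nat.succ_ne_zero n
    simp [c, this]
  have h3 := tendsto_nhds_unique h1 (tendsto_const_nhds.congr fun n => (h2 n).symm)
  have h4 := intCLM_absL φ
  rw [habs, h3] at h4
  exact_mod_cast h4.symm

end WeakCompactness

/-! ### Consequences of irreducibility: positivity and uniqueness of the invariant density. -/

section Irreducible

variable {α : Type*} [MeasurableSpace α] {μ : Measure α} {K : Lp ℂ 1 μ →L[ℂ] Lp ℂ 1 μ}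

lemma measurableSet_zero (φ : Lp ℂ 1 μ) : MeasurableSet {z | φ z = 0} :=
  (Lp.stronglyMeasurable φ).measurable (measurableSet_singleton 0)

/-- An invariant density of an irreducible operator is positive almost everywhere. -/
lemma invariant_pos [SigmaFinite μ] (hK : IsMarkov K) (hirr : IrreducibleOnL1 K) {φ : Lp ℂ 1 μ}
    (hfix : K φ = φ) (habs : absL φ = φ) (h0 : φ ≠ 0) : ∀ᵐ z ∂μ, φ z ≠ 0 := by
  set Z := {z | φ z = 0} with hZ
  have hZm : MeasurableSet Z := measurableSet_zero φ
  -- The elements vanishing where φ vanishes form a closed ideal containing φ. Once it is known to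
  -- be invariant it must be everything, which forces the zero set of φ to be null.
  let I : Submodule ℂ (Lp ℂ 1 μ) := LinearMap.ker (indCLM μ Z hZm).toLinearMap
  have hmem : ∀ f : Lp ℂ 1 μ, f ∈ I ↔ ∀ᵐ z ∂μ, φ z = 0 → f z = 0 := by
    intro f
    have h1 : f ∈ I ↔ indCLM μ Z hZm f = 0 := LinearMap.mem_ker
    rw [h1, Lp.eq_zero_iff_ae_eq_zero]
    constructor <;> intro h
    · filter_upwards [h, indCLM_coeFn hZm f] with z a b hz
      rw [b] at a
      simpa [indicator_of_mem (show z ∈ Z from hz)] using a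
    · filter_upwards [h, indCLM_coeFn hZm f] with z a b
      rw [b]
      by_cases hz : z ∈ Z
      · simpa [hz] using a hz
      · simp [hz]
  have hcl : IsClosed (I : Set (Lp ℂ 1 μ)) := (indCLM μ Z hZm).isClosed_ker
  have hinv : ∀ f ∈ I, K f ∈ I := by
    intro f hf
    -- For f in the ideal, |f| is the limit of min(|f|, nφ), and K maps these truncations below nKφ
    -- = nφ.
    let g : ℕ → α → ℂ := fun n z => ((min ‖f z‖ (n * ‖φ z‖) : ℝ) : ℂ)
    have hgm : ∀ n, AEStronglyMeasurable (g n) μ := fun n => by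
      refine (Complex.measurable_ofReal.comp ?_).aestronglyMeasurable
      exact ((Lp.stronglyMeasurable f).measurable.norm).min
        (((Lp.stronglyMeasurable φ).measurable.norm).const_mul _)
    have hnn : ∀ (n : ℕ) z, 0 ≤ min ‖f z‖ (n * ‖φ z‖) := fun n z =>
      le_min (norm_nonneg _) (mul_nonneg (Nat.cast_nonneg _) (norm_nonneg _))
    have hgn : ∀ n z, ‖g n z‖ = min ‖f z‖ (n * ‖φ z‖) := fun n z => by
      rw [Complex.norm_real, Real.norm_of_nonneg (hnn n z)]
    have hgi : ∀ n, Integrable (g n) μ := fun n =>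
      (Lp_int f).norm.mono' (hgm n) (Eventually.of_forall fun z => by
        rw [hgn]; exact min_le_left _ _)
    let F : ℕ → Lp ℂ 1 μ := fun n => toL1 μ (g n)
    have hF : ∀ n, F n =ᵐ[μ] g n := fun n => toL1_coeFn (hgi n)
    have hlim : Tendsto F atTop (𝓝 (absL f)) := by
      rw [tendsto_iff_norm_sub_tendsto_zero]
      have h1 : Tendsto (fun n => ∫ z, ‖g n z - ((‖f z‖ : ℝ) : ℂ)‖ ∂μ) atTop
          (𝓝 (∫ _, (0 : ℝ) ∂μ)) := by
        refine tendsto_integral_of_dominated_convergence (fun z => ‖f z‖) (fun n => ?_)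
          (Lp_int f).norm (fun n => Eventually.of_forall fun z => ?_) ?_
        · exact ((hgm n).sub (Complex.continuous_ofReal.comp_aestronglyMeasurable
            (Lp_int f).norm.aestronglyMeasurable)).norm
        · rw [norm_norm]
          simp only [g]
          rw [← Complex.ofReal_sub, Complex.norm_real, Real.norm_eq_abs, abs_le]
          have a := hnn n z
          have b := min_le_left ‖f z‖ (n * ‖φ z‖)
          constructor <;> linarith [norm_nonneg (f z)]
        · filter_upwards [(hmem f).1 hf] with z hz
          refine tendsto_const_nhds.congr' ?_
          rcases eq_or_ne (φ z) 0 with h | h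
          · exact Eventually.of_forall fun n => by simp [g, hz h, h]
          · obtain ⟨n0, hn0⟩ := exists_nat_ge (‖f z‖ / ‖φ z‖)
            filter_upwards [eventually_ge_atTop n0] with n hn
            have h2 : ‖f z‖ ≤ n * ‖φ z‖ := by
              rw [div_le_iff₀ (norm_pos_iff.2 h)] at hn0
              refine hn0.trans ?_
              gcongr
            simp only [g]
            rw [min_eq_left h2]; simp
      rw [integral_zero] at h1
      refine h1.congr fun n => ?_
      rw [Lp_norm]
      refine integral_congr_ae ?_
      filter_upwards [hF n, absL_coeFn f, coeFn_sub_ae (F n) (absL f)] with z a b c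
      rw [c, a, b]
    have hFI : ∀ n, K (F n) ∈ I := by
      intro n
      have hn1 : absL (F n) = F n := by
        apply absL_eq_of_re_nonneg
        filter_upwards [hF n] with z hz
        rw [hz]; exact ⟨by simpa [g] using hnn n z, by simp [g]⟩
      have hn2 : absL ((n : ℂ) • φ) = (n : ℂ) • φ := by
        apply absL_eq_of_re_nonneg
        filter_upwards [coeFn_smul_ae (n : ℂ) φ, re_of_absL_eq habs] with z a b
        rw [a]; simp [b.2.1]; positivity [b.1]
      have h1 := hK.mono hn1 hn2 (by
        filter_upwards [hF n, coeFn_smul_ae (n : ℂ) φ] with z a b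
        rw [a, b, hgn, norm_mul, Complex.norm_natCast]; exact min_le_right _ _)
      rw [map_smul, hfix] at h1
      rw [hmem]
      filter_upwards [h1, coeFn_smul_ae (n : ℂ) φ] with z a b hz
      rw [b, hz, mul_zero, norm_zero] at a
      exact norm_le_zero_iff.1 a
    have h2 : K (absL f) ∈ I :=
      hcl.mem_of_tendsto ((K.continuous.tendsto _).comp hlim) (Eventually.of_forall hFI)
    rw [hmem] at h2 ⊢
    filter_upwards [h2, hK.dom f] with z a b hz
    rw [a hz, norm_zero] at b
    exact norm_le_zero_iff.1 b
  rcases hirr I hcl (fun g hg f hfg => by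
    rw [hmem] at hg ⊢
    filter_upwards [hg, hfg] with z a b hz
    rw [a hz, norm_zero] at b
    exact norm_le_zero_iff.1 b) hinv with h | h
  · exact absurd ((Submodule.mem_bot ℂ).1 (h ▸ (hmem φ).2 (Eventually.of_forall fun z hz => hz))) h0
  -- σ-finiteness supplies indicator functions of finite measure pieces of the zero set; they lie in
  -- L¹, hence in the ideal.
  · have h3 : ∀ n, μ (Z ∩ spanningSets μ n) = 0 := by
      intro n
      have hm : MeasurableSet (Z ∩ spanningSets μ n) := hZm.inter (measurableSet_spanningSets μ n)
      have hfin : μ (Z ∩ spanningSets μ n) ≠ ∞ :=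
        ((measure_mono inter_subset_right).trans_lt (measure_spanningSets_lt_top μ n)).ne
      have h4 : indicatorConstLp 1 hm hfin (1 : ℂ) ∈ I := by rw [h]; trivial
      rw [hmem] at h4
      have h5 : ∀ᵐ z ∂μ, z ∉ Z ∩ spanningSets μ n := by
        filter_upwards [h4, indicatorConstLp_coeFn (p := 1) (hs := hm) (hμs := hfin) (c := (1 : ℂ))]
          with z a b hz
        rw [b, indicator_of_mem hz] at a
        exact one_ne_zero (a hz.1)
      exact measure_eq_zero_iff_ae_notMem.2 h5
    have h4 : μ Z = 0 := by
      have : Z = ⋃ n, Z ∩ spanningSets μ n := by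
        rw [← inter_iUnion, iUnion_spanningSets, inter_univ]
      rw [this]; exact measure_iUnion_null h3
    exact measure_eq_zero_iff_ae_notMem.1 h4

/-- Fixed points of an irreducible operator with vanishing integral are zero. -/
lemma fixed_eq_zero [SigmaFinite μ] (hK : IsMarkov K) (hirr : IrreducibleOnL1 K) {θ : Lp ℂ 1 μ}
    (hfix : K θ = θ) (hmean : intCLM μ θ = 0) : θ = 0 := by
  -- For real θ the modulus |θ| is fixed as well, so |θ| + θ is a nonnegative fixed point: it is
  -- zero or positive almost everywhere. Either way θ has constant sign, and zero integral gives θ =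
  -- 0.
  have key : ∀ θ : Lp ℂ 1 μ, K θ = θ → intCLM μ θ = 0 → (∀ᵐ z ∂μ, (θ z).im = 0) → θ = 0 := by
    intro θ hfix hmean him
    have ha : K (absL θ) = absL θ := by
      have := hK.norm_abs_sub_le θ
      rw [hfix, sub_self, norm_zero, mul_zero] at this
      exact sub_eq_zero.1 (norm_le_zero_iff.1 this)
    have h1 : K (absL θ + θ) = absL θ + θ := by rw [map_add, ha, hfix]
    have h2 : absL (absL θ + θ) = absL θ + θ := by
      apply absL_eq_of_re_nonneg
      filter_upwards [absL_coeFn θ, coeFn_add_ae (absL θ) θ, him] with z a b c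
      rw [b, a]
      refine ⟨?_, by simp [c]⟩
      have := (abs_le.1 (Complex.abs_re_le_norm (θ z))).1
      simp; linarith
    have h3 : absL θ = θ ∨ absL θ = -θ := by
      by_cases h : absL θ + θ = 0
      · exact Or.inr (eq_neg_of_add_eq_zero_left h)
      · left
        rw [absL_eq_self_iff]
        filter_upwards [invariant_pos hK hirr h1 h2 h, absL_coeFn θ, coeFn_add_ae (absL θ) θ, him]
          with z a b c e
        rw [c, b] at a
        have hθ : θ z = (((θ z).re : ℝ) : ℂ) := Complex.ext (by simp) (by simp [e])
        rw [hθ, Complex.norm_real, Real.norm_eq_abs] at a ⊢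
        rcases abs_cases (θ z).re with ⟨h, -⟩ | ⟨h, -⟩
        · rw [h]
        · rw [h] at a; exact absurd (by push_cast; ring) a
    have h4 := intCLM_absL θ
    have h5 : intCLM μ (absL θ) = 0 := by
      rcases h3 with h | h <;> simp [h, hmean]
    rw [h5] at h4
    exact norm_eq_zero.1 (by exact_mod_cast h4.symm)
  have hre : ∀ θ : Lp ℂ 1 μ, intCLM μ θ = 0 → intCLM μ (reL θ) = 0 := by
    intro θ h
    rw [intCLM_apply, integral_congr_ae (reL_coeFn θ)]
    have h1 : ∫ z, (θ z).re ∂μ = (∫ z, θ z ∂μ).re := integral_re (Lp_int θ)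
    rw [show ∫ z, (((θ z).re : ℝ) : ℂ) ∂μ = ((∫ z, (θ z).re ∂μ : ℝ) : ℂ) from integral_ofReal, h1,
      ← intCLM_apply, h]
    simp
  have hz : ∀ θ : Lp ℂ 1 μ, K θ = θ → intCLM μ θ = 0 → ∀ᵐ z ∂μ, (θ z).re = 0 := by
    intro θ hfix hmean
    have h := key (reL θ) (by rw [hK.map_reL, hfix]) (hre θ hmean) (by
      filter_upwards [reL_coeFn θ] with z hz; rw [hz, Complex.ofReal_im])
    filter_upwards [reL_coeFn θ, Lp.eq_zero_iff_ae_eq_zero.1 h] with z a b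
    rw [a, Pi.zero_apply] at b
    exact_mod_cast b
  rw [Lp.eq_zero_iff_ae_eq_zero]
  filter_upwards [hz θ hfix hmean, hz (-Complex.I • θ) (by rw [map_smul, hfix])
    (by rw [map_smul, hmean, smul_zero]), coeFn_smul_ae (-Complex.I) θ] with z a b c
  rw [c] at b
  refine Complex.ext (by simpa using a) ?_
  simpa using b

end Irreducible

/-! ### The averaging estimate behind the spectral gap. -/

section AlmostOrthogonal

variable {α : Type*} [MeasurableSpace α] {μ : Measure α}

/-- Multiplication by a bounded real function. -/
def mulR (μ : Measure α) (g : α → ℝ) (hg : Measurable g) (M : ℝ) (hM : ∀ z, |g z| ≤ M) :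
    Lp ℂ 1 μ →L[ℂ] Lp ℂ 1 μ :=
  mulCLM μ (fun z => (g z : ℂ)) (Complex.measurable_ofReal.comp hg) M
    (fun z => by rw [Complex.norm_real]; exact hM z)

lemma mulR_coeFn {g : α → ℝ} {hg : Measurable g} {M : ℝ} {hM : ∀ z, |g z| ≤ M} (ψ : Lp ℂ 1 μ) :
    mulR μ g hg M hM ψ =ᵐ[μ] fun z => (g z : ℂ) * ψ z := mulCLM_coeFn ψ

lemma mulR_int {g : α → ℝ} (hg : Measurable g) {M : ℝ} (hM : ∀ z, |g z| ≤ M)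
    (ψ : Lp ℂ 1 μ) : Integrable (fun z => |g z| * ‖ψ z‖) μ :=
  (Lp_int ψ).norm.bdd_mul (c := M) hg.abs.aestronglyMeasurable
    (Eventually.of_forall fun z => by rw [Real.norm_eq_abs, abs_abs]; exact hM z)

/-- If `|u|` is bounded by `M` and small off a set on which `χ` has small integral, then
`∫ |u| |χ|` is small. -/
lemma integral_abs_mul_le {u : α → ℝ} (hu : Measurable u) {M κ : ℝ} (hM : ∀ z, |u z| ≤ M)
    (hκ : 0 ≤ κ) (χ : Lp ℂ 1 μ) {e : ℝ}
    (he : ∫ z in {z | κ < |u z|}, ‖χ z‖ ∂μ ≤ e) (hM0 : 0 ≤ M) :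
    ∫ z, |u z| * ‖χ z‖ ∂μ ≤ κ * ‖χ‖ + M * e := by
  have hA : MeasurableSet {z | κ < |u z|} := measurableSet_lt measurable_const hu.abs
  have hi1 : Integrable (fun z => κ * ‖χ z‖) μ := (Lp_int χ).norm.const_mul κ
  have hi2 : Integrable ({z | κ < |u z|}.indicator fun z => M * ‖χ z‖) μ :=
    ((Lp_int χ).norm.const_mul M).indicator hA
  calc ∫ z, |u z| * ‖χ z‖ ∂μ
      ≤ ∫ z, (κ * ‖χ z‖ + {z | κ < |u z|}.indicator (fun z => M * ‖χ z‖) z) ∂μ := by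
        refine integral_mono (mulR_int hu hM χ) (hi1.add hi2) fun z => ?_
        by_cases hz : z ∈ {z | κ < |u z|}
        · simp only [indicator_of_mem hz]
          have := mul_le_mul_of_nonneg_right (hM z) (norm_nonneg (χ z))
          have := mul_nonneg hκ (norm_nonneg (χ z))
          linarith
        · simp only [indicator_of_notMem hz, add_zero]
          exact mul_le_mul_of_nonneg_right (not_lt.1 hz) (norm_nonneg _)
    _ = κ * ‖χ‖ + M * ∫ z in {z | κ < |u z|}, ‖χ z‖ ∂μ := by
        rw [integral_add hi1 hi2, integral_const_mul, integral_indicator hA, integral_const_mul,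
          Lp_norm]
    _ ≤ _ := by gcongr

/-- For many almost orthogonal bounded functions `g i`, the average of `∫ g i T(φ g i)` is small,
if `T` maps the unit ball to a uniformly integrable set. -/
lemma average_small {φ : Lp ℂ 1 μ} (hφ1 : ‖φ‖ = 1)
    {T : Lp ℂ 1 μ →L[ℂ] Lp ℂ 1 μ} (hT : ‖T‖ ≤ 1) {M δ ε κ η : ℝ} (hM : 0 < M) (hκ : 0 < κ)
    (hη0 : 0 ≤ η)
    (hU : ∀ A, MeasurableSet A → ∫ z in A, ‖φ z‖ ∂μ ≤ δ → ∀ ψ, ∫ z in A, ‖T ψ z‖ ∂μ ≤ ε * ‖ψ‖)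
    {N q : ℕ} (hN : 0 < N) (hq : 0 < q) {g : ℕ → α → ℝ} (hg : ∀ i, Measurable (g i))
    (hgM : ∀ i z, |g i z| ≤ M)
    (horth : ∀ i j, i ≠ j → |∫ z, g i z * g j z * ‖φ z‖ ∂μ| ≤ η)
    (hδ : (M ^ 4 / N + M ^ 2 * η) / κ ^ 2 ≤ δ) :
    ‖∑ i ∈ Finset.range N, intCLM μ (mulR μ (g i) (hg i) M (hgM i)
      (T (mulR μ (g i) (hg i) M (hgM i) φ)))‖ ≤ N * (M ^ 2 / q + κ + M ^ 2 * ε) := by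
  classical
  have hNr : (0 : ℝ) < N := by exact_mod_cast hN
  have hqr : (0 : ℝ) < q := by exact_mod_cast hq
  -- Round every g i down to a multiple of s. The joint rounded values cut φ into finitely many
  -- pieces φl on each of which all g i are constant up to s. How many pieces there are is
  -- immaterial, because the final bounds are proportional to ‖φl‖ and these norms add up to 1.
  set s : ℝ := M / q with hs
  have hs0 : 0 < s := div_pos hM hqr
  have hsq : s * q = M := by rw [hs]; field_simp
  let γ : ℕ → α → ℤ := fun i z => ⌊g i z / s⌋
  have hγm : ∀ i, Measurable (γ i) := fun i => Int.measurable_floor.comp ((hg i).div_const s)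
  have hγq : ∀ i z, γ i z ∈ Finset.Icc (-(q : ℤ)) q := by
    intro i z
    have h1 := abs_le.1 (hgM i z)
    rw [Finset.mem_Icc]
    constructor
    · rw [Int.le_floor, le_div_iff₀ hs0]; push_cast; nlinarith
    · have : g i z / s ≤ q := by rw [div_le_iff₀ hs0]; nlinarith
      have h2 := (Int.floor_le (g i z / s)).trans this
      exact_mod_cast h2
  have hγd : ∀ i z, |g i z - s * γ i z| ≤ s := by
    intro i z
    have h1 := Int.floor_le (g i z / s)
    have h2 := Int.lt_floor_add_one (g i z / s)
    rw [le_div_iff₀ hs0] at h1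
    rw [div_lt_iff₀ hs0] at h2
    rw [abs_le]
    constructor <;> simp only [γ] <;> nlinarith
  let S : Finset (Fin N → ℤ) := Fintype.piFinset fun _ => Finset.Icc (-(q : ℤ)) q
  let P : (Fin N → ℤ) → Set α := fun l => {z | ∀ i : Fin N, γ i z = l i}
  have hPm : ∀ l, MeasurableSet (P l) := fun l => by
    have : P l = ⋂ i : Fin N, γ i ⁻¹' {l i} := by ext z; simp [P]
    rw [this]
    exact MeasurableSet.iInter fun i => hγm i (measurableSet_singleton _)
  let φl : (Fin N → ℤ) → Lp ℂ 1 μ := fun l => indCLM μ (P l) (hPm l) φ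
  have hφl : ∀ l, φl l =ᵐ[μ] (P l).indicator φ := fun l => indCLM_coeFn (hPm l) φ
  -- the pieces exhaust `φ`
  have hpiece : ∀ z (F : (Fin N → ℤ) → ℂ),
      ∑ l ∈ S, (P l).indicator (fun _ => F l) z = F fun i => γ i z := by
    intro z F
    rw [Finset.sum_eq_single (fun i : Fin N => γ i z)]
    · rw [indicator_of_mem]; intro i; rfl
    · intro l _ hl
      rw [indicator_of_notMem]
      intro hz; exact hl (funext fun i => (hz i).symm)
    · intro h; exact absurd (Fintype.mem_piFinset.2 fun i : Fin N => hγq i z) h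
  have hsumφ : ∑ l ∈ S, ‖φl l‖ = 1 := by
    rw [← hφ1, Lp_norm φ]
    have h1 : ∀ l, ‖φl l‖ = ∫ z, (P l).indicator (fun z => ‖φ z‖) z ∂μ := fun l => by
      rw [norm_ind, integral_indicator (hPm l)]
    simp_rw [h1]
    rw [← integral_finsetSum _ fun l _ => (Lp_int φ).norm.indicator (hPm l)]
    refine integral_congr_ae (Eventually.of_forall fun z => ?_)
    have h2 := hpiece z fun _ => ((‖φ z‖ : ℝ) : ℂ)
    simp only
    have h3 : ((∑ l ∈ S, (P l).indicator (fun z => ‖φ z‖) z : ℝ) : ℂ) = ((‖φ z‖ : ℝ) : ℂ) := by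
      rw [← h2]; push_cast
      refine Finset.sum_congr rfl fun l _ => ?_
      by_cases hz : z ∈ P l <;> simp [hz]
    exact_mod_cast h3
  -- rounding
  have hround : ∀ i : Fin N, ‖mulR μ (g i) (hg i) M (hgM i) φ -
      ∑ l ∈ S, (((s * l i : ℝ)) : ℂ) • φl l‖ ≤ s := by
    intro i
    have h1 : ∫ z, s * ‖φ z‖ ∂μ = s := by rw [integral_const_mul, ← Lp_norm, hφ1, mul_one]
    refine (norm_le_of_ae_le ((Lp_int φ).norm.const_mul s) ?_).trans_eq h1
    have h2 : ∀ᵐ z ∂μ, (∑ l ∈ S, (((s * l i : ℝ)) : ℂ) • φl l : Lp ℂ 1 μ) z =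
        ((s * γ i z : ℝ) : ℂ) * φ z := by
      have h3 : ∀ᵐ z ∂μ, ∀ l ∈ S, ((((s * l i : ℝ)) : ℂ) • φl l : Lp ℂ 1 μ) z =
          (P l).indicator (fun _ => ((s * l i : ℝ) : ℂ) * φ z) z := by
        refine (Filter.eventually_all_finset S).2 fun l _ => ?_
        filter_upwards [coeFn_smul_ae (((s * l i : ℝ)) : ℂ) (φl l), hφl l] with z a b
        rw [a, b]
        by_cases hz : z ∈ P l <;> simp [hz]
      filter_upwards [h3, Lp.coeFn_finsetSum S fun l => (((s * l i : ℝ)) : ℂ) • φl l] with z a b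
      rw [b, Finset.sum_apply, Finset.sum_congr rfl a]
      exact hpiece z fun l => ((s * l i : ℝ) : ℂ) * φ z
    filter_upwards [h2, mulR_coeFn (hg := hg i) (hM := hgM i) φ,
      coeFn_sub_ae (mulR μ (g i) (hg i) M (hgM i) φ) (∑ l ∈ S, (((s * l i : ℝ)) : ℂ) • φl l)]
      with z a b c
    rw [c, a, b, ← sub_mul, ← Complex.ofReal_sub, norm_mul, Complex.norm_real]
    exact mul_le_mul_of_nonneg_right (hγd i z) (norm_nonneg _)
  -- the averaged functions
  let u : (Fin N → ℤ) → α → ℝ := fun l z => (N : ℝ)⁻¹ * ∑ i : Fin N, s * l i * g i z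
  have hum : ∀ l, Measurable (u l) := fun l =>
    (Finset.measurable_fun_sum _ fun (i : Fin N) _ => (hg i).const_mul (s * l i)).const_mul _
  have hsl : ∀ l ∈ S, ∀ i, |s * l i| ≤ M := by
    intro l hl i
    have h1 := Finset.mem_Icc.1 (Fintype.mem_piFinset.1 hl i)
    have h2 : (-(q : ℝ)) ≤ l i := by exact_mod_cast h1.1
    have h3 : (l i : ℝ) ≤ q := by exact_mod_cast h1.2
    rw [abs_le]; constructor <;> nlinarith
  have huM : ∀ l ∈ S, ∀ z, |u l z| ≤ M ^ 2 := by
    intro l hl z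
    simp only [u]
    rw [abs_mul, abs_inv, abs_of_pos hNr, inv_mul_le_iff₀ hNr]
    calc |∑ i : Fin N, s * l i * g i z| ≤ ∑ i : Fin N, |s * l i * g i z| :=
          Finset.abs_sum_le_sum_abs _ _
      _ ≤ ∑ i : Fin N, M ^ 2 := Finset.sum_le_sum fun i _ => by
          rw [abs_mul, sq]
          exact mul_le_mul (hsl l hl i) (hgM i z) (abs_nonneg _) hM.le
      _ = N * M ^ 2 := by simp
  have hggi : ∀ i j, Integrable (fun z => g i z * g j z * ‖φ z‖) μ := fun i j =>
    (Lp_int φ).norm.bdd_mul (c := M * M) ((hg i).mul (hg j)).aestronglyMeasurable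
      (Eventually.of_forall fun z => by
        rw [norm_mul]
        exact mul_le_mul (hgM i z) (hgM j z) (abs_nonneg _) hM.le)
  have hη : ∀ i j, |∫ z, g i z * g j z * ‖φ z‖ ∂μ| ≤ M ^ 2 * (if i = j then 1 else 0) + η := by
    intro i j
    split_ifs with h
    · have h1 : |∫ z, g i z * g j z * ‖φ z‖ ∂μ| ≤ ∫ z, M ^ 2 * ‖φ z‖ ∂μ := by
        refine (abs_integral_le_integral_abs).trans
          (integral_mono (hggi i j).abs ((Lp_int φ).norm.const_mul _) fun z => ?_)
        simp only [abs_mul, abs_norm]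
        rw [sq]
        exact mul_le_mul_of_nonneg_right
          (mul_le_mul (hgM i z) (hgM j z) (abs_nonneg _) hM.le) (norm_nonneg _)
      rw [integral_const_mul, ← Lp_norm, hφ1] at h1
      linarith
    · have := horth i j h
      rw [mul_zero, zero_add]; exact this
  -- Expanding the square of the average, the N diagonal terms contribute M⁴/N and the almost
  -- orthogonal pairs at most M²η.
  have hu2 : ∀ l ∈ S, ∫ z, u l z ^ 2 * ‖φ z‖ ∂μ ≤ M ^ 4 / N + M ^ 2 * η := by
    intro l hl
    have h1 : ∀ z, u l z ^ 2 * ‖φ z‖ = ((N : ℝ)⁻¹) ^ 2 *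
        ∑ i : Fin N, ∑ j : Fin N, (s * l i * (s * l j)) * (g i z * g j z * ‖φ z‖) := by
      intro z
      simp only [u]
      rw [mul_pow, sq (∑ i : Fin N, s * l i * g i z), Finset.sum_mul_sum, mul_assoc, Finset.sum_mul]
      congr 1
      refine Finset.sum_congr rfl fun i _ => ?_
      rw [Finset.sum_mul]
      exact Finset.sum_congr rfl fun j _ => by ring
    simp_rw [h1]
    have hij : ∀ i j : Fin N, Integrable
        (fun z => s * l i * (s * l j) * (g i z * g j z * ‖φ z‖)) μ :=
      fun i j => (hggi i j).const_mul _
    have h4 : ∀ i : Fin N, ∫ z, ∑ j : Fin N, s * l i * (s * l j) * (g i z * g j z * ‖φ z‖) ∂μ =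
        ∑ j : Fin N, s * l i * (s * l j) * ∫ z, g i z * g j z * ‖φ z‖ ∂μ := fun i => by
      rw [integral_finsetSum _ fun j _ => hij i j]
      simp_rw [integral_const_mul]
    rw [integral_const_mul, integral_finsetSum _ fun i _ =>
      integrable_finsetSum _ fun j _ => hij i j]
    simp_rw [h4]
    have h2 : ∑ i : Fin N, ∑ j : Fin N, (s * l i * (s * l j)) * ∫ z, g i z * g j z * ‖φ z‖ ∂μ ≤
        ∑ i : Fin N, ∑ j : Fin N, M ^ 2 * (M ^ 2 * (if i = j then 1 else 0) + η) := by
      refine Finset.sum_le_sum fun i _ => Finset.sum_le_sum fun j _ => ?_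
      refine (le_abs_self _).trans ?_
      rw [abs_mul]
      refine mul_le_mul ?_ ?_ (abs_nonneg _) (sq_nonneg M)
      · rw [abs_mul, sq]; exact mul_le_mul (hsl l hl i) (hsl l hl j) (abs_nonneg _) hM.le
      · have := hη i j
        simpa only [Fin.val_inj] using this
    have h3 : ∑ i : Fin N, ∑ j : Fin N, M ^ 2 * (M ^ 2 * (if i = j then (1 : ℝ) else 0) + η) =
        M ^ 4 * N + N ^ 2 * (M ^ 2 * η) := by
      simp only [mul_add, Finset.sum_add_distrib, ← Finset.mul_sum, Finset.sum_ite_eq,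
        Finset.mem_univ, if_true, Finset.sum_const, Finset.card_univ, Fintype.card_fin,
        nsmul_eq_mul]
      ring
    rw [h3] at h2
    calc _ ≤ ((N : ℝ)⁻¹) ^ 2 * (M ^ 4 * N + N ^ 2 * (M ^ 2 * η)) := by gcongr
      _ = M ^ 4 / N + M ^ 2 * η := by field_simp
  have hu2i : ∀ l ∈ S, Integrable (fun z => u l z ^ 2 * ‖φ z‖) μ := fun l hl =>
    (Lp_int φ).norm.bdd_mul (c := (M ^ 2) ^ 2) ((hum l).pow_const 2).aestronglyMeasurable
      (Eventually.of_forall fun z => by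
        rw [norm_pow, Real.norm_eq_abs]
        exact pow_le_pow_left₀ (abs_nonneg _) (huM l hl z) 2)
  -- Chebyshev's inequality for the measure |φ|μ.
  have hsmall : ∀ l ∈ S, ∫ z in {z | κ < |u l z|}, ‖φ z‖ ∂μ ≤ δ := by
    intro l hl
    refine le_trans ?_ hδ
    rw [le_div_iff₀ (by positivity), mul_comm, ← integral_const_mul]
    refine le_trans ?_ (hu2 l hl)
    have hA : MeasurableSet {z | κ < |u l z|} := measurableSet_lt measurable_const (hum l).abs
    refine (setIntegral_mono_on ((Lp_int φ).norm.const_mul _).integrableOn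
      (hu2i l hl).integrableOn hA fun z hz => ?_).trans
      (setIntegral_le_integral (hu2i l hl) (Eventually.of_forall fun z => by positivity))
    have : κ ^ 2 ≤ u l z ^ 2 := by
      rw [← sq_abs (u l z)]; exact pow_le_pow_left₀ hκ.le (le_of_lt hz) 2
    exact mul_le_mul_of_nonneg_right this (norm_nonneg _)
  have hTn : ∀ χ, ‖T χ‖ ≤ ‖χ‖ := fun χ => by
    simpa using T.le_of_opNorm_le hT χ
  -- On a single piece the sum over i is N times the integral of u l against T(φl). It is small
  -- because u l is at most κ off a set of small |φ|μ measure, on which T(φl) is uniformly small.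
  have hl : ∀ l ∈ S, ‖∑ i : Fin N, ((s * l i : ℝ) : ℂ) *
      intCLM μ (mulR μ (g i) (hg i) M (hgM i) (T (φl l)))‖ ≤ N * ((κ + M ^ 2 * ε) * ‖φl l‖) := by
    intro l hl
    have h1 : ∑ i : Fin N, ((s * l i : ℝ) : ℂ) *
        intCLM μ (mulR μ (g i) (hg i) M (hgM i) (T (φl l))) =
        ∫ z, ((N * u l z : ℝ) : ℂ) * T (φl l) z ∂μ := by
      have h2 : ∀ i : Fin N, intCLM μ (mulR μ (g i) (hg i) M (hgM i) (T (φl l))) =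
          ∫ z, (g i z : ℂ) * T (φl l) z ∂μ := fun i => intCLM_mul _
      simp_rw [h2, ← integral_const_mul]
      rw [← integral_finsetSum]
      · refine integral_congr_ae (Eventually.of_forall fun z => ?_)
        simp only [u]
        rw [mul_inv_cancel_left₀ hNr.ne']
        push_cast
        rw [Finset.sum_mul]
        exact Finset.sum_congr rfl fun i _ => by ring
      · intro i _
        exact (mul_int (Complex.measurable_ofReal.comp (hg i)) (C := M)
          (fun z => by rw [Function.comp_apply, Complex.norm_real]; exact hgM i z) _).const_mul _
    rw [h1]
    refine (norm_integral_le_integral_norm _).trans ?_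
    have h2 : ∀ z, ‖((N * u l z : ℝ) : ℂ) * T (φl l) z‖ = N * (|u l z| * ‖T (φl l) z‖) := by
      intro z
      rw [norm_mul, Complex.norm_real, norm_mul, Real.norm_eq_abs, Real.norm_eq_abs,
        abs_of_pos hNr, mul_assoc]
    simp_rw [h2]
    rw [integral_const_mul]
    refine mul_le_mul_of_nonneg_left ?_ hNr.le
    have h3 := integral_abs_mul_le (hum l) (huM l hl) hκ.le (T (φl l))
      (hU _ (measurableSet_lt measurable_const (hum l).abs) (hsmall l hl) (φl l)) (sq_nonneg M)
    refine h3.trans ?_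
    have := mul_le_mul_of_nonneg_left (hTn (φl l)) hκ.le
    nlinarith
  have hdec : ∀ i : Fin N, intCLM μ (mulR μ (g i) (hg i) M (hgM i)
      (T (mulR μ (g i) (hg i) M (hgM i) φ))) =
      intCLM μ (mulR μ (g i) (hg i) M (hgM i) (T (mulR μ (g i) (hg i) M (hgM i) φ -
        ∑ l ∈ S, (((s * l i : ℝ)) : ℂ) • φl l))) +
      ∑ l ∈ S, ((s * l i : ℝ) : ℂ) * intCLM μ (mulR μ (g i) (hg i) M (hgM i) (T (φl l))) := by
    intro i
    simp only [map_sub, map_sum, map_smul, smul_eq_mul, sub_add_cancel]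
  rw [← Fin.sum_univ_eq_sum_range (fun i => intCLM μ (mulR μ (g i) (hg i) M (hgM i)
      (T (mulR μ (g i) (hg i) M (hgM i) φ)))) N, Finset.sum_congr rfl fun i _ => hdec i,
    Finset.sum_add_distrib, Finset.sum_comm]
  refine (norm_add_le _ _).trans ?_
  have e1 : ‖∑ i : Fin N, intCLM μ (mulR μ (g i) (hg i) M (hgM i)
      (T (mulR μ (g i) (hg i) M (hgM i) φ - ∑ l ∈ S, (((s * l i : ℝ)) : ℂ) • φl l)))‖ ≤
      N * (M * s) := by
    refine (norm_sum_le _ _).trans ((Finset.sum_le_card_nsmul _ _ (M * s) fun i _ => ?_).trans_eq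
      (by simp))
    refine (intCLM_norm_le _).trans (((mulR μ (g i) (hg i) M (hgM i)).le_of_opNorm_le
      (mulCLM_norm_le hM.le) _).trans ?_)
    exact mul_le_mul_of_nonneg_left ((hTn _).trans (hround i)) hM.le
  have e2 : ‖∑ l ∈ S, ∑ i : Fin N, ((s * l i : ℝ) : ℂ) *
      intCLM μ (mulR μ (g i) (hg i) M (hgM i) (T (φl l)))‖ ≤ N * (κ + M ^ 2 * ε) := by
    refine (norm_sum_le _ _).trans ((Finset.sum_le_sum hl).trans_eq ?_)
    rw [← Finset.mul_sum, ← Finset.mul_sum, hsumφ, mul_one]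
  have e3 : M * s = M ^ 2 / q := by rw [hs]; ring
  rw [e3] at e1
  linarith

end AlmostOrthogonal

/-! ### The spectral gap at λ = 0. -/

section Gap

variable {α : Type*} [MeasurableSpace α] {μ : Measure α} {K : Lp ℂ 1 μ →L[ℂ] Lp ℂ 1 μ}

lemma norm_reL_sub_le (ψ χ : Lp ℂ 1 μ) : ‖reL ψ - reL χ‖ ≤ ‖ψ - χ‖ := by
  have := (lipschitz_reC.lipschitzWith_compLp (p := 1) (μ := μ) (by simp)).dist_le_mul ψ χ
  rwa [dist_eq_norm, dist_eq_norm, NNReal.coe_one, one_mul] at this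

lemma intCLM_reL (ψ : Lp ℂ 1 μ) : intCLM μ (reL ψ) = (((intCLM μ ψ).re : ℝ) : ℂ) := by
  rw [intCLM_apply, integral_congr_ae (reL_coeFn ψ)]
  have h1 : ∫ z, (ψ z).re ∂μ = (∫ z, ψ z ∂μ).re := integral_re (Lp_int ψ)
  exact integral_ofReal.trans (by rw [h1]; rfl)

lemma reL_decomp (ψ : Lp ℂ 1 μ) : ψ = reL ψ + Complex.I • reL (-Complex.I • ψ) := by
  apply Lp.ext
  filter_upwards [coeFn_add_ae (reL ψ) (Complex.I • reL (-Complex.I • ψ)), reL_coeFn ψ,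
    coeFn_smul_ae Complex.I (reL (-Complex.I • ψ)), reL_coeFn (-Complex.I • ψ),
    coeFn_smul_ae (-Complex.I) ψ] with z a b c d e
  rw [a, b, c, d, e]
  apply Complex.ext <;> simp

lemma norm_sq_sub_le (hK : IsMarkov K) (ψ : Lp ℂ 1 μ) :
    ‖K (K ψ) - ψ‖ ≤ 2 * ‖K ψ - ψ‖ := by
  have : K (K ψ) - ψ = K (K ψ - ψ) + (K ψ - ψ) := by rw [map_sub]; abel
  rw [this]
  linarith [norm_add_le (K (K ψ - ψ)) (K ψ - ψ), hK.norm_apply_le (K ψ - ψ)]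

/-- Real normalised almost fixed points with vanishing integral, if the spectral gap fails. -/
lemma exists_real_almost_fixed (hK : IsMarkov K)
    (h : ∀ c > 0, ∃ ψ, intCLM μ ψ = 0 ∧ ‖K ψ - ψ‖ < c * ‖ψ‖) {e : ℝ} (he : 0 < e) :
    ∃ χ : Lp ℂ 1 μ, intCLM μ χ = 0 ∧ ‖χ‖ = 1 ∧ (∀ᵐ z ∂μ, (χ z).im = 0) ∧ ‖K χ - χ‖ ≤ e := by
  -- K commutes with real parts; after multiplication by -i if necessary, the real part carries at
  -- least half of the norm and can be normalised.
  have key : ∀ ψ : Lp ℂ 1 μ, intCLM μ ψ = 0 → ψ ≠ 0 → ‖ψ‖ ≤ 2 * ‖reL ψ‖ →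
      ‖K ψ - ψ‖ ≤ e / 2 * ‖ψ‖ →
      ∃ χ : Lp ℂ 1 μ, intCLM μ χ = 0 ∧ ‖χ‖ = 1 ∧ (∀ᵐ z ∂μ, (χ z).im = 0) ∧ ‖K χ - χ‖ ≤ e := by
    intro ψ hm h0 h2 hfix
    have hn : 0 < ‖reL ψ‖ := by linarith [norm_pos_iff.2 h0]
    refine ⟨((‖reL ψ‖⁻¹ : ℝ) : ℂ) • reL ψ, ?_, ?_, ?_, ?_⟩
    · rw [map_smul, intCLM_reL, hm]; simp
    · rw [norm_smul, Complex.norm_real, norm_inv, norm_norm, inv_mul_cancel₀ hn.ne']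
    · filter_upwards [coeFn_smul_ae ((‖reL ψ‖⁻¹ : ℝ) : ℂ) (reL ψ), reL_coeFn ψ] with z a b
      rw [a, b, ← Complex.ofReal_mul, Complex.ofReal_im]
    · rw [map_smul, ← smul_sub, norm_smul, Complex.norm_real, norm_inv, norm_norm,
        inv_mul_le_iff₀ hn, hK.map_reL]
      have := norm_reL_sub_le (K ψ) ψ
      nlinarith
  obtain ⟨ψ, hm, hfix⟩ := h (e / 2) (by positivity)
  have h0 : ψ ≠ 0 := by rintro rfl; simp at hfix
  have hd : ‖ψ‖ ≤ ‖reL ψ‖ + ‖reL (-Complex.I • ψ)‖ := by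
    conv_lhs => rw [reL_decomp ψ]
    refine (norm_add_le _ _).trans ?_
    rw [norm_smul, Complex.norm_I, one_mul]
  have hI : ∀ χ : Lp ℂ 1 μ, ‖-Complex.I • χ‖ = ‖χ‖ := fun χ => by simp [norm_smul]
  rcases le_total ‖reL (-Complex.I • ψ)‖ ‖reL ψ‖ with hle | hle
  · exact key ψ hm h0 (by linarith) hfix.le
  · refine key (-Complex.I • ψ) (by rw [map_smul, hm, smul_zero]) ?_ ?_ ?_
    · rw [← norm_ne_zero_iff, hI]; exact norm_ne_zero_iff.2 h0
    · rw [hI]; linarith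
    · rw [map_smul, ← smul_sub, hI, hI]; exact hfix.le

/-- Truncation of a real function `χ` at height `M φ`. -/
def clampL (φ : Lp ℂ 1 μ) (M : ℝ) (χ : Lp ℂ 1 μ) : Lp ℂ 1 μ :=
  (1 / 2 : ℂ) • (absL (χ + (M : ℂ) • φ) - absL (χ - (M : ℂ) • φ))

/-- For y ≥ 0 the expression (|x + y| - |x - y|)/2 is x cut off to [-y, y]. Writing the cut-off
through moduli is what allows `norm_abs_sub_le` to be applied to it. -/
lemma clampL_coeFn {φ χ : Lp ℂ 1 μ} (habs : absL φ = φ) (him : ∀ᵐ z ∂μ, (χ z).im = 0) (M : ℝ) :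
    ∀ᵐ z ∂μ, clampL φ M χ z =
      (((|(χ z).re + M * ‖φ z‖| - |(χ z).re - M * ‖φ z‖|) / 2 : ℝ) : ℂ) := by
  filter_upwards [coeFn_smul_ae (1 / 2 : ℂ) (absL (χ + (M : ℂ) • φ) - absL (χ - (M : ℂ) • φ)),
    coeFn_sub_ae (absL (χ + (M : ℂ) • φ)) (absL (χ - (M : ℂ) • φ)), absL_coeFn (χ + (M : ℂ) • φ),
    absL_coeFn (χ - (M : ℂ) • φ), coeFn_add_ae χ ((M : ℂ) • φ), coeFn_sub_ae χ ((M : ℂ) • φ),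
    coeFn_smul_ae (M : ℂ) φ, absL_eq_self_iff.1 habs, him] with z a b c d e f g h i
  have hχ : χ z = (((χ z).re : ℝ) : ℂ) := Complex.ext (by simp) (by simp [i])
  have h1 : χ z + (M : ℂ) * φ z = (((χ z).re + M * ‖φ z‖ : ℝ) : ℂ) := by
    rw [h, hχ]; simp
  have h2 : χ z - (M : ℂ) * φ z = (((χ z).re - M * ‖φ z‖ : ℝ) : ℂ) := by
    rw [h, hχ]; simp
  rw [clampL, a, b, c, d, e, f, g, h1, h2, Complex.norm_real, Complex.norm_real,
    Real.norm_eq_abs, Real.norm_eq_abs]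
  push_cast; ring

/-- Adding multiples of the fixed vector φ does not change the defect of χ, and taking a modulus at
most doubles it. -/
lemma norm_map_clampL_sub_le (hK : IsMarkov K) {φ : Lp ℂ 1 μ} (hfix : K φ = φ) (M : ℝ)
    (χ : Lp ℂ 1 μ) : ‖K (clampL φ M χ) - clampL φ M χ‖ ≤ 2 * ‖K χ - χ‖ := by
  have h1 := hK.norm_abs_sub_le (χ + (M : ℂ) • φ)
  have h2 := hK.norm_abs_sub_le (χ - (M : ℂ) • φ)
  have e1 : K (χ + (M : ℂ) • φ) - (χ + (M : ℂ) • φ) = K χ - χ := by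
    rw [map_add, map_smul, hfix]; abel
  have e2 : K (χ - (M : ℂ) • φ) - (χ - (M : ℂ) • φ) = K χ - χ := by
    rw [map_sub, map_smul, hfix]; abel
  rw [e1] at h1
  rw [e2] at h2
  have e3 : K (clampL φ M χ) - clampL φ M χ = (1 / 2 : ℂ) •
      ((K (absL (χ + (M : ℂ) • φ)) - absL (χ + (M : ℂ) • φ)) -
        (K (absL (χ - (M : ℂ) • φ)) - absL (χ - (M : ℂ) • φ))) := by
    rw [clampL, map_smul, map_sub, ← smul_sub]; congr 1; abel
  rw [e3, norm_smul]
  have := norm_sub_le (K (absL (χ + (M : ℂ) • φ)) - absL (χ + (M : ℂ) • φ))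
    (K (absL (χ - (M : ℂ) • φ)) - absL (χ - (M : ℂ) • φ))
  have h3 : ‖(1 / 2 : ℂ)‖ = 1 / 2 := by norm_num
  rw [h3]; linarith

/-- Truncating an almost fixed point changes little. -/
lemma norm_clampL_sub_le (hK : IsMarkov K) {φ χ : Lp ℂ 1 μ} (habs : absL φ = φ)
    (him : ∀ᵐ z ∂μ, (χ z).im = 0) (hχ : ‖χ‖ = 1) {M δ ε : ℝ} (hM : 0 < M) (hMδ : 1 / M ≤ δ)
    (hU : ∀ A, MeasurableSet A → ∫ z in A, ‖φ z‖ ∂μ ≤ δ →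
      ∀ ψ, ∫ z in A, ‖K (K ψ) z‖ ∂μ ≤ ε * ‖ψ‖) :
    ‖clampL φ M χ - χ‖ ≤ ε + 2 * ‖K χ - χ‖ := by
  -- Truncation changes χ only on A, where ∫ φ ≤ 1/M. There χ is close to K²χ, whose integral over A
  -- is small by uniform integrability.
  set A := {z | M * ‖φ z‖ < ‖χ z‖} with hA
  have hAm : MeasurableSet A := measurableSet_lt
    ((Lp.stronglyMeasurable φ).measurable.norm.const_mul M) (Lp.stronglyMeasurable χ).measurable.norm
  have h1 : ‖clampL φ M χ - χ‖ ≤ ∫ z, A.indicator (fun z => ‖χ z‖) z ∂μ := by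
    refine norm_le_of_ae_le ((Lp_int χ).norm.indicator hAm) ?_
    filter_upwards [coeFn_sub_ae (clampL φ M χ) χ, clampL_coeFn habs him M, him] with z a b c
    have hχz : χ z = (((χ z).re : ℝ) : ℂ) := Complex.ext (by simp) (by simp [c])
    have hn : ‖χ z‖ = |(χ z).re| := by rw [hχz, Complex.norm_real]; simp
    have hp : 0 ≤ M * ‖φ z‖ := by positivity
    rw [a, b]
    nth_rewrite 3 [hχz]
    rw [← Complex.ofReal_sub, Complex.norm_real, Real.norm_eq_abs]
    by_cases hz : z ∈ A
    · rw [indicator_of_mem hz, hn]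
      have hz' : M * ‖φ z‖ < |(χ z).re| := by rw [← hn]; exact hz
      generalize (χ z).re = x at *
      generalize M * ‖φ z‖ = y at *
      rcases abs_cases (x + y) with ⟨e1, _⟩ | ⟨e1, _⟩ <;>
      rcases abs_cases (x - y) with ⟨e2, _⟩ | ⟨e2, _⟩ <;>
      rcases abs_cases x with ⟨e3, _⟩ | ⟨e3, _⟩ <;> rw [e1, e2, e3, abs_le] <;>
      constructor <;> linarith
    · rw [indicator_of_notMem hz]
      have hz' : |(χ z).re| ≤ M * ‖φ z‖ := by rw [← hn]; exact not_lt.1 hz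
      generalize (χ z).re = x at *
      generalize M * ‖φ z‖ = y at *
      have := abs_le.1 hz'
      rw [abs_of_nonneg (by linarith : 0 ≤ x + y), abs_of_nonpos (by linarith : x - y ≤ 0)]
      apply le_of_eq
      rw [abs_eq_zero]; ring
  rw [integral_indicator hAm] at h1
  have h2 : ∫ z in A, ‖φ z‖ ∂μ ≤ δ := by
    refine le_trans ?_ hMδ
    rw [le_div_iff₀ hM, mul_comm, ← integral_const_mul, ← hχ, Lp_norm χ]
    exact (setIntegral_mono_on ((Lp_int φ).norm.const_mul _).integrableOn
      (Lp_int χ).norm.integrableOn hAm fun z hz => (le_of_lt hz)).trans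
      (setIntegral_le_integral (Lp_int χ).norm (Eventually.of_forall fun z => norm_nonneg _))
  have h3 := hU A hAm h2 χ
  rw [hχ, mul_one, ← norm_ind hAm] at h3
  rw [← norm_ind hAm] at h1
  have h4 : ‖indCLM μ A hAm χ‖ ≤ ‖indCLM μ A hAm (K (K χ))‖ + ‖indCLM μ A hAm (K (K χ) - χ)‖ := by
    have : indCLM μ A hAm χ = indCLM μ A hAm (K (K χ)) - indCLM μ A hAm (K (K χ) - χ) := by
      rw [map_sub]; abel
    rw [this]; exact norm_sub_le _ _
  have h5 : ‖indCLM μ A hAm (K (K χ) - χ)‖ ≤ ‖K (K χ) - χ‖ := by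
    simpa using (indCLM μ A hAm).le_of_opNorm_le (mulCLM_norm_le zero_le_one) (K (K χ) - χ)
  linarith [norm_sq_sub_le hK χ]

/-- The spectral gap: `1 - K` is bounded below on elements with vanishing integral. -/
lemma exists_gap [SigmaFinite μ] (hK : IsMarkov K)
    {C : Set (WeakSpace ℂ (Lp ℂ 1 μ))} (hC : IsCompact C)
    (hKC : ∀ ψ, ‖ψ‖ ≤ 1 → toWeakSpace ℂ _ (K (K ψ)) ∈ C) (hirr : IrreducibleOnL1 K)
    {φ : Lp ℂ 1 μ} (hfix : K φ = φ) (habs : absL φ = φ) (hφ1 : ‖φ‖ = 1) :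
    ∃ c > 0, ∀ ψ, intCLM μ ψ = 0 → c * ‖ψ‖ ≤ ‖K ψ - ψ‖ := by
  have hφ0 : φ ≠ 0 := by rintro rfl; simp at hφ1
  have hpos := invariant_pos hK hirr hfix habs hφ0
  have hT : IsMarkov (K.comp K) := hK.comp hK
  have hintφ : intCLM μ φ = 1 := by
    have := intCLM_absL φ; rw [habs, hφ1] at this; simpa using this
  -- If no c works, there are normalised real almost fixed points of zero integral. Truncation makes
  -- them bounded multiples of φ, and the averaging estimate for K² refutes them.
  by_contra! hcon
  obtain ⟨δ₁, hδ₁, hU₁⟩ := unif_small hT hC hKC hpos (show (0 : ℝ) < 1 / 8 by norm_num)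
  have hn16 : ∀ n : ℕ, (0 : ℝ) < 1 / (n + 16) := fun n => by positivity
  choose χ hχm hχ1 hχr hχf using fun n : ℕ => exists_real_almost_fixed hK hcon (hn16 n)
  have hsmall : ∀ n : ℕ, ‖K (χ n) - χ n‖ ≤ 1 / 16 := fun n => (hχf n).trans (by
    apply one_div_le_one_div_of_le <;> linarith [(Nat.cast_nonneg n : (0 : ℝ) ≤ n)])
  set M : ℝ := 1 / δ₁ with hM
  have hM0 : 0 < M := by positivity
  have hMδ : 1 / M ≤ δ₁ := by rw [hM, one_div_one_div]
  let θ₀ : ℕ → Lp ℂ 1 μ := fun n => clampL φ M (χ n)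
  have hd : ∀ n, ‖θ₀ n - χ n‖ ≤ 1 / 4 := fun n => by
    linarith [norm_clampL_sub_le hK habs (hχr n) (hχ1 n) hM0 hMδ hU₁, hsmall n]
  let m : ℕ → ℝ := fun n => (intCLM μ (θ₀ n)).re
  have hm : ∀ n, intCLM μ (θ₀ n) = m n := by
    intro n
    refine Complex.ext (by simp [m]) ?_
    have h1 : (∫ z, θ₀ n z ∂μ).im = ∫ z, (θ₀ n z).im ∂μ := (integral_im (Lp_int (θ₀ n))).symm
    rw [Complex.ofReal_im, intCLM_apply, h1, integral_eq_zero_of_ae]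
    filter_upwards [clampL_coeFn habs (hχr n) M] with z hz
    simp only [θ₀]
    rw [hz, Complex.ofReal_im]; rfl
  have hm1 : ∀ n, |m n| ≤ 1 / 4 := by
    intro n
    have h1 : intCLM μ (θ₀ n) = intCLM μ (θ₀ n - χ n) := by rw [map_sub, hχm, sub_zero]
    have h2 : |m n| = ‖intCLM μ (θ₀ n)‖ := by rw [hm, Complex.norm_real]; rfl
    rw [h2, h1]
    exact (intCLM_norm_le _).trans (hd n)
  -- Truncation may destroy the zero integral; subtracting m φ restores it at the cost of at most
  -- 1/4 in norm and leaves the defect unchanged.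
  let θ : ℕ → Lp ℂ 1 μ := fun n => θ₀ n - (m n : ℂ) • φ
  have hθm : ∀ n, intCLM μ (θ n) = 0 := fun n => by
    simp only [θ]; rw [map_sub, map_smul, hm, hintφ]; simp
  have hmφ : ∀ n, ‖(m n : ℂ) • φ‖ ≤ 1 / 4 := fun n => by
    rw [norm_smul, hφ1, mul_one, Complex.norm_real]; exact hm1 n
  have hdist : ∀ n, ‖θ n - χ n‖ ≤ 1 / 2 := fun n => by
    have : θ n - χ n = (θ₀ n - χ n) - (m n : ℂ) • φ := by simp only [θ]; abel
    rw [this]; linarith [norm_sub_le (θ₀ n - χ n) ((m n : ℂ) • φ), hd n, hmφ n]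
  have hθlo : ∀ n, 1 / 2 ≤ ‖θ n‖ := fun n => by
    have := norm_sub_norm_le (χ n) (θ n)
    rw [norm_sub_rev (χ n) (θ n), hχ1] at this; linarith [hdist n]
  have hθhi : ∀ n, ‖θ n‖ ≤ 2 := fun n => by
    have := norm_sub_norm_le (θ n) (χ n)
    rw [hχ1] at this; linarith [hdist n]
  have hθf : ∀ n : ℕ, ‖K (θ n) - θ n‖ ≤ 2 * (1 / (n + 16)) := fun n => by
    have h1 : K (θ n) - θ n = K (θ₀ n) - θ₀ n := by
      simp only [θ]; rw [map_sub, map_smul, hfix]; abel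
    rw [h1]
    linarith [norm_map_clampL_sub_le hK hfix M (χ n), hχf n]
  set M' : ℝ := M + 1 with hM'
  have hM'0 : 0 < M' := by linarith
  -- g n is the density of θ n relative to φ. The clipping at M' is inactive almost everywhere and
  -- only provides a bound valid at every point.
  let g : ℕ → α → ℝ := fun n z => max (-M') (min M' ((θ n z).re / ‖φ z‖))
  have hgm : ∀ n, Measurable (g n) := fun n => measurable_const.max (measurable_const.min
    ((Complex.measurable_re.comp (Lp.stronglyMeasurable (θ n)).measurable).div
      (Lp.stronglyMeasurable φ).measurable.norm))
  have hgM : ∀ n z, |g n z| ≤ M' := fun n z =>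
    abs_le.2 ⟨le_max_left _ _, max_le (by linarith) (min_le_left _ _)⟩
  have hθg : ∀ n, ∀ᵐ z ∂μ, θ n z = (g n z : ℂ) * φ z := by
    intro n
    filter_upwards [coeFn_sub_ae (θ₀ n) ((m n : ℂ) • φ), coeFn_smul_ae (m n : ℂ) φ,
      clampL_coeFn habs (hχr n) M, hpos, absL_eq_self_iff.1 habs] with z a b c d e
    have hp : 0 < ‖φ z‖ := norm_pos_iff.2 d
    set v : ℝ := (|(χ n z).re + M * ‖φ z‖| - |(χ n z).re - M * ‖φ z‖|) / 2 with hv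
    have h1 : θ n z = ((v - m n * ‖φ z‖ : ℝ) : ℂ) := by
      simp only [θ, θ₀] at a ⊢
      rw [a, b, c, e, ← Complex.ofReal_mul, ← Complex.ofReal_sub, Complex.norm_real, norm_norm]
    have hv1 : |v| ≤ M * ‖φ z‖ := by
      have := abs_abs_sub_abs_le ((χ n z).re + M * ‖φ z‖) ((χ n z).re - M * ‖φ z‖)
      rw [show (χ n z).re + M * ‖φ z‖ - ((χ n z).re - M * ‖φ z‖) = 2 * (M * ‖φ z‖) by ring,
        abs_of_nonneg (show 0 ≤ 2 * (M * ‖φ z‖) by positivity)] at this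
      rw [hv, abs_div, abs_two]; linarith
    have h2 : |v - m n * ‖φ z‖| ≤ M' * ‖φ z‖ := by
      have h3 : |m n * ‖φ z‖| ≤ 1 * ‖φ z‖ := by
        rw [abs_mul, abs_norm]
        exact mul_le_mul_of_nonneg_right ((hm1 n).trans (by norm_num)) hp.le
      have := abs_sub v (m n * ‖φ z‖)
      rw [hM', add_mul]; linarith
    have h3 : g n z = (v - m n * ‖φ z‖) / ‖φ z‖ := by
      simp only [g]
      rw [h1, Complex.ofReal_re]
      have h4 := abs_le.1 h2
      rw [min_eq_right (by rw [div_le_iff₀ hp]; exact h4.2),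
        max_eq_right (by rw [le_div_iff₀ hp]; linarith [h4.1])]
    rw [h1, h3, e, Complex.norm_real, norm_norm, ← Complex.ofReal_mul, div_mul_cancel₀ _ hp.ne']
  have hθmul : ∀ n, θ n = mulR μ (g n) (hgm n) M' (hgM n) φ := fun n => by
    apply Lp.ext
    filter_upwards [hθg n, mulR_coeFn (hg := hgm n) (hM := hgM n) φ] with z a b
    rw [a, b]
  -- weak convergence to zero
  have hweak : ∀ l : Lp ℂ 1 μ →L[ℂ] ℂ, Tendsto (fun n => l (θ n)) (hyperfilter ℕ) (𝓝 0) := by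
    have hz : Tendsto (fun n : ℕ => 2 * (1 / ((n : ℝ) + 16))) atTop (𝓝 0) := by
      have h1 : Tendsto (fun n : ℕ => ((n : ℝ) + 16)⁻¹) atTop (𝓝 0) :=
        tendsto_inv_atTop_zero.comp
          (tendsto_atTop_add_const_right _ _ tendsto_natCast_atTop_atTop)
      simpa using h1.const_mul 2
    obtain ⟨θ', hθ', hlim⟩ := exists_weak_limit hC hKC (hyperfilter ℕ)
      (ψ := fun n => (1 / 2 : ℂ) • θ n) (fun n => by
        rw [norm_smul]; have h3 : ‖(1 / 2 : ℂ)‖ = 1 / 2 := by norm_num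
        rw [h3]; linarith [hθhi n]) (by
        refine (squeeze_zero_norm (fun n => ?_) hz).mono_left Nat.hyperfilter_le_atTop
        rw [map_smul, ← smul_sub, norm_smul]
        have h3 : ‖(1 / 2 : ℂ)‖ = 1 / 2 := by norm_num
        rw [h3]; linarith [hθf n, norm_nonneg (K (θ n) - θ n)])
    have h0 : intCLM μ θ' = 0 := by
      refine tendsto_nhds_unique (hlim (intCLM μ)) (tendsto_const_nhds.congr fun n => ?_)
      rw [map_smul, hθm, smul_zero]
    have h1 := fixed_eq_zero hK hirr hθ' h0
    intro l
    have h2 := (hlim l).const_mul 2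
    rw [h1, map_zero, mul_zero] at h2
    refine h2.congr fun n => ?_
    rw [map_smul, smul_eq_mul]; ring
  -- constants
  set ε : ℝ := 1 / (32 * M' ^ 2) with hε
  obtain ⟨δ, hδ, hU⟩ := unif_small hT hC hKC hpos (show (0 : ℝ) < ε by positivity)
  obtain ⟨q, hq⟩ := exists_nat_gt (32 * M' ^ 2)
  have hqr : (0 : ℝ) < q := lt_trans (by positivity) hq
  set κ : ℝ := 1 / 32 with hκ
  obtain ⟨N, hN⟩ := exists_nat_gt (2 * M' ^ 4 / (κ ^ 2 * δ))
  have hNr : (0 : ℝ) < N := lt_of_le_of_lt (by positivity) hN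
  set η : ℝ := min (κ ^ 2 * δ / (2 * M' ^ 2)) (1 / (16 * M')) with hη
  have hη0 : 0 < η := by positivity
  have half_bound : ∀ a b : ℝ, 2 * a ≤ b → a ≤ b / 2 := fun a b h => by linarith
  have hδ' : (M' ^ 4 / N + M' ^ 2 * η) / κ ^ 2 ≤ δ := by
    have h1 : M' ^ 4 / N ≤ κ ^ 2 * δ / 2 := by
      rw [div_lt_iff₀ (by positivity)] at hN
      rw [div_le_iff₀ hNr]
      calc M' ^ 4 ≤ (N : ℝ) * (κ ^ 2 * δ) / 2 := half_bound _ _ hN.le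
        _ = _ := by ring
    have h2 : M' ^ 2 * η ≤ κ ^ 2 * δ / 2 := by
      have := min_le_left (κ ^ 2 * δ / (2 * M' ^ 2)) (1 / (16 * M'))
      rw [← hη, le_div_iff₀ (by positivity)] at this
      calc M' ^ 2 * η = η * (2 * M' ^ 2) / 2 := by ring
        _ ≤ _ := div_le_div_of_nonneg_right this zero_le_two
    rw [div_le_iff₀ (by positivity)]
    exact (add_le_add h1 h2).trans_eq (by ring)
  have hpair : ∀ i j, intCLM μ (mulR μ (g i) (hgm i) M' (hgM i) (θ j)) =
      ((∫ z, g i z * g j z * ‖φ z‖ ∂μ : ℝ) : ℂ) := by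
    intro i j
    rw [← integral_complex_ofReal]
    refine integral_congr_ae ?_
    filter_upwards [mulR_coeFn (hg := hgm i) (hM := hgM i) (θ j), hθg j, absL_eq_self_iff.1 habs]
      with z a b c
    rw [a, b, c, Complex.norm_real, norm_norm]; push_cast; ring
  -- Since θ n tends weakly to 0, finitely many chosen g i are almost orthogonal to all θ n for
  -- suitable n; this selects an almost orthogonal sequence inductively.
  obtain ⟨f, hf1, hf2⟩ := exists_seq_of_forall_finset_exists
    (fun n : ℕ => 2 * ‖K (θ n) - θ n‖ ≤ η)
    (fun i j => |∫ z, g i z * g j z * ‖φ z‖ ∂μ| ≤ η) (by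
      intro s _
      have h1 : ∀ᶠ n in (hyperfilter ℕ : Filter ℕ), 2 * ‖K (θ n) - θ n‖ ≤ η := by
        have hz : Tendsto (fun n : ℕ => 4 * (1 / ((n : ℝ) + 16))) atTop (𝓝 0) := by
          have h1 : Tendsto (fun n : ℕ => ((n : ℝ) + 16)⁻¹) atTop (𝓝 0) :=
            tendsto_inv_atTop_zero.comp
              (tendsto_atTop_add_const_right _ _ tendsto_natCast_atTop_atTop)
          simpa using h1.const_mul 4
        have h2 := (hz.eventually (gt_mem_nhds hη0)).filter_mono Nat.hyperfilter_le_atTop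
        filter_upwards [h2] with n hn
        linarith [hθf n]
      have h2 : ∀ᶠ n in (hyperfilter ℕ : Filter ℕ),
          ∀ i ∈ s, |∫ z, g i z * g n z * ‖φ z‖ ∂μ| ≤ η := by
        refine (Filter.eventually_all_finset s).2 fun i _ => ?_
        have h3 := (hweak ((intCLM μ).comp (mulR μ (g i) (hgm i) M' (hgM i)))).norm
        rw [norm_zero] at h3
        filter_upwards [h3.eventually (gt_mem_nhds hη0)] with n hn
        rw [ContinuousLinearMap.comp_apply, hpair, Complex.norm_real] at hn
        exact le_of_lt hn
      obtain ⟨n, hn1, hn2⟩ := (h1.and h2).exists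
      exact ⟨n, hn1, hn2⟩)
  have horth : ∀ i j, i ≠ j → |∫ z, g (f i) z * g (f j) z * ‖φ z‖ ∂μ| ≤ η := by
    intro i j hij
    rcases lt_or_gt_of_ne hij with h | h
    · exact hf2 i j h
    · have := hf2 j i h
      simpa only [mul_comm (g (f j) _)] using this
  have hup := average_small hφ1 hT.norm_le hM'0 (by positivity : 0 < κ) hη0.le hU
    (Nat.cast_pos.1 hNr) (Nat.cast_pos.1 hqr) (fun i => hgm (f i)) (fun i => hgM (f i)) horth hδ'
  -- From g² ≥ |g| - 1/4 one gets ∫ g²φ ≥ ‖θ‖ - 1/4 ≥ 1/4; the 1/16 is reserved for replacing θ by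
  -- K²θ.
  have hlo : ∀ i, 1 / 4 - 1 / 16 ≤ (intCLM μ (mulR μ (g i) (hgm i) M' (hgM i) (θ i))).re - 1 / 16 := by
    intro i
    rw [hpair, Complex.ofReal_re]
    have h1 : ∫ z, (|g i z| * ‖φ z‖ - 1 / 4 * ‖φ z‖) ∂μ ≤ ∫ z, g i z * g i z * ‖φ z‖ ∂μ := by
      refine integral_mono ((mulR_int (hgm i) (hgM i) φ).sub ((Lp_int φ).norm.const_mul _)) ?_ ?_
      · exact (Lp_int φ).norm.bdd_mul (c := M' * M') ((hgm i).mul (hgm i)).aestronglyMeasurable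
          (Eventually.of_forall fun z => by
            rw [norm_mul]
            exact mul_le_mul (hgM i z) (hgM i z) (abs_nonneg _) hM'0.le)
      · intro z
        have h2 : |g i z| - 1 / 4 ≤ g i z * g i z := by
          rw [← abs_mul_abs_self (g i z)]; nlinarith [sq_nonneg (|g i z| - 1 / 2)]
        have := mul_le_mul_of_nonneg_right h2 (norm_nonneg (φ z))
        simp only; linarith
    rw [integral_sub (mulR_int (hgm i) (hgM i) φ) ((Lp_int φ).norm.const_mul _),
      integral_const_mul, ← Lp_norm, hφ1] at h1
    have h2 : ∫ z, |g i z| * ‖φ z‖ ∂μ = ‖θ i‖ := by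
      rw [Lp_norm]
      refine integral_congr_ae ?_
      filter_upwards [hθg i] with z hz
      rw [hz, norm_mul, Complex.norm_real, Real.norm_eq_abs]
    rw [h2] at h1
    linarith [hθlo i]
  have hterm : ∀ i, 3 / 16 ≤ (intCLM μ (mulR μ (g (f i)) (hgm (f i)) M' (hgM (f i))
      ((K.comp K) (mulR μ (g (f i)) (hgm (f i)) M' (hgM (f i)) φ)))).re := by
    intro i
    rw [← hθmul]
    have h1 : (K.comp K) (θ (f i)) = θ (f i) + (K (K (θ (f i))) - θ (f i)) := by simp
    rw [h1, map_add, map_add, Complex.add_re]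
    have h2 : ‖intCLM μ (mulR μ (g (f i)) (hgm (f i)) M' (hgM (f i))
        (K (K (θ (f i))) - θ (f i)))‖ ≤ 1 / 16 := by
      refine (intCLM_norm_le _).trans (((mulR μ (g (f i)) (hgm (f i)) M' (hgM (f i))).le_of_opNorm_le
        (mulCLM_norm_le hM'0.le) _).trans ?_)
      have h3 := (norm_sq_sub_le hK (θ (f i))).trans (hf1 i)
      have h4 := min_le_right (κ ^ 2 * δ / (2 * M' ^ 2)) (1 / (16 * M'))
      rw [← hη, le_div_iff₀ (by positivity)] at h4
      nlinarith
    have h3 := (abs_le.1 ((Complex.abs_re_le_norm _).trans h2)).1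
    linarith [hlo (f i)]
  have hsum : (N : ℝ) * (3 / 16) ≤ (∑ i ∈ Finset.range N, intCLM μ (mulR μ (g (f i)) (hgm (f i)) M'
      (hgM (f i)) ((K.comp K) (mulR μ (g (f i)) (hgm (f i)) M' (hgM (f i)) φ)))).re := by
    rw [Complex.re_sum]
    calc (N : ℝ) * (3 / 16) = ∑ i ∈ Finset.range N, (3 / 16 : ℝ) := by simp
      _ ≤ _ := Finset.sum_le_sum fun i _ => hterm i
  -- The averages would be at least 3/16 and at most three times 1/32.
  have hfin := (hsum.trans (Complex.re_le_norm _)).trans hup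
  have h1 : M' ^ 2 / q ≤ 1 / 32 := by rw [div_le_iff₀ hqr]; linarith
  have h2 : M' ^ 2 * ε = 1 / 32 := by rw [hε]; field_simp
  rw [h2] at hfin
  have h3 := le_of_mul_le_mul_left hfin hNr
  rw [hκ] at h3
  linarith

end Gap

/-! ### Multiplication by exp(-λt). -/

section ExpMul

variable {α : Type*} [MeasurableSpace α] {μ : Measure α} {t : α → ℝ≥0}

lemma norm_exp_neg_mul (lam : ℂ) (s : ℝ) :
    ‖Complex.exp (-lam * s)‖ = Real.exp (-(lam.re * s)) := by
  rw [Complex.norm_exp]; simp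

lemma norm_exp_neg_mul_le {lam : ℂ} (hl : 0 ≤ lam.re) (s : ℝ≥0) :
    ‖Complex.exp (-lam * (s : ℝ))‖ ≤ 1 := by
  rw [norm_exp_neg_mul]
  exact Real.exp_le_one_iff.2 (neg_nonpos.2 (mul_nonneg hl s.2))

open Classical in
/-- Multiplication by `exp (-λ t)` on `L¹(μ)`, for `Re λ ≥ 0` and a measurable function `t ≥ 0`. -/
def expMul (μ : Measure α) (t : α → ℝ≥0) (lam : ℂ) : Lp ℂ 1 μ →L[ℂ] Lp ℂ 1 μ :=
  if h : Measurable t ∧ 0 ≤ lam.re then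
    mulCLM μ (fun z => Complex.exp (-lam * (t z : ℝ)))
      (by have := h.1; fun_prop) 1 (fun z => norm_exp_neg_mul_le h.2 (t z))
  else 0

lemma expMul_coeFn (ht : Measurable t) {lam : ℂ} (hl : 0 ≤ lam.re) (ψ : Lp ℂ 1 μ) :
    expMul μ t lam ψ =ᵐ[μ] fun z => Complex.exp (-lam * (t z : ℝ)) * ψ z := by
  rw [expMul, dif_pos ⟨ht, hl⟩]
  exact mulCLM_coeFn ψ

/-- The default value 0 off the closed right half plane keeps this bound free of side conditions. -/
lemma norm_expMul_le (μ : Measure α) (t : α → ℝ≥0) (lam : ℂ) : ‖expMul μ t lam‖ ≤ 1 := by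
  rw [expMul]
  split_ifs
  · exact mulCLM_norm_le zero_le_one
  · simp

lemma norm_expMul_apply_le (lam : ℂ) (ψ : Lp ℂ 1 μ) : ‖expMul μ t lam ψ‖ ≤ ‖ψ‖ := by
  simpa using (expMul μ t lam).le_of_opNorm_le (norm_expMul_le μ t lam) ψ

lemma expMul_zero (ht : Measurable t) : expMul μ t 0 = ContinuousLinearMap.id ℂ _ := by
  ext1 ψ
  apply Lp.ext
  filter_upwards [expMul_coeFn ht (le_refl (0 : ℂ).re) ψ] with z h
  rw [h]; simp

end ExpMul

/-! ### Cyclicity of the approximate peripheral spectrum. -/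

section Phase

variable {α : Type*} [MeasurableSpace α] {μ : Measure α} {K : Lp ℂ 1 μ →L[ℂ] Lp ℂ 1 μ}

lemma norm_pow_sub_pow_le {D β : ℂ} (hD : ‖D‖ = 1) (hβ : ‖β‖ = 1) (j : ℕ) :
    ‖D ^ j - β ^ j‖ ≤ j * ‖D - β‖ := by
  induction j with
  | zero => simp
  | succ j ih =>
    have : D ^ (j + 1) - β ^ (j + 1) = (D ^ j - β ^ j) * D + β ^ j * (D - β) := by ring
    rw [this]
    refine (norm_add_le _ _).trans ?_
    rw [norm_mul, norm_mul, norm_pow, hD, hβ, one_pow]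
    push_cast; linarith

/-- |D - β|² = 2(1 - Re(β̄D)), and x ≤ κ + x²/κ. The right side is affine in D, so a positive
operator can be applied to the inequality. -/
lemma norm_sub_le_phase {D β : ℂ} (hD : ‖D‖ = 1) (hβ : ‖β‖ = 1) {κ : ℝ} (hκ : 0 < κ) :
    ‖D - β‖ ≤ κ + 2 / κ * (1 - (star β * D).re) := by
  have h1 : ‖D - β‖ ^ 2 = 2 * (1 - (star β * D).re) := by
    have e1 := Complex.sq_norm D
    have e2 := Complex.sq_norm β
    rw [hD, Complex.normSq_apply] at e1
    rw [hβ, Complex.normSq_apply] at e2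
    rw [Complex.sq_norm, Complex.normSq_apply]
    simp only [Complex.sub_re, Complex.sub_im, Complex.mul_re, Complex.star_def, Complex.conj_re,
      Complex.conj_im]
    nlinarith
  have h2 : 2 / κ * (1 - (star β * D).re) = ‖D - β‖ ^ 2 / κ := by rw [h1]; ring
  rw [h2]
  have h3 : 0 ≤ (‖D - β‖ - κ) ^ 2 := sq_nonneg _
  have h4 : ‖D - β‖ - κ ≤ ‖D - β‖ ^ 2 / κ := by
    rw [le_div_iff₀ hκ]; nlinarith [norm_nonneg (D - β)]
  linarith

/-- Multiplication by a function of modulus one. -/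
abbrev phaseMul (μ : Measure α) (D : α → ℂ) (hD : Measurable D) (hD1 : ∀ z, ‖D z‖ = 1) (j : ℕ) :
    Lp ℂ 1 μ →L[ℂ] Lp ℂ 1 μ :=
  mulCLM μ (fun z => D z ^ j) (hD.pow_const j) 1 (fun z => by rw [norm_pow, hD1, one_pow])

/-- The two preceding bounds control |Dʲ - βʲ|φ by an expression that is real linear in φ and
Re(β̄Dφ); K preserves the inequality and commutes with real parts. -/
lemma phase_pointwise_const (hK : IsMarkov K) {φ : Lp ℂ 1 μ} (hφ : absL φ = φ) {D : α → ℂ}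
    (hD : Measurable D) (hD1 : ∀ z, ‖D z‖ = 1) (j : ℕ) {κ : ℝ} (hκ : 0 < κ) {β : ℂ}
    (hβ : ‖β‖ = 1) : ∀ᵐ z ∂μ, ‖K (phaseMul μ D hD hD1 j φ) z - β ^ j * K φ z‖ ≤
      j * (κ * (K φ z).re + 2 / κ * ((K φ z).re - (star β * K (phaseMul μ D hD hD1 1 φ) z).re)) := by
  set ψ := phaseMul μ D hD hD1 1 φ with hψ
  set X : Lp ℂ 1 μ := phaseMul μ D hD hD1 j φ - β ^ j • φ with hX
  set Y : Lp ℂ 1 μ := ((j : ℝ) : ℂ) • ((κ : ℂ) • φ + ((2 / κ : ℝ) : ℂ) • (φ - reL (star β • ψ))) with hY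
  have hYz : ∀ᵐ z ∂μ, Y z =
      ((j * (κ * ‖φ z‖ + 2 / κ * (‖φ z‖ - (star β * D z).re * ‖φ z‖)) : ℝ) : ℂ) := by
    filter_upwards [coeFn_smul_ae ((j : ℝ) : ℂ) ((κ : ℂ) • φ + ((2 / κ : ℝ) : ℂ) • (φ - reL (star β • ψ))),
      coeFn_add_ae ((κ : ℂ) • φ) (((2 / κ : ℝ) : ℂ) • (φ - reL (star β • ψ))),
      coeFn_smul_ae (κ : ℂ) φ, coeFn_smul_ae ((2 / κ : ℝ) : ℂ) (φ - reL (star β • ψ)),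
      coeFn_sub_ae φ (reL (star β • ψ)), reL_coeFn (star β • ψ), coeFn_smul_ae (star β) ψ,
      mulCLM_coeFn (hb := hD.pow_const 1) (hC := fun z => by rw [norm_pow, hD1, one_pow]) φ,
      absL_eq_self_iff.1 hφ] with z a b c d e f g h i
    have h' : ψ z = D z * φ z := h.trans (by rw [pow_one])
    have h2 : (star β * (D z * ((‖φ z‖ : ℝ) : ℂ))).re = (star β * D z).re * ‖φ z‖ := by
      rw [← mul_assoc, Complex.re_mul_ofReal]
    rw [hY, a, b, c, d, e, f, g, h', i, h2, Complex.norm_real, norm_norm]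
    push_cast; ring
  have hXz : ∀ᵐ z ∂μ, X z = (D z ^ j - β ^ j) * φ z := by
    filter_upwards [coeFn_sub_ae (phaseMul μ D hD hD1 j φ) (β ^ j • φ), coeFn_smul_ae (β ^ j) φ,
      mulCLM_coeFn (hb := hD.pow_const j) (hC := fun z => by rw [norm_pow, hD1, one_pow]) φ]
      with z a b c
    rw [hX, a, b, c]; ring
  have hbd : ∀ z, 0 ≤ 1 - (star β * D z).re := fun z => by
    have := Complex.abs_re_le_norm (star β * D z)
    rw [norm_mul, norm_star, hβ, hD1, one_mul] at this
    linarith [(abs_le.1 this).2]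
  have hYn : ∀ z, 0 ≤ (j : ℝ) * (κ * ‖φ z‖ + 2 / κ * (‖φ z‖ - (star β * D z).re * ‖φ z‖)) := by
    intro z
    have : ‖φ z‖ - (star β * D z).re * ‖φ z‖ = (1 - (star β * D z).re) * ‖φ z‖ := by ring
    rw [this]
    have := hbd z
    positivity
  have hYa : absL Y = Y := by
    apply absL_eq_of_re_nonneg
    filter_upwards [hYz] with z hz
    rw [hz, Complex.ofReal_re, Complex.ofReal_im]
    exact ⟨hYn z, rfl⟩
  have hle : ∀ᵐ z ∂μ, ‖absL X z‖ ≤ ‖Y z‖ := by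
    filter_upwards [norm_absL_ae X, hXz, hYz] with z a b c
    rw [a, b, c, norm_mul, Complex.norm_real, Real.norm_of_nonneg (hYn z)]
    calc ‖D z ^ j - β ^ j‖ * ‖φ z‖ ≤ (j * ‖D z - β‖) * ‖φ z‖ :=
          mul_le_mul_of_nonneg_right (norm_pow_sub_pow_le (hD1 z) hβ j) (norm_nonneg _)
      _ ≤ (j * (κ + 2 / κ * (1 - (star β * D z).re))) * ‖φ z‖ := by
          gcongr; exact norm_sub_le_phase (hD1 z) hβ hκ
      _ = _ := by ring
  have hKY : K Y = ((j : ℝ) : ℂ) • ((κ : ℂ) • K φ + ((2 / κ : ℝ) : ℂ) • (K φ - reL (star β • K ψ))) := by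
    rw [hY, map_smul, map_add, map_smul, map_smul, map_sub, hK.map_reL, map_smul]
  have hKX : K X = K (phaseMul μ D hD hD1 j φ) - β ^ j • K φ := by rw [hX, map_sub, map_smul]
  filter_upwards [hK.dom X, hK.mono (absL_absL X) hYa hle, re_of_absL_eq (hK.nonneg' hYa),
    coeFn_sub_ae (K (phaseMul μ D hD hD1 j φ)) (β ^ j • K φ), coeFn_smul_ae (β ^ j) (K φ),
    coeFn_smul_ae ((j : ℝ) : ℂ) ((κ : ℂ) • K φ + ((2 / κ : ℝ) : ℂ) • (K φ - reL (star β • K ψ))),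
    coeFn_add_ae ((κ : ℂ) • K φ) (((2 / κ : ℝ) : ℂ) • (K φ - reL (star β • K ψ))),
    coeFn_smul_ae (κ : ℂ) (K φ), coeFn_smul_ae ((2 / κ : ℝ) : ℂ) (K φ - reL (star β • K ψ)),
    coeFn_sub_ae (K φ) (reL (star β • K ψ)), reL_coeFn (star β • K ψ), coeFn_smul_ae (star β) (K ψ)]
    with z a b c d e f g h i k l m
  rw [← e, ← d, ← hKX]
  refine (a.trans b).trans (le_of_eq ?_)
  rw [c.2.2, hKY, f, g, h, i, k, l, m, Complex.re_ofReal_mul, Complex.add_re, Complex.re_ofReal_mul,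
    Complex.re_ofReal_mul, Complex.sub_re, Complex.ofReal_re]

/-- Later β has to depend on the point z, so the exceptional null set must not depend on β: use a
countable dense subset of the circle and continuity in β. -/
lemma phase_pointwise (hK : IsMarkov K) {φ : Lp ℂ 1 μ} (hφ : absL φ = φ) {D : α → ℂ}
    (hD : Measurable D) (hD1 : ∀ z, ‖D z‖ = 1) (j : ℕ) {κ : ℝ} (hκ : 0 < κ) :
    ∀ᵐ z ∂μ, ∀ β : Circle, ‖K (phaseMul μ D hD hD1 j φ) z - (β : ℂ) ^ j * K φ z‖ ≤
      j * (κ * (K φ z).re +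
        2 / κ * ((K φ z).re - (star (β : ℂ) * K (phaseMul μ D hD hD1 1 φ) z).re)) := by
  have h := ae_all_iff.2 fun n : ℕ => phase_pointwise_const hK hφ hD hD1 j hκ
    (β := (TopologicalSpace.denseSeq Circle n : ℂ)) (Circle.norm_coe _)
  filter_upwards [h] with z hz β
  refine (TopologicalSpace.denseRange_denseSeq Circle).induction_on (p := fun β : Circle =>
    ‖K (phaseMul μ D hD hD1 j φ) z - (β : ℂ) ^ j * K φ z‖ ≤ j * (κ * (K φ z).re +
      2 / κ * ((K φ z).re - (star (β : ℂ) * K (phaseMul μ D hD hD1 1 φ) z).re))) β ?_ hz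
  apply isClosed_le
  · fun_prop
  · have : Continuous fun β : Circle => (star (β : ℂ) * K (phaseMul μ D hD hD1 1 φ) z).re :=
      Complex.continuous_re.comp ((continuous_star.comp continuous_subtype_val).mul continuous_const)
    fun_prop

variable {t : α → ℝ≥0}

/-- Approximate eigenvectors of `exp (-iηt) K` on the unit circle produce approximate eigenvectors
of `exp (-ijηt) K` for all multiples `jη`. -/
lemma almost_eigen_mul (hK : IsMarkov K) (ht : Measurable t) {η : ℝ}
    (h : ∀ c > 0, ∃ ψ, ‖ψ‖ = 1 ∧ ‖expMul μ t (η * Complex.I) (K ψ) - ψ‖ ≤ c) (j : ℕ) :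
    ∀ c > 0, ∃ ψ, ‖ψ‖ = 1 ∧ ‖expMul μ t ((j * η : ℝ) * Complex.I) (K ψ) - ψ‖ ≤ c := by
  intro c₀ hc₀
  set κ : ℝ := c₀ / (2 * (j + 1)) with hκ
  have hj : (0 : ℝ) ≤ j := j.cast_nonneg
  have hκ0 : 0 < κ := by positivity
  set c : ℝ := c₀ / (2 * (j * (2 / κ) + 2)) with hc
  have hc0 : 0 < c := by positivity
  obtain ⟨ψ, hψ1, hψ⟩ := h c hc0
  have hre : ∀ s : ℝ, (0 : ℝ) ≤ ((s : ℂ) * Complex.I).re := fun s => by simp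
  have hψm : Measurable ψ := (Lp.stronglyMeasurable ψ).measurable
  -- The phase of ψ, set equal to 1 where ψ vanishes so that its modulus is 1 everywhere. The
  -- approximate eigenvector for jη will be Dʲ|ψ|.
  let D : α → ℂ := fun z => if ψ z = 0 then 1 else ψ z / ‖ψ z‖
  have hD : Measurable D := Measurable.ite (hψm (measurableSet_singleton 0)) measurable_const
    (hψm.div (Complex.measurable_ofReal.comp hψm.norm))
  have hD1 : ∀ z, ‖D z‖ = 1 := fun z => by
    simp only [D]
    split_ifs with h0
    · simp
    · rw [norm_div, Complex.norm_real, norm_norm, div_self (norm_ne_zero_iff.2 h0)]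
  have hDψ : ∀ z, D z * ‖ψ z‖ = ψ z := fun z => by
    simp only [D]
    split_ifs with h0
    · simp [h0]
    · rw [div_mul_cancel₀]; exact_mod_cast norm_ne_zero_iff.2 h0
  set φ := absL ψ with hφ
  have hφa : absL φ = φ := absL_absL ψ
  have hDφ : phaseMul μ D hD hD1 1 φ = ψ := by
    apply Lp.ext
    filter_upwards [mulCLM_coeFn (hb := hD.pow_const 1)
      (hC := fun z => by rw [norm_pow, hD1, one_pow]) φ, absL_coeFn ψ] with z a b
    rw [a, hφ, b, pow_one, hDψ]
  have hexp : ∀ s r : ℝ, ‖Complex.exp (-((s : ℂ) * Complex.I) * (r : ℝ))‖ = 1 := fun s r => by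
    rw [norm_exp_neg_mul]; simp
  -- A = exp(iηt)D is the phase that Kψ nearly has, because exp(-iηt)Kψ is close to ψ = D|ψ|.
  obtain ⟨A, hAe⟩ : ∃ A : α → ℂ,
      ∀ z, Complex.exp (-((η : ℂ) * Complex.I) * (t z : ℝ)) * A z = D z :=
    ⟨fun z => Complex.exp ((η : ℂ) * Complex.I * (t z : ℝ)) * D z, fun z => by
      rw [← mul_assoc, ← Complex.exp_add]; simp⟩
  have hAj : ∀ z, Complex.exp (-(((j * η : ℝ) : ℂ) * Complex.I) * (t z : ℝ)) * A z ^ j = D z ^ j :=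
    fun z => by
      have e : Complex.exp (-(((j * η : ℝ) : ℂ) * Complex.I) * (t z : ℝ)) =
          Complex.exp (-((η : ℂ) * Complex.I) * (t z : ℝ)) ^ j := by
        rw [← Complex.exp_nat_mul]; congr 1; push_cast; ring
      rw [e, ← mul_pow, hAe]
  have hA1 : ∀ z, ‖A z‖ = 1 := fun z => by
    have := congrArg norm (hAe z)
    rwa [norm_mul, hexp, one_mul, hD1] at this
  set R := expMul μ t (η * Complex.I) (K ψ) with hR
  have hRψ : ∀ᵐ z ∂μ, (star (A z) * K ψ z).re ≥ ‖ψ z‖ - ‖(R - ψ) z‖ := by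
    filter_upwards [expMul_coeFn ht (hre η) (K ψ), coeFn_sub_ae R ψ] with z a b
    have e1 : star (A z) * K ψ z = star (D z) * R z := by
      have hE : star (Complex.exp (-((η : ℂ) * Complex.I) * (t z : ℝ))) *
          Complex.exp (-((η : ℂ) * Complex.I) * (t z : ℝ)) = 1 := by
        rw [mul_comm, Complex.star_def, Complex.mul_conj, Complex.normSq_eq_norm_sq, hexp]; simp
      rw [← hAe z, hR, a, star_mul', mul_mul_mul_comm, hE, one_mul]
    have e2 : (star (D z) * ψ z).re = ‖ψ z‖ := by
      rw [← hDψ z, ← mul_assoc, Complex.star_def, mul_comm ((starRingEnd ℂ) _), Complex.mul_conj,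
        Complex.normSq_eq_norm_sq, hD1]; simp [hDψ, hD1]
    have e3 : star (D z) * R z = star (D z) * ψ z + star (D z) * (R z - ψ z) := by ring
    have e4 := (abs_le.1 (Complex.abs_re_le_norm (star (D z) * (R z - ψ z)))).1
    rw [norm_mul, norm_star, hD1, one_mul] at e4
    rw [e1, e3, Complex.add_re, e2, b]; linarith
  have hKφn : ‖K φ‖ = 1 := by rw [hφ, hK.norm_abs, hψ1]
  -- Apply `phase_pointwise` with β = A z: K(Dʲφ) is close to AʲKφ, and exp(-ijηt)Aʲ = Dʲ.
  -- Integration turns the defect of the phases into the defect c of ψ.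
  have hstep : ‖expMul μ t ((j * η : ℝ) * Complex.I) (K (phaseMul μ D hD hD1 j φ)) -
      phaseMul μ D hD hD1 j (K φ)‖ ≤ j * (κ + 2 / κ * c) := by
    have hint : Integrable (fun z => (j : ℝ) * (κ * ‖K φ z‖ +
        2 / κ * (‖K φ z‖ - (‖ψ z‖ - ‖(R - ψ) z‖)))) μ :=
      (((Lp_int (K φ)).norm.const_mul _).add (((Lp_int (K φ)).norm.sub
        ((Lp_int ψ).norm.sub (Lp_int (R - ψ)).norm)).const_mul _)).const_mul _
    refine (norm_le_of_ae_le hint ?_).trans ?_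
    · filter_upwards [phase_pointwise hK hφa hD hD1 j hκ0, hRψ, re_of_absL_eq (hK.nonneg' hφa),
        coeFn_sub_ae (expMul μ t ((j * η : ℝ) * Complex.I) (K (phaseMul μ D hD hD1 j φ)))
          (phaseMul μ D hD hD1 j (K φ)),
        expMul_coeFn ht (hre (j * η)) (K (phaseMul μ D hD hD1 j φ)),
        mulCLM_coeFn (hb := hD.pow_const j)
          (hC := fun z => by rw [norm_pow, hD1, one_pow]) (K φ)] with z a b d e f g
      have a' := a ⟨A z, by simp [Submonoid.unitSphere, hA1]⟩
      rw [hDφ] at a'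
      simp only at a'
      rw [e, f, g, ← hAj z, mul_assoc, ← mul_sub, norm_mul, hexp, one_mul, d.2.2]
      refine a'.trans ?_
      gcongr
    · have i1 : Integrable (fun z => ‖ψ z‖ - ‖(R - ψ) z‖) μ := (Lp_int ψ).norm.sub (Lp_int _).norm
      have i2 : Integrable (fun z => ‖K φ z‖ - (‖ψ z‖ - ‖(R - ψ) z‖)) μ :=
        (Lp_int (K φ)).norm.sub i1
      rw [integral_const_mul, integral_add ((Lp_int (K φ)).norm.const_mul _) (i2.const_mul _),
        integral_const_mul, integral_const_mul, integral_sub (Lp_int (K φ)).norm i1,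
        integral_sub (Lp_int ψ).norm
        (Lp_int (R - ψ)).norm, ← Lp_norm, ← Lp_norm, ← Lp_norm, hKφn, hψ1]
      have : 1 - (1 - ‖R - ψ‖) ≤ c := by linarith
      rw [mul_one]
      gcongr
  -- |R| ≤ Kφ while ‖Kφ‖ = 1 and ‖R‖ ≥ 1 - c, so Kφ is within c of |R|, which is within c of φ =
  -- |ψ|.
  have hKφ : ‖K φ - φ‖ ≤ 2 * c := by
    have h1 : ‖absL R - φ‖ ≤ c := (norm_absL_sub_le R ψ).trans hψ
    have h2 : ‖K φ - absL R‖ ≤ c := by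
      have hae : ∀ᵐ z ∂μ, ‖(K φ - absL R) z‖ ≤ ‖K φ z‖ - ‖R z‖ := by
        filter_upwards [coeFn_sub_ae (K φ) (absL R), absL_coeFn R, hK.dom ψ,
          expMul_coeFn ht (hre η) (K ψ), absL_eq_self_iff.1 (hK.nonneg' hφa)] with z a b d e f
        rw [a, b, f, ← Complex.ofReal_sub, Complex.norm_real, Complex.norm_real, norm_norm,
          Real.norm_of_nonneg]
        rw [hR, e, norm_mul, hexp, one_mul]; linarith
      refine (norm_le_of_ae_le (g := fun z => ‖K φ z‖ - ‖R z‖)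
        ((Lp_int _).norm.sub (Lp_int _).norm) hae).trans ?_
      rw [integral_sub (Lp_int _).norm (Lp_int _).norm, ← Lp_norm, ← Lp_norm, hKφn]
      have := norm_sub_norm_le ψ R
      rw [norm_sub_rev, hψ1] at this
      linarith
    have : K φ - φ = (K φ - absL R) + (absL R - φ) := by abel
    rw [this]; linarith [norm_add_le (K φ - absL R) (absL R - φ)]
  refine ⟨phaseMul μ D hD hD1 j φ, ?_, ?_⟩
  · rw [← hψ1, Lp_norm, Lp_norm]
    refine integral_congr_ae ?_
    filter_upwards [mulCLM_coeFn (hb := hD.pow_const j)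
      (hC := fun z => by rw [norm_pow, hD1, one_pow]) φ, norm_absL_ae ψ] with z a b
    rw [a, norm_mul, norm_pow, hD1, one_pow, one_mul, hφ, b]
  · have h1 : ‖phaseMul μ D hD hD1 j (K φ) - phaseMul μ D hD hD1 j φ‖ ≤ 2 * c := by
      rw [← map_sub]
      refine ((phaseMul μ D hD hD1 j).le_of_opNorm_le (mulCLM_norm_le zero_le_one) _).trans ?_
      rw [one_mul]; exact hKφ
    have h2 := norm_sub_le_norm_sub_add_norm_sub
      (expMul μ t ((j * η : ℝ) * Complex.I) (K (phaseMul μ D hD hD1 j φ)))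
      (phaseMul μ D hD hD1 j (K φ)) (phaseMul μ D hD hD1 j φ)
    have h3 : j * κ ≤ c₀ / 2 := by
      rw [hκ, mul_div_assoc', div_le_div_iff₀ (by positivity) (by positivity)]; nlinarith
    have h4 : c * (j * (2 / κ) + 2) = c₀ / 2 := by
      rw [hc]; field_simp
    nlinarith

lemma norm_pow_ge_one_of_almost_eigen {E : Type*} [NormedAddCommGroup E] [NormedSpace ℂ E]
    {T : E →L[ℂ] E} (hT : ‖T‖ ≤ 1) (h : ∀ c > 0, ∃ ψ, ‖ψ‖ = 1 ∧ ‖T ψ - ψ‖ ≤ c) (p : ℕ) :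
    1 ≤ ‖T ^ p‖ := by
  have key : ∀ (p : ℕ) ψ, ‖(T ^ p) ψ - ψ‖ ≤ p * ‖T ψ - ψ‖ := by
    intro p ψ
    induction p with
    | zero => simp
    | succ p ih =>
      have : (T ^ (p + 1)) ψ - ψ = T ((T ^ p) ψ - ψ) + (T ψ - ψ) := by
        rw [pow_succ', map_sub]; simp
      rw [this]
      refine (norm_add_le _ _).trans ?_
      have := T.le_of_opNorm_le hT ((T ^ p) ψ - ψ)
      rw [one_mul] at this
      calc _ ≤ (p : ℝ) * ‖T ψ - ψ‖ + ‖T ψ - ψ‖ := add_le_add (this.trans ih) le_rfl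
        _ = _ := by push_cast; ring
  refine le_of_forall_pos_le_add fun c hc => ?_
  obtain ⟨ψ, h1, h2⟩ := h (c / (p + 1)) (by positivity)
  have h3 := (T ^ p).le_opNorm ψ
  have h4 := norm_sub_norm_le ψ ((T ^ p) ψ)
  rw [norm_sub_rev, h1] at h4
  rw [h1, mul_one] at h3
  have h5 := (key p ψ).trans (mul_le_mul_of_nonneg_left h2 p.cast_nonneg)
  have h6 : (p : ℝ) * (c / (p + 1)) ≤ c := by
    rw [mul_div_assoc', div_le_iff₀ (by positivity)]; nlinarith
  linarith

end Phase

/-! ### Invertibility of operators bounded below; rank one regularisation. -/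

section Units

variable {E : Type*} [NormedAddCommGroup E] [NormedSpace ℂ E] [CompleteSpace E]

/-- An operator which is bounded below and is a limit of invertible operators is invertible. -/
lemma isUnit_of_bddBelow_of_approx {T : E →L[ℂ] E} {c : ℝ} (hc : 0 < c)
    (hT : ∀ x, c * ‖x‖ ≤ ‖T x‖) (h : ∀ e > 0, ∃ S : E →L[ℂ] E, IsUnit S ∧ ‖T - S‖ ≤ e) :
    IsUnit T := by
  rcases subsingleton_or_nontrivial E with hE | hE
  · have : T = 1 := by ext x; exact Subsingleton.elim _ _
    rw [this]; exact isUnit_one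
  obtain ⟨S, ⟨u, rfl⟩, hS⟩ := h (c / 4) (by positivity)
  -- The unit close to T inherits its lower bound, so its inverse has norm at most 2/c, and T lies
  -- within c/4 of it, inside the ball where perturbations stay invertible.
  have h1 : ‖(↑u⁻¹ : E →L[ℂ] E)‖ ≤ 2 / c := by
    refine ContinuousLinearMap.opNorm_le_bound _ (by positivity) fun x => ?_
    set y := (↑u⁻¹ : E →L[ℂ] E) x with hy
    have hx : (u : E →L[ℂ] E) y = x := by
      exact congrArg (fun A : E →L[ℂ] E => A x) u.mul_inv
    have h2 := (T - u).le_of_opNorm_le hS y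
    have h3 : ‖T y‖ ≤ ‖x‖ + ‖(T - u) y‖ := by
      have : T y = x + (T - u) y := by rw [ContinuousLinearMap.sub_apply, hx]; abel
      rw [this]; exact norm_add_le _ _
    have h4 := hT y
    rw [div_mul_eq_mul_div, le_div_iff₀ hc]
    nlinarith [norm_nonneg y]
  have h0 : 0 < ‖(↑u⁻¹ : E →L[ℂ] E)‖ := norm_pos_iff.2 u⁻¹.ne_zero
  refine ⟨Units.ofNearby u T ?_, rfl⟩
  refine hS.trans_lt ?_
  rw [lt_inv_comm₀ (by positivity) h0]
  refine h1.trans_lt ?_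
  rw [inv_div]
  exact div_lt_div_of_pos_right (by norm_num) hc

lemma isUnit_one_sub_smul {K : E →L[ℂ] E} (hK : ‖K‖ ≤ 1) {r : ℝ} (h0 : 0 ≤ r) (h1 : r < 1) :
    IsUnit (1 - (r : ℂ) • K) := by
  apply isUnit_one_sub_of_norm_lt_one
  refine (norm_smul_le (r : ℂ) K).trans_lt ?_
  rw [Complex.norm_real, Real.norm_of_nonneg h0]
  exact (mul_le_of_le_one_right h0 hK).trans_lt h1

/-- The operators 1 - rK with r < 1 are units by the Neumann series and converge to 1 - K in norm as
r tends to 1. -/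
lemma isUnit_one_sub_of_bddBelow {K : E →L[ℂ] E} (hK : ‖K‖ ≤ 1) {c : ℝ} (hc : 0 < c)
    (h : ∀ x, c * ‖x‖ ≤ ‖K x - x‖) : IsUnit (1 - K) := by
  refine isUnit_of_bddBelow_of_approx hc (fun x => ?_) fun e he => ?_
  · have : (1 - K) x = -(K x - x) := by simp
    rw [this, norm_neg]; exact h x
  · refine ⟨1 - ((1 - min e 1 : ℝ) : ℂ) • K, isUnit_one_sub_smul hK
      (by linarith [min_le_right e 1]) (by linarith [lt_min he one_pos]), ?_⟩
    have : 1 - K - (1 - ((1 - min e 1 : ℝ) : ℂ) • K) = -(((min e 1 : ℝ) : ℂ) • K) := by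
      push_cast; rw [sub_smul, one_smul]; abel
    rw [this, norm_neg, norm_smul, Complex.norm_real,
      Real.norm_of_nonneg (lt_min he one_pos).le]
    exact (mul_le_of_le_one_right (lt_min he one_pos).le hK).trans (min_le_left _ _)

/-- 1 - K² factors into the commuting operators 1 - K and 1 + K. -/
lemma isUnit_one_sub_of_norm_sq_lt {K : E →L[ℂ] E} (h : ‖K * K‖ < 1) : IsUnit (1 - K) := by
  have h1 : IsUnit ((1 - K) * (1 + K)) := by
    have : (1 - K) * (1 + K) = 1 - K * K := by noncomm_ring
    rw [this]; exact isUnit_one_sub_of_norm_lt_one h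
  have hc : Commute (1 - K) (1 + K) := by
    rw [commute_iff_eq]; noncomm_ring
  exact (hc.isUnit_mul_iff.1 h1).1

/-- The rank one operator `ψ ↦ e(ψ) φ`. -/
abbrev rankOne (e : E →L[ℂ] ℂ) (φ : E) : E →L[ℂ] E := e.smulRight φ

/-- If `K` is a contraction with fixed vector `φ` and invariant functional `e`, `e(φ) = 1`, and
`1 - K` is bounded below on `ker e`, then `1 - K + φ ⊗ e` is invertible. -/
lemma isUnit_one_sub_add_rankOne {K : E →L[ℂ] E} (hK : ‖K‖ ≤ 1) {e : E →L[ℂ] ℂ} {φ : E}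
    (he : ‖e‖ ≤ 1) (hφ : ‖φ‖ = 1) (heφ : e φ = 1) (hfix : K φ = φ) (hinv : ∀ x, e (K x) = e x)
    {c : ℝ} (hc : 0 < c) (h : ∀ x, e x = 0 → c * ‖x‖ ≤ ‖K x - x‖) :
    IsUnit (1 - K + rankOne e φ) := by
  have hB : ∀ x, (1 - K + rankOne e φ) x = x - K x + e x • φ := fun x => by simp [rankOne]
  have hex : ∀ x, ‖e x‖ ≤ ‖x‖ := fun x => by simpa using e.le_of_opNorm_le he x
  refine isUnit_of_bddBelow_of_approx (c := (1 + 2 / c)⁻¹) (by positivity) (fun x => ?_)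
    fun d hd => ?_
  · rw [inv_mul_le_iff₀ (by positivity), hB]
    set b := x - K x + e x • φ with hb
    -- The component e(x) can be read off from the image b; what remains of x lies in ker e, where
    -- the gap applies.
    have h1 : e b = e x := by
      rw [hb, map_add, map_sub, hinv, map_smul, heφ]; simp
    have h2 : ‖e x‖ ≤ ‖b‖ := h1 ▸ hex b
    have h3 : e (x - e x • φ) = 0 := by rw [map_sub, map_smul, heφ]; simp
    have h4 := h _ h3
    have h5 : K (x - e x • φ) - (x - e x • φ) = -(b - e x • φ) := by
      rw [map_sub, map_smul, hfix, hb]; abel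
    have h7 : ‖e x • φ‖ = ‖e x‖ := by rw [norm_smul, hφ, mul_one]
    rw [h5, norm_neg] at h4
    have h6 := norm_sub_le b (e x • φ)
    have h8 : ‖x‖ ≤ ‖x - e x • φ‖ + ‖e x • φ‖ := by
      simpa using norm_add_le (x - e x • φ) (e x • φ)
    have h9 : ‖x - e x • φ‖ ≤ 2 * ‖b‖ / c := by
      rw [le_div_iff₀ hc]; linarith
    calc ‖x‖ ≤ 2 * ‖b‖ / c + ‖b‖ := by linarith
      _ = _ := by ring
  -- Approximate by A + φ ⊗ e with A = 1 - (1 - s)K. As Aφ = sφ, this equals A(1 + s⁻¹ φ ⊗ e), and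
  -- the second factor has the explicit inverse 1 - (1 + s)⁻¹ φ ⊗ e.
  · set s : ℝ := min d 1 with hs
    have hs0 : 0 < s := lt_min hd one_pos
    have hs1 : s ≤ 1 := min_le_right _ _
    have hsC : (s : ℂ) ≠ 0 := by exact_mod_cast hs0.ne'
    have hs1C : (1 : ℂ) + s ≠ 0 := by
      have : (1 : ℝ) + s ≠ 0 := by positivity
      exact_mod_cast this
    set A := 1 - ((1 - s : ℝ) : ℂ) • K with hA
    have hAu : IsUnit A := isUnit_one_sub_smul hK (by linarith) (by linarith)
    have hAφ : A φ = (s : ℂ) • φ := by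
      simp [hA, hfix, sub_smul]
    have hr : IsUnit (1 + (s : ℂ)⁻¹ • rankOne e φ) := by
      have hsq : rankOne e φ * rankOne e φ = rankOne e φ := by
        ext x; simp [rankOne, heφ]
      have e1 : (1 + (s : ℂ)⁻¹ • rankOne e φ) * (1 - (1 + (s : ℂ))⁻¹ • rankOne e φ) = 1 := by
        rw [mul_sub, mul_one, add_mul, one_mul, smul_mul_smul_comm, hsq]
        have : (s : ℂ)⁻¹ = (1 + (s : ℂ))⁻¹ + (s : ℂ)⁻¹ * (1 + (s : ℂ))⁻¹ := by
          field_simp; ring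
        nth_rewrite 1 [this]
        rw [add_smul]; abel
      have e2 : (1 - (1 + (s : ℂ))⁻¹ • rankOne e φ) * (1 + (s : ℂ)⁻¹ • rankOne e φ) = 1 := by
        rw [mul_add, mul_one, sub_mul, one_mul, smul_mul_smul_comm, hsq]
        have : (s : ℂ)⁻¹ • rankOne e φ =
            (1 + (s : ℂ))⁻¹ • rankOne e φ + ((1 + (s : ℂ))⁻¹ * (s : ℂ)⁻¹) • rankOne e φ := by
          rw [← add_smul]; congr 1; field_simp; ring
        rw [this]; abel
      exact ⟨⟨_, _, e1, e2⟩, rfl⟩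
    refine ⟨A + rankOne e φ, ?_, ?_⟩
    · have : A + rankOne e φ = A * (1 + (s : ℂ)⁻¹ • rankOne e φ) := by
        rw [mul_add, mul_one]
        congr 1
        ext x
        have : (A * (s : ℂ)⁻¹ • rankOne e φ) x = (s : ℂ)⁻¹ • e x • A φ := by
          simp [rankOne]
        rw [this, hAφ, smul_comm (e x), inv_smul_smul₀ hsC]
        rfl
      rw [this]; exact hAu.mul hr
    · have : 1 - K + rankOne e φ - (A + rankOne e φ) = -((s : ℂ) • K) := by
        rw [hA]; push_cast; rw [sub_smul, one_smul]; abel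
      rw [this, norm_neg, norm_smul, Complex.norm_real, Real.norm_of_nonneg hs0.le]
      exact (mul_le_of_le_one_right hs0.le hK).trans (min_le_left _ _)

end Units

/-! ### Invertibility of 1 - K_λ away from λ = 0. -/

section Resolvent

variable {α : Type*} [MeasurableSpace α] {μ : Measure α} {K : Lp ℂ 1 μ →L[ℂ] Lp ℂ 1 μ}
  {t : α → ℝ≥0}

/-- The operator `K_λ = exp (-λt) K`. -/
def Kfam (K : Lp ℂ 1 μ →L[ℂ] Lp ℂ 1 μ) (t : α → ℝ≥0) (lam : ℂ) : Lp ℂ 1 μ →L[ℂ] Lp ℂ 1 μ :=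
  (expMul μ t lam).comp K

lemma Kfam_apply (lam : ℂ) (ψ : Lp ℂ 1 μ) : Kfam K t lam ψ = expMul μ t lam (K ψ) := rfl

lemma Kfam_zero (ht : Measurable t) : Kfam K t 0 = K := by
  rw [Kfam, expMul_zero ht, ContinuousLinearMap.id_comp]

lemma norm_Kfam_apply_le (hK : IsMarkov K) (lam : ℂ) (ψ : Lp ℂ 1 μ) : ‖Kfam K t lam ψ‖ ≤ ‖ψ‖ :=
  (norm_expMul_apply_le lam _).trans (hK.norm_apply_le ψ)

lemma norm_Kfam_le (hK : IsMarkov K) (lam : ℂ) : ‖Kfam K t lam‖ ≤ 1 :=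
  ContinuousLinearMap.opNorm_le_bound _ zero_le_one fun ψ => by
    simpa using norm_Kfam_apply_le hK lam ψ

/-- For `Re λ > 0` the square of `K_λ` is a strict contraction. -/
lemma norm_Kfam_sq_lt (hK : IsMarkov K) (ht : Measurable t) (hpos : ∀ᵐ z ∂μ, 0 < t z)
    {C : Set (WeakSpace ℂ (Lp ℂ 1 μ))} (hC : IsCompact C)
    (hKC : ∀ ψ, ‖ψ‖ ≤ 1 → toWeakSpace ℂ _ (K (K ψ)) ∈ C) {lam : ℂ} (hl : 0 < lam.re) :
    ‖Kfam K t lam * Kfam K t lam‖ < 1 := by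
  have hT : IsMarkov (K.comp K) := hK.comp hK
  -- Where t is tiny the exponential gives no contraction, but for large k at most half of the mass
  -- of K²|ψ| lies in A k; elsewhere the factor is at most q < 1. Together the bound is (1 - q)/2 +
  -- q = (1 + q)/2.
  let A : ℕ → Set α := fun k => {z | (t z : ℝ) < 1 / (k + 1)}
  have hA : ∀ k, MeasurableSet (A k) := fun k => measurableSet_lt (by fun_prop) measurable_const
  have hanti : Antitone A := fun i j hij z hz => by
    refine lt_of_lt_of_le (show (t z : ℝ) < _ from hz) ?_
    exact one_div_le_one_div_of_le (by positivity) (by gcongr)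
  obtain ⟨k, hk⟩ := unif_small_antitone hT hC hKC hA hanti (by
    filter_upwards [hpos] with z hz
    obtain ⟨k, hk⟩ := exists_nat_one_div_lt (show (0 : ℝ) < t z from hz)
    exact ⟨k, fun h => lt_asymm h hk⟩) (show (0 : ℝ) < 1 / 2 by norm_num)
  set q := Real.exp (-(lam.re * (1 / (k + 1)))) with hq
  have hq1 : q < 1 := Real.exp_lt_one_iff.2 (by
    have : 0 < lam.re * (1 / ((k : ℝ) + 1)) := by positivity
    linarith)
  have hq0 : 0 < q := Real.exp_pos _
  have key : ∀ ψ : Lp ℂ 1 μ, ‖ψ‖ ≤ 1 → ‖(Kfam K t lam * Kfam K t lam) ψ‖ ≤ (1 + q) / 2 := by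
    intro ψ hψ
    set χ := K.comp K (absL ψ) with hχ
    have hχn : ‖χ‖ = ‖ψ‖ := hT.norm_abs ψ
    have hint : Integrable (fun z => (1 - q) * (A k).indicator (fun z => ‖χ z‖) z + q * ‖χ z‖) μ :=
      (((Lp_int χ).norm.indicator (hA k)).const_mul _).add ((Lp_int χ).norm.const_mul _)
    refine (norm_le_of_ae_le hint ?_).trans ?_
    · have h1 := hK.mono (absL_absL (Kfam K t lam ψ)) (hK.nonneg ψ) (by
        filter_upwards [norm_absL_ae (Kfam K t lam ψ), expMul_coeFn ht hl.le (K ψ), hK.dom ψ]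
          with z a b c
        rw [a, Kfam_apply, b, norm_mul]
        exact (mul_le_of_le_one_left (norm_nonneg _) (norm_exp_neg_mul_le hl.le _)).trans c)
      filter_upwards [expMul_coeFn ht hl.le (K (Kfam K t lam ψ)), hK.dom (Kfam K t lam ψ), h1]
        with z a b c
      have e1 : (Kfam K t lam * Kfam K t lam) ψ = expMul μ t lam (K (Kfam K t lam ψ)) := rfl
      have hle : ‖K (Kfam K t lam ψ) z‖ ≤ ‖χ z‖ := b.trans c
      rw [e1, a, norm_mul]
      by_cases hz : z ∈ A k
      · rw [indicator_of_mem hz]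
        have := norm_exp_neg_mul_le hl.le (t z)
        nlinarith [norm_nonneg (χ z), norm_nonneg (K (Kfam K t lam ψ) z),
          mul_le_of_le_one_left (norm_nonneg (K (Kfam K t lam ψ) z)) this]
      · rw [indicator_of_notMem hz, mul_zero, zero_add, norm_exp_neg_mul]
        have hz' : 1 / ((k : ℝ) + 1) ≤ t z := not_lt.1 hz
        refine mul_le_mul (Real.exp_le_exp.2 (neg_le_neg ?_)) hle (norm_nonneg _) hq0.le
        exact mul_le_mul_of_nonneg_left hz' hl.le
    · rw [integral_add (((Lp_int χ).norm.indicator (hA k)).const_mul _)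
        ((Lp_int χ).norm.const_mul _), integral_const_mul, integral_const_mul, ← Lp_norm,
        integral_indicator (hA k), hχn]
      have h2 := hk (absL ψ) (by rwa [norm_absL])
      have h3 : 0 ≤ ∫ z in A k, ‖χ z‖ ∂μ := integral_nonneg fun z => norm_nonneg _
      have h4 : (1 - q) * ∫ z in A k, ‖χ z‖ ∂μ ≤ (1 - q) * (1 / 2) :=
        mul_le_mul_of_nonneg_left h2 (by linarith)
      nlinarith
  refine lt_of_le_of_lt (ContinuousLinearMap.opNorm_le_of_unit_norm (C := (1 + q) / 2)
    (by positivity) fun ψ hψ => key ψ hψ.le) (by linarith)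

lemma isUnit_one_sub_Kfam_of_re_pos (hK : IsMarkov K) (ht : Measurable t)
    (hpos : ∀ᵐ z ∂μ, 0 < t z)
    {C : Set (WeakSpace ℂ (Lp ℂ 1 μ))} (hC : IsCompact C)
    (hKC : ∀ ψ, ‖ψ‖ ≤ 1 → toWeakSpace ℂ _ (K (K ψ)) ∈ C) {lam : ℂ} (hl : 0 < lam.re) :
    IsUnit (1 - Kfam K t lam) :=
  isUnit_one_sub_of_norm_sq_lt (norm_Kfam_sq_lt hK ht hpos hC hKC hl)

/-- On the imaginary axis, away from `0`, `1 - K_λ` is invertible as soon as `‖K_{iη}ᵖ‖` decays. -/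
lemma isUnit_one_sub_Kfam_of_imag (hK : IsMarkov K) (ht : Measurable t) {p : ℕ}
    (hdecay : Tendsto (fun η : ℝ => ‖Kfam K t (η * Complex.I) ^ p‖) (cocompact ℝ) (𝓝 0))
    {η : ℝ} (hη : η ≠ 0) : IsUnit (1 - Kfam K t (η * Complex.I)) := by
  by_contra hcon
  -- If 1 - K_{iη} is no unit it is not bounded below, which yields approximate eigenvectors; they
  -- propagate to all multiples jη and contradict the decay of the p-th powers.
  have h1 : ∀ c > 0, ∃ ψ, ‖ψ‖ = 1 ∧ ‖expMul μ t (η * Complex.I) (K ψ) - ψ‖ ≤ c := by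
    intro c hc
    by_contra! h
    refine hcon (isUnit_one_sub_of_bddBelow (norm_Kfam_le hK _) hc fun x => ?_)
    rcases eq_or_ne x 0 with rfl | hx
    · simp
    have hn : 0 < ‖x‖ := norm_pos_iff.2 hx
    have h2 := (h (((‖x‖⁻¹ : ℝ) : ℂ) • x) (by
      rw [norm_smul, Complex.norm_real, norm_inv, norm_norm, inv_mul_cancel₀ hn.ne'])).le
    rw [map_smul, map_smul, ← smul_sub, norm_smul, Complex.norm_real, norm_inv, norm_norm,
      le_inv_mul_iff₀ hn] at h2
    rw [mul_comm]; exact h2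
  have h2 : ∀ j : ℕ, 1 ≤ ‖Kfam K t ((j * η : ℝ) * Complex.I) ^ p‖ := fun j =>
    norm_pow_ge_one_of_almost_eigen (norm_Kfam_le hK _) (almost_eigen_mul hK ht h1 j) p
  have h3 : Tendsto (fun j : ℕ => (j : ℝ) * η) atTop (cocompact ℝ) := by
    rw [← Metric.cobounded_eq_cocompact, ← comap_norm_atTop, tendsto_comap_iff, Function.comp_def]
    have : (fun j : ℕ => ‖(j : ℝ) * η‖) = fun j : ℕ => (j : ℝ) * ‖η‖ := by
      ext j; rw [norm_mul, RCLike.norm_natCast]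
    rw [this]
    exact tendsto_natCast_atTop_atTop.atTop_mul_const (norm_pos_iff.2 hη)
  have h4 := (hdecay.comp h3).eventually (gt_mem_nhds one_pos)
  obtain ⟨j, hj⟩ := h4.exists
  exact absurd hj (not_lt.2 (h2 j))

end Resolvent

/-! ### Difference and Taylor estimates for exp(-λs), uniform on the half plane. -/

section ExpEstimates

lemma convex_halfPlane : Convex ℝ {lam : ℂ | 0 ≤ lam.re} := convex_halfSpace_re_ge 0

lemma hasDerivAt_exp_neg_mul (s : ℝ) (lam : ℂ) :
    HasDerivAt (fun l : ℂ => Complex.exp (-l * s)) (-(s * Complex.exp (-lam * s))) lam := by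
  have h := ((hasDerivAt_neg lam).mul_const (s : ℂ)).cexp
  exact h.congr_deriv (by simp [mul_comm])

lemma norm_exp_sub_exp_le {a b : ℂ} (ha : 0 ≤ a.re) (hb : 0 ≤ b.re) (s : ℝ≥0) :
    ‖Complex.exp (-b * (s : ℝ)) - Complex.exp (-a * (s : ℝ))‖ ≤ s * ‖b - a‖ :=
  convex_halfPlane.norm_image_sub_le_of_norm_hasDerivWithin_le
    (f := fun l : ℂ => Complex.exp (-l * (s : ℝ)))
    (fun x _ => (hasDerivAt_exp_neg_mul s x).hasDerivWithinAt) (fun x hx => by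
      rw [norm_neg, norm_mul, Complex.norm_real, NNReal.norm_eq]
      exact mul_le_of_le_one_right s.2 (norm_exp_neg_mul_le hx s)) ha hb

lemma norm_exp_taylor_le {a b : ℂ} (ha : 0 ≤ a.re) (hb : 0 ≤ b.re) (s : ℝ≥0) :
    ‖Complex.exp (-b * (s : ℝ)) - Complex.exp (-a * (s : ℝ)) +
      (b - a) * ((s : ℝ) * Complex.exp (-a * (s : ℝ)))‖ ≤ s ^ 2 * ‖b - a‖ ^ 2 := by
  have hc : Convex ℝ ({lam : ℂ | 0 ≤ lam.re} ∩ Metric.closedBall a ‖b - a‖) :=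
    convex_halfPlane.inter (convex_closedBall _ _)
  have h := hc.norm_image_sub_le_of_norm_hasDerivWithin_le (C := s ^ 2 * ‖b - a‖)
    (f := fun l : ℂ => Complex.exp (-l * (s : ℝ)) + l * ((s : ℝ) * Complex.exp (-a * (s : ℝ))))
    (x := a) (y := b)
    (fun x _ => ((hasDerivAt_exp_neg_mul s x).add
      ((hasDerivAt_id x).mul_const _)).hasDerivWithinAt) (fun x hx => by
        have e : -((s : ℝ) * Complex.exp (-x * (s : ℝ))) + 1 * ((s : ℝ) * Complex.exp (-a * (s : ℝ)))
            = -((s : ℝ) * (Complex.exp (-x * (s : ℝ)) - Complex.exp (-a * (s : ℝ)))) := by ring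
        rw [e, norm_neg, norm_mul, Complex.norm_real, NNReal.norm_eq, pow_two, mul_assoc]
        refine mul_le_mul_of_nonneg_left ((norm_exp_sub_exp_le ha hx.1 s).trans ?_) s.2
        exact mul_le_mul_of_nonneg_left (mem_closedBall_iff_norm.1 hx.2) s.2)
    ⟨ha, by simp⟩ ⟨hb, by simp [dist_eq_norm]⟩
  refine le_trans (le_of_eq ?_) (h.trans (le_of_eq (by ring)))
  congr 1; ring

end ExpEstimates

/-! ### Differentiating λ ↦ exp(-λt)T with the help of moments tⁱT. -/

section Tower

variable {β : Type*} [MeasurableSpace β] {ν : Measure β} {t : β → ℝ≥0}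
  {Y : Type*} [NormedAddCommGroup Y] [NormedSpace ℂ Y]

/-- `T i = tⁱ T 0` for `i ≤ M`. -/
def IsTower (t : β → ℝ≥0) (M : ℕ) (T : ℕ → Y →L[ℂ] Lp ℂ 1 ν) : Prop :=
  ∀ i < M, ∀ y, ∀ᵐ z ∂ν, T (i + 1) y z = ((t z : ℝ) : ℂ) * T i y z

lemma IsTower.shift {M : ℕ} {T : ℕ → Y →L[ℂ] Lp ℂ 1 ν} (h : IsTower t (M + 1) T) :
    IsTower t M fun i => T (i + 1) := fun i hi y => h (i + 1) (by omega) y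

lemma IsTower.mono {M M' : ℕ} {T : ℕ → Y →L[ℂ] Lp ℂ 1 ν} (h : IsTower t M T) (hM : M' ≤ M) :
    IsTower t M' T := fun i hi y => h i (hi.trans_le hM) y

lemma norm_expMul_sub_le (ht : Measurable t) {T : ℕ → Y →L[ℂ] Lp ℂ 1 ν} (h : IsTower t 1 T)
    {a b : ℂ} (ha : 0 ≤ a.re) (hb : 0 ≤ b.re) (y : Y) :
    ‖expMul ν t b (T 0 y) - expMul ν t a (T 0 y)‖ ≤ ‖b - a‖ * ‖T 1 y‖ := by
  rw [Lp_norm (T 1 y), ← integral_const_mul]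
  refine norm_le_of_ae_le ((Lp_int _).norm.const_mul _) ?_
  filter_upwards [coeFn_sub_ae (expMul ν t b (T 0 y)) (expMul ν t a (T 0 y)),
    expMul_coeFn ht ha (T 0 y), expMul_coeFn ht hb (T 0 y), h 0 one_pos y] with z e1 e2 e3 e4
  rw [e1, e2, e3, ← sub_mul, norm_mul, e4, norm_mul, Complex.norm_real, NNReal.norm_eq,
    ← mul_assoc, mul_comm ‖b - a‖]
  exact mul_le_mul_of_nonneg_right (norm_exp_sub_exp_le ha hb (t z)) (norm_nonneg _)

/-- A quadratic remainder that is uniform in y, at the price of a second moment. It is the source of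
differentiability in operator norm, whereas strong differentiability needs only one moment. -/
lemma norm_expMul_taylor_le (ht : Measurable t) {T : ℕ → Y →L[ℂ] Lp ℂ 1 ν} (h : IsTower t 2 T)
    {a b : ℂ} (ha : 0 ≤ a.re) (hb : 0 ≤ b.re) (y : Y) :
    ‖expMul ν t b (T 0 y) - expMul ν t a (T 0 y) + (b - a) • expMul ν t a (T 1 y)‖ ≤
      ‖b - a‖ ^ 2 * ‖T 2 y‖ := by
  rw [Lp_norm (T 2 y), ← integral_const_mul]
  refine norm_le_of_ae_le ((Lp_int _).norm.const_mul _) ?_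
  filter_upwards [coeFn_add_ae (expMul ν t b (T 0 y) - expMul ν t a (T 0 y))
      ((b - a) • expMul ν t a (T 1 y)),
    coeFn_sub_ae (expMul ν t b (T 0 y)) (expMul ν t a (T 0 y)),
    coeFn_smul_ae (b - a) (expMul ν t a (T 1 y)), expMul_coeFn ht ha (T 0 y),
    expMul_coeFn ht hb (T 0 y), expMul_coeFn ht ha (T 1 y), h 0 two_pos y, h 1 one_lt_two y]
    with z e0 e1 e2 e3 e4 e5 e6 e7
  have e : Complex.exp (-b * (t z : ℝ)) * T 0 y z - Complex.exp (-a * (t z : ℝ)) * T 0 y z +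
      (b - a) * (Complex.exp (-a * (t z : ℝ)) * ((t z : ℝ) * T 0 y z)) =
      (Complex.exp (-b * (t z : ℝ)) - Complex.exp (-a * (t z : ℝ)) +
      (b - a) * ((t z : ℝ) * Complex.exp (-a * (t z : ℝ)))) * T 0 y z := by ring
  rw [e0, e1, e2, e3, e4, e5, e7, e6, e, norm_mul, norm_mul, norm_mul, Complex.norm_real,
    NNReal.norm_eq]
  calc _ ≤ ((t z : ℝ) ^ 2 * ‖b - a‖ ^ 2) * ‖T 0 y z‖ :=
        mul_le_mul_of_nonneg_right (norm_exp_taylor_le ha hb (t z)) (norm_nonneg _)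
    _ = _ := by ring

lemma tendsto_expMul (ht : Measurable t) {a : ℂ} (ha : 0 ≤ a.re) (g : Lp ℂ 1 ν) :
    Tendsto (fun l => expMul ν t l g) (𝓝[{l | 0 ≤ l.re}] a) (𝓝 (expMul ν t a g)) := by
  rw [tendsto_iff_norm_sub_tendsto_zero]
  have h1 : Tendsto (fun l : ℂ => ∫ z, ‖Complex.exp (-l * (t z : ℝ)) - Complex.exp (-a * (t z : ℝ))‖
      * ‖g z‖ ∂ν) (𝓝[{l | 0 ≤ l.re}] a) (𝓝 (∫ z, (0 : ℝ) ∂ν)) := by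
    refine tendsto_integral_filter_of_dominated_convergence (fun z => 2 * ‖g z‖)
      (Eventually.of_forall fun l => ?_) ?_ ((Lp_int g).norm.const_mul _)
      (Eventually.of_forall fun z => ?_)
    · refine AEStronglyMeasurable.mul ?_ (Lp_int g).norm.aestronglyMeasurable
      have : Measurable fun z => ‖Complex.exp (-l * (t z : ℝ)) - Complex.exp (-a * (t z : ℝ))‖ := by
        fun_prop
      exact this.aestronglyMeasurable
    · filter_upwards [self_mem_nhdsWithin] with l hl
      filter_upwards with z
      rw [norm_mul, norm_norm, norm_norm]
      refine mul_le_mul_of_nonneg_right ((norm_sub_le _ _).trans ?_) (norm_nonneg _)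
      linarith [norm_exp_neg_mul_le hl (t z), norm_exp_neg_mul_le ha (t z)]
    · have hc : ContinuousAt (fun l : ℂ => ‖Complex.exp (-l * (t z : ℝ)) -
          Complex.exp (-a * (t z : ℝ))‖ * ‖g z‖) a := by fun_prop
      have := hc.tendsto.mono_left (nhdsWithin_le_nhds (s := {l : ℂ | 0 ≤ l.re}))
      simpa using this
  rw [integral_zero] at h1
  refine h1.congr' ?_
  filter_upwards [self_mem_nhdsWithin] with l hl
  rw [Lp_norm]
  refine integral_congr_ae ?_
  filter_upwards [coeFn_sub_ae (expMul ν t l g) (expMul ν t a g), expMul_coeFn ht ha g,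
    expMul_coeFn ht hl g] with z e1 e2 e3
  rw [e1, e2, e3, ← sub_mul, norm_mul]

/-- The difference quotients are dominated by t|T 0 y| = |T 1 y|, so dominated convergence needs a
single moment. -/
lemma hasDerivWithinAt_expMul (ht : Measurable t) {T : ℕ → Y →L[ℂ] Lp ℂ 1 ν} (h : IsTower t 1 T)
    {a : ℂ} (ha : 0 ≤ a.re) (y : Y) :
    HasDerivWithinAt (fun l => expMul ν t l (T 0 y)) (-expMul ν t a (T 1 y)) {l | 0 ≤ l.re} a := by
  rw [hasDerivWithinAt_iff_tendsto_slope, tendsto_iff_norm_sub_tendsto_zero]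
  let q : ℂ → β → ℝ := fun l z => ‖(l - a)⁻¹ * (Complex.exp (-l * (t z : ℝ)) -
    Complex.exp (-a * (t z : ℝ))) + (t z : ℝ) * Complex.exp (-a * (t z : ℝ))‖
  have h1 : Tendsto (fun l : ℂ => ∫ z, q l z * ‖T 0 y z‖ ∂ν)
      (𝓝[{l | 0 ≤ l.re} \ {a}] a) (𝓝 (∫ z, (0 : ℝ) ∂ν)) := by
    refine tendsto_integral_filter_of_dominated_convergence (fun z => 2 * ‖T 1 y z‖)
      (Eventually.of_forall fun l => ?_) ?_ ((Lp_int _).norm.const_mul _)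
      (Eventually.of_forall fun z => ?_)
    · refine AEStronglyMeasurable.mul ?_ (Lp_int _).norm.aestronglyMeasurable
      have : Measurable (q l) := by fun_prop
      exact this.aestronglyMeasurable
    · filter_upwards [self_mem_nhdsWithin] with l hl
      filter_upwards [h 0 one_pos y] with z hz
      have hla : 0 < ‖l - a‖ := norm_pos_iff.2 (sub_ne_zero.2 hl.2)
      rw [hz, norm_mul, norm_norm, Real.norm_of_nonneg (norm_nonneg _), norm_mul,
        Complex.norm_real, NNReal.norm_eq, ← mul_assoc]
      refine mul_le_mul_of_nonneg_right ((norm_add_le _ _).trans ?_) (norm_nonneg _)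
      rw [norm_mul, norm_inv, norm_mul, Complex.norm_real, NNReal.norm_eq]
      have e1 : ‖l - a‖⁻¹ * ‖Complex.exp (-l * (t z : ℝ)) - Complex.exp (-a * (t z : ℝ))‖ ≤ t z := by
        rw [inv_mul_le_iff₀ hla, mul_comm ‖l - a‖]
        exact norm_exp_sub_exp_le ha hl.1 (t z)
      have e2 : (t z : ℝ) * ‖Complex.exp (-a * (t z : ℝ))‖ ≤ t z :=
        mul_le_of_le_one_right (t z).2 (norm_exp_neg_mul_le ha (t z))
      linarith
    · have hd := (hasDerivAt_iff_tendsto_slope.1 (hasDerivAt_exp_neg_mul (t z) a)).mono_left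
        (nhdsWithin_mono a (fun l hl => hl.2 : {l : ℂ | 0 ≤ l.re} \ {a} ⊆ {a}ᶜ))
      have := ((hd.sub_const (-((t z : ℝ) * Complex.exp (-a * (t z : ℝ))))).norm).mul_const
        ‖T 0 y z‖
      rw [sub_self, norm_zero, zero_mul] at this
      refine this.congr fun l => ?_
      simp only [q, slope_def_field, sub_neg_eq_add, div_eq_inv_mul]
  rw [integral_zero] at h1
  refine h1.congr' ?_
  filter_upwards [self_mem_nhdsWithin] with l hl
  rw [Lp_norm]
  refine integral_congr_ae ?_
  rw [slope_def_module, sub_neg_eq_add]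
  filter_upwards [coeFn_add_ae ((l - a)⁻¹ • (expMul ν t l (T 0 y) - expMul ν t a (T 0 y)))
      (expMul ν t a (T 1 y)),
    coeFn_smul_ae (l - a)⁻¹ (expMul ν t l (T 0 y) - expMul ν t a (T 0 y)),
    coeFn_sub_ae (expMul ν t l (T 0 y)) (expMul ν t a (T 0 y)), expMul_coeFn ht ha (T 0 y),
    expMul_coeFn ht hl.1 (T 0 y), expMul_coeFn ht ha (T 1 y), h 0 one_pos y]
    with z e0 e1 e2 e3 e4 e5 e6
  simp only [q]
  rw [e0, e1, e2, e3, e4, e5, e6, ← norm_mul]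
  congr 1; ring

end Tower

/-! ### The closed half plane parametrised by all of ℝ². -/

section Param

/-- The parametrisation `(ε, η) ↦ ε² + iη` of the closed right half plane. -/
def lamP (p : ℝ × ℝ) : ℂ := ((p.1 ^ 2 : ℝ) : ℂ) + (p.2 : ℂ) * Complex.I

lemma lamP_re (p : ℝ × ℝ) : (lamP p).re = p.1 ^ 2 := by
  rw [lamP, Complex.add_re, Complex.ofReal_re]; simp

lemma lamP_im (p : ℝ × ℝ) : (lamP p).im = p.2 := by
  rw [lamP, Complex.add_im, Complex.ofReal_im]; simp

/-- Squaring ε makes every point of ℝ² admissible: regularity up to the imaginary axis becomes plain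
`ContDiff` on ℝ², and the limit ε → 0⁺ becomes continuity at ε = 0. -/
lemma lamP_re_nonneg (p : ℝ × ℝ) : 0 ≤ (lamP p).re := by rw [lamP_re]; positivity

lemma contDiff_lamP {n : WithTop ℕ∞} : ContDiff ℝ n lamP := by
  have h : ContDiff ℝ n (Complex.ofRealCLM : ℝ → ℂ) := Complex.ofRealCLM.contDiff
  exact (h.comp (contDiff_fst.pow 2)).add ((h.comp contDiff_snd).mul contDiff_const)

/-- The derivative of `lamP`. -/
def dlamP (p : ℝ × ℝ) : ℝ × ℝ →L[ℝ] ℂ := fderiv ℝ lamP p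

lemma contDiff_dlamP {n : WithTop ℕ∞} : ContDiff ℝ n dlamP :=
  (contDiff_lamP (n := n + 1)).fderiv_right le_rfl

lemma hasFDerivAt_lamP (p : ℝ × ℝ) : HasFDerivAt lamP (dlamP p) p :=
  ((contDiff_lamP (n := 1)).differentiable one_ne_zero p).hasFDerivAt

lemma dlamP_snd (p : ℝ × ℝ) : dlamP p (0, 1) = Complex.I := by
  have h1 : HasDerivAt (fun η : ℝ => lamP (p.1, η)) (dlamP p (0, 1)) p.2 := by
    have hp : HasDerivAt (fun η : ℝ => (p.1, η)) ((0 : ℝ), (1 : ℝ)) p.2 :=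
      (hasDerivAt_const _ _).prodMk (hasDerivAt_id _)
    exact (hasFDerivAt_lamP p).comp_hasDerivAt p.2 hp
  have h2 : HasDerivAt (fun η : ℝ => lamP (p.1, η)) Complex.I p.2 := by
    have := ((Complex.ofRealCLM.hasDerivAt (x := p.2)).mul_const Complex.I).const_add
      (((p.1 ^ 2 : ℝ) : ℂ))
    simpa [lamP] using this
  exact h1.unique h2

end Param

/-! ### Partial derivatives in η and restriction to vertical lines. -/

section Deta

variable {Z : Type*} [NormedAddCommGroup Z] [NormedSpace ℝ Z]

/-- The partial derivative `∂/∂η` of a function of `(ε, η)`. -/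
def deta (h : ℝ × ℝ → Z) (p : ℝ × ℝ) : Z := fderiv ℝ h p (0, 1)

lemma contDiff_deta {n : ℕ} {h : ℝ × ℝ → Z} (hh : ContDiff ℝ (n + 1 : ℕ) h) :
    ContDiff ℝ n (deta h) := by
  have : ContDiff ℝ n (fderiv ℝ h) := hh.fderiv_right (by norm_cast)
  exact this.clm_apply contDiff_const

lemma contDiff_deta_iterate {n j : ℕ} {h : ℝ × ℝ → Z} (hh : ContDiff ℝ (n + j : ℕ) h) :
    ContDiff ℝ n (deta^[j] h) := by
  induction j generalizing n with
  | zero => simpa using hh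
  | succ j ih =>
    rw [Function.iterate_succ_apply']
    refine contDiff_deta (ih ?_)
    rwa [show n + (j + 1) = n + 1 + j by omega] at hh

lemma hasDerivAt_slice {h : ℝ × ℝ → Z} (hh : Differentiable ℝ h) (ε η : ℝ) :
    HasDerivAt (fun s => h (ε, s)) (deta h (ε, η)) η :=
  (hh (ε, η)).hasFDerivAt.comp_hasDerivAt η ((hasDerivAt_const _ _).prodMk (hasDerivAt_id _))

lemma iteratedDeriv_slice {n : ℕ} {h : ℝ × ℝ → Z} (hh : ContDiff ℝ n h) (ε : ℝ) {j : ℕ}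
    (hj : j ≤ n) : iteratedDeriv j (fun s => h (ε, s)) = fun s => (deta^[j] h) (ε, s) := by
  induction j with
  | zero => simp
  | succ j ih =>
    rw [iteratedDeriv_succ, ih (by omega)]
    ext η
    rw [Function.iterate_succ_apply']
    refine (hasDerivAt_slice (ContDiff.differentiable (n := (1 : ℕ)) ?_ (by simp)) ε η).deriv
    exact contDiff_deta_iterate (hh.of_le (by norm_cast; omega))

lemma contDiff_slice {n : WithTop ℕ∞} {h : ℝ × ℝ → Z} (hh : ContDiff ℝ n h) (ε : ℝ) :
    ContDiff ℝ n fun s => h (ε, s) :=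
  hh.comp (contDiff_const.prodMk contDiff_id)

lemma deta_iterate_add {n : ℕ} {f g : ℝ × ℝ → Z} (hf : ContDiff ℝ n f) (hg : ContDiff ℝ n g)
    {j : ℕ} (hj : j ≤ n) : deta^[j] (f + g) = deta^[j] f + deta^[j] g := by
  induction j generalizing f g n with
  | zero => rfl
  | succ j ih =>
    obtain ⟨n, rfl⟩ := Nat.exists_eq_add_of_le' (show 1 ≤ n by omega)
    have h1 : deta (f + g) = deta f + deta g := by
      ext p
      have hf' := (hf.differentiable (by simp)) p
      have hg' := (hg.differentiable (by simp)) p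
      simp only [deta, Pi.add_apply]
      rw [fderiv_add hf' hg', ContinuousLinearMap.add_apply]
    rw [Function.iterate_succ_apply, Function.iterate_succ_apply, Function.iterate_succ_apply, h1,
      ih (contDiff_deta hf) (contDiff_deta hg) (by omega)]

lemma deta_iterate_smul {R : Type*} [NormedField R] [NormedSpace R Z] [NormedAlgebra ℝ R]
    [IsScalarTower ℝ R Z] {n : ℕ} {f : ℝ × ℝ → Z} (hf : ContDiff ℝ n f) (c : R)
    {j : ℕ} (hj : j ≤ n) : deta^[j] (c • f) = c • deta^[j] f := by
  induction j generalizing f n with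
  | zero => rfl
  | succ j ih =>
    obtain ⟨n, rfl⟩ := Nat.exists_eq_add_of_le' (show 1 ≤ n by omega)
    have h1 : deta (c • f) = c • deta f := by
      ext p
      have hf' := (hf.differentiable (by simp)) p
      simp only [deta, Pi.smul_apply]
      rw [fderiv_const_smul hf' c, ContinuousLinearMap.smul_apply]
    rw [Function.iterate_succ_apply, Function.iterate_succ_apply, h1, ih (contDiff_deta hf) (by omega)]

end Deta

/-! ### Smoothness of the operator families l exp(-λt)T. -/

section Fam

variable {β : Type*} [MeasurableSpace β] {ν : Measure β} {t : β → ℝ≥0}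
  {Y : Type*} [NormedAddCommGroup Y] [NormedSpace ℂ Y]
  {Z : Type*} [NormedAddCommGroup Z] [NormedSpace ℂ Z]

/-- The operator family `p ↦ l exp (-λ(p) t) T`. -/
def fam (l : Lp ℂ 1 ν →L[ℂ] Z) (t : β → ℝ≥0) (T : Y →L[ℂ] Lp ℂ 1 ν) (p : ℝ × ℝ) : Y →L[ℂ] Z :=
  l.comp ((expMul ν t (lamP p)).comp T)

variable {l : Lp ℂ 1 ν →L[ℂ] Z}

lemma fam_apply (T : Y →L[ℂ] Lp ℂ 1 ν) (p : ℝ × ℝ) (y : Y) :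
    fam l t T p y = l (expMul ν t (lamP p) (T y)) := rfl

lemma norm_fam_apply_le (T : Y →L[ℂ] Lp ℂ 1 ν) (p : ℝ × ℝ) (y : Y) :
    ‖fam l t T p y‖ ≤ ‖l‖ * ‖T‖ * ‖y‖ := by
  rw [fam_apply, mul_assoc]
  exact (l.le_opNorm _).trans (mul_le_mul_of_nonneg_left
    ((norm_expMul_apply_le _ _).trans (T.le_opNorm y)) (norm_nonneg _))

lemma norm_fam_le (T : Y →L[ℂ] Lp ℂ 1 ν) (p : ℝ × ℝ) : ‖fam l t T p‖ ≤ ‖l‖ * ‖T‖ :=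
  ContinuousLinearMap.opNorm_le_bound _ (by positivity) (norm_fam_apply_le T p)

lemma tendsto_lamP (p : ℝ × ℝ) : Tendsto lamP (𝓝 p) (𝓝[{l | 0 ≤ l.re}] (lamP p)) :=
  tendsto_nhdsWithin_iff.2 ⟨(contDiff_lamP (n := 0)).continuous.continuousAt,
    Eventually.of_forall lamP_re_nonneg⟩

lemma continuous_fam_apply (ht : Measurable t) (T : Y →L[ℂ] Lp ℂ 1 ν) (y : Y) :
    Continuous fun p => fam l t T p y :=
  continuous_iff_continuousAt.2 fun p =>
    (l.continuous.tendsto _).comp ((tendsto_expMul ht (lamP_re_nonneg p) (T y)).comp (tendsto_lamP p))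

lemma continuous_fam_comp (ht : Measurable t) (T : Y →L[ℂ] Lp ℂ 1 ν) {y : ℝ × ℝ → Y}
    (hy : Continuous y) : Continuous fun p => fam l t T p (y p) := by
  rw [continuous_iff_continuousAt]
  intro p
  rw [ContinuousAt, tendsto_iff_norm_sub_tendsto_zero]
  have h1 : Tendsto (fun q => ‖l‖ * ‖T‖ * ‖y q - y p‖ + ‖fam l t T q (y p) - fam l t T p (y p)‖)
      (𝓝 p) (𝓝 0) := by
    have a := (tendsto_iff_norm_sub_tendsto_zero.1 (hy.tendsto p)).const_mul (‖l‖ * ‖T‖)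
    have b := tendsto_iff_norm_sub_tendsto_zero.1 ((continuous_fam_apply (l := l) ht T (y p)).tendsto p)
    simpa using a.add b
  refine squeeze_zero (fun _ => norm_nonneg _) (fun q => ?_) h1
  have : fam l t T q (y q) - fam l t T p (y p) =
      fam l t T q (y q - y p) + (fam l t T q (y p) - fam l t T p (y p)) := by
    rw [map_sub]; abel
  rw [this]
  exact (norm_add_le _ _).trans (add_le_add_left (norm_fam_apply_le _ _ _) _)

variable [NormedSpace ℝ Z] [IsScalarTower ℝ ℂ Z] [NormedSpace ℝ Y] [IsScalarTower ℝ ℂ Y]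

lemma hasFDerivAt_fam_const (ht : Measurable t) {T : ℕ → Y →L[ℂ] Lp ℂ 1 ν} (h : IsTower t 1 T)
    (p : ℝ × ℝ) (y : Y) : HasFDerivAt (fun p => fam l t (T 0) p y)
      ((dlamP p).smulRight (-fam l t (T 1) p y)) p := by
  have h0 := (hasDerivWithinAt_expMul ht h (lamP_re_nonneg p) y).hasFDerivWithinAt.restrictScalars ℝ
  have h1 : HasFDerivAt (fun q => expMul ν t (lamP q) (T 0 y))
      ((dlamP p).smulRight (-expMul ν t (lamP p) (T 1 y))) p := by
    have := h0.comp p (s := univ) (hasFDerivAt_lamP p).hasFDerivWithinAt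
      (fun q _ => lamP_re_nonneg q)
    refine (hasFDerivWithinAt_univ.1 this).congr_fderiv ?_
    ext v <;> simp
  have h2 : HasFDerivAt (fun w => l.restrictScalars ℝ w) (l.restrictScalars ℝ)
      (expMul ν t (lamP p) (T 0 y)) := (l.restrictScalars ℝ).hasFDerivAt
  refine (h2.comp p h1).congr_fderiv ?_
  ext v <;> simp [fam_apply]

/-- The product rule although the family is only strongly differentiable. The cross term (fam q -
fam p)(y'(q - p)) is negligible because y' has a range spanned by two vectors, on which strong
continuity is uniform. -/
lemma hasFDerivAt_fam (ht : Measurable t) {T : ℕ → Y →L[ℂ] Lp ℂ 1 ν} (h : IsTower t 1 T)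
    {y : ℝ × ℝ → Y} {p : ℝ × ℝ} {y' : ℝ × ℝ →L[ℝ] Y} (hy : HasFDerivAt y y' p) :
    HasFDerivAt (fun p => fam l t (T 0) p (y p))
      ((dlamP p).smulRight (-fam l t (T 1) p (y p)) +
        ((fam l t (T 0) p).restrictScalars ℝ).comp y') p := by
  have h0 := hasFDerivAt_fam_const (l := l) ht h p (y p)
  rw [hasFDerivAt_iff_isLittleO] at h0 hy ⊢
  -- the remainder of `y`
  have h1 : (fun q => fam l t (T 0) q (y q - y p - y' (q - p))) =o[𝓝 p] fun q => q - p := by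
    refine (Asymptotics.IsBigO.of_bound (‖l‖ * ‖T 0‖) (Eventually.of_forall fun q => ?_)).trans_isLittleO hy
    exact norm_fam_apply_le _ _ _
  -- strong continuity on the range of `y'`
  have h2 : (fun q => (fam l t (T 0) q - fam l t (T 0) p) (y' (q - p))) =o[𝓝 p] fun q => q - p := by
    have hs : ∀ w : Y, Tendsto (fun q => ‖(fam l t (T 0) q - fam l t (T 0) p) w‖) (𝓝 p) (𝓝 0) := by
      intro w
      have := tendsto_iff_norm_sub_tendsto_zero.1 ((continuous_fam_apply (l := l) ht (T 0) w).tendsto p)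
      simpa using this
    rw [Asymptotics.isLittleO_iff]
    intro c hc
    have hsum := (hs (y' (1, 0))).add (hs (y' (0, 1)))
    rw [add_zero] at hsum
    filter_upwards [hsum.eventually (gt_mem_nhds hc)] with q hq
    have e : y' (q - p) = ((q - p).1 : ℂ) • y' (1, 0) + ((q - p).2 : ℂ) • y' (0, 1) := by
      have : q - p = (q - p).1 • ((1 : ℝ), (0 : ℝ)) + (q - p).2 • ((0 : ℝ), (1 : ℝ)) := by
        ext <;> simp
      have hr : ∀ (r : ℝ) (w : Y), (r : ℂ) • w = r • w := fun r w => algebraMap_smul ℂ r w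
      conv_lhs => rw [this, map_add, map_smul, map_smul]
      rw [hr, hr]
    rw [e, map_add, map_smul, map_smul]
    refine (norm_add_le _ _).trans ?_
    rw [norm_smul, norm_smul, Complex.norm_real, Complex.norm_real]
    have n1 := norm_fst_le (q - p)
    have n2 := norm_snd_le (q - p)
    calc _ ≤ ‖q - p‖ * ‖(fam l t (T 0) q - fam l t (T 0) p) (y' (1, 0))‖ +
          ‖q - p‖ * ‖(fam l t (T 0) q - fam l t (T 0) p) (y' (0, 1))‖ := by gcongr
      _ ≤ c * ‖q - p‖ := by rw [← mul_add, mul_comm]; gcongr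
  refine ((h0.add h1).add h2).congr_left fun q => ?_
  simp only [ContinuousLinearMap.add_apply, ContinuousLinearMap.sub_apply, map_sub,
    ContinuousLinearMap.coe_comp, Function.comp_apply, ContinuousLinearMap.coe_restrictScalars']
  abel

lemma contDiff_bilin {E F G : Type*} [NormedAddCommGroup E] [NormedSpace ℂ E] [NormedSpace ℝ E]
    [IsScalarTower ℝ ℂ E] [NormedAddCommGroup F] [NormedSpace ℂ F] [NormedSpace ℝ F]
    [IsScalarTower ℝ ℂ F] [NormedAddCommGroup G] [NormedSpace ℂ G] [NormedSpace ℝ G]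
    [IsScalarTower ℝ ℂ G] (B : E →L[ℂ] F →L[ℂ] G) {n : WithTop ℕ∞} {f : ℝ × ℝ → E} {g : ℝ × ℝ → F}
    (hf : ContDiff ℝ n f) (hg : ContDiff ℝ n g) : ContDiff ℝ n fun p => B (f p) (g p) :=
  (B.bilinearRestrictScalars ℝ).isBoundedBilinearMap.contDiff.comp (hf.prodMk hg)

/-- Each derivative shifts the tower by one, so n moments give strong Cⁿ regularity. -/
lemma contDiff_fam_apply (ht : Measurable t) {n : ℕ} {T : ℕ → Y →L[ℂ] Lp ℂ 1 ν} (h : IsTower t n T)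
    {y : ℝ × ℝ → Y} (hy : ContDiff ℝ n y) : ContDiff ℝ n fun p => fam l t (T 0) p (y p) := by
  induction n generalizing T y with
  | zero => exact contDiff_zero.2 (continuous_fam_comp ht (T 0) hy.continuous)
  | succ n ih =>
    have hy1 : ContDiff ℝ n y := hy.of_le (by norm_cast; omega)
    have hd := fun p => hasFDerivAt_fam (l := l) ht (h.mono (by omega))
      (hy.differentiable (by simp) p).hasFDerivAt
    refine contDiff_succ_iff_hasFDerivAt.2 ⟨_, ?_, hd⟩
    refine contDiff_clm_apply_iff.2 fun v => ?_
    simp only [ContinuousLinearMap.add_apply, ContinuousLinearMap.smulRight_apply,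
      ContinuousLinearMap.coe_comp, Function.comp_apply, ContinuousLinearMap.coe_restrictScalars']
    refine ContDiff.add ?_ ?_
    · exact contDiff_bilin (ContinuousLinearMap.lsmul ℂ ℂ) (contDiff_dlamP.clm_apply contDiff_const)
        (ih h.shift hy1).neg
    · exact ih (h.mono (by omega)) ((hy.fderiv_right (by norm_cast)).clm_apply contDiff_const)

lemma deta_fam (ht : Measurable t) {T : ℕ → Y →L[ℂ] Lp ℂ 1 ν} (h : IsTower t 1 T)
    {y : ℝ × ℝ → Y} (hy : Differentiable ℝ y) :
    deta (fun p => fam l t (T 0) p (y p)) =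
      (-Complex.I) • (fun p => fam l t (T 1) p (y p)) + fun p => fam l t (T 0) p (deta y p) := by
  ext p
  rw [deta, (hasFDerivAt_fam ht h (hy p).hasFDerivAt).fderiv]
  simp [dlamP_snd, deta]

/-- Only the term in which all derivatives fall on y has top order; isolating it lets the decay
argument treat all remaining terms as lower order errors. -/
lemma deta_fam_bound (ht : Measurable t) {n : ℕ} {T : ℕ → Y →L[ℂ] Lp ℂ 1 ν} (h : IsTower t n T)
    {y : ℝ × ℝ → Y} (hy : ContDiff ℝ n y) {j : ℕ} (hj : j ≤ n) :
    ∃ C, 0 ≤ C ∧ ∀ p, ‖(deta^[j] fun p => fam l t (T 0) p (y p)) p - fam l t (T 0) p ((deta^[j] y) p)‖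
      ≤ C * ∑ i ∈ Finset.range j, ‖(deta^[i] y) p‖ := by
  induction j generalizing T y n with
  | zero => exact ⟨0, le_rfl, fun p => by simp⟩
  | succ j ih =>
    obtain ⟨n, rfl⟩ := Nat.exists_eq_add_of_le' (show 1 ≤ n by omega)
    have hy1 : ContDiff ℝ n y := hy.of_le (by norm_cast; omega)
    have hdy : ContDiff ℝ n (deta y) := contDiff_deta hy
    have h0 : IsTower t n T := h.mono (by omega)
    obtain ⟨C₁, hC₁, h₁⟩ := ih (n := n) (T := fun i => T (i + 1)) (y := y) h.shift hy1 (by omega)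
    obtain ⟨C₂, hC₂, h₂⟩ := ih (n := n) (T := T) (y := deta y) h0 hdy (by omega)
    refine ⟨‖l‖ * ‖T 1‖ + C₁ + C₂, by positivity, fun p => ?_⟩
    have c1 : ContDiff ℝ n fun p => fam l t (T 1) p (y p) :=
      contDiff_fam_apply (l := l) ht h.shift hy1
    have c1' : ContDiff ℝ n ((-Complex.I) • fun p => fam l t (T 1) p (y p)) :=
      c1.const_smul (-Complex.I)
    have c2 := contDiff_fam_apply (l := l) ht h0 hdy
    rw [Function.iterate_succ_apply, deta_fam ht (h.mono (by omega)) (hy.differentiable (by simp)),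
      deta_iterate_add (n := n) c1' c2 (by omega),
      deta_iterate_smul (n := n) c1 (-Complex.I) (by omega), Pi.add_apply, Pi.smul_apply, add_sub_assoc]
    refine (norm_add_le _ _).trans ?_
    rw [norm_smul, norm_neg, Complex.norm_I, one_mul]
    have e1 : ‖(deta^[j] fun p => fam l t (T 1) p (y p)) p‖ ≤
        ‖l‖ * ‖T 1‖ * ‖(deta^[j] y) p‖ + C₁ * ∑ i ∈ Finset.range j, ‖(deta^[i] y) p‖ := by
      have := norm_le_norm_add_norm_sub (fam l t (T 1) p ((deta^[j] y) p))
        ((deta^[j] fun p => fam l t (T 1) p (y p)) p)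
      rw [norm_sub_rev] at this
      have a := h₁ p
      have b := norm_fam_apply_le (l := l) (t := t) (T 1) p ((deta^[j] y) p)
      simp only [zero_add] at a
      linarith
    have e2 := h₂ p
    have e3 : ∑ i ∈ Finset.range j, ‖(deta^[i] (deta y)) p‖ ≤
        ∑ i ∈ Finset.range (j + 1), ‖(deta^[i] y) p‖ := by
      rw [Finset.sum_range_succ']
      simp only [← Function.iterate_succ_apply]
      linarith [norm_nonneg ((deta^[0] y) p)]
    have e4 := Finset.sum_range_succ (fun i => ‖(deta^[i] y) p‖) j
    have e5 : 0 ≤ ∑ i ∈ Finset.range j, ‖(deta^[i] y) p‖ := Finset.sum_nonneg fun i _ => norm_nonneg _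
    have e6 := mul_le_mul_of_nonneg_left e3 hC₂
    rw [Function.iterate_succ_apply]
    have e7 : ‖l‖ * ‖T 1‖ * ‖(deta^[j] y) p‖ ≤
        ‖l‖ * ‖T 1‖ * ∑ i ∈ Finset.range (j + 1), ‖(deta^[i] y) p‖ := by
      gcongr; rw [e4]; linarith
    have e8 : C₁ * ∑ i ∈ Finset.range j, ‖(deta^[i] y) p‖ ≤
        C₁ * ∑ i ∈ Finset.range (j + 1), ‖(deta^[i] y) p‖ :=
      mul_le_mul_of_nonneg_left (by rw [e4]; linarith [norm_nonneg ((deta^[j] y) p)]) hC₁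
    calc _ ≤ _ := add_le_add e1 e2
      _ ≤ _ := by rw [add_mul, add_mul]; linarith

lemma deta_fam_le (ht : Measurable t) {n : ℕ} {T : ℕ → Y →L[ℂ] Lp ℂ 1 ν} (h : IsTower t n T)
    {y : ℝ × ℝ → Y} (hy : ContDiff ℝ n y) {j : ℕ} (hj : j ≤ n) :
    ∃ C, 0 ≤ C ∧ ∀ p, ‖(deta^[j] fun p => fam l t (T 0) p (y p)) p‖
      ≤ C * ∑ i ∈ Finset.range (j + 1), ‖(deta^[i] y) p‖ := by
  obtain ⟨C, hC, hb⟩ := deta_fam_bound (l := l) ht h hy hj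
  refine ⟨‖l‖ * ‖T 0‖ + C, by positivity, fun p => ?_⟩
  have a := hb p
  have b := norm_fam_apply_le (l := l) (t := t) (T 0) p ((deta^[j] y) p)
  have c := norm_le_norm_add_norm_sub (fam l t (T 0) p ((deta^[j] y) p))
    ((deta^[j] fun p => fam l t (T 0) p (y p)) p)
  rw [norm_sub_rev] at c
  have e5 : 0 ≤ ∑ i ∈ Finset.range j, ‖(deta^[i] y) p‖ := Finset.sum_nonneg fun i _ => norm_nonneg _
  rw [Finset.sum_range_succ, mul_add, add_mul, add_mul]
  have d1 : 0 ≤ ‖l‖ * ‖T 0‖ * ∑ i ∈ Finset.range j, ‖(deta^[i] y) p‖ := by positivity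
  have d2 : 0 ≤ C * ‖(deta^[j] y) p‖ := by positivity
  linarith

/-- The derivatives of `exp (-λ t) y` for constant `y`. -/
lemma deta_fam_const (ht : Measurable t) {n : ℕ} {T : ℕ → Y →L[ℂ] Lp ℂ 1 ν} (h : IsTower t n T)
    (y : Y) {j : ℕ} (hj : j ≤ n) : deta^[j] (fun p => fam l t (T 0) p y) =
      ((-Complex.I) ^ j) • fun p => fam l t (T j) p y := by
  induction j generalizing T n with
  | zero => simp
  | succ j ih =>
    obtain ⟨n, rfl⟩ := Nat.exists_eq_add_of_le' (show 1 ≤ n by omega)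
    have c1 := contDiff_fam_apply (l := l) ht h.shift (y := fun _ => y) contDiff_const
    have e : deta (fun p => fam l t (T 0) p y) = (-Complex.I) • (fun p => fam l t (T 1) p y) := by
      have := deta_fam (l := l) ht (h.mono (by omega)) (y := fun _ => y) (differentiable_const _)
      rw [this]
      ext p
      simp [deta]
    rw [Function.iterate_succ_apply, e, deta_iterate_smul (n := n) c1 _ (by omega),
      ih (T := fun i => T (i + 1)) h.shift (by omega), smul_smul, pow_succ']

lemma hasFDerivAt_fam_op (ht : Measurable t) {T : ℕ → Y →L[ℂ] Lp ℂ 1 ν} (h : IsTower t 2 T)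
    (p : ℝ × ℝ) : HasFDerivAt (fun p => fam l t (T 0) p)
      ((dlamP p).smulRight (-fam l t (T 1) p)) p := by
  have h1 := hasFDerivAt_lamP p
  rw [hasFDerivAt_iff_isLittleO] at h1 ⊢
  have e1 : (fun q => -((lamP q - lamP p - dlamP p (q - p)) • fam l t (T 1) p)) =o[𝓝 p]
      fun q => q - p := by
    refine (Asymptotics.IsBigO.of_bound ‖fam l t (T 1) p‖ (Eventually.of_forall fun q => ?_)).trans_isLittleO h1
    rw [norm_neg, norm_smul, mul_comm]
  have e2 : (fun q => fam l t (T 0) q - fam l t (T 0) p + (lamP q - lamP p) • fam l t (T 1) p)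
      =o[𝓝 p] fun q => q - p := by
    have hO : (fun q => lamP q - lamP p) =O[𝓝 p] fun q => q - p :=
      (hasFDerivAt_lamP p).isBigO_sub
    have ho : (fun q => lamP q - lamP p) =o[𝓝 p] fun _ => (1 : ℝ) := by
      rw [Asymptotics.isLittleO_one_iff]
      have := (contDiff_lamP (n := 0)).continuous.tendsto p
      simpa using this.sub_const (lamP p)
    have hm := ho.mul_isBigO hO.norm_right
    simp only [one_mul] at hm
    refine Asymptotics.IsLittleO.of_norm_right (Asymptotics.IsBigO.trans_isLittleO
      (Asymptotics.IsBigO.of_bound (‖l‖ * ‖T 2‖) (Eventually.of_forall fun q => ?_)) hm)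
    refine ContinuousLinearMap.opNorm_le_bound _ (by positivity) fun y => ?_
    have e : (fam l t (T 0) q - fam l t (T 0) p + (lamP q - lamP p) • fam l t (T 1) p) y =
        l (expMul ν t (lamP q) (T 0 y) - expMul ν t (lamP p) (T 0 y) +
          (lamP q - lamP p) • expMul ν t (lamP p) (T 1 y)) := by
      simp [fam_apply]
    rw [e, norm_mul]
    calc _ ≤ ‖l‖ * (‖lamP q - lamP p‖ ^ 2 * ‖T 2 y‖) := (l.le_opNorm _).trans
          (mul_le_mul_of_nonneg_left (norm_expMul_taylor_le ht (h.mono (by omega))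
            (lamP_re_nonneg p) (lamP_re_nonneg q) y) (norm_nonneg _))
      _ ≤ ‖l‖ * (‖lamP q - lamP p‖ ^ 2 * (‖T 2‖ * ‖y‖)) := by
          gcongr; exact (T 2).le_opNorm y
      _ = _ := by ring
  refine (e2.add e1).congr_left fun q => ?_
  simp only [ContinuousLinearMap.smulRight_apply, smul_neg, sub_smul]
  abel

/-- Smoothness in operator norm, at the expense of one more weight. -/
lemma contDiff_fam (ht : Measurable t) {n : ℕ} {T : ℕ → Y →L[ℂ] Lp ℂ 1 ν}
    (h : IsTower t (n + 1) T) : ContDiff ℝ n fun p => fam l t (T 0) p := by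
  induction n generalizing T with
  | zero =>
    refine contDiff_zero.2 (continuous_iff_continuousAt.2 fun p => ?_)
    rw [ContinuousAt, tendsto_iff_norm_sub_tendsto_zero]
    have h1 : Tendsto (fun q => ‖l‖ * (‖lamP q - lamP p‖ * ‖T 1‖)) (𝓝 p) (𝓝 0) := by
      have := (tendsto_iff_norm_sub_tendsto_zero.1
        ((contDiff_lamP (n := 0)).continuous.tendsto p)).mul_const ‖T 1‖
      simpa using this.const_mul ‖l‖
    refine squeeze_zero (fun _ => norm_nonneg _) (fun q => ?_) h1
    refine ContinuousLinearMap.opNorm_le_bound _ (by positivity) fun y => ?_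
    rw [ContinuousLinearMap.sub_apply, fam_apply, fam_apply, ← map_sub]
    refine (l.le_opNorm _).trans ?_
    rw [mul_assoc, mul_assoc]
    refine mul_le_mul_of_nonneg_left ((norm_expMul_sub_le ht h (lamP_re_nonneg p)
      (lamP_re_nonneg q) y).trans ?_) (norm_nonneg _)
    exact mul_le_mul_of_nonneg_left ((T 1).le_opNorm y) (norm_nonneg _)
  | succ n ih =>
    refine contDiff_succ_iff_hasFDerivAt.2
      ⟨fun p => (dlamP p).smulRight (-fam l t (T 1) p), ?_, fun p => ?_⟩
    · refine contDiff_clm_apply_iff.2 fun v => ?_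
      simp only [ContinuousLinearMap.smulRight_apply]
      exact contDiff_bilin (ContinuousLinearMap.lsmul ℂ ℂ) (contDiff_dlamP.clm_apply contDiff_const)
        (ih h.shift).neg
    · exact hasFDerivAt_fam_op ht (h.mono (by omega)) p

/-- The derivatives of the operator family in operator norm. -/
lemma deta_fam_op (ht : Measurable t) {n : ℕ} {T : ℕ → Y →L[ℂ] Lp ℂ 1 ν}
    (h : IsTower t (n + 1) T) {j : ℕ} (hj : j ≤ n) : deta^[j] (fun p => fam l t (T 0) p) =
      ((-Complex.I) ^ j) • fun p => fam l t (T j) p := by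
  induction j generalizing T n with
  | zero => simp
  | succ j ih =>
    obtain ⟨n, rfl⟩ := Nat.exists_eq_add_of_le' (show 1 ≤ n by omega)
    have c1 : ContDiff ℝ n fun p => fam l t (T 1) p := contDiff_fam (l := l) ht h.shift
    have e : deta (fun p => fam l t (T 0) p) = (-Complex.I) • (fun p => fam l t (T 1) p) := by
      ext p
      rw [deta, (hasFDerivAt_fam_op ht (h.mono (by omega)) p).fderiv]
      simp [dlamP_snd]
    rw [Function.iterate_succ_apply, e, deta_iterate_smul (n := n) c1 _ (by omega),
      ih (T := fun i => T (i + 1)) h.shift (by omega), smul_smul, pow_succ']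

end Fam

/-! ### Uniform convergence and decay at infinity. -/

section Tails

variable {Z : Type*} [NormedAddCommGroup Z]

/-- Outside a compact set of η both values are small by the tail hypothesis; on the compact set
continuity suffices. -/
lemma tendstoUniformly_slice {g : ℝ × ℝ → Z} (hg : Continuous g)
    (h0 : Tendsto g (𝓝 0 ×ˢ cocompact ℝ) (𝓝 0)) :
    TendstoUniformly (fun s η => g (s, η)) (fun η => g (0, η)) (𝓝 0) := by
  rw [Metric.tendstoUniformly_iff]
  intro δ hδ
  have h1 : ∀ᶠ p in 𝓝 (0 : ℝ) ×ˢ cocompact ℝ, ‖g p‖ < δ / 2 := by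
    have := h0.norm
    rw [norm_zero] at this
    exact this.eventually (gt_mem_nhds (by positivity))
  obtain ⟨U, hU, S, hS, hUS⟩ := mem_prod_iff.1 h1
  obtain ⟨Kc, hKc, hKS⟩ := mem_cocompact.1 hS
  have h2 : ∀ᶠ s in 𝓝 (0 : ℝ), ∀ η ∈ Kc, dist (g (0, η)) (g (s, η)) < δ := by
    refine hKc.eventually_forall_of_forall_eventually (P := fun s η => dist (g (0, η)) (g (s, η)) < δ)
      fun η _ => ?_
    have hc : Continuous fun z : ℝ × ℝ => dist (g (0, z.2)) (g (z.1, z.2)) := by fun_prop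
    have := hc.tendsto (0, η)
    rw [dist_self] at this
    exact this.eventually (gt_mem_nhds hδ)
  filter_upwards [h2, hU] with s hs hsU η
  by_cases hη : η ∈ Kc
  · exact hs η hη
  · have a : ‖g (0, η)‖ < δ / 2 := hUS (mk_mem_prod (mem_of_mem_nhds hU) (hKS hη))
    have b : ‖g (s, η)‖ < δ / 2 := hUS (mk_mem_prod hsU (hKS hη))
    rw [dist_eq_norm]
    linarith [norm_sub_le (g (0, η)) (g (s, η))]

variable [NormedSpace ℝ Z]

lemma memC0_slice {n : ℕ} {F : ℝ × ℝ → Z} (hF : ContDiff ℝ n F)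
    (hd : ∀ j ≤ n, ∀ ε₀, Tendsto (deta^[j] F) (𝓝 ε₀ ×ˢ cocompact ℝ) (𝓝 0)) (ε₀ : ℝ) :
    MemC0 n fun η => F (ε₀, η) := by
  refine ⟨contDiff_slice hF ε₀, fun j hj => ?_⟩
  rw [iteratedDeriv_slice hF ε₀ hj]
  exact (hd j hj ε₀).comp (tendsto_const_nhds.prodMk tendsto_id)

/-- Decay along 𝓝 ε₀ × cocompact covers each single line and the uniformity near ε = 0 at once. The
root undoes the square in `lamP`. -/
lemma tendstoInC0_of_tails {n : ℕ} {F : ℝ × ℝ → Z} (hF : ContDiff ℝ n F)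
    (hd : ∀ j ≤ n, ∀ ε₀, Tendsto (deta^[j] F) (𝓝 ε₀ ×ˢ cocompact ℝ) (𝓝 0)) {h : ℝ → ℝ → Z}
    (hh : ∀ ε > 0, ∀ η, h ε η = F (√ε, η)) : TendstoInC0 n h fun η => F (0, η) := by
  have hh' : ∀ ε > 0, h ε = fun η => F (√ε, η) := fun ε hε => funext (hh ε hε)
  refine ⟨fun ε hε => ?_, memC0_slice hF hd 0, fun j hj => ?_⟩
  · rw [hh' ε hε]; exact memC0_slice hF hd _
  · have h1 := tendstoUniformly_slice
      (contDiff_deta_iterate (n := n - j) (j := j) (by rwa [Nat.sub_add_cancel hj])).continuous (hd j hj 0)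
    have hs : Tendsto (fun ε : ℝ => √ε) (𝓝[>] 0) (𝓝 0) := by
      have := (Real.continuous_sqrt.tendsto 0).mono_left (nhdsWithin_le_nhds (s := Ioi (0 : ℝ)))
      rwa [Real.sqrt_zero] at this
    intro u hu
    filter_upwards [hs.eventually (h1 u hu), self_mem_nhdsWithin] with ε hε hpos η
    rw [hh' ε hpos, iteratedDeriv_slice hF _ hj, iteratedDeriv_slice hF _ hj]
    exact hε η

/-- A nonnegative integrable Lipschitz function tends to zero at infinity. -/
lemma tendsto_zero_of_lipschitz_of_integrable {h : ℝ → ℝ} (h0 : ∀ x, 0 ≤ h x) {L : ℝ}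
    (hL : ∀ x y, |h x - h y| ≤ L * |x - y|) (hi : Integrable h) :
    Tendsto h (cocompact ℝ) (𝓝 0) := by
  have hL0 : 0 ≤ L := by have := (abs_nonneg _).trans (hL 1 0); simpa using this
  have : (cocompact ℝ).IsCountablyGenerated := by rw [cocompact_eq_atBot_atTop]; infer_instance
  rw [Metric.tendsto_nhds]
  intro δ hδ
  -- Chosen so that Lr < δ/2: a value h η ≥ δ would keep h above δ/2 on [η, η + r], so the integral
  -- over this interval would be at least rδ/2, which fails far out.
  set r : ℝ := δ / (2 * (L + 1)) with hr
  have hr0 : 0 < r := by positivity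
  have h1 : Tendsto (fun η => ∫ x, (Icc η (η + r)).indicator h x) (cocompact ℝ)
      (𝓝 (∫ _ : ℝ, (0 : ℝ))) := by
    refine tendsto_integral_filter_of_dominated_convergence h
      (Eventually.of_forall fun η => (hi.indicator measurableSet_Icc).aestronglyMeasurable)
      (Eventually.of_forall fun η => Eventually.of_forall fun x => ?_) hi
      (Eventually.of_forall fun x => ?_)
    · rw [Real.norm_of_nonneg (indicator_nonneg (fun y _ => h0 y) x)]
      exact indicator_le_self' (fun y _ => h0 y) x
    · refine tendsto_const_nhds.congr' ?_
      have : (Icc (x - r) x)ᶜ ∈ cocompact ℝ := isCompact_Icc.compl_mem_cocompact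
      filter_upwards [this] with η hη
      rw [indicator_of_notMem]
      intro hx
      exact hη ⟨by linarith [hx.2], hx.1⟩
  rw [integral_zero] at h1
  filter_upwards [h1.eventually (gt_mem_nhds (show 0 < r * (δ / 2) by positivity))] with η hη
  rw [Real.dist_eq, sub_zero, abs_of_nonneg (h0 η)]
  rw [integral_indicator measurableSet_Icc] at hη
  have h2 : ∫ x in Icc η (η + r), (h η - L * r) ≤ ∫ x in Icc η (η + r), h x := by
    refine setIntegral_mono_on (by simp [integrableOn_const_iff]) hi.integrableOn measurableSet_Icc fun x hx => ?_
    have := (abs_le.1 (hL η x)).2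
    have hx' : |η - x| ≤ r := by rw [abs_le]; constructor <;> linarith [hx.1, hx.2]
    nlinarith
  rw [setIntegral_const, smul_eq_mul] at h2
  have h3 : (volume : Measure ℝ).real (Icc η (η + r)) = r := by
    rw [measureReal_def, Real.volume_Icc, ENNReal.toReal_ofReal] <;> linarith
  rw [h3] at h2
  have h4 := lt_of_mul_lt_mul_left (h2.trans_lt hη) hr0.le
  have h5 : L * r < δ / 2 := by
    rw [hr, mul_div_assoc', div_lt_div_iff₀ (by positivity) two_pos]; nlinarith
  linarith

end Tails

/-! ### Leibniz estimates for bilinear products. -/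

section Products

variable {E F G : Type*} [NormedAddCommGroup E] [NormedSpace ℝ E] [NormedAddCommGroup F]
  [NormedSpace ℝ F] [NormedAddCommGroup G] [NormedSpace ℝ G]

/-- `f` is of class `Cᴺ` with bounded derivatives. -/
def BddDeriv (n : ℕ) (f : ℝ → E) : Prop :=
  ContDiff ℝ n f ∧ ∀ i ≤ n, ∃ C, ∀ x, ‖iteratedDeriv i f x‖ ≤ C

lemma contDiff_bilin_real (B : E →L[ℝ] F →L[ℝ] G) {n : ℕ} {f : ℝ → E} {g : ℝ → F}
    (hf : ContDiff ℝ n f) (hg : ContDiff ℝ n g) : ContDiff ℝ n fun x => B (f x) (g x) :=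
  B.isBoundedBilinearMap.contDiff.comp (hf.prodMk hg)

lemma norm_iteratedDeriv_bilin_le (B : E →L[ℝ] F →L[ℝ] G) {n : ℕ} {f : ℝ → E} {g : ℝ → F}
    (hf : ContDiff ℝ n f) (hg : ContDiff ℝ n g) {i : ℕ} (hi : i ≤ n) (x : ℝ) :
    ‖iteratedDeriv i (fun x => B (f x) (g x)) x‖ ≤ ‖B‖ * ∑ l ∈ Finset.range (i + 1),
      (i.choose l) * ‖iteratedDeriv l f x‖ * ‖iteratedDeriv (i - l) g x‖ := by
  simpa only [norm_iteratedFDeriv_eq_norm_iteratedDeriv] using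
    B.norm_iteratedFDeriv_le_of_bilinear hf hg x (n := i) (by exact_mod_cast hi)

lemma BddDeriv.bilin (B : E →L[ℝ] F →L[ℝ] G) {n : ℕ} {f : ℝ → E} {g : ℝ → F}
    (hf : BddDeriv n f) (hg : BddDeriv n g) : BddDeriv n fun x => B (f x) (g x) := by
  refine ⟨contDiff_bilin_real B hf.1 hg.1, fun i hi => ?_⟩
  have h1 : ∀ l : ℕ, ∃ C, l ≤ i → ∀ x, ‖iteratedDeriv l f x‖ * ‖iteratedDeriv (i - l) g x‖ ≤ C := by
    intro l
    by_cases hl : l ≤ i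
    · obtain ⟨C, hC⟩ := hf.2 l (hl.trans hi)
      obtain ⟨C', hC'⟩ := hg.2 (i - l) ((Nat.sub_le _ _).trans hi)
      exact ⟨C * C', fun _ x => mul_le_mul (hC x) (hC' x) (norm_nonneg _)
        ((norm_nonneg _).trans (hC x))⟩
    · exact ⟨0, fun h => absurd h hl⟩
  choose C hC using h1
  refine ⟨‖B‖ * ∑ l ∈ Finset.range (i + 1), (i.choose l) * C l, fun x => ?_⟩
  refine (norm_iteratedDeriv_bilin_le B hf.1 hg.1 hi x).trans ?_
  refine mul_le_mul_of_nonneg_left (Finset.sum_le_sum fun l hl => ?_) (norm_nonneg B)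
  rw [mul_assoc]
  exact mul_le_mul_of_nonneg_left (hC l (by simpa [Nat.lt_succ_iff] using hl) x) (Nat.cast_nonneg _)

/-- Integrability of a derivative of a product. -/
lemma BddDeriv.integrable_bilin (B : E →L[ℝ] F →L[ℝ] G) {n : ℕ} {f : ℝ → E} {g : ℝ → F}
    (hf : BddDeriv n f) (hg : BddDeriv n g) {i : ℕ} (hi : i ≤ n)
    (h : ∀ l ≤ i, Integrable (iteratedDeriv l f) ∨ Integrable (iteratedDeriv (i - l) g)) :
    Integrable (iteratedDeriv i fun x => B (f x) (g x)) := by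
  have h1 : ∀ l ∈ Finset.range (i + 1), Integrable fun x =>
      (i.choose l : ℝ) * ‖iteratedDeriv l f x‖ * ‖iteratedDeriv (i - l) g x‖ := by
    intro l hl
    have hl' : l ≤ i := by simpa [Nat.lt_succ_iff] using hl
    have cf : Continuous (iteratedDeriv l f) :=
      hf.1.continuous_iteratedDeriv l (by exact_mod_cast hl'.trans hi)
    have cg : Continuous (iteratedDeriv (i - l) g) :=
      hg.1.continuous_iteratedDeriv (i - l) (by exact_mod_cast (Nat.sub_le _ _).trans hi)
    simp only [mul_assoc]
    refine Integrable.const_mul ?_ _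
    rcases h l hl' with h | h
    · obtain ⟨C, hC⟩ := hg.2 (i - l) ((Nat.sub_le _ _).trans hi)
      exact h.norm.mul_bdd (c := C) cg.norm.aestronglyMeasurable
        (Eventually.of_forall fun x => by rw [norm_norm]; exact hC x)
    · obtain ⟨C, hC⟩ := hf.2 l (hl'.trans hi)
      exact h.norm.bdd_mul (c := C) cf.norm.aestronglyMeasurable
        (Eventually.of_forall fun x => by rw [norm_norm]; exact hC x)
  refine ((integrable_finsetSum _ h1).const_mul ‖B‖).mono'
    ((contDiff_bilin_real B hf.1 hg.1).continuous_iteratedDeriv i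
      (by exact_mod_cast hi)).aestronglyMeasurable (Eventually.of_forall fun x => ?_)
  exact norm_iteratedDeriv_bilin_le B hf.1 hg.1 hi x

end Products

/-! ### Integrable derivatives of operator powers. -/

section Powers

variable {E : Type*} [NormedAddCommGroup E] [NormedSpace ℂ E] [NormedSpace ℝ E] [IsScalarTower ℝ ℂ E]

/-- Composition of operators as a real bilinear map. -/
def compB (E : Type*) [NormedAddCommGroup E] [NormedSpace ℂ E] [NormedSpace ℝ E]
    [IsScalarTower ℝ ℂ E] : (E →L[ℂ] E) →L[ℝ] (E →L[ℂ] E) →L[ℝ] (E →L[ℂ] E) :=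
  (ContinuousLinearMap.compL ℂ E E E).bilinearRestrictScalars ℝ

lemma compB_apply (A B : E →L[ℂ] E) : compB E A B = A * B := rfl

/-- Evaluation of operators as a real bilinear map. -/
def evalB (E : Type*) [NormedAddCommGroup E] [NormedSpace ℂ E] [NormedSpace ℝ E]
    [IsScalarTower ℝ ℂ E] : (E →L[ℂ] E) →L[ℝ] E →L[ℝ] E :=
  (ContinuousLinearMap.id ℂ (E →L[ℂ] E)).bilinearRestrictScalars ℝ

lemma BddDeriv.pow {n : ℕ} {A : ℝ → E →L[ℂ] E} (hA : BddDeriv n A) (m : ℕ) :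
    BddDeriv n fun x => A x ^ m := by
  induction m with
  | zero =>
    refine ⟨by simpa using contDiff_const, fun i _ => ?_⟩
    refine ⟨‖(1 : E →L[ℂ] E)‖, fun x => ?_⟩
    simp only [pow_zero, iteratedDeriv_const]
    split_ifs <;> simp
  | succ m ih =>
    have := ih.bilin (compB E) hA
    simpa only [compB_apply, ← pow_succ] using this

/-- If `Aᵐ` is integrable then the derivatives of order `≤ j` of `A ^ (2ʲ m)` are integrable. -/
lemma BddDeriv.integrable_pow {n : ℕ} {A : ℝ → E →L[ℂ] E} (hA : BddDeriv n A) {m : ℕ}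
    (hm : Integrable fun x => A x ^ m) (j : ℕ) :
    ∀ i ≤ j, i ≤ n → Integrable (iteratedDeriv i fun x => A x ^ (2 ^ j * m)) := by
  induction j with
  | zero =>
    intro i hi _
    obtain rfl : i = 0 := by omega
    simpa using hm
  | succ j ih =>
    intro i hi hin
    have e : (fun x => A x ^ (2 ^ (j + 1) * m)) =
        fun x => compB E (A x ^ (2 ^ j * m)) (A x ^ (2 ^ j * m)) := by
      ext1 x; rw [compB_apply, ← pow_add]; congr 1; ring
    rw [e]
    refine (hA.pow _).integrable_bilin (compB E) (hA.pow _) hin fun l hl => ?_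
    -- The power is split into two equal factors. If i ≤ j + 1 derivatives are distributed over
    -- them, at least one factor receives no more than j; this is where the exponent 2ᴺp comes from.
    rcases Nat.lt_or_ge j l with h | h
    · exact Or.inr (ih _ (by omega) (by omega))
    · exact Or.inl (ih _ h (by omega))

end Powers

/-! ### Local versions of the smoothness and decay lemmas. -/

section Local

/-- Multiplication by a smooth bump function; it reduces regularity at a point to the global
statements about `fam`. -/
lemma exists_contDiff_eventuallyEq {Y : Type*} [NormedAddCommGroup Y] [NormedSpace ℝ Y] {n : ℕ}
    {y : ℝ × ℝ → Y} {p : ℝ × ℝ} (hy : ContDiffAt ℝ n y p) :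
    ∃ y' : ℝ × ℝ → Y, ContDiff ℝ n y' ∧ y' =ᶠ[𝓝 p] y := by
  have h1 := hy.eventually (by simp)
  obtain ⟨r, hr, hb⟩ := Metric.eventually_nhds_iff_ball.1 h1
  let χ : ContDiffBump p := ⟨r / 4, r / 2, by positivity, by linarith⟩
  refine ⟨fun q => χ q • y q, contDiff_iff_contDiffAt.2 fun q => ?_, ?_⟩
  · by_cases hq' : q ∈ tsupport χ
    swap
    · refine (contDiffAt_const (c := (0 : Y))).congr_of_eventuallyEq ?_
      filter_upwards [notMem_tsupport_iff_eventuallyEq.1 hq'] with x hx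
      rw [hx]; simp
    rw [χ.tsupport_eq] at hq'
    refine χ.contDiff.contDiffAt.smul (hb q ?_)
    exact Metric.closedBall_subset_ball (show χ.rOut < r by simp only [χ]; linarith) hq'
  · filter_upwards [χ.eventuallyEq_one] with q hq
    rw [hq]; simp

variable {β : Type*} [MeasurableSpace β] {ν : Measure β} {t : β → ℝ≥0}
  {Y : Type*} [NormedAddCommGroup Y] [NormedSpace ℂ Y] [NormedSpace ℝ Y] [IsScalarTower ℝ ℂ Y]
  {Z : Type*} [NormedAddCommGroup Z] [NormedSpace ℂ Z] [NormedSpace ℝ Z] [IsScalarTower ℝ ℂ Z]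
  {l : Lp ℂ 1 ν →L[ℂ] Z}

lemma contDiffAt_fam_apply (ht : Measurable t) {n : ℕ} {T : ℕ → Y →L[ℂ] Lp ℂ 1 ν}
    (h : IsTower t n T) {y : ℝ × ℝ → Y} {p : ℝ × ℝ} (hy : ContDiffAt ℝ n y p) :
    ContDiffAt ℝ n (fun p => fam l t (T 0) p (y p)) p := by
  obtain ⟨y', h1, h2⟩ := exists_contDiff_eventuallyEq hy
  refine (contDiff_fam_apply (l := l) ht h h1).contDiffAt.congr_of_eventuallyEq ?_
  filter_upwards [h2] with q hq
  rw [hq]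

/-- Decay along `𝓝 ε₀ × cocompact` of all `η`-derivatives is preserved by operator families. -/
lemma tendsto_deta_fam (ht : Measurable t) {n : ℕ} {T : ℕ → Y →L[ℂ] Lp ℂ 1 ν} (h : IsTower t n T)
    {y : ℝ × ℝ → Y} (hy : ContDiff ℝ n y)
    (hd : ∀ j ≤ n, ∀ ε₀, Tendsto (deta^[j] y) (𝓝 ε₀ ×ˢ cocompact ℝ) (𝓝 0)) :
    ∀ j ≤ n, ∀ ε₀, Tendsto (deta^[j] fun p => fam l t (T 0) p (y p)) (𝓝 ε₀ ×ˢ cocompact ℝ) (𝓝 0) := by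
  intro j hj ε₀
  obtain ⟨C, -, hb⟩ := deta_fam_le (l := l) ht h hy hj
  refine squeeze_zero_norm hb ?_
  have : Tendsto (fun p => ∑ i ∈ Finset.range (j + 1), ‖(deta^[i] y) p‖) (𝓝 ε₀ ×ˢ cocompact ℝ)
      (𝓝 (∑ i ∈ Finset.range (j + 1), 0)) := by
    refine tendsto_finsetSum _ fun i hi => ?_
    have := (hd i ((Nat.lt_succ_iff.1 (Finset.mem_range.1 hi)).trans hj) ε₀).norm
    rwa [norm_zero] at this
  simpa using this.const_mul C

lemma contDiffAt_bilin {E F G : Type*} [NormedAddCommGroup E] [NormedSpace ℂ E] [NormedSpace ℝ E]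
    [IsScalarTower ℝ ℂ E] [NormedAddCommGroup F] [NormedSpace ℂ F] [NormedSpace ℝ F]
    [IsScalarTower ℝ ℂ F] [NormedAddCommGroup G] [NormedSpace ℂ G] [NormedSpace ℝ G]
    [IsScalarTower ℝ ℂ G] (B : E →L[ℂ] F →L[ℂ] G) {n : WithTop ℕ∞} {f : ℝ × ℝ → E} {g : ℝ × ℝ → F}
    {p : ℝ × ℝ} (hf : ContDiffAt ℝ n f p) (hg : ContDiffAt ℝ n g p) :
    ContDiffAt ℝ n (fun p => B (f p) (g p)) p :=
  ContDiffAt.comp (g := fun q : E × F => B q.1 q.2) (f := fun p => (f p, g p)) p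
    ((B.bilinearRestrictScalars ℝ).isBoundedBilinearMap.contDiff.contDiffAt) (hf.prodMk hg)

end Local

/-! ### Neumann series when only the square is a strict contraction. -/

section Neumann

variable {E : Type*} [NormedAddCommGroup E] [NormedSpace ℂ E] [CompleteSpace E]

/-- Even powers are dominated by a geometric series in ‖K²‖, and odd powers by the even ones since
‖K‖ ≤ 1. -/
lemma summable_pow_of_norm_sq_lt {R : Type*} [NormedRing R] {K : R} (h0 : ‖(1 : R)‖ ≤ 1)
    (h1 : ‖K‖ ≤ 1) (h2 : ‖K * K‖ < 1) : Summable fun j : ℕ => ‖K ^ j‖ := by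
  obtain ⟨r, hr0, hr1, hr2⟩ : ∃ r : ℝ, 0 < r ∧ r < 1 ∧ ‖K * K‖ ≤ r :=
    ⟨max ‖K * K‖ (1 / 2), lt_of_lt_of_le (by norm_num) (le_max_right _ _),
      max_lt h2 (by norm_num), le_max_left _ _⟩
  have hb : ∀ k : ℕ, ‖(K * K) ^ k‖ ≤ r ^ k := fun k => by
    induction k with
    | zero => rw [pow_zero, pow_zero]; exact h0
    | succ k ih =>
      rw [pow_succ, pow_succ r]
      exact (norm_mul_le ((K * K) ^ k) (K * K)).trans
        (mul_le_mul ih hr2 (norm_nonneg (K * K)) (pow_nonneg hr0.le k))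
  have hg := summable_geometric_of_lt_one hr0.le hr1
  have he : Summable fun k : ℕ => ‖K ^ (2 * k)‖ :=
    Summable.of_nonneg_of_le (fun _ => norm_nonneg _) (fun k => by
      rw [pow_mul, pow_two]; exact hb k) hg
  have ho : Summable fun k : ℕ => ‖K ^ (2 * k + 1)‖ :=
    Summable.of_nonneg_of_le (fun _ => norm_nonneg _) (fun k => by
      rw [pow_succ, pow_mul, pow_two]
      exact (norm_mul_le ((K * K) ^ k) K).trans
        ((mul_le_of_le_one_right (norm_nonneg ((K * K) ^ k)) h1).trans (hb k))) hg
  exact (HasSum.even_add_odd (f := fun j : ℕ => ‖K ^ j‖) he.hasSum ho.hasSum).summable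

lemma hasSum_pow_apply {K : E →L[ℂ] E} (h1 : ‖K‖ ≤ 1) (h2 : ‖K * K‖ < 1) (x : E) :
    HasSum (fun j : ℕ => (K ^ j) x) (Ring.inverse (1 - K) x) := by
  have hs : Summable fun j : ℕ => (K ^ j) x :=
    Summable.of_norm_bounded
      ((summable_pow_of_norm_sq_lt ContinuousLinearMap.norm_id_le h1 h2).mul_right ‖x‖)
      fun j => (K ^ j).le_opNorm x
  have hu := isUnit_one_sub_of_norm_sq_lt h2
  have e1 : ∑' j : ℕ, (K ^ j) x = x + K (∑' j : ℕ, (K ^ j) x) := by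
    conv_lhs => rw [hs.tsum_eq_zero_add]
    rw [K.map_tsum hs]
    simp [pow_succ']
  have e2 : (1 - K) (∑' j : ℕ, (K ^ j) x) = x := by
    rw [ContinuousLinearMap.sub_apply, ContinuousLinearMap.one_apply]
    nth_rewrite 1 [e1]; abel
  have e3 : Ring.inverse (1 - K) x = ∑' j : ℕ, (K ^ j) x := by
    conv_lhs => rw [← e2]
    exact congrArg (fun A : E →L[ℂ] E => A (∑' j : ℕ, (K ^ j) x)) (Ring.inverse_mul_cancel _ hu)
  rw [e3]; exact hs.hasSum

/-- Used to recover x from x - Kx: when ‖Kᵐ‖ ≤ 1/2 it yields ‖x‖ ≤ 2m‖x - Kx‖. -/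
lemma norm_sub_pow_apply_le {K : E →L[ℂ] E} (h1 : ‖K‖ ≤ 1) (m : ℕ) (x : E) :
    ‖x - (K ^ m) x‖ ≤ m * ‖x - K x‖ := by
  induction m with
  | zero => simp
  | succ m ih =>
    have e : x - (K ^ (m + 1)) x = (x - K x) + K (x - (K ^ m) x) := by
      rw [pow_succ', map_sub]; simp
    have h2 := K.le_of_opNorm_le h1 (x - (K ^ m) x)
    rw [one_mul] at h2
    rw [e]
    calc _ ≤ ‖x - K x‖ + m * ‖x - K x‖ := (norm_add_le _ _).trans (add_le_add le_rfl (h2.trans ih))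
      _ = _ := by push_cast; ring

lemma norm_pow_sub_pow_op_le {A B : E →L[ℂ] E} (hA : ‖A‖ ≤ 1) (hB : ‖B‖ ≤ 1) (m : ℕ) :
    ‖A ^ m - B ^ m‖ ≤ m * ‖A - B‖ := by
  have hp : ∀ k : ℕ, ‖A ^ k‖ ≤ 1 := fun k => by
    induction k with
    | zero => rw [pow_zero]; exact ContinuousLinearMap.norm_id_le
    | succ k ih =>
      rw [pow_succ]
      exact (norm_mul_le (A ^ k) A).trans (mul_le_one₀ ih (norm_nonneg A) hA)
  induction m with
  | zero => simp
  | succ m ih =>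
    have e : A ^ (m + 1) - B ^ (m + 1) = A ^ m * (A - B) + (A ^ m - B ^ m) * B := by
      rw [pow_succ, pow_succ]; noncomm_ring
    rw [e]
    have a := (norm_mul_le (A ^ m) (A - B)).trans (mul_le_of_le_one_left (norm_nonneg _) (hp m))
    have b := (norm_mul_le (A ^ m - B ^ m) B).trans (mul_le_of_le_one_right (norm_nonneg _) hB)
    calc _ ≤ ‖A - B‖ + m * ‖A - B‖ := (norm_add_le _ _).trans (add_le_add a (b.trans ih))
      _ = _ := by push_cast; ring

end Neumann

/-! ### The abstract transport model: bounds for K_λ and for the source G_λ f. -/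

variable {α β : Type*} [MeasurableSpace α] [MeasurableSpace β]

/-- The abstract structure behind the collisionless transport semigroup: a Markov operator
`K = TK 0` on `L¹(μ)`, its weighted versions `TK i = τⁱ K`, the lifting `TS 0` to `L¹(ν)` with
`TS i = tⁱ TS 0`, and the operator `G` collecting on the boundary functions of the phase space. -/
structure TransportModel (μ : Measure α) (ν : Measure β) (τ : α → ℝ≥0) (t s : β → ℝ≥0)
    (TK : ℕ → Lp ℂ 1 μ →L[ℂ] Lp ℂ 1 μ) (TS : ℕ → Lp ℂ 1 μ →L[ℂ] Lp ℂ 1 ν)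
    (G : Lp ℂ 1 ν →L[ℂ] Lp ℂ 1 μ) (N p : ℕ) : Prop where
  nontriv : Nontrivial (Lp ℂ 1 μ)
  markov : IsMarkov (TK 0)
  meas_τ : Measurable τ
  meas_t : Measurable t
  meas_s : Measurable s
  τ_pos : ∀ᵐ z ∂μ, 0 < τ z
  towerK : IsTower τ (N + 1) TK
  towerS : IsTower t N TS
  compact : ∃ C : Set (WeakSpace ℂ (Lp ℂ 1 μ)), IsCompact C ∧
    ∀ ψ, ‖ψ‖ ≤ 1 → toWeakSpace ℂ _ (TK 0 (TK 0 ψ)) ∈ C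
  irreducible : IrreducibleOnL1 (TK 0)
  mass_G : ∀ h, intCLM μ (G h) = intCLM ν h
  balance : ∀ lam : ℂ, 0 ≤ lam.re → ∀ ψ, intCLM μ ψ - intCLM μ (Kfam (TK 0) τ lam ψ) =
    lam * intCLM ν (expMul ν t lam (TS 0 ψ))
  mean_time : ∀ ψ, intCLM ν (TS 0 ψ) = intCLM μ (TK 1 ψ)
  riemann_lebesgue : ∀ h, Tendsto (fun η : ℝ => G (expMul ν s (η * Complex.I) h)) (cocompact ℝ) (𝓝 0)
  power_integrable : ∃ C : ℝ≥0, ∀ ε : ℝ, 0 ≤ ε →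
    ∫⁻ η : ℝ, ‖Kfam (TK 0) τ (ε + η * Complex.I) ^ p‖ₑ ≤ C

namespace TransportModel

variable {μ : Measure α} {ν : Measure β} [SigmaFinite μ] [SigmaFinite ν] {τ : α → ℝ≥0}
  {t s : β → ℝ≥0}
  {TK : ℕ → Lp ℂ 1 μ →L[ℂ] Lp ℂ 1 μ} {TS : ℕ → Lp ℂ 1 μ →L[ℂ] Lp ℂ 1 ν}
  {G : Lp ℂ 1 ν →L[ℂ] Lp ℂ 1 μ} {N p : ℕ}

/-- The family `K_λ` in the parameters `(ε, η)`. -/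
abbrev Kp (τ : α → ℝ≥0) (TK : ℕ → Lp ℂ 1 μ →L[ℂ] Lp ℂ 1 μ) (q : ℝ × ℝ) : Lp ℂ 1 μ →L[ℂ] Lp ℂ 1 μ :=
  fam (ContinuousLinearMap.id ℂ _) τ (TK 0) q

lemma Kp_eq (q : ℝ × ℝ) : Kp τ TK q = Kfam (TK 0) τ (lamP q) := rfl

lemma norm_Kp_le (M : TransportModel μ ν τ t s TK TS G N p) (q : ℝ × ℝ) : ‖Kp τ TK q‖ ≤ 1 :=
  norm_Kfam_le M.markov _

lemma norm_Kfam_sub_le (M : TransportModel μ ν τ t s TK TS G N p) {a b : ℂ} (ha : 0 ≤ a.re)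
    (hb : 0 ≤ b.re) : ‖Kfam (TK 0) τ b - Kfam (TK 0) τ a‖ ≤ ‖TK 1‖ * ‖b - a‖ :=
  ContinuousLinearMap.opNorm_le_bound _ (by positivity) fun y => by
    refine (norm_expMul_sub_le M.meas_τ (M.towerK.mono (by omega)) ha hb y).trans ?_
    rw [mul_comm ‖TK 1‖, mul_assoc]
    exact mul_le_mul_of_nonneg_left ((TK 1).le_opNorm y) (norm_nonneg _)

lemma norm_Kfam_pow_sub_le (M : TransportModel μ ν τ t s TK TS G N p) {a b : ℂ} (ha : 0 ≤ a.re)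
    (hb : 0 ≤ b.re) : |‖Kfam (TK 0) τ b ^ p‖ - ‖Kfam (TK 0) τ a ^ p‖| ≤ p * ‖TK 1‖ * ‖b - a‖ := by
  refine (abs_norm_sub_norm_le _ _).trans ((norm_pow_sub_pow_op_le (norm_Kfam_le M.markov _)
    (norm_Kfam_le M.markov _) p).trans ?_)
  rw [mul_assoc]
  exact mul_le_mul_of_nonneg_left (M.norm_Kfam_sub_le ha hb) (Nat.cast_nonneg _)

lemma re_line {ε : ℝ} (hε : 0 ≤ ε) (η : ℝ) : 0 ≤ ((ε : ℂ) + η * Complex.I).re := by simpa using hε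

lemma integrable_norm_pow (M : TransportModel μ ν τ t s TK TS G N p) {ε : ℝ} (hε : 0 ≤ ε) :
    Integrable fun η : ℝ => Kfam (TK 0) τ (ε + η * Complex.I) ^ p := by
  obtain ⟨C, hC⟩ := M.power_integrable
  have hc : Continuous fun η : ℝ => Kfam (TK 0) τ (ε + η * Complex.I) ^ p := by
    refine Continuous.pow (continuous_iff_continuousAt.2 fun η => ?_) p
    rw [ContinuousAt, tendsto_iff_norm_sub_tendsto_zero]
    have h1 : Tendsto (fun x : ℝ => ‖TK 1‖ * ‖((ε : ℂ) + x * Complex.I) - (ε + η * Complex.I)‖)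
        (𝓝 η) (𝓝 0) := by
      have hc : Continuous fun x : ℝ =>
          ‖TK 1‖ * ‖((ε : ℂ) + x * Complex.I) - (ε + η * Complex.I)‖ := by fun_prop
      simpa using hc.tendsto η
    exact squeeze_zero (fun _ => norm_nonneg _)
      (fun x => M.norm_Kfam_sub_le (re_line hε η) (re_line hε x)) h1
  exact ⟨hc.aestronglyMeasurable, (hC ε hε).trans_lt ENNReal.coe_lt_top⟩

/-- One moment of K makes the norm of the p-th power Lipschitz in η; a nonnegative integrable
Lipschitz function vanishes at infinity. -/
lemma tendsto_norm_pow_line (M : TransportModel μ ν τ t s TK TS G N p) {ε : ℝ} (hε : 0 ≤ ε) :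
    Tendsto (fun η : ℝ => ‖Kfam (TK 0) τ (ε + η * Complex.I) ^ p‖) (cocompact ℝ) (𝓝 0) := by
  refine tendsto_zero_of_lipschitz_of_integrable (fun _ => norm_nonneg _) (L := p * ‖TK 1‖)
    (fun x y => ?_) (M.integrable_norm_pow hε).norm
  refine (M.norm_Kfam_pow_sub_le (re_line hε y) (re_line hε x)).trans (le_of_eq ?_)
  have : ((ε : ℂ) + x * Complex.I) - (ε + y * Complex.I) = ((x - y : ℝ) : ℂ) * Complex.I := by
    push_cast; ring
  rw [this, norm_mul, Complex.norm_I, mul_one, Complex.norm_real, Real.norm_eq_abs]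

/-- Lipschitz dependence on Re λ, uniform in η, carries the decay from the line Re λ = ε₀² to the
neighbouring lines. -/
lemma tendsto_norm_Kp_pow (M : TransportModel μ ν τ t s TK TS G N p) (ε₀ : ℝ) :
    Tendsto (fun q => ‖Kp τ TK q ^ p‖) (𝓝 ε₀ ×ˢ cocompact ℝ) (𝓝 0) := by
  have h1 := (M.tendsto_norm_pow_line (sq_nonneg ε₀)).comp
    (tendsto_snd (f := 𝓝 ε₀) (g := cocompact ℝ))
  have h2 : Tendsto (fun q : ℝ × ℝ => p * ‖TK 1‖ * |q.1 ^ 2 - ε₀ ^ 2|) (𝓝 ε₀ ×ˢ cocompact ℝ) (𝓝 0) := by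
    have hc : Continuous fun x : ℝ => p * ‖TK 1‖ * |x ^ 2 - ε₀ ^ 2| := by fun_prop
    have := (hc.tendsto ε₀).comp (tendsto_fst (f := 𝓝 ε₀) (g := cocompact ℝ))
    simpa [Function.comp_def] using this
  have h3 := h1.add h2
  rw [add_zero] at h3
  refine squeeze_zero (fun _ => norm_nonneg _) (fun q => ?_) h3
  have h4 := M.norm_Kfam_pow_sub_le (re_line (sq_nonneg ε₀) q.2) (lamP_re_nonneg q)
  have e : lamP q - (((ε₀ ^ 2 : ℝ) : ℂ) + q.2 * Complex.I) = ((q.1 ^ 2 - ε₀ ^ 2 : ℝ) : ℂ) := by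
    rw [lamP]; push_cast; ring
  rw [e, Complex.norm_real, Real.norm_eq_abs] at h4
  have h5 := (abs_le.1 h4).2
  simp only [Function.comp_apply, Kp_eq] at h5 ⊢
  linarith

lemma isUnit_one_sub (M : TransportModel μ ν τ t s TK TS G N p) {q : ℝ × ℝ} (hq : q ≠ 0) :
    IsUnit (1 - Kp τ TK q) := by
  rw [Kp_eq]
  obtain ⟨C, hC, hKC⟩ := M.compact
  by_cases h : q.1 = 0
  · have h2 : q.2 ≠ 0 := fun h2 => hq (Prod.ext h h2)
    have e : lamP q = q.2 * Complex.I := by rw [lamP, h]; simp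
    rw [e]
    refine isUnit_one_sub_Kfam_of_imag M.markov M.meas_τ (p := p) ?_ h2
    simpa using M.tendsto_norm_pow_line le_rfl
  · refine isUnit_one_sub_Kfam_of_re_pos M.markov M.meas_τ M.τ_pos hC hKC ?_
    rw [lamP_re]; positivity

/-- The sources: an element `ft 0` of `L¹(ν)` of zero mean and its weighted versions
`ft i = sⁱ ft 0`. -/
structure Source (s : β → ℝ≥0) (M : ℕ) (ft : ℕ → Lp ℂ 1 ν) : Prop where
  tower : ∀ i < M, ∀ᵐ z ∂ν, ft (i + 1) z = ((s z : ℝ) : ℂ) * ft i z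
  mean : intCLM ν (ft 0) = 0

/-- The operators `ℂ → L¹(ν)` spanned by the `ft i`. -/
abbrev srcT (ft : ℕ → Lp ℂ 1 ν) (i : ℕ) : ℂ →L[ℂ] Lp ℂ 1 ν := ContinuousLinearMap.toSpanSingleton ℂ (ft i)

lemma Source.isTower {M : ℕ} {ft : ℕ → Lp ℂ 1 ν} (hf : Source s M ft) : IsTower s M (srcT ft) := by
  intro i hi y
  filter_upwards [hf.tower i hi, coeFn_smul_ae y (ft (i + 1)), coeFn_smul_ae y (ft i)] with z a b c
  simp only [srcT, ContinuousLinearMap.toSpanSingleton_apply]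
  rw [b, c, a]; ring

/-- The family `G_λ f`. -/
abbrev gp (G : Lp ℂ 1 ν →L[ℂ] Lp ℂ 1 μ) (s : β → ℝ≥0) (ft : ℕ → Lp ℂ 1 ν) (q : ℝ × ℝ) : Lp ℂ 1 μ :=
  fam G s (srcT ft 0) q 1

lemma gp_eq (ft : ℕ → Lp ℂ 1 ν) (q : ℝ × ℝ) : gp G s ft q = G (expMul ν s (lamP q) (ft 0)) := by
  simp [gp, fam_apply, srcT]

lemma contDiff_gp (M : TransportModel μ ν τ t s TK TS G N p) {ft : ℕ → Lp ℂ 1 ν}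
    (hf : Source s (N + 1) ft) : ContDiff ℝ N (gp G s ft) :=
  contDiff_fam_apply M.meas_s (hf.isTower.mono (by omega)) contDiff_const

/-- Factor exp(-λs) into exp(-iηs) exp(-ε²s). The Riemann–Lebesgue property is used for the fixed
function at ε₀, and the error is small by strong continuity in ε, uniformly in η. -/
lemma tendsto_expMul_tail (M : TransportModel μ ν τ t s TK TS G N p) (h : Lp ℂ 1 ν) (ε₀ : ℝ) :
    Tendsto (fun q => G (expMul ν s (lamP q) h)) (𝓝 ε₀ ×ˢ cocompact ℝ) (𝓝 0) := by
  have hre : ∀ η : ℝ, 0 ≤ ((η : ℂ) * Complex.I).re := fun η => by simp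
  have hre2 : ∀ x : ℝ, 0 ≤ (((x ^ 2 : ℝ) : ℂ)).re := fun x => by
    rw [Complex.ofReal_re]; positivity
  have hsplit : ∀ q : ℝ × ℝ, ∀ h, expMul ν s (lamP q) h =
      expMul ν s (q.2 * Complex.I) (expMul ν s ((q.1 ^ 2 : ℝ) : ℂ) h) := by
    intro q h
    apply Lp.ext
    filter_upwards [expMul_coeFn M.meas_s (lamP_re_nonneg q) h,
      expMul_coeFn M.meas_s (hre q.2) (expMul ν s ((q.1 ^ 2 : ℝ) : ℂ) h),
      expMul_coeFn M.meas_s (hre2 q.1) h] with z a b c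
    rw [a, b, c, ← mul_assoc, ← Complex.exp_add]
    congr 2; rw [lamP]; ring
  have h1 := (M.riemann_lebesgue (expMul ν s ((ε₀ ^ 2 : ℝ) : ℂ) h)).comp
    (tendsto_snd (f := 𝓝 ε₀) (g := cocompact ℝ))
  have hc : Tendsto (fun x : ℝ => ((x ^ 2 : ℝ) : ℂ)) (𝓝 ε₀) (𝓝[{l | 0 ≤ l.re}] ((ε₀ ^ 2 : ℝ) : ℂ)) := by
    refine tendsto_nhdsWithin_iff.2 ⟨?_, Eventually.of_forall hre2⟩
    exact (Complex.continuous_ofReal.comp (continuous_pow 2)).tendsto ε₀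
  have h2 := (tendsto_iff_norm_sub_tendsto_zero.1 ((tendsto_expMul M.meas_s (hre2 ε₀) h).comp hc)).comp
    (tendsto_fst (f := 𝓝 ε₀) (g := cocompact ℝ))
  have h3 := h1.norm.add (h2.const_mul ‖G‖)
  rw [norm_zero, mul_zero, add_zero] at h3
  refine squeeze_zero_norm (fun q => ?_) h3
  simp only [Function.comp_apply]
  have e : G (expMul ν s (lamP q) h) = G (expMul ν s (q.2 * Complex.I) (expMul ν s ((ε₀ ^ 2 : ℝ) : ℂ) h))
      + G (expMul ν s (q.2 * Complex.I) (expMul ν s ((q.1 ^ 2 : ℝ) : ℂ) h -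
        expMul ν s ((ε₀ ^ 2 : ℝ) : ℂ) h)) := by
    rw [← map_add, ← map_add, hsplit]; congr 2; abel
  rw [e]
  refine (norm_add_le _ _).trans (add_le_add le_rfl ((G.le_opNorm _).trans ?_))
  exact mul_le_mul_of_nonneg_left (norm_expMul_apply_le _ _) (norm_nonneg _)

lemma tendsto_deta_gp (M : TransportModel μ ν τ t s TK TS G N p) {ft : ℕ → Lp ℂ 1 ν}
    (hf : Source s (N + 1) ft) : ∀ j ≤ N, ∀ ε₀, Tendsto (deta^[j] (gp G s ft))
      (𝓝 ε₀ ×ˢ cocompact ℝ) (𝓝 0) := by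
  intro j hj ε₀
  have h1 := deta_fam_const (l := G) M.meas_s (hf.isTower.mono (Nat.le_succ N)) 1 hj
  have h2 : deta^[j] (gp G s ft) = fun q => (-Complex.I) ^ j • G (expMul ν s (lamP q) (ft j)) := by
    refine h1.trans ?_
    ext1 q
    simp [fam_apply, srcT]
  rw [h2]
  simpa using (M.tendsto_expMul_tail (ft j) ε₀).const_smul ((-Complex.I) ^ j)

/-! ### The regularised mean of the source -/

/-- `uⁱ s(x)ⁱ⁺¹ f(x)` on the product with the unit interval. -/
def gammaSrc (ft : ℕ → Lp ℂ 1 ν) (i : ℕ) :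
    Lp ℂ 1 (ν.prod ((volume : Measure ℝ).restrict (Ioc 0 1))) :=
  toL1 _ fun z => ft (i + 1) z.1 * ((z.2 : ℂ)) ^ i

lemma gammaSrc_int (ft : ℕ → Lp ℂ 1 ν) (i : ℕ) :
    Integrable (fun z : β × ℝ => ft (i + 1) z.1 * ((z.2 : ℂ)) ^ i)
      (ν.prod ((volume : Measure ℝ).restrict (Ioc 0 1))) := by
  have h : Integrable (fun u : ℝ => (u : ℂ) ^ i) ((volume : Measure ℝ).restrict (Ioc 0 1)) := by
    have hc : Continuous fun u : ℝ => (u : ℂ) ^ i := by fun_prop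
    exact hc.integrableOn_Ioc
  exact (Lp_int (ft (i + 1))).mul_prod h

/-- The time function of the product with the unit interval. -/
def gammaTime (s : β → ℝ≥0) (z : β × ℝ) : ℝ≥0 := z.2.toNNReal * s z.1

lemma measurable_gammaTime (hs : Measurable s) : Measurable (gammaTime s) :=
  (measurable_real_toNNReal.comp measurable_snd).mul (hs.comp measurable_fst)

lemma ae_unit_interval : ∀ᵐ z ∂(ν.prod ((volume : Measure ℝ).restrict (Ioc 0 1))),
    (z.2.toNNReal : ℝ) = z.2 := by
  have h : ∀ᵐ u ∂((volume : Measure ℝ).restrict (Ioc (0 : ℝ) 1)), (u.toNNReal : ℝ) = u := by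
    filter_upwards [ae_restrict_mem measurableSet_Ioc] with u hu
    exact Real.coe_toNNReal u hu.1.le
  exact Measure.quasiMeasurePreserving_snd.ae h

/-- The i-th moment involves sⁱ⁺¹f, so N moments here require N + 1 moments of the source. -/
lemma gammaSrc_source {ft : ℕ → Lp ℂ 1 ν} (hf : Source s (N + 1) ft) :
    IsTower (gammaTime s) N (srcT (gammaSrc ft)) := by
  intro i hi y
  have h1 : ∀ᵐ z ∂(ν.prod ((volume : Measure ℝ).restrict (Ioc 0 1))),
      ft (i + 1 + 1) z.1 = ((s z.1 : ℝ) : ℂ) * ft (i + 1) z.1 :=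
    Measure.quasiMeasurePreserving_fst.ae (hf.tower (i + 1) (by omega))
  filter_upwards [coeFn_smul_ae y (gammaSrc ft (i + 1)), coeFn_smul_ae y (gammaSrc ft i),
    toL1_coeFn (gammaSrc_int ft (i + 1)), toL1_coeFn (gammaSrc_int ft i), h1,
    ae_unit_interval (ν := ν)] with z a b c d e f
  simp only [srcT, ContinuousLinearMap.toSpanSingleton_apply]
  rw [a, b, gammaSrc, gammaSrc, c, d, e, gammaTime, NNReal.coe_mul, f]
  push_cast; ring

/-- `γ(λ) = ∫ q(λ, s) f`, where `q(λ, s) = (1 - exp (-λ s)) / λ`. -/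
abbrev gamP (ν : Measure β) (s : β → ℝ≥0) (ft : ℕ → Lp ℂ 1 ν) (q : ℝ × ℝ) : ℂ :=
  fam (intCLM _) (gammaTime s) (srcT (gammaSrc ft) 0) q 1

/-- As f has zero mean, the mass of G_λ f is ∫ (exp(-λs) - 1) f, and 1 - exp(-λs) is λ times the
integral of s exp(-λus) over u in [0, 1]. The factor λ is thereby explicit and the cofactor stays
regular at λ = 0. -/
lemma mul_gamP (M : TransportModel μ ν τ t s TK TS G N p) {ft : ℕ → Lp ℂ 1 ν}
    (hf : Source s (N + 1) ft) (q : ℝ × ℝ) :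
    intCLM μ (gp G s ft q) = -(lamP q * gamP ν s ft q) := by
  have hl := lamP_re_nonneg q
  rw [gp_eq, M.mass_G]
  have h1 : gamP ν s ft q = ∫ z, Complex.exp (-lamP q * ((z.2 * s z.1 : ℝ) : ℂ)) * ft 1 z.1
      ∂(ν.prod ((volume : Measure ℝ).restrict (Ioc 0 1))) := by
    have e : gamP ν s ft q = intCLM _ (expMul _ (gammaTime s) (lamP q) (gammaSrc ft 0)) := by
      simp [gamP, fam_apply, srcT]
    rw [e, intCLM_apply]
    refine integral_congr_ae ?_
    filter_upwards [expMul_coeFn (measurable_gammaTime M.meas_s) hl (gammaSrc ft 0),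
      toL1_coeFn (gammaSrc_int ft 0), ae_unit_interval (ν := ν)] with z a b c
    rw [a, gammaSrc, b, gammaTime, NNReal.coe_mul, c, pow_zero, mul_one]
  have hint : Integrable (fun z : β × ℝ => Complex.exp (-lamP q * ((z.2 * s z.1 : ℝ) : ℂ)) * ft 1 z.1)
      (ν.prod ((volume : Measure ℝ).restrict (Ioc 0 1))) := by
    refine (Lp_int (expMul _ (gammaTime s) (lamP q) (gammaSrc ft 0))).congr ?_
    filter_upwards [expMul_coeFn (measurable_gammaTime M.meas_s) hl (gammaSrc ft 0),
      toL1_coeFn (gammaSrc_int ft 0), ae_unit_interval (ν := ν)] with z a b c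
    rw [a, gammaSrc, b, gammaTime, NNReal.coe_mul, c, pow_zero, mul_one]
  have hftc : ∀ S : ℝ, lamP q * ∫ u in Ioc (0 : ℝ) 1, Complex.exp (-lamP q * ((u * S : ℝ) : ℂ)) * S =
      1 - Complex.exp (-lamP q * (S : ℂ)) := by
    intro S
    rw [← intervalIntegral.integral_of_le zero_le_one, ← intervalIntegral.integral_const_mul]
    have hd : ∀ u ∈ uIcc (0 : ℝ) 1, HasDerivAt
        (fun u : ℝ => -Complex.exp (-lamP q * ((u * S : ℝ) : ℂ)))
        (lamP q * (Complex.exp (-lamP q * ((u * S : ℝ) : ℂ)) * S)) u := by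
      intro u _
      have a : HasDerivAt (fun u : ℝ => ((u * S : ℝ) : ℂ)) (S : ℂ) u := by
        have := (Complex.ofRealCLM.hasDerivAt (x := u)).mul_const (S : ℂ)
        simpa using this
      have b := (a.const_mul (-lamP q)).cexp.neg
      exact b.congr_deriv (by ring)
    rw [intervalIntegral.integral_eq_sub_of_hasDerivAt hd
      (Continuous.intervalIntegrable (by fun_prop) _ _)]
    simp; ring
  rw [h1, integral_prod _ hint]
  have h2 : intCLM ν (expMul ν s (lamP q) (ft 0)) = intCLM ν (expMul ν s (lamP q) (ft 0)) -
      intCLM ν (ft 0) := by rw [hf.mean, sub_zero]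
  rw [h2, ← map_sub, intCLM_apply, ← integral_const_mul, ← integral_neg]
  refine integral_congr_ae ?_
  filter_upwards [coeFn_sub_ae (expMul ν s (lamP q) (ft 0)) (ft 0), expMul_coeFn M.meas_s hl (ft 0),
    hf.tower 0 (by omega)] with x a b c
  rw [a, b]
  simp only [zero_add] at c
  have e : ∀ u : ℝ, Complex.exp (-lamP q * ((u * s x : ℝ) : ℂ)) * ft 1 x =
      (Complex.exp (-lamP q * ((u * s x : ℝ) : ℂ)) * ((s x : ℝ) : ℂ)) * ft 0 x := fun u => by
    rw [c]; ring
  simp only [e]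
  rw [integral_mul_const, ← mul_assoc, hftc]; ring

end TransportModel

/-! ### Solving (1 - K_λ)y = G_λ f up to the imaginary axis, including λ = 0. -/

variable {α β : Type*} [MeasurableSpace α] [MeasurableSpace β]

namespace TransportModel

variable {μ : Measure α} {ν : Measure β} [SigmaFinite μ] [SigmaFinite ν] {τ : α → ℝ≥0}
  {t s : β → ℝ≥0}
  {TK : ℕ → Lp ℂ 1 μ →L[ℂ] Lp ℂ 1 μ} {TS : ℕ → Lp ℂ 1 μ →L[ℂ] Lp ℂ 1 ν}
  {G : Lp ℂ 1 ν →L[ℂ] Lp ℂ 1 μ} {N p : ℕ}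

/-- The functional `J_λ ψ = ∫ exp (-λt) TS 0 ψ`. -/
abbrev Jp (ν : Measure β) (t : β → ℝ≥0) (TS : ℕ → Lp ℂ 1 μ →L[ℂ] Lp ℂ 1 ν) (q : ℝ × ℝ) :
    Lp ℂ 1 μ →L[ℂ] ℂ := fam (intCLM ν) t (TS 0) q

/-- The regularisation `1 - K_λ + φ ⊗ e` of `1 - K_λ`. -/
abbrev Bp (τ : α → ℝ≥0) (TK : ℕ → Lp ℂ 1 μ →L[ℂ] Lp ℂ 1 μ) (φ : Lp ℂ 1 μ) (q : ℝ × ℝ) :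
    Lp ℂ 1 μ →L[ℂ] Lp ℂ 1 μ := 1 - Kp τ TK q + rankOne (intCLM μ) φ

/-- The solution of `(1 - K_λ) y = G_λ f` near `λ = 0`. -/
def yLoc (ν : Measure β) (τ : α → ℝ≥0) (t s : β → ℝ≥0) (TK : ℕ → Lp ℂ 1 μ →L[ℂ] Lp ℂ 1 μ)
    (TS : ℕ → Lp ℂ 1 μ →L[ℂ] Lp ℂ 1 ν) (G : Lp ℂ 1 ν →L[ℂ] Lp ℂ 1 μ) (ft : ℕ → Lp ℂ 1 ν)
    (φ : Lp ℂ 1 μ) (q : ℝ × ℝ) : Lp ℂ 1 μ :=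
  Ring.inverse (Bp τ TK φ q) (gp G s ft q) +
    (-(gamP ν s ft q + Jp ν t TS q (Ring.inverse (Bp τ TK φ q) (gp G s ft q))) /
      Jp ν t TS q (Ring.inverse (Bp τ TK φ q) φ)) • Ring.inverse (Bp τ TK φ q) φ

open Classical in
/-- The solution of `(1 - K_λ) y = G_λ f`, extended to `λ = 0`. -/
def ySol (ν : Measure β) (τ : α → ℝ≥0) (t s : β → ℝ≥0) (TK : ℕ → Lp ℂ 1 μ →L[ℂ] Lp ℂ 1 μ)
    (TS : ℕ → Lp ℂ 1 μ →L[ℂ] Lp ℂ 1 ν) (G : Lp ℂ 1 ν →L[ℂ] Lp ℂ 1 μ) (ft : ℕ → Lp ℂ 1 ν)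
    (φ : Lp ℂ 1 μ) (q : ℝ × ℝ) : Lp ℂ 1 μ :=
  if q = 0 then yLoc ν τ t s TK TS G ft φ q else Ring.inverse (1 - Kp τ TK q) (gp G s ft q)

lemma lamP_zero : lamP 0 = 0 := by simp [lamP]

lemma lamP_ne_zero {q : ℝ × ℝ} (hq : q ≠ 0) : lamP q ≠ 0 := by
  intro h
  have h1 := lamP_re q
  have h2 := lamP_im q
  rw [h, Complex.zero_re] at h1
  rw [h, Complex.zero_im] at h2
  exact hq (Prod.ext (pow_eq_zero_iff two_ne_zero |>.1 h1.symm) h2.symm)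

lemma Kp_zero (M : TransportModel μ ν τ t s TK TS G N p) : Kp τ TK 0 = TK 0 := by
  rw [Kp_eq, lamP_zero, Kfam_zero M.meas_τ]

lemma contDiff_Kp (M : TransportModel μ ν τ t s TK TS G N p) : ContDiff ℝ N (Kp τ TK) :=
  contDiff_fam M.meas_τ M.towerK

lemma contDiffAt_ringInverse_apply {E : Type*} [NormedAddCommGroup E] [NormedSpace ℂ E]
    [NormedSpace ℝ E] [IsScalarTower ℝ ℂ E] [CompleteSpace E] {n : ℕ} {A : ℝ × ℝ → E →L[ℂ] E}
    {v : ℝ × ℝ → E} {q : ℝ × ℝ} (hA : ContDiffAt ℝ n A q) (hu : IsUnit (A q))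
    (hv : ContDiffAt ℝ n v q) : ContDiffAt ℝ n (fun q => Ring.inverse (A q) (v q)) q := by
  obtain ⟨u, hu⟩ := hu
  have h1 : ContDiffAt ℝ n (Ring.inverse : (E →L[ℂ] E) → _) (A q) := by
    rw [← hu]; exact (contDiffAt_ringInverse ℂ u).restrict_scalars ℝ
  exact contDiffAt_bilin (ContinuousLinearMap.id ℂ (E →L[ℂ] E)) (h1.comp q hA) hv

lemma isUnit_Bp_zero (M : TransportModel μ ν τ t s TK TS G N p) {φ : Lp ℂ 1 μ}
    (hfix : TK 0 φ = φ) (habs : absL φ = φ) (hφ1 : ‖φ‖ = 1) : IsUnit (Bp τ TK φ 0) := by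
  obtain ⟨C, hC, hKC⟩ := M.compact
  obtain ⟨c, hc, hgap⟩ := exists_gap M.markov hC hKC M.irreducible hfix habs hφ1
  have he : ‖intCLM μ‖ ≤ 1 := ContinuousLinearMap.opNorm_le_bound _ zero_le_one fun ψ => by
    rw [one_mul]; exact intCLM_norm_le ψ
  have heφ : intCLM μ φ = 1 := by
    have := intCLM_absL φ; rw [habs, hφ1] at this; simpa using this
  rw [Bp, M.Kp_zero]
  exact isUnit_one_sub_add_rankOne M.markov.norm_le he hφ1 heφ hfix M.markov.mass hc hgap

/-- J₀φ = ∫ τφ is the mean travel time of the invariant density, and τ is positive almost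
everywhere. -/
lemma Jp_zero_ne (M : TransportModel μ ν τ t s TK TS G N p) {φ : Lp ℂ 1 μ}
    (hfix : TK 0 φ = φ) (habs : absL φ = φ) (hφ1 : ‖φ‖ = 1) : Jp ν t TS 0 φ ≠ 0 := by
  have e : Jp ν t TS 0 φ = intCLM μ (TK 1 φ) := by
    rw [Jp, fam_apply, lamP_zero, expMul_zero M.meas_t]; exact M.mean_time φ
  have h1 : ∀ᵐ z ∂μ, TK 1 φ z = ((τ z * ‖φ z‖ : ℝ) : ℂ) := by
    filter_upwards [M.towerK 0 (by omega) φ, absL_eq_self_iff.1 habs] with z a b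
    rw [zero_add, hfix, b] at a
    rw [a]; push_cast; simp
  have h2 : intCLM μ (TK 1 φ) = ((∫ z, (τ z * ‖φ z‖ : ℝ) ∂μ : ℝ) : ℂ) := by
    rw [intCLM_apply, integral_congr_ae h1]; exact integral_complex_ofReal
  have hi : Integrable (fun z => (τ z * ‖φ z‖ : ℝ)) μ := by
    refine (Lp_int (TK 1 φ)).norm.congr ?_
    filter_upwards [h1] with z hz
    rw [hz, Complex.norm_real, Real.norm_of_nonneg (by positivity)]
  intro h0
  rw [e, h2, Complex.ofReal_eq_zero,
    integral_eq_zero_iff_of_nonneg (fun z => by simp only [Pi.zero_apply]; positivity) hi] at h0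
  have h3 : φ = 0 := by
    rw [Lp.eq_zero_iff_ae_eq_zero]
    filter_upwards [h0, M.τ_pos] with z a b
    have hb : ((τ z : ℝ≥0) : ℝ) ≠ 0 := by exact_mod_cast b.ne'
    have : ‖φ z‖ = 0 := (mul_eq_zero.1 a).resolve_left hb
    exact norm_eq_zero.1 this
  rw [h3, norm_zero] at hφ1
  exact zero_ne_one hφ1

lemma contDiffAt_yLoc (M : TransportModel μ ν τ t s TK TS G N p) {ft : ℕ → Lp ℂ 1 ν}
    (hf : Source s (N + 1) ft) {φ : Lp ℂ 1 μ} (hfix : TK 0 φ = φ) (habs : absL φ = φ)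
    (hφ1 : ‖φ‖ = 1) : ContDiffAt ℝ N (yLoc ν τ t s TK TS G ft φ) 0 := by
  have hB : ContDiffAt ℝ N (Bp τ TK φ) 0 :=
    ((contDiff_const.sub M.contDiff_Kp).add contDiff_const).contDiffAt
  have hu := M.isUnit_Bp_zero hfix habs hφ1
  have hg := contDiffAt_ringInverse_apply hB hu (M.contDiff_gp hf).contDiffAt
  have hφ := contDiffAt_ringInverse_apply hB hu (contDiffAt_const (c := φ))
  have hJg := contDiffAt_fam_apply (l := intCLM ν) M.meas_t M.towerS hg
  have hJφ := contDiffAt_fam_apply (l := intCLM ν) M.meas_t M.towerS hφ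
  have hγ : ContDiffAt ℝ N (gamP ν s ft) 0 :=
    (contDiff_fam_apply (measurable_gammaTime M.meas_s) (gammaSrc_source hf) contDiff_const).contDiffAt
  -- B₀ fixes φ, hence so does its inverse, and the denominator of the coefficient at λ = 0 is J₀φ.
  have hne : Jp ν t TS 0 (Ring.inverse (Bp τ TK φ 0) φ) ≠ 0 := by
    have e : Bp τ TK φ 0 φ = φ := by
      have heφ : intCLM μ φ = 1 := by
        have := intCLM_absL φ; rw [habs, hφ1] at this; simpa using this
      simp [Bp, M.Kp_zero, hfix, rankOne, heφ]
    have e2 : Ring.inverse (Bp τ TK φ 0) φ = φ := by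
      have h : Ring.inverse (Bp τ TK φ 0) (Bp τ TK φ 0 φ) = φ :=
        congrArg (fun A : Lp ℂ 1 μ →L[ℂ] Lp ℂ 1 μ => A φ) (Ring.inverse_mul_cancel _ hu)
      rwa [e] at h
    rw [e2]; exact M.Jp_zero_ne hfix habs hφ1
  have hc : ContDiffAt ℝ N (fun q =>
      -(gamP ν s ft q + Jp ν t TS q (Ring.inverse (Bp τ TK φ q) (gp G s ft q))) *
        (Jp ν t TS q (Ring.inverse (Bp τ TK φ q) φ))⁻¹) 0 :=
    (hγ.add hJg).neg.mul (hJφ.inv hne)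
  simp only [← div_eq_mul_inv] at hc
  exact hg.add (contDiffAt_bilin (ContinuousLinearMap.lsmul ℂ ℂ) hc hφ)

lemma ySol_solves_of_ne (M : TransportModel μ ν τ t s TK TS G N p) {ft : ℕ → Lp ℂ 1 ν}
    (φ : Lp ℂ 1 μ) {q : ℝ × ℝ} (hq : q ≠ 0) :
    ySol ν τ t s TK TS G ft φ q = Kp τ TK q (ySol ν τ t s TK TS G ft φ q) + gp G s ft q := by
  have hu := M.isUnit_one_sub hq
  have h : (1 - Kp τ TK q) (Ring.inverse (1 - Kp τ TK q) (gp G s ft q)) = gp G s ft q :=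
    congrArg (fun A : Lp ℂ 1 μ →L[ℂ] Lp ℂ 1 μ => A (gp G s ft q)) (Ring.mul_inverse_cancel _ hu)
  rw [ySol, if_neg hq]
  set y := Ring.inverse (1 - Kp τ TK q) (gp G s ft q)
  rw [← h]; simp

/-- For λ ≠ 0 the solution satisfies By = g + e(y)φ, so only the number e(y) is missing. Mass
balance gives λJ(y) = e(g) = -λγ; cancelling λ leaves J(y) = -γ, a linear equation for e(y) whose
solution is the coefficient in `yLoc`, with no singularity left. -/
lemma ySol_eventuallyEq (M : TransportModel μ ν τ t s TK TS G N p) {ft : ℕ → Lp ℂ 1 ν}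
    (hf : Source s (N + 1) ft) {φ : Lp ℂ 1 μ} (hfix : TK 0 φ = φ) (habs : absL φ = φ)
    (hφ1 : ‖φ‖ = 1) : ySol ν τ t s TK TS G ft φ =ᶠ[𝓝 0] yLoc ν τ t s TK TS G ft φ := by
  have hBc : ContinuousAt (Bp τ TK φ) 0 :=
    ((contDiff_const.sub M.contDiff_Kp).add contDiff_const).continuous.continuousAt
  have hu := M.isUnit_Bp_zero hfix habs hφ1
  have h1 : ∀ᶠ q in 𝓝 (0 : ℝ × ℝ), IsUnit (Bp τ TK φ q) :=
    hBc.eventually (Units.isOpen.mem_nhds hu)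
  have hne : Jp ν t TS 0 (Ring.inverse (Bp τ TK φ 0) φ) ≠ 0 := by
    have e : Bp τ TK φ 0 φ = φ := by
      have heφ : intCLM μ φ = 1 := by
        have := intCLM_absL φ; rw [habs, hφ1] at this; simpa using this
      simp [Bp, M.Kp_zero, hfix, rankOne, heφ]
    have e2 : Ring.inverse (Bp τ TK φ 0) φ = φ := by
      have h : Ring.inverse (Bp τ TK φ 0) (Bp τ TK φ 0 φ) = φ :=
        congrArg (fun A : Lp ℂ 1 μ →L[ℂ] Lp ℂ 1 μ => A φ) (Ring.inverse_mul_cancel _ hu)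
      rwa [e] at h
    rw [e2]; exact M.Jp_zero_ne hfix habs hφ1
  have hB : ContDiffAt ℝ N (Bp τ TK φ) 0 :=
    ((contDiff_const.sub M.contDiff_Kp).add contDiff_const).contDiffAt
  have hφ := contDiffAt_ringInverse_apply hB hu (contDiffAt_const (c := φ))
  have hJφ := contDiffAt_fam_apply (l := intCLM ν) M.meas_t M.towerS hφ
  have h2 : ∀ᶠ q in 𝓝 (0 : ℝ × ℝ), Jp ν t TS q (Ring.inverse (Bp τ TK φ q) φ) ≠ 0 :=
    hJφ.continuousAt.eventually_ne hne
  filter_upwards [h1, h2] with q hq1 hq2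
  by_cases hq : q = 0
  · rw [ySol, if_pos hq]
  have hsol := M.ySol_solves_of_ne (ft := ft) φ hq
  set y := ySol ν τ t s TK TS G ft φ q with hy
  have hBy : Bp τ TK φ q y = gp G s ft q + intCLM μ y • φ := by
    have : Bp τ TK φ q y = y - Kp τ TK q y + intCLM μ y • φ := by simp [Bp, rankOne]
    rw [this]
    congr 1
    exact sub_eq_of_eq_add' hsol
  have hy2 : y = Ring.inverse (Bp τ TK φ q) (gp G s ft q) +
      intCLM μ y • Ring.inverse (Bp τ TK φ q) φ := by
    rw [← map_smul, ← map_add, ← hBy]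
    exact (congrArg (fun A : Lp ℂ 1 μ →L[ℂ] Lp ℂ 1 μ => A y) (Ring.inverse_mul_cancel _ hq1)).symm
  have hJy : Jp ν t TS q y = -gamP ν s ft q := by
    have b := M.balance (lamP q) (lamP_re_nonneg q) y
    have b2 := mul_gamP M hf q
    have b3 : intCLM μ y - intCLM μ (Kfam (TK 0) τ (lamP q) y) = intCLM μ (gp G s ft q) := by
      rw [← map_sub]; congr 1
      exact sub_eq_of_eq_add' hsol
    rw [b3, b2, ← mul_neg] at b
    exact (mul_left_cancel₀ (lamP_ne_zero hq) b).symm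
  have hJ2 : Jp ν t TS q y = Jp ν t TS q (Ring.inverse (Bp τ TK φ q) (gp G s ft q)) +
      intCLM μ y * Jp ν t TS q (Ring.inverse (Bp τ TK φ q) φ) := by
    conv_lhs => rw [hy2]
    rw [map_add, map_smul, smul_eq_mul]
  have hc : intCLM μ y = -(gamP ν s ft q + Jp ν t TS q (Ring.inverse (Bp τ TK φ q) (gp G s ft q))) /
      Jp ν t TS q (Ring.inverse (Bp τ TK φ q) φ) := by
    rw [eq_div_iff hq2]
    rw [hJy] at hJ2
    linear_combination -hJ2
  rw [hc] at hy2
  exact hy2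

lemma contDiff_ySol (M : TransportModel μ ν τ t s TK TS G N p) {ft : ℕ → Lp ℂ 1 ν}
    (hf : Source s (N + 1) ft) {φ : Lp ℂ 1 μ} (hfix : TK 0 φ = φ) (habs : absL φ = φ)
    (hφ1 : ‖φ‖ = 1) : ContDiff ℝ N (ySol ν τ t s TK TS G ft φ) := by
  rw [contDiff_iff_contDiffAt]
  intro q
  by_cases hq : q = 0
  · rw [hq]
    exact (M.contDiffAt_yLoc hf hfix habs hφ1).congr_of_eventuallyEq
      (M.ySol_eventuallyEq hf hfix habs hφ1)
  · have h1 : ContDiffAt ℝ N (fun q => Ring.inverse (1 - Kp τ TK q) (gp G s ft q)) q :=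
      contDiffAt_ringInverse_apply (contDiff_const.sub M.contDiff_Kp).contDiffAt
        (M.isUnit_one_sub hq) (M.contDiff_gp hf).contDiffAt
    refine h1.congr_of_eventuallyEq ?_
    filter_upwards [isOpen_ne.mem_nhds hq] with x hx
    rw [ySol, if_neg hx]

/-- Both sides are continuous and agree off the origin, whose complement is dense. -/
lemma ySol_solves (M : TransportModel μ ν τ t s TK TS G N p) {ft : ℕ → Lp ℂ 1 ν}
    (hf : Source s (N + 1) ft) {φ : Lp ℂ 1 μ} (hfix : TK 0 φ = φ) (habs : absL φ = φ)
    (hφ1 : ‖φ‖ = 1) : ySol ν τ t s TK TS G ft φ =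
      (fun q => Kp τ TK q (ySol ν τ t s TK TS G ft φ q)) + gp G s ft := by
  have hy := (M.contDiff_ySol hf hfix habs hφ1)
  refine Continuous.ext_on (dense_compl_singleton (0 : ℝ × ℝ)) hy.continuous ?_
    fun q hq => M.ySol_solves_of_ne φ hq
  exact ((contDiff_fam_apply M.meas_τ (M.towerK.mono (Nat.le_succ N)) hy).add
    (M.contDiff_gp hf)).continuous

/-- Strong induction on the order. For the j-th derivative Y, differentiating y = K_λ y + g shows
that Y - K_λY consists of lower order terms and a derivative of g, all tending to 0; and ‖Y‖ ≤ p‖Y -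
K_λY‖ + ‖K_λᵖY‖ with ‖K_λᵖ‖ < 1/2 far out. -/
lemma tendsto_deta_ySol (M : TransportModel μ ν τ t s TK TS G N p) {ft : ℕ → Lp ℂ 1 ν}
    (hf : Source s (N + 1) ft) {φ : Lp ℂ 1 μ} (hfix : TK 0 φ = φ) (habs : absL φ = φ)
    (hφ1 : ‖φ‖ = 1) : ∀ j ≤ N, ∀ ε₀, Tendsto (deta^[j] (ySol ν τ t s TK TS G ft φ))
      (𝓝 ε₀ ×ˢ cocompact ℝ) (𝓝 0) := by
  intro j
  induction j using Nat.strong_induction_on with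
  | _ j ih =>
    intro hj ε₀
    set y := ySol ν τ t s TK TS G ft φ with hyd
    have hy : ContDiff ℝ N y := M.contDiff_ySol hf hfix habs hφ1
    have hT : IsTower τ N TK := M.towerK.mono (Nat.le_succ N)
    obtain ⟨C, hC, hb⟩ := deta_fam_bound (l := ContinuousLinearMap.id ℂ (Lp ℂ 1 μ)) M.meas_τ hT hy hj
    have hsum : Tendsto (fun q => C * ∑ i ∈ Finset.range j, ‖(deta^[i] y) q‖ + ‖(deta^[j] (gp G s ft)) q‖)
        (𝓝 ε₀ ×ˢ cocompact ℝ) (𝓝 0) := by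
      have h1 : Tendsto (fun q => ∑ i ∈ Finset.range j, ‖(deta^[i] y) q‖) (𝓝 ε₀ ×ˢ cocompact ℝ)
          (𝓝 (∑ i ∈ Finset.range j, 0)) := by
        refine tendsto_finsetSum _ fun i hi => ?_
        have hij := Finset.mem_range.1 hi
        have := (ih i hij (by omega) ε₀).norm
        rwa [norm_zero] at this
      have h2 := (M.tendsto_deta_gp hf j hj ε₀).norm
      rw [norm_zero] at h2
      simpa using (h1.const_mul C).add h2
    have heq : deta^[j] y = (deta^[j] fun q => Kp τ TK q (y q)) + deta^[j] (gp G s ft) := by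
      conv_lhs => rw [hyd, M.ySol_solves hf hfix habs hφ1]
      exact deta_iterate_add (contDiff_fam_apply M.meas_τ hT hy) (M.contDiff_gp hf) hj
    have h2 := hsum.const_mul (2 * p : ℝ)
    rw [mul_zero] at h2
    refine squeeze_zero_norm' ?_ h2
    filter_upwards [(M.tendsto_norm_Kp_pow ε₀).eventually (gt_mem_nhds (show (0 : ℝ) < 1 / 2 by norm_num))]
      with q hq
    set Y := (deta^[j] y) q with hY
    have e1 : ‖Y - Kp τ TK q Y‖ ≤
        C * ∑ i ∈ Finset.range j, ‖(deta^[i] y) q‖ + ‖(deta^[j] (gp G s ft)) q‖ := by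
      have : Y - Kp τ TK q Y = ((deta^[j] fun q => Kp τ TK q (y q)) q - Kp τ TK q Y) +
          (deta^[j] (gp G s ft)) q := by
        rw [hY, heq, Pi.add_apply]; abel
      rw [this]
      exact (norm_add_le _ _).trans (add_le_add (hb q) le_rfl)
    have e2 := norm_sub_pow_apply_le (M.norm_Kp_le q) p Y
    have e3 := (Kp τ TK q ^ p).le_of_opNorm_le hq.le Y
    have e4 := norm_sub_norm_le Y ((Kp τ TK q ^ p) Y)
    have e5 := mul_le_mul_of_nonneg_left e1 (Nat.cast_nonneg (α := ℝ) p)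
    have e6 : ‖Y‖ ≤ 2 * (p * (C * ∑ i ∈ Finset.range j, ‖(deta^[i] y) q‖ + ‖(deta^[j] (gp G s ft)) q‖)) := by
      linarith
    exact e6.trans (le_of_eq (by ring))

/-- The iterates `K_λⁿ y`. -/
lemma iterate_Kp (M : TransportModel μ ν τ t s TK TS G N p) {y : ℝ × ℝ → Lp ℂ 1 μ}
    (hy : ContDiff ℝ N y)
    (hd : ∀ j ≤ N, ∀ ε₀, Tendsto (deta^[j] y) (𝓝 ε₀ ×ˢ cocompact ℝ) (𝓝 0)) (n : ℕ) :
    ContDiff ℝ N (fun q => (Kp τ TK q ^ n) (y q)) ∧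
    ∀ j ≤ N, ∀ ε₀, Tendsto (deta^[j] fun q => (Kp τ TK q ^ n) (y q)) (𝓝 ε₀ ×ˢ cocompact ℝ) (𝓝 0) := by
  have hT : IsTower τ N TK := M.towerK.mono (Nat.le_succ N)
  induction n with
  | zero => exact ⟨hy, hd⟩
  | succ n ih =>
    have e : (fun q => (Kp τ TK q ^ (n + 1)) (y q)) = fun q => Kp τ TK q ((Kp τ TK q ^ n) (y q)) := by
      ext1 q; rw [pow_succ']; rfl
    rw [e]
    exact ⟨contDiff_fam_apply M.meas_τ hT ih.1, tendsto_deta_fam M.meas_τ hT ih.1 ih.2⟩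

lemma bddDeriv_Kp (M : TransportModel μ ν τ t s TK TS G N p) : BddDeriv N fun η => Kp τ TK (0, η) := by
  refine ⟨contDiff_slice M.contDiff_Kp 0, fun i hi => ⟨‖TK i‖, fun η => ?_⟩⟩
  rw [iteratedDeriv_slice M.contDiff_Kp 0 hi]
  have := deta_fam_op (l := ContinuousLinearMap.id ℂ (Lp ℂ 1 μ)) M.meas_τ M.towerK hi
  simp only [Kp]
  rw [this, Pi.smul_apply, norm_smul, norm_pow, norm_neg, Complex.norm_I, one_pow, one_mul]
  refine (norm_fam_le _ _).trans ?_
  exact mul_le_of_le_one_left (norm_nonneg _) ContinuousLinearMap.norm_id_le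

lemma bddDeriv_slice_of_tendsto {Z : Type*} [NormedAddCommGroup Z] [NormedSpace ℝ Z]
    {y : ℝ × ℝ → Z} (hy : ContDiff ℝ N y)
    (hd : ∀ j ≤ N, ∀ ε₀, Tendsto (deta^[j] y) (𝓝 ε₀ ×ˢ cocompact ℝ) (𝓝 0)) :
    BddDeriv N fun η => y (0, η) := by
  obtain ⟨h1, h2⟩ := memC0_slice hy hd 0
  refine ⟨h1, fun i hi => ?_⟩
  have hc := h1.continuous_iteratedDeriv i (by exact_mod_cast hi)
  have h3 := (h2 i hi).norm
  rw [norm_zero] at h3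
  obtain ⟨Kc, hKc, hK⟩ := mem_cocompact.1 (h3.eventually (gt_mem_nhds one_pos))
  obtain ⟨C, hC⟩ := hKc.exists_bound_of_continuousOn hc.continuousOn
  refine ⟨max C 1, fun η => ?_⟩
  by_cases hη : η ∈ Kc
  · exact (hC η hη).trans (le_max_left _ _)
  · exact (le_of_lt (hK hη)).trans (le_max_right _ _)

/-- Integrability of the derivatives of `K_{iη}ⁿ y` for large `n`. -/
lemma integrable_iterate_Kp (M : TransportModel μ ν τ t s TK TS G N p) {y : ℝ × ℝ → Lp ℂ 1 μ}
    (hy : ContDiff ℝ N y)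
    (hd : ∀ j ≤ N, ∀ ε₀, Tendsto (deta^[j] y) (𝓝 ε₀ ×ˢ cocompact ℝ) (𝓝 0)) {n : ℕ}
    (hn : 2 ^ N * p ≤ n) {i : ℕ} (hi : i ≤ N) :
    Integrable (iteratedDeriv i fun η => (Kp τ TK (0, η) ^ n) (y (0, η))) := by
  have hA := M.bddDeriv_Kp
  have hyb := bddDeriv_slice_of_tendsto hy hd
  have hm : Integrable fun η : ℝ => Kp τ TK (0, η) ^ p := by
    have := M.integrable_norm_pow le_rfl
    simpa [Kp_eq, lamP] using this
  have h1 := hA.integrable_pow hm N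
  generalize 2 ^ N * p = k at h1 hn
  obtain ⟨r, rfl⟩ := Nat.exists_eq_add_of_le hn
  have h2 : ∀ i ≤ N, Integrable (iteratedDeriv i fun η => Kp τ TK (0, η) ^ (k + r)) := by
    intro i hi
    have e : (fun η => Kp τ TK (0, η) ^ (k + r)) =
        fun η => compB (Lp ℂ 1 μ) (Kp τ TK (0, η) ^ k) (Kp τ TK (0, η) ^ r) := by
      ext1 η; rw [compB_apply, ← pow_add]
    rw [e]
    exact BddDeriv.integrable_bilin (compB (Lp ℂ 1 μ)) (hA.pow k) (hA.pow r) hi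
      fun l hl => Or.inl (h1 l (hl.trans hi) (hl.trans hi))
  exact BddDeriv.integrable_bilin (evalB (Lp ℂ 1 μ)) (hA.pow (k + r)) hyb hi
    fun l hl => Or.inl (h2 l (hl.trans hi))

/-- The Dyson series in the abstract setting. -/
abbrev series (τ : α → ℝ≥0) (t s : β → ℝ≥0) (TK : ℕ → Lp ℂ 1 μ →L[ℂ] Lp ℂ 1 μ)
    (TS : ℕ → Lp ℂ 1 μ →L[ℂ] Lp ℂ 1 ν) (G : Lp ℂ 1 ν →L[ℂ] Lp ℂ 1 μ) (f : Lp ℂ 1 ν) (lam : ℂ)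
    (j : ℕ) : Lp ℂ 1 ν :=
  expMul ν t lam (TS 0 ((Kfam (TK 0) τ lam ^ j) (G (expMul ν s lam f))))

lemma hasSum_series (M : TransportModel μ ν τ t s TK TS G N p) (f : Lp ℂ 1 ν) {lam : ℂ}
    (hl : 0 < lam.re) (n : ℕ) : HasSum (fun j => series τ t s TK TS G f lam (n + j))
      (expMul ν t lam (TS 0 ((Kfam (TK 0) τ lam ^ n)
        (Ring.inverse (1 - Kfam (TK 0) τ lam) (G (expMul ν s lam f)))))) := by
  obtain ⟨C, hC, hKC⟩ := M.compact
  have h := hasSum_pow_apply (norm_Kfam_le M.markov lam)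
    (norm_Kfam_sq_lt M.markov M.meas_τ M.τ_pos hC hKC hl) (G (expMul ν s lam f))
  have h2 := (((expMul ν t lam).comp (TS 0)).comp (Kfam (TK 0) τ lam ^ n)).hasSum h
  simpa only [Function.comp_def, ContinuousLinearMap.comp_apply, series, pow_add,
    mul_apply_eq_comp] using h2

/-- Summing the geometric series identifies the n-th tail with F = Ξ_λH K_λⁿ y at ε² + iη. As y
extends to ε = 0, F is Cᴺ on all of ℝ² with decaying η-derivatives, and Ψ is its restriction to ε =
0. Integrability of the derivatives of K_λⁿ y passes to F through the Leibniz bound. -/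
theorem main (M : TransportModel μ ν τ t s TK TS G N p) {ft : ℕ → Lp ℂ 1 ν}
    (hf : Source s (N + 1) ft) (n : ℕ) :
    (∀ lam : ℂ, 0 < lam.re → Summable fun j => series τ t s TK TS G (ft 0) lam (n + j)) ∧
    ∃ Ψ : ℝ → Lp ℂ 1 ν,
      TendstoInC0 N (fun ε η => ∑' j, series τ t s TK TS G (ft 0) (ε + η * Complex.I) (n + j)) Ψ ∧
      (2 ^ N * p ≤ n → ∀ j ≤ N, Integrable (iteratedDeriv j Ψ)) := by
  refine ⟨fun lam hl => (M.hasSum_series (ft 0) hl n).summable, ?_⟩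
  obtain ⟨C, hC, hKC⟩ := M.compact
  have := M.nontriv
  obtain ⟨φ, hfix, habs, hφ1⟩ := exists_invariant M.markov hC hKC
  set y := ySol ν τ t s TK TS G ft φ with hyd
  have hy : ContDiff ℝ N y := M.contDiff_ySol hf hfix habs hφ1
  have hd := M.tendsto_deta_ySol hf hfix habs hφ1
  obtain ⟨hw, hwd⟩ := M.iterate_Kp hy hd n
  set w := fun q => (Kp τ TK q ^ n) (y q) with hwdef
  let F : ℝ × ℝ → Lp ℂ 1 ν := fun q => fam (ContinuousLinearMap.id ℂ _) t (TS 0) q (w q)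
  have hF : ContDiff ℝ N F := contDiff_fam_apply M.meas_t M.towerS hw
  have hFd := tendsto_deta_fam (l := ContinuousLinearMap.id ℂ (Lp ℂ 1 ν)) M.meas_t M.towerS hw hwd
  refine ⟨fun η => F (0, η), tendstoInC0_of_tails hF hFd fun ε hε η => ?_, fun hn j hj => ?_⟩
  · have hl : 0 < ((ε : ℂ) + η * Complex.I).re := by simpa using hε
    have e : lamP (√ε, η) = (ε : ℂ) + η * Complex.I := by
      rw [lamP, Real.sq_sqrt hε.le]
    have hne : ((√ε, η) : ℝ × ℝ) ≠ 0 := by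
      intro h
      have : √ε = 0 := congrArg Prod.fst h
      exact (Real.sqrt_pos.2 hε).ne' this
    rw [(M.hasSum_series (ft 0) hl n).tsum_eq]
    have hs : srcT ft 0 1 = ft 0 := by simp [srcT]
    simp only [F, hwdef, hyd, fam_apply, ySol, if_neg hne, Kp_eq, e, hs]
    rfl
  · obtain ⟨C', -, hb⟩ := deta_fam_le (l := ContinuousLinearMap.id ℂ (Lp ℂ 1 ν)) M.meas_t M.towerS hw hj
    have hint : Integrable fun η : ℝ => C' * ∑ i ∈ Finset.range (j + 1), ‖(deta^[i] w) (0, η)‖ := by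
      refine (integrable_finsetSum _ fun i hi => ?_).const_mul _
      have hiN : i ≤ N := (Nat.lt_succ_iff.1 (Finset.mem_range.1 hi)).trans hj
      have := M.integrable_iterate_Kp hy hd hn hiN
      rw [show (fun η => (Kp τ TK (0, η) ^ n) (y (0, η))) = fun η => w (0, η) from rfl,
        iteratedDeriv_slice hw 0 hiN] at this
      exact this.norm
    refine hint.mono' ((contDiff_slice hF 0).continuous_iteratedDeriv j
      (by exact_mod_cast hj)).aestronglyMeasurable (Eventually.of_forall fun η => ?_)
    rw [iteratedDeriv_slice hF 0 hj]
    exact hb (0, η)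

end TransportModel

/-! ### Travel times and exit points. -/

section TravelTime

variable {d : ℕ} {Ω : Set (Vec d)} {x v : Vec d}

lemma tMinus_le {s : ℝ} (hs : 0 < s) (h : x - s • v ∉ Ω) : tMinus Ω x v ≤ ENNReal.ofReal s :=
  iInf_le_of_le s (iInf_le_of_le hs (iInf_le _ h))

lemma mem_of_lt_tMinus {s : ℝ} (hs : 0 < s) (h : ENNReal.ofReal s < tMinus Ω x v) :
    x - s • v ∈ Ω := by
  by_contra hn
  exact absurd (tMinus_le hs hn) (not_le.2 h)

lemma le_tMinus {c : ℝ≥0∞} (h : ∀ s : ℝ, 0 < s → ENNReal.ofReal s < c → x - s • v ∈ Ω) :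
    c ≤ tMinus Ω x v := by
  refine le_iInf fun s => le_iInf fun hs => le_iInf fun hn => ?_
  by_contra hc
  exact hn (h s hs (not_le.1 hc))

lemma tMinus_eq {s : ℝ} (hs : 0 < s) (h1 : ∀ r, 0 < r → r < s → x - r • v ∈ Ω)
    (h2 : x - s • v ∉ Ω) : tMinus Ω x v = ENNReal.ofReal s :=
  le_antisymm (tMinus_le hs h2) (le_tMinus fun r hr hrs =>
    h1 r hr ((ENNReal.ofReal_lt_ofReal_iff hs).1 hrs))

lemma mem_of_lt_toReal {s : ℝ} (hs : 0 < s) (h : s < (tMinus Ω x v).toReal) : x - s • v ∈ Ω := by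
  refine mem_of_lt_tMinus hs ?_
  by_cases ht : tMinus Ω x v = ∞
  · rw [ht]; exact ENNReal.ofReal_lt_top
  · exact (ENNReal.ofReal_lt_iff_lt_toReal hs.le ht).2 h

/-- The exit point does not belong to `Ω`. -/
lemma exitPoint_notMem (hΩ : IsOpen Ω) (h0 : 0 < tMinus Ω x v) (ht : tMinus Ω x v < ∞) :
    exitPoint Ω x v ∉ Ω := by
  intro hmem
  set T := (tMinus Ω x v).toReal with hT
  have hT0 : 0 < T := ENNReal.toReal_pos h0.ne' ht.ne
  have hc : ContinuousAt (fun s : ℝ => x - s • v) T := by fun_prop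
  have h1 : ∀ᶠ s in 𝓝 T, x - s • v ∈ Ω := hc.eventually (hΩ.mem_nhds hmem)
  obtain ⟨r, hr, hb⟩ := Metric.eventually_nhds_iff.1 h1
  have h2 : ENNReal.ofReal (T + r) ≤ tMinus Ω x v := by
    refine le_tMinus fun s hs hsr => ?_
    have hsr' : s < T + r := (ENNReal.ofReal_lt_ofReal_iff (by linarith)).1 hsr
    rcases lt_or_ge s T with h | h
    · exact mem_of_lt_toReal hs h
    · exact hb (by rw [Real.dist_eq, abs_of_nonneg] <;> linarith)
  rw [ENNReal.ofReal_le_iff_le_toReal ht.ne] at h2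
  linarith

lemma tMinus_pos_of_mem (hΩ : IsOpen Ω) (hx : x ∈ Ω) : 0 < tMinus Ω x v := by
  have hc : ContinuousAt (fun s : ℝ => x - s • v) 0 := by fun_prop
  have h1 : ∀ᶠ s in 𝓝 (0 : ℝ), x - s • v ∈ Ω := hc.eventually (hΩ.mem_nhds (by simpa using hx))
  obtain ⟨r, hr, hb⟩ := Metric.eventually_nhds_iff.1 h1
  refine lt_of_lt_of_le (ENNReal.ofReal_pos.2 hr) (le_tMinus fun s hs hsr => hb ?_)
  rw [Real.dist_eq, sub_zero, abs_of_pos hs]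
  exact (ENNReal.ofReal_lt_ofReal_iff hr).1 hsr

/-- In a bounded domain the travel time is at most `diam / |v|`. -/
lemma exists_tMinus_le (hb : Bornology.IsBounded Ω) :
    ∃ D : ℝ≥0, ∀ x ∈ closure Ω, ∀ v : Vec d, v ≠ 0 → tMinus Ω x v ≤ ENNReal.ofReal (D * ‖v‖⁻¹) := by
  have hd : (0 : ℝ) < Metric.diam (closure Ω) + 1 := by positivity
  refine ⟨Real.toNNReal (Metric.diam (closure Ω) + 1), fun x hx v hv => ?_⟩
  have hn : 0 < ‖v‖ := norm_pos_iff.2 hv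
  rw [Real.coe_toNNReal _ hd.le]
  refine tMinus_le (by positivity) fun hmem => ?_
  have h1 := Metric.dist_le_diam_of_mem hb.closure hx (subset_closure hmem)
  rw [dist_eq_norm, sub_sub_cancel, norm_smul, Real.norm_of_nonneg (by positivity),
    mul_assoc, inv_mul_cancel₀ hn.ne', mul_one] at h1
  linarith

lemma tMinus_lt_top (hb : Bornology.IsBounded Ω) (hx : x ∈ closure Ω) (hv : v ≠ 0) :
    tMinus Ω x v < ∞ := by
  obtain ⟨D, hD⟩ := exists_tMinus_le hb
  exact (hD x hx v hv).trans_lt ENNReal.ofReal_lt_top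

lemma exitPoint_mem_frontier (hΩ : IsOpen Ω) (h0 : 0 < tMinus Ω x v) (ht : tMinus Ω x v < ∞) :
    exitPoint Ω x v ∈ frontier Ω := by
  rw [hΩ.frontier_eq]
  refine ⟨?_, exitPoint_notMem hΩ h0 ht⟩
  set T := (tMinus Ω x v).toReal with hT
  have hT0 : 0 < T := ENNReal.toReal_pos h0.ne' ht.ne
  have hc : Tendsto (fun s : ℝ => x - s • v) (𝓝[<] T) (𝓝 (x - T • v)) := by
    have : ContinuousAt (fun s : ℝ => x - s • v) T := by fun_prop
    exact this.tendsto.mono_left nhdsWithin_le_nhds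
  refine mem_closure_of_tendsto hc ?_
  filter_upwards [Ioo_mem_nhdsLT hT0] with s hs
  exact mem_of_lt_toReal hs.1 hs.2

/-- Moving backwards along the trajectory. -/
lemma tMinus_sub (hΩ : IsOpen Ω) (ht : tMinus Ω x v < ∞) {s : ℝ} (hs : 0 < s)
    (hst : s < (tMinus Ω x v).toReal) :
    tMinus Ω (x - s • v) v = ENNReal.ofReal ((tMinus Ω x v).toReal - s) := by
  have h0 : 0 < tMinus Ω x v := (ENNReal.toReal_pos_iff.1 (hs.trans hst)).1
  refine tMinus_eq (by linarith) (fun r hr hrs => ?_) ?_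
  · rw [sub_sub, ← add_smul]
    exact mem_of_lt_toReal (by linarith) (by linarith)
  · rw [sub_sub, ← add_smul, add_sub_cancel]
    exact exitPoint_notMem hΩ h0 ht

lemma exitPoint_sub (hΩ : IsOpen Ω) (ht : tMinus Ω x v < ∞) {s : ℝ} (hs : 0 < s)
    (hst : s < (tMinus Ω x v).toReal) : exitPoint Ω (x - s • v) v = exitPoint Ω x v := by
  rw [exitPoint, tMinus_sub hΩ ht hs hst, ENNReal.toReal_ofReal (by linarith), sub_sub, ← add_smul,
    add_sub_cancel]; rfl

/-- The forward travel time of a point on the backward trajectory of `x ∉ Ω`. -/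
lemma tMinus_neg_sub (hx : x ∉ Ω) {s : ℝ} (hs : 0 < s) (hst : s < (tMinus Ω x v).toReal) :
    tMinus Ω (x - s • v) (-v) = ENNReal.ofReal s := by
  refine tMinus_eq hs (fun r hr hrs => ?_) ?_
  · have e : x - s • v - r • -v = x - (s - r) • v := by rw [sub_smul]; module
    rw [e]
    exact mem_of_lt_toReal (by linarith) (by linarith)
  · have e : x - s • v - s • -v = x := by module
    rwa [e]

/-- Exit and re-entry: the travel time back from the exit point. -/
lemma tMinus_neg_exitPoint (hx : x ∉ Ω) (h0 : 0 < tMinus Ω x v) (ht : tMinus Ω x v < ∞) :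
    tMinus Ω (exitPoint Ω x v) (-v) = tMinus Ω x v := by
  set T := (tMinus Ω x v).toReal with hT
  have hT0 : 0 < T := ENNReal.toReal_pos h0.ne' ht.ne
  rw [← ENNReal.ofReal_toReal ht.ne]
  refine tMinus_eq hT0 (fun r hr hrs => ?_) ?_
  · have e : exitPoint Ω x v - r • -v = x - (T - r) • v := by rw [exitPoint, sub_smul]; module
    rw [e]
    exact mem_of_lt_toReal (by linarith) (by linarith)
  · have e : exitPoint Ω x v - T • -v = x := by rw [exitPoint]; module
    rwa [e]

/-- The travel time is at least c exactly when, for each n, the trajectory stays in Ω on a compact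
time interval exhausting (0, c); by compactness each of these conditions is open in (x, v). -/
lemma measurable_tMinus (hΩ : IsOpen Ω) :
    Measurable fun z : Vec d × Vec d => tMinus Ω z.1 z.2 := by
  refine measurable_of_Ici fun c => ?_
  rcases eq_or_ne c ∞ with rfl | hc
  · have e : (fun z : Vec d × Vec d => tMinus Ω z.1 z.2) ⁻¹' Ici ∞ =
        ⋂ n : ℕ, {z | ∀ s ∈ Icc (1 / (n + 1) : ℝ) n, z.1 - s • z.2 ∈ Ω} := by
      ext z
      simp only [mem_preimage, mem_Ici, mem_iInter, mem_ofPred_eq]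
      constructor
      · intro h n s hs
        refine mem_of_lt_tMinus (lt_of_lt_of_le (by positivity) hs.1) ?_
        exact lt_of_lt_of_le ENNReal.ofReal_lt_top h
      · intro h
        refine le_tMinus fun s hs _ => ?_
        obtain ⟨n, hn⟩ := exists_nat_one_div_lt hs
        obtain ⟨k, hk⟩ := exists_nat_ge s
        refine h (max n k) s ⟨?_, hk.trans (by exact_mod_cast le_max_right n k)⟩
        refine le_trans (one_div_le_one_div_of_le (by positivity) ?_) hn.le
        have : (n : ℝ) ≤ (max n k : ℕ) := by exact_mod_cast le_max_left n k
        linarith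
    rw [e]
    refine MeasurableSet.iInter fun n => IsOpen.measurableSet ?_
    rw [isOpen_iff_mem_nhds]
    intro z hz
    refine isCompact_Icc.eventually_forall_of_forall_eventually
      (P := fun (z : Vec d × Vec d) (s : ℝ) => z.1 - s • z.2 ∈ Ω) fun s hs => ?_
    have hcont : Continuous fun y : (Vec d × Vec d) × ℝ => y.1.1 - y.2 • y.1.2 := by fun_prop
    exact hcont.continuousAt.eventually (hΩ.mem_nhds (hz s hs))
  · have e : (fun z : Vec d × Vec d => tMinus Ω z.1 z.2) ⁻¹' Ici c =
        ⋂ n : ℕ, {z | ∀ s ∈ Icc (1 / (n + 1) : ℝ) (c.toReal - 1 / (n + 1)), z.1 - s • z.2 ∈ Ω} := by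
      ext z
      simp only [mem_preimage, mem_Ici, mem_iInter, mem_ofPred_eq]
      constructor
      · intro h n s hs
        have hp : (0 : ℝ) < 1 / (n + 1) := by positivity
        have hs0 : 0 < s := lt_of_lt_of_le hp hs.1
        refine mem_of_lt_tMinus hs0 (lt_of_lt_of_le ?_ h)
        rw [ENNReal.ofReal_lt_iff_lt_toReal hs0.le hc]
        linarith [hs.2]
      · intro h
        refine le_tMinus fun s hs hsc => ?_
        rw [ENNReal.ofReal_lt_iff_lt_toReal hs.le hc] at hsc
        obtain ⟨n, hn⟩ := exists_nat_one_div_lt (lt_min hs (sub_pos.2 hsc))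
        have h1 := hn.trans_le (min_le_left _ _)
        have h2 := hn.trans_le (min_le_right _ _)
        exact h n s ⟨h1.le, by linarith⟩
    rw [e]
    refine MeasurableSet.iInter fun n => IsOpen.measurableSet ?_
    rw [isOpen_iff_mem_nhds]
    intro z hz
    refine isCompact_Icc.eventually_forall_of_forall_eventually
      (P := fun (z : Vec d × Vec d) (s : ℝ) => z.1 - s • z.2 ∈ Ω) fun s hs => ?_
    have hcont : Continuous fun y : (Vec d × Vec d) × ℝ => y.1.1 - y.2 • y.1.2 := by fun_prop
    exact hcont.continuousAt.eventually (hΩ.mem_nhds (hz s hs))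

lemma measurable_exitPoint (hΩ : IsOpen Ω) :
    Measurable fun z : Vec d × Vec d => (exitPoint Ω z.1 z.2, z.2) :=
  (measurable_fst.sub ((measurable_tMinus hΩ).ennreal_toReal.smul measurable_snd)).prodMk measurable_snd

end TravelTime

/-! ### The outward normal and transversality at the boundary. -/

section Normal

variable {d : ℕ} {Ω : Set (Vec d)} {x : Vec d}

/-- The unit vector in direction of the gradient. -/
abbrev unitGrad (ρ : Vec d → ℝ) (x : Vec d) : Vec d := ‖gradient ρ x‖⁻¹ • gradient ρ x

lemma norm_unitGrad {ρ : Vec d → ℝ} (h : gradient ρ x ≠ 0) : ‖unitGrad ρ x‖ = 1 := by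
  rw [unitGrad, norm_smul, norm_inv, norm_norm, inv_mul_cancel₀ (norm_ne_zero_iff.2 h)]

lemma exists_outwardNormal_eq (hC : HasC1Boundary Ω) (hx : x ∈ frontier Ω) :
    ∃ ρ, IsDefiningFunctionAt Ω x ρ ∧ outwardNormal Ω x = unitGrad ρ x := by
  have h : x ∈ frontier Ω ∧ ∃ ρ, IsDefiningFunctionAt Ω x ρ := ⟨hx, hC x hx⟩
  exact ⟨h.2.choose, h.2.choose_spec, by rw [outwardNormal, dif_pos h]⟩

lemma norm_outwardNormal (hC : HasC1Boundary Ω) (hx : x ∈ frontier Ω) : ‖outwardNormal Ω x‖ = 1 := by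
  obtain ⟨ρ, h, e⟩ := exists_outwardNormal_eq hC hx
  rw [e, norm_unitGrad h.2.1]

lemma IsDefiningFunctionAt.eventually_zero {ρ : Vec d → ℝ} (hΩ : IsOpen Ω)
    (h : IsDefiningFunctionAt Ω x ρ) : ∀ᶠ y in 𝓝 x, y ∈ frontier Ω → ρ y = 0 := by
  have hc : ∀ᶠ y in 𝓝 x, ContinuousAt ρ y :=
    (h.1.eventually (by simp)).mono fun y hy => hy.continuousAt
  filter_upwards [hc, h.2.2.eventually_nhds] with y hy1 hy2 hy
  rw [hΩ.frontier_eq] at hy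
  refine le_antisymm ?_ ?_
  · have hfr : ∃ᶠ z in 𝓝 y, z ∈ Ω := mem_closure_iff_frequently.1 hy.1
    refine le_of_not_gt fun hpos => ?_
    obtain ⟨z, hz1, hz2, hz3⟩ := (hfr.and_eventually (hy2.and (hy1.eventually (lt_mem_nhds hpos)))).exists
    exact lt_asymm (hz2.1 hz1) hz3
  · exact not_lt.1 fun hneg => hy.2 (hy2.self_of_nhds.2 hneg)

lemma IsDefiningFunctionAt.hasGradientAt {ρ : Vec d → ℝ} (h : IsDefiningFunctionAt Ω x ρ) :
    HasGradientAt ρ (gradient ρ x) x :=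
  (h.1.differentiableAt one_ne_zero).hasGradientAt

/-- The derivative of a defining function along a line. -/
lemma IsDefiningFunctionAt.hasDerivAt_line {ρ : Vec d → ℝ} (h : IsDefiningFunctionAt Ω x ρ)
    (w : Vec d) : HasDerivAt (fun s : ℝ => ρ (x + s • w)) (inner ℝ (gradient ρ x) w) 0 := by
  have h1 : HasDerivAt (fun s : ℝ => x + s • w) w 0 := by
    simpa using ((hasDerivAt_id (0 : ℝ)).smul_const w).const_add x
  have h2 : HasFDerivAt ρ (InnerProductSpace.toDual ℝ (Vec d) (gradient ρ x)) (x + (0 : ℝ) • w) := by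
    simpa using h.hasGradientAt.hasFDerivAt
  exact (h2.comp_hasDerivAt (0 : ℝ) h1).congr_deriv (InnerProductSpace.toDual_apply_apply ..)

lemma IsDefiningFunctionAt.eventually_line {ρ : Vec d → ℝ} (hΩ : IsOpen Ω)
    (h : IsDefiningFunctionAt Ω x ρ) (hx : x ∈ frontier Ω) {w : Vec d} :
    (inner ℝ (gradient ρ x) w < 0 → ∀ᶠ s in 𝓝[>] (0 : ℝ), x + s • w ∈ Ω) ∧
    (0 < inner ℝ (gradient ρ x) w → ∀ᶠ s in 𝓝[>] (0 : ℝ), x + s • w ∉ Ω) := by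
  have h0 : ρ x = 0 := (h.eventually_zero hΩ).self_of_nhds hx
  have hc : Tendsto (fun s : ℝ => x + s • w) (𝓝[>] 0) (𝓝 x) := by
    have : ContinuousAt (fun s : ℝ => x + s • w) 0 := by fun_prop
    have h1 := this.tendsto.mono_left (nhdsWithin_le_nhds (s := Ioi (0 : ℝ)))
    simpa using h1
  have hmem := hc.eventually h.2.2
  have hsl := (hasDerivAt_iff_tendsto_slope.1 (h.hasDerivAt_line w)).mono_left
    (nhdsWithin_mono (0 : ℝ) (fun s (hs : 0 < s) => hs.ne' : Ioi (0 : ℝ) ⊆ {0}ᶜ))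
  have e : ∀ s : ℝ, slope (fun s : ℝ => ρ (x + s • w)) 0 s = s⁻¹ * ρ (x + s • w) := fun s => by
    simp [slope_def_field, h0, div_eq_inv_mul]
  constructor
  · intro hneg
    filter_upwards [hmem, hsl.eventually (gt_mem_nhds hneg), self_mem_nhdsWithin] with s h1 h2 h3
    rw [e] at h2
    refine h1.2 ?_
    by_contra hge
    exact absurd h2 (not_lt.2 (mul_nonneg (inv_nonneg.2 (le_of_lt h3)) (not_lt.1 hge)))
  · intro hpos
    filter_upwards [hmem, hsl.eventually (lt_mem_nhds hpos), self_mem_nhdsWithin] with s h1 h2 h3 h4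
    rw [e] at h2
    exact absurd h2 (not_lt.2 (mul_nonpos_of_nonneg_of_nonpos (inv_nonneg.2 (le_of_lt h3)) (h1.1 h4).le))

/-- The unit normal does not depend on the defining function. -/
lemma IsDefiningFunctionAt.unitGrad_eq {ρ σ : Vec d → ℝ} (hΩ : IsOpen Ω)
    (hρ : IsDefiningFunctionAt Ω x ρ) (hσ : IsDefiningFunctionAt Ω x σ) (hx : x ∈ frontier Ω) :
    unitGrad ρ x = unitGrad σ x := by
  by_contra hne
  set a := unitGrad ρ x with ha
  set b := unitGrad σ x with hb
  have na : ‖a‖ = 1 := norm_unitGrad hρ.2.1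
  have nb : ‖b‖ = 1 := norm_unitGrad hσ.2.1
  have hlt : inner ℝ a b < 1 := (inner_lt_one_iff_real_of_norm_eq_one na nb).2 hne
  have pa : 0 < ‖gradient ρ x‖ := norm_pos_iff.2 hρ.2.1
  have pb : 0 < ‖gradient σ x‖ := norm_pos_iff.2 hσ.2.1
  have ga : gradient ρ x = ‖gradient ρ x‖ • a := by rw [ha, unitGrad, smul_inv_smul₀ pa.ne']
  have gb : gradient σ x = ‖gradient σ x‖ • b := by rw [hb, unitGrad, smul_inv_smul₀ pb.ne']
  -- If the unit gradients a and b differed, the direction b - a would point into Ω according to ρ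
  -- and out of Ω according to σ.
  have h1 : inner ℝ (gradient ρ x) (b - a) < 0 := by
    rw [ga, real_inner_smul_left, inner_sub_right, real_inner_self_eq_norm_sq, na]
    nlinarith
  have h2 : 0 < inner ℝ (gradient σ x) (b - a) := by
    rw [gb, real_inner_smul_left, inner_sub_right, real_inner_self_eq_norm_sq, nb,
      real_inner_comm]
    nlinarith
  obtain ⟨s, h3, h4⟩ := (((hρ.eventually_line hΩ hx).1 h1).and ((hσ.eventually_line hΩ hx).2 h2)).exists
  exact h4 h3

lemma outwardNormal_eq (hΩ : IsOpen Ω) (hC : HasC1Boundary Ω) {ρ : Vec d → ℝ}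
    (hρ : IsDefiningFunctionAt Ω x ρ) (hx : x ∈ frontier Ω) : outwardNormal Ω x = unitGrad ρ x := by
  obtain ⟨σ, hσ, e⟩ := exists_outwardNormal_eq hC hx
  rw [e, hσ.unitGrad_eq hΩ hρ hx]

/-- A defining function at x also serves at nearby boundary points, and by uniqueness of the normal
its normalised gradient computes `outwardNormal` there. -/
lemma continuousOn_outwardNormal (hΩ : IsOpen Ω) (hC : HasC1Boundary Ω) :
    ContinuousOn (outwardNormal Ω) (frontier Ω) := by
  intro x hx
  obtain ⟨ρ, hρ⟩ := hC x hx
  have hg : ContinuousAt (gradient ρ) x := by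
    have h1 : ContinuousAt (fderiv ℝ ρ) x := (hρ.1.fderiv_right (m := 0) (by simp)).continuousAt
    exact (InnerProductSpace.toDual ℝ (Vec d)).symm.continuous.continuousAt.comp h1
  have hu : ContinuousAt (unitGrad ρ) x :=
    (hg.norm.inv₀ (norm_ne_zero_iff.2 hρ.2.1)).smul hg
  refine (hu.continuousWithinAt (s := frontier Ω)).congr_of_eventuallyEq ?_
    (outwardNormal_eq hΩ hC hρ hx)
  rw [eventuallyEq_nhdsWithin_iff]
  filter_upwards [hρ.1.eventually (by simp), hg.eventually_ne hρ.2.1, hρ.2.2.eventually_nhds]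
    with y h1 h2 h3 hy
  exact outwardNormal_eq hΩ hC ⟨h1, h2, h3⟩ hy

lemma outwardNormal_of_notMem (hx : x ∉ frontier Ω) : outwardNormal Ω x = 0 := by
  rw [outwardNormal, dif_neg fun h => hx h.1]

lemma measurable_outwardNormal (hΩ : IsOpen Ω) (hC : HasC1Boundary Ω) :
    Measurable (outwardNormal Ω) := by
  classical
  have hm : MeasurableSet (frontier Ω) := isClosed_frontier.measurableSet
  have e : outwardNormal Ω = (frontier Ω).indicator (outwardNormal Ω) := by
    ext1 x
    by_cases hx : x ∈ frontier Ω
    · rw [indicator_of_mem hx]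
    · rw [indicator_of_notMem hx, outwardNormal_of_notMem hx]
  rw [e, ← Set.piecewise_eq_indicator]
  exact (continuousOn_outwardNormal hΩ hC).measurable_piecewise continuousOn_const hm

lemma measurable_normalVelocity (hΩ : IsOpen Ω) (hC : HasC1Boundary Ω) :
    Measurable fun z : Vec d × Vec d => normalVelocity Ω z.1 z.2 :=
  measurable_snd.inner ((measurable_outwardNormal hΩ hC).comp measurable_fst)

/-- Near a boundary point the boundary is almost orthogonal to the normal. -/
lemma exists_nhds_inner_normal_le (hΩ : IsOpen Ω) (hC : HasC1Boundary Ω) (hx : x ∈ frontier Ω)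
    {δ : ℝ} (hδ : 0 < δ) : ∃ U ∈ 𝓝 x, ∀ a ∈ frontier Ω ∩ U, ∀ b ∈ frontier Ω ∩ U,
      |inner ℝ (a - b) (outwardNormal Ω x)| ≤ δ * ‖a - b‖ := by
  obtain ⟨ρ, hρ, e⟩ := exists_outwardNormal_eq hC hx
  have pg : 0 < ‖gradient ρ x‖ := norm_pos_iff.2 hρ.2.1
  -- Strict differentiability compares two arbitrary points near x; ρ vanishes at both boundary
  -- points, so only the linear term remains.
  have hs : HasStrictFDerivAt ρ (InnerProductSpace.toDual ℝ (Vec d) (gradient ρ x)) x := by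
    have h1 := hρ.1.hasStrictFDerivAt one_ne_zero
    have h2 := hρ.hasGradientAt.hasFDerivAt
    rwa [h1.hasFDerivAt.unique h2] at h1
  have h1 := hs.isLittleO.def (show 0 < δ * ‖gradient ρ x‖ by positivity)
  rw [nhds_prod_eq] at h1
  obtain ⟨U₁, hU₁, hU⟩ := mem_prod_self_iff.1 h1
  refine ⟨U₁ ∩ {y | y ∈ frontier Ω → ρ y = 0}, inter_mem hU₁ (hρ.eventually_zero hΩ),
    fun a ha b hb => ?_⟩
  have h2 : ‖ρ a - ρ b - InnerProductSpace.toDual ℝ (Vec d) (gradient ρ x) (a - b)‖ ≤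
      δ * ‖gradient ρ x‖ * ‖a - b‖ := hU (mk_mem_prod ha.2.1 hb.2.1)
  rw [ha.2.2 ha.1, hb.2.2 hb.1, sub_self, zero_sub, norm_neg, InnerProductSpace.toDual_apply_apply,
    Real.norm_eq_abs] at h2
  rw [e, unitGrad, real_inner_smul_right, abs_mul, abs_of_nonneg (by positivity), real_inner_comm,
    inv_mul_le_iff₀ pg]
  linarith

/-- Transversality: trajectories enter or leave `Ω` according to the sign of the normal velocity. -/
lemma eventually_sub_smul (hΩ : IsOpen Ω) (hC : HasC1Boundary Ω) (hx : x ∈ frontier Ω) {v : Vec d} :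
    (0 < normalVelocity Ω x v → ∀ᶠ s in 𝓝[>] (0 : ℝ), x - s • v ∈ Ω) ∧
    (normalVelocity Ω x v < 0 → ∀ᶠ s in 𝓝[>] (0 : ℝ), x - s • v ∉ Ω) := by
  obtain ⟨ρ, hρ, e⟩ := exists_outwardNormal_eq hC hx
  have pg : 0 < ‖gradient ρ x‖ := norm_pos_iff.2 hρ.2.1
  have h := hρ.eventually_line hΩ hx (w := -v)
  have e1 : inner ℝ (gradient ρ x) (-v) = -(‖gradient ρ x‖ * normalVelocity Ω x v) := by
    rw [normalVelocity, e, unitGrad, real_inner_smul_right, inner_neg_right, real_inner_comm v,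
      mul_inv_cancel_left₀ pg.ne']
  simp only [smul_neg, ← sub_eq_add_neg] at h
  rw [e1] at h
  exact ⟨fun hp => h.1 (neg_neg_iff_pos.2 (mul_pos pg hp)),
    fun hn => h.2 (neg_pos.2 (mul_neg_of_pos_of_neg pg hn))⟩

lemma tMinus_pos_of_normalVelocity_pos (hΩ : IsOpen Ω) (hC : HasC1Boundary Ω) (hx : x ∈ frontier Ω)
    {v : Vec d} (hv : 0 < normalVelocity Ω x v) : 0 < tMinus Ω x v := by
  have h := (eventually_sub_smul hΩ hC hx).1 hv
  obtain ⟨r, hr, hb⟩ := mem_nhdsGT_iff_exists_Ioo_subset.1 h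
  refine lt_of_lt_of_le (ENNReal.ofReal_pos.2 hr) (le_tMinus fun s hs hsr => hb ⟨hs, ?_⟩)
  exact (ENNReal.ofReal_lt_ofReal_iff hr).1 hsr

end Normal

/-! ### Hausdorff measure under bi-Lipschitz maps. -/

section BiLipschitz

variable {X Y : Type*} [EMetricSpace X] [EMetricSpace Y] [MeasurableSpace X] [BorelSpace X]
  [MeasurableSpace Y] [BorelSpace Y]

lemma euclideanHausdorffMeasure_image_le {K : ℝ≥0} {f : X → Y} {S : Set X}
    (h : LipschitzOnWith K f S) (k : ℕ) :
    (μHE[k] : Measure Y) (f '' S) ≤ (K : ℝ≥0∞) ^ k * (μHE[k] : Measure X) S := by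
  have h1 := h.hausdorffMeasure_image_le (d := k) (Nat.cast_nonneg k)
  rw [ENNReal.rpow_natCast] at h1
  simp_rw [Measure.euclideanHausdorffMeasure_def, Measure.smul_apply, ENNReal.smul_def, smul_eq_mul]
  rw [mul_left_comm]
  gcongr

lemma euclideanHausdorffMeasure_le_image {K : ℝ≥0} {f : X → Y} {S : Set X}
    (h : ∀ a ∈ S, ∀ b ∈ S, edist a b ≤ K * edist (f a) (f b)) (k : ℕ) :
    (μHE[k] : Measure X) S ≤ (K : ℝ≥0∞) ^ k * (μHE[k] : Measure Y) (f '' S) := by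
  rcases S.eq_empty_or_nonempty with rfl | ⟨x₀, hx₀⟩
  · simp
  have : Nonempty X := ⟨x₀⟩
  have hinj : InjOn f S := fun a ha b hb hab => by
    have := h a ha b hb
    rwa [hab, edist_self, mul_zero, nonpos_iff_eq_zero, edist_eq_zero] at this
  have hl : LipschitzOnWith K (Function.invFunOn f S) (f '' S) := by
    rintro _ ⟨a, ha, rfl⟩ _ ⟨b, hb, rfl⟩
    rw [hinj.leftInvOn_invFunOn ha, hinj.leftInvOn_invFunOn hb]
    exact h a ha b hb
  have h1 := euclideanHausdorffMeasure_image_le hl k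
  rwa [hinj.leftInvOn_invFunOn.image_image] at h1

end BiLipschitz

/-! ### Almost flat sets, slicing of Lebesgue measure, and the shear. -/

section Flattening

variable {d : ℕ}

/-- The orthogonal projection to the hyperplane orthogonal to the unit vector `n`. -/
def flatten (n a : Vec d) : Vec d := a - inner ℝ a n • n

lemma flatten_sub (n a b : Vec d) : flatten n (a - b) = flatten n a - flatten n b := by
  simp only [flatten, inner_sub_left, sub_smul]; abel

lemma inner_flatten {n : Vec d} (hn : ‖n‖ = 1) (a : Vec d) : inner ℝ (flatten n a) n = 0 := by
  rw [flatten, inner_sub_left, real_inner_smul_left, real_inner_self_eq_norm_sq, hn]; ring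

lemma norm_flatten_le {n : Vec d} (hn : ‖n‖ = 1) (a : Vec d) : ‖flatten n a‖ ≤ ‖a‖ := by
  have h : ‖flatten n a‖ ^ 2 + (inner ℝ a n) ^ 2 = ‖a‖ ^ 2 := by
    have e : a = flatten n a + inner ℝ a n • n := by rw [flatten, sub_add_cancel]
    conv_rhs => rw [e]
    rw [norm_add_sq_real, real_inner_smul_right, inner_flatten hn, norm_smul, hn, Real.norm_eq_abs]
    rw [mul_one, sq_abs]; ring
  exact le_of_sq_le_sq (by nlinarith [sq_nonneg (inner ℝ a n)]) (norm_nonneg _)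

lemma le_norm_flatten {n : Vec d} (hn : ‖n‖ = 1) {a : Vec d} {δ : ℝ}
    (h : |inner ℝ a n| ≤ δ * ‖a‖) : (1 - δ) * ‖a‖ ≤ ‖flatten n a‖ := by
  have h1 : ‖a‖ - ‖inner ℝ a n • n‖ ≤ ‖flatten n a‖ := norm_sub_norm_le _ _
  rw [norm_smul, hn, mul_one, Real.norm_eq_abs] at h1
  linarith

/-- The set obtained from `C ⊆ ℝᵈ × ℝ` by flattening the first component to the hyperplane
orthogonal to `n`, and using the second component as the normal coordinate. -/
def flatProd (n : Vec d) (z : Vec d × ℝ) : Vec d := flatten n z.1 + z.2 • n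

lemma continuous_flatProd (n : Vec d) : Continuous (flatProd n) := by
  unfold flatProd flatten; fun_prop

lemma inner_flatProd {n : Vec d} (hn : ‖n‖ = 1) (z : Vec d × ℝ) : inner ℝ (flatProd n z) n = z.2 := by
  rw [flatProd, inner_add_left, inner_flatten hn, real_inner_smul_left, real_inner_self_eq_norm_sq,
    hn]; ring

lemma flatten_flatProd {n : Vec d} (hn : ‖n‖ = 1) (z : Vec d × ℝ) :
    flatten n (flatProd n z) = flatten n z.1 := by
  rw [flatten, inner_flatProd hn, flatProd, add_sub_cancel_right]

/-- `A` is almost flat, with normal vector `n`. -/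
def AlmostFlat (n : Vec d) (δ : ℝ) (A : Set (Vec d)) : Prop :=
  ∀ a ∈ A, ∀ b ∈ A, |inner ℝ (a - b) n| ≤ δ * ‖a - b‖

lemma AlmostFlat.norm_sub_le {n : Vec d} (hn : ‖n‖ = 1) {δ : ℝ} (hδ : δ < 1) {A : Set (Vec d)}
    (hA : AlmostFlat n δ A) {a b : Vec d} (ha : a ∈ A) (hb : b ∈ A) :
    ‖a - b‖ ≤ (1 - δ)⁻¹ * ‖flatten n (a - b)‖ := by
  rw [le_inv_mul_iff₀ (by linarith)]
  exact le_norm_flatten hn (hA a ha b hb)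

lemma AlmostFlat.injOn {n : Vec d} (hn : ‖n‖ = 1) {δ : ℝ} (hδ : δ < 1) {A : Set (Vec d)}
    (hA : AlmostFlat n δ A) : InjOn (flatProd n) (A ×ˢ univ) := by
  intro z hz w hw h
  have h1 : z.2 = w.2 := by rw [← inner_flatProd hn z, h, inner_flatProd hn]
  have h2 : flatten n (z.1 - w.1) = 0 := by
    rw [flatten_sub, ← flatten_flatProd hn z, h, flatten_flatProd hn, sub_self]
  have h3 := hA.norm_sub_le hn hδ hz.1 hw.1
  rw [h2, norm_zero, mul_zero] at h3
  exact Prod.ext (sub_eq_zero.1 (norm_le_zero_iff.1 h3)) h1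

/-- Slicing of Lebesgue measure by hyperplanes orthogonal to a unit vector. -/
lemma volume_eq_lintegral_slice {n : Vec d} (hn : ‖n‖ = 1) {B : Set (Vec d)} (hB : MeasurableSet B) :
    volume B = ∫⁻ s : ℝ, (μHE[d - 1] : Measure (Vec d)) (B ∩ {y | inner ℝ y n = s}) := by
  have h := EuclideanGeometry.euclideanHausdorffMeasure_eq_lintegral (0 : Vec d)
    (v := n) (by rw [← norm_ne_zero_iff, hn]; exact one_ne_zero) hB
  rw [finrank_euclideanSpace_fin, EuclideanSpace.euclideanHausdorffMeasure_eq_volume,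
    ← ofReal_norm, hn, ENNReal.ofReal_one, one_mul] at h
  rw [h]
  refine lintegral_congr fun s => ?_
  congr 2
  ext y
  rw [SetLike.mem_coe, AffineSubspace.mem_mk', Submodule.mem_orthogonal_singleton_iff_inner_left,
    vsub_eq_sub, vadd_eq_add, add_zero, inner_sub_left, real_inner_smul_left,
    real_inner_self_eq_norm_sq, hn, mem_ofPred_eq]
  constructor <;> intro h <;> linarith

lemma slice_flatProd {n : Vec d} (hn : ‖n‖ = 1) (C : Set (Vec d × ℝ)) (s : ℝ) :
    flatProd n '' C ∩ {y | inner ℝ y n = s} =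
      (fun a => flatProd n (a, s)) '' ((fun a => (a, s)) ⁻¹' C) := by
  ext y
  constructor
  · rintro ⟨⟨z, hz, rfl⟩, h⟩
    rw [mem_ofPred_eq, inner_flatProd hn] at h
    subst h
    exact ⟨z.1, hz, rfl⟩
  · rintro ⟨a, ha, rfl⟩
    exact ⟨⟨_, ha, rfl⟩, inner_flatProd hn _⟩

lemma flatProd_sub_flatProd (n a b : Vec d) (s : ℝ) :
    flatProd n (a, s) - flatProd n (b, s) = flatten n (a - b) := by
  rw [flatProd, flatProd, flatten_sub]; abel

lemma slice_flatProd_le {n : Vec d} (hn : ‖n‖ = 1) (S : Set (Vec d)) (s : ℝ) (k : ℕ) :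
    (μHE[k] : Measure (Vec d)) ((fun a => flatProd n (a, s)) '' S) ≤
      (μHE[k] : Measure (Vec d)) S := by
  have h : LipschitzOnWith 1 (fun a => flatProd n (a, s)) S := by
    refine LipschitzOnWith.of_dist_le_mul fun a _ b _ => ?_
    rw [NNReal.coe_one, one_mul, dist_eq_norm, dist_eq_norm, flatProd_sub_flatProd]
    exact norm_flatten_le hn _
  simpa using euclideanHausdorffMeasure_image_le h k

lemma AlmostFlat.le_slice_flatProd {n : Vec d} (hn : ‖n‖ = 1) {δ : ℝ≥0} (hδ : δ < 1)
    {A : Set (Vec d)} (hA : AlmostFlat n δ A) {S : Set (Vec d)} (hS : S ⊆ A) (s : ℝ) (k : ℕ) :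
    (μHE[k] : Measure (Vec d)) S ≤
      (((1 - δ)⁻¹ : ℝ≥0) : ℝ≥0∞) ^ k * (μHE[k] : Measure (Vec d)) ((fun a => flatProd n (a, s)) '' S) := by
  refine euclideanHausdorffMeasure_le_image (fun a ha b hb => ?_) k
  rw [edist_nndist, edist_nndist, ← ENNReal.coe_mul, ENNReal.coe_le_coe, ← NNReal.coe_le_coe,
    NNReal.coe_mul, NNReal.coe_inv, NNReal.coe_sub hδ.le, coe_nndist, coe_nndist, dist_eq_norm,
    dist_eq_norm, flatProd_sub_flatProd, NNReal.coe_one]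
  exact hA.norm_sub_le hn (by exact_mod_cast hδ) (hS ha) (hS hb)

variable {π : Measure (Vec d)} [SFinite π]

/-- Flattening does not increase the product measure. -/
lemma volume_flatProd_le {n : Vec d} (hn : ‖n‖ = 1) {C : Set (Vec d × ℝ)}
    (hC : MeasurableSet C) (hm : MeasurableSet (flatProd n '' C))
    (hπ : ∀ s, π ((fun a => (a, s)) ⁻¹' C) = (μHE[d - 1] : Measure (Vec d)) ((fun a => (a, s)) ⁻¹' C)) :
    volume (flatProd n '' C) ≤ (π.prod volume) C := by
  rw [volume_eq_lintegral_slice hn hm, Measure.prod_apply_symm hC]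
  refine lintegral_mono fun s => ?_
  rw [slice_flatProd hn, hπ]
  exact slice_flatProd_le hn _ _ _

lemma AlmostFlat.le_volume_flatProd {n : Vec d} (hn : ‖n‖ = 1) {δ : ℝ≥0} (hδ : δ < 1)
    {A : Set (Vec d)} (hA : AlmostFlat n δ A) {C : Set (Vec d × ℝ)} (hCA : C ⊆ A ×ˢ univ)
    (hC : MeasurableSet C) (hm : MeasurableSet (flatProd n '' C))
    (hπ : ∀ s, π ((fun a => (a, s)) ⁻¹' C) = (μHE[d - 1] : Measure (Vec d)) ((fun a => (a, s)) ⁻¹' C)) :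
    (π.prod volume) C ≤ (((1 - δ)⁻¹ : ℝ≥0) : ℝ≥0∞) ^ (d - 1) * volume (flatProd n '' C) := by
  rw [volume_eq_lintegral_slice hn hm, Measure.prod_apply_symm hC, ← lintegral_const_mul' _ _ (by finiteness)]
  refine lintegral_mono fun s => ?_
  simp only
  rw [slice_flatProd hn, hπ]
  exact hA.le_slice_flatProd hn hδ (fun a ha => (hCA ha).1) s _

/-- The linear map which fixes the hyperplane orthogonal to `n` and maps `n` to `-v`. -/
def shear (n v : Vec d) : Vec d →L[ℝ] Vec d :=
  ContinuousLinearMap.id ℝ _ - (innerSL ℝ n).smulRight (n + v)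

lemma shear_apply (n v y : Vec d) : shear n v y = y - inner ℝ n y • (n + v) := rfl

/-- The shear is a transvection, with determinant 1 - ⟨n, n + v⟩ = -⟨v, n⟩; this is the origin of
the Jacobian |v·n(x)|. -/
lemma det_shear {n : Vec d} (hn : ‖n‖ = 1) (v : Vec d) : (shear n v).det = -inner ℝ v n := by
  have e : ((shear n v : Vec d →L[ℝ] Vec d) : Vec d →ₗ[ℝ] Vec d) =
      LinearMap.transvection (-(innerSL ℝ n : Vec d →L[ℝ] ℝ) : Vec d →ₗ[ℝ] ℝ) (n + v) := by
    ext1 y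
    simp [shear_apply, LinearMap.transvection.apply, sub_eq_add_neg, add_comm]
  rw [ContinuousLinearMap.det, e, LinearMap.transvection.det]
  simp only [LinearMap.neg_apply, ContinuousLinearMap.coe_coe, innerSL_apply_apply, inner_add_right,
    real_inner_self_eq_norm_sq, hn, real_inner_comm]
  ring

/-- On an almost flat set, transport along `v` is close to a linear map in flat coordinates. -/
lemma AlmostFlat.approximatesLinearOn {n : Vec d} (hn : ‖n‖ = 1) {δ : ℝ≥0} (hδ : δ < 1)
    {A : Set (Vec d)} (hA : AlmostFlat n δ A) (v : Vec d) {C : Set (Vec d × ℝ)}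
    (hCA : C ⊆ A ×ˢ univ) :
    ∃ Θ : Vec d → Vec d, ApproximatesLinearOn Θ (shear n v) (flatProd n '' C) (δ * (1 - δ)⁻¹) ∧
      Θ '' (flatProd n '' C) = (fun z : Vec d × ℝ => z.1 - z.2 • v) '' C := by
  have hδ' : (δ : ℝ) < 1 := by exact_mod_cast hδ
  have hinj : InjOn (flatProd n) C := (hA.injOn hn hδ').mono hCA
  have hli := hinj.leftInvOn_invFunOn
  refine ⟨fun y => (fun z : Vec d × ℝ => z.1 - z.2 • v) (Function.invFunOn (flatProd n) C y), ?_, ?_⟩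
  · rintro _ ⟨z, hz, rfl⟩ _ ⟨w, hw, rfl⟩
    simp only [hli hz, hli hw]
    have h1 : inner ℝ n (flatProd n z - flatProd n w) = z.2 - w.2 := by
      rw [real_inner_comm, inner_sub_left, inner_flatProd hn, inner_flatProd hn]
    -- Transport and shear differ exactly by the normal displacement of the base points, which
    -- almost flatness bounds.
    have h2 : z.1 - z.2 • v - (w.1 - w.2 • v) - shear n v (flatProd n z - flatProd n w) =
        inner ℝ (z.1 - w.1) n • n := by
      rw [shear_apply, h1, flatProd, flatProd]
      simp only [flatten, inner_sub_left]
      module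
    have h3 : flatten n (z.1 - w.1) = flatten n (flatProd n z - flatProd n w) := by
      rw [flatten_sub, flatten_sub, flatten_flatProd hn, flatten_flatProd hn]
    rw [h2, norm_smul, hn, mul_one, Real.norm_eq_abs, NNReal.coe_mul, NNReal.coe_inv,
      NNReal.coe_sub hδ.le, NNReal.coe_one, mul_assoc]
    refine (hA _ (hCA hz).1 _ (hCA hw).1).trans ?_
    refine mul_le_mul_of_nonneg_left ?_ δ.2
    refine (hA.norm_sub_le hn hδ' (hCA hz).1 (hCA hw).1).trans ?_
    refine mul_le_mul_of_nonneg_left ?_ (inv_nonneg.2 (by linarith))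
    rw [h3]
    exact norm_flatten_le hn _
  · rw [← image_image (fun z : Vec d × ℝ => z.1 - z.2 • v), hli.image_image]

end Flattening

/-! ### Finiteness of the surface measure. -/

section SurfaceMeasure

variable {d : ℕ} {Ω : Set (Vec d)}

/-- The translates of the disc by sn with 0 ≤ s ≤ 1 are slices of a slightly larger ball, whose
volume is finite. -/
lemma euclideanHausdorffMeasure_slice_lt_top {n : Vec d} (hn : ‖n‖ = 1) (R : ℝ) :
    (μHE[d - 1] : Measure (Vec d)) (Metric.closedBall 0 R ∩ {y | inner ℝ y n = 0}) < ∞ := by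
  set S : Set (Vec d) := Metric.closedBall 0 R ∩ {y | inner ℝ y n = 0} with hS
  have h1 := volume_eq_lintegral_slice hn (Metric.isClosed_closedBall (x := (0 : Vec d))
    (ε := R + 1)).measurableSet
  have h2 : volume (Metric.closedBall (0 : Vec d) (R + 1)) < ∞ :=
    Metric.isBounded_closedBall.measure_lt_top
  have h3 : ∫⁻ s in Icc (0 : ℝ) 1, (μHE[d - 1] : Measure (Vec d)) S ≤
      volume (Metric.closedBall (0 : Vec d) (R + 1)) := by
    rw [h1]
    refine (setLIntegral_mono' measurableSet_Icc fun s hs => ?_).trans (setLIntegral_le_lintegral _ _)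
    have hi : Isometry fun y : Vec d => y + s • n := isometry_add_right (s • n)
    rw [← hi.euclideanHausdorffMeasure_image]
    refine measure_mono ?_
    rintro _ ⟨y, hy, rfl⟩
    refine ⟨?_, ?_⟩
    · rw [mem_closedBall_zero_iff]
      refine (norm_add_le _ _).trans (add_le_add (mem_closedBall_zero_iff.1 hy.1) ?_)
      rw [norm_smul, hn, mul_one, Real.norm_of_nonneg hs.1]
      exact hs.2
    · have := hy.2
      rw [mem_ofPred_eq] at this
      rw [mem_ofPred_eq, inner_add_left, real_inner_smul_left, real_inner_self_eq_norm_sq, hn, this]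
      ring
  rw [setLIntegral_const, Real.volume_Icc, sub_zero, ENNReal.ofReal_one, mul_one] at h3
  exact h3.trans_lt h2

/-- By compactness it suffices to treat small boundary pieces; these are almost flat, so orthogonal
projection to a bounded part of a hyperplane distorts their measure by a bounded factor only. -/
lemma isFiniteMeasure_surface (hΩ : IsOpen Ω) (hb : Bornology.IsBounded Ω) (hC : HasC1Boundary Ω) :
    IsFiniteMeasure ((μHE[d - 1] : Measure (Vec d)).restrict (frontier Ω)) := by
  have hcomp : IsCompact (frontier Ω) :=
    Metric.isCompact_of_isClosed_isBounded isClosed_frontier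
      (hb.closure.subset frontier_subset_closure)
  rw [isFiniteMeasure_restrict]
  refine (lt_top_iff_ne_top.1 ?_)
  have key : (μHE[d - 1] : Measure (Vec d)) (frontier Ω ∩ frontier Ω) < ∞ := by
    refine hcomp.induction_on (p := fun S => (μHE[d - 1] : Measure (Vec d)) (frontier Ω ∩ S) < ∞)
      (by simp) (fun s t hst ht => (measure_mono (inter_subset_inter_right _ hst)).trans_lt ht)
      (fun s t hs ht => ?_) (fun x hx => ?_)
    · rw [inter_union_distrib_left]
      exact (measure_union_le _ _).trans_lt (ENNReal.add_lt_top.2 ⟨hs, ht⟩)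
    · obtain ⟨U, hU, h⟩ := exists_nhds_inner_normal_le hΩ hC hx (show (0 : ℝ) < ((1 / 2 : ℝ≥0) : ℝ) by
        norm_num)
      have hn := norm_outwardNormal hC hx
      set n := outwardNormal Ω x
      have hA : AlmostFlat n ((1 / 2 : ℝ≥0) : ℝ) (frontier Ω ∩ (U ∩ Metric.closedBall 0 (‖x‖ + 1))) :=
        fun a ha b hb => h a ⟨ha.1, ha.2.1⟩ b ⟨hb.1, hb.2.1⟩
      refine ⟨U ∩ Metric.closedBall 0 (‖x‖ + 1), mem_nhdsWithin_of_mem_nhds (inter_mem hU ?_), ?_⟩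
      · refine Filter.mem_of_superset (Metric.ball_mem_nhds x one_pos) fun y hy => ?_
        rw [mem_closedBall_zero_iff]
        have := norm_le_norm_add_norm_sub' y x
        rw [Metric.mem_ball, dist_eq_norm] at hy
        linarith
      · refine (hA.le_slice_flatProd hn (by rw [← NNReal.coe_lt_coe]; norm_num) subset_rfl 0 (d - 1)).trans_lt
          (ENNReal.mul_lt_top (by finiteness) ?_)
        refine (measure_mono ?_).trans_lt (euclideanHausdorffMeasure_slice_lt_top hn (‖x‖ + 1))
        rintro _ ⟨a, ha, rfl⟩
        refine ⟨?_, inner_flatProd hn _⟩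
        simp only [mem_closedBall_zero_iff, flatProd, zero_smul, add_zero]
        exact (norm_flatten_le hn a).trans (mem_closedBall_zero_iff.1 ha.2.2)
  rwa [inter_self] at key

end SurfaceMeasure

/-! ### The change of variables near a boundary point. -/

section LocalTransport

variable {d : ℕ} {Ω : Set (Vec d)}

/-- The surface measure on `∂Ω`. -/
abbrev surface (Ω : Set (Vec d)) : Measure (Vec d) := (μHE[d - 1] : Measure (Vec d)).restrict (frontier Ω)

/-- Transport of the point `x` along `-v` during the time `s`. -/
abbrev transport (v : Vec d) (z : Vec d × ℝ) : Vec d := z.1 - z.2 • v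

lemma surface_slice {C : Set (Vec d × ℝ)} (hCf : C ⊆ frontier Ω ×ˢ univ) (s : ℝ) :
    surface Ω ((fun a => (a, s)) ⁻¹' C) = (μHE[d - 1] : Measure (Vec d)) ((fun a => (a, s)) ⁻¹' C) :=
  Measure.restrict_eq_self _ fun _ ha => (hCf ha).1

/-- In flat coordinates transport is a small perturbation of the shear, so it multiplies volumes by
nearly h₀ = |v·n(x)|. Flattening costs a factor (1 - δ)^(d-1) at most, and |v·n| varies by less than
ε/2 near x. -/
lemma exists_nhds_volume_transport (hΩ : IsOpen Ω) (hb : Bornology.IsBounded Ω) (hC : HasC1Boundary Ω)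
    {x : Vec d} (hx : x ∈ frontier Ω) (v : Vec d) {ε : ℝ≥0} (hε : 0 < ε) :
    ∃ U ∈ 𝓝 x, IsOpen U ∧ ∀ C : Set (Vec d × ℝ), MeasurableSet C → C ⊆ (frontier Ω ∩ U) ×ˢ univ →
      volume (transport v '' C) ≤ ∫⁻ z in C, ENNReal.ofReal |normalVelocity Ω z.1 v| ∂((surface Ω).prod volume)
        + ε * ((surface Ω).prod volume) C ∧
      ∫⁻ z in C, ENNReal.ofReal |normalVelocity Ω z.1 v| ∂((surface Ω).prod volume) ≤
        volume (transport v '' C) + ε * ((surface Ω).prod volume) C := by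
  have := isFiniteMeasure_surface hΩ hb hC
  have hn := norm_outwardNormal hC hx
  set n := outwardNormal Ω x with hn_def
  set h₀ : ℝ≥0 := ‖inner ℝ v n‖₊ with hh₀
  have hdet : ENNReal.ofReal |(shear n v).det| = h₀ := by
    rw [det_shear hn, abs_neg, ← Real.norm_eq_abs, ofReal_norm]; rfl
  set m₁ : ℝ≥0 := h₀ - ε / 4 with hm₁
  set m₂ : ℝ≥0 := h₀ + ε / 2 with hm₂
  have h4 : 0 < ε / 4 := by positivity
  obtain ⟨δ₂, hδ₂, hδ₂0⟩ := ((addHaar_image_le_mul_of_det_lt volume (shear n v) (m := m₂)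
    (by rw [hdet, ENNReal.coe_lt_coe]; exact lt_add_of_pos_right _ (by positivity))).and
      self_mem_nhdsWithin).exists
  obtain ⟨δ₁, hδ₁, hδ₁0⟩ : ∃ δ₁ : ℝ≥0, (∀ (s : Set (Vec d)) (f : Vec d → Vec d),
      ApproximatesLinearOn f (shear n v) s δ₁ → (m₁ : ℝ≥0∞) * volume s ≤ volume (f '' s)) ∧ 0 < δ₁ := by
    -- For a grazing velocity the shear is singular, but then m₁ = 0 and the lower bound is void.
    rcases eq_or_ne h₀ 0 with h0 | h0
    · refine ⟨1, fun s f _ => ?_, one_pos⟩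
      rw [hm₁, h0, zero_tsub, ENNReal.coe_zero, zero_mul]
      exact zero_le
    · obtain ⟨δ₁, h, h'⟩ := ((mul_le_addHaar_image_of_lt_det volume (shear n v) (m := m₁)
        (by rw [hdet, ENNReal.coe_lt_coe]; exact tsub_lt_self (pos_iff_ne_zero.2 h0) h4)).and
          self_mem_nhdsWithin).exists
      exact ⟨δ₁, h, h'⟩
  have hev : ∀ᶠ δ : ℝ≥0 in 𝓝[>] 0, h₀ < m₁ * (1 - δ) ^ (d - 1) + ε / 2 := by
    have hc : Continuous fun δ : ℝ≥0 => m₁ * (1 - δ) ^ (d - 1) + ε / 2 := by fun_prop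
    have := hc.tendsto 0
    refine (this.mono_left nhdsWithin_le_nhds).eventually (lt_mem_nhds ?_)
    rw [tsub_zero, one_pow, mul_one, hm₁]
    have h2 : ε / 4 < ε / 2 := by
      rw [← NNReal.coe_lt_coe]; push_cast
      have : (0 : ℝ) < ε := hε
      linarith
    exact lt_of_le_of_lt le_tsub_add (add_lt_add_right h2 _)
  have hmin : (0 : ℝ≥0) < min (1 / 2) (min (δ₁ / 2) (δ₂ / 2)) := by
    have : 0 < δ₂ := hδ₂0
    positivity
  obtain ⟨δ, hδ, hδs, hδ0⟩ := (hev.and (((gt_mem_nhds hmin).filter_mono nhdsWithin_le_nhds).and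
    self_mem_nhdsWithin)).exists
  have hδh : δ < 1 / 2 := hδs.trans_le (min_le_left _ _)
  have hδ1 : δ < 1 := hδh.trans (by rw [← NNReal.coe_lt_coe]; norm_num)
  have hq : ∀ δ' : ℝ≥0, δ < δ' / 2 → δ * (1 - δ)⁻¹ ≤ δ' := fun δ' h => by
    rw [← div_eq_mul_inv, div_le_iff₀ (tsub_pos_of_lt hδ1), ← NNReal.coe_le_coe, NNReal.coe_mul,
      NNReal.coe_sub hδ1.le, NNReal.coe_one]
    have a1 : (δ : ℝ) < 1 / 2 := by exact_mod_cast hδh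
    have a2 : (δ : ℝ) < δ' / 2 := by exact_mod_cast h
    nlinarith [δ'.2]
  have hq₁ := hq δ₁ (hδs.trans_le ((min_le_right _ _).trans (min_le_left _ _)))
  have hq₂ := hq δ₂ (hδs.trans_le ((min_le_right _ _).trans (min_le_right _ _)))
  obtain ⟨U₁, hU₁, hflat⟩ := exists_nhds_inner_normal_le hΩ hC hx (δ := δ) hδ0
  have hcont : ContinuousOn (fun y => normalVelocity Ω y v) (frontier Ω) :=
    continuousOn_const.inner (continuousOn_outwardNormal hΩ hC)
  have hε2 : (0 : ℝ) < ε / 2 := by positivity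
  obtain ⟨U₂, hU₂, hnear⟩ := mem_nhdsWithin_iff_exists_mem_nhds_inter.1
    (hcont x hx (Metric.ball_mem_nhds _ hε2))
  obtain ⟨U, hUs, hUo, hxU⟩ := mem_nhds_iff.1 (inter_mem hU₁ hU₂)
  refine ⟨U, hUo.mem_nhds hxU, hUo, fun C hCm hCA => ?_⟩
  have hCf : C ⊆ frontier Ω ×ˢ univ := hCA.trans (prod_mono inter_subset_left subset_rfl)
  have hA : AlmostFlat n δ (frontier Ω ∩ U) := fun a ha b hb =>
    hflat a ⟨ha.1, (hUs ha.2).1⟩ b ⟨hb.1, (hUs hb.2).1⟩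
  have hδ1' : (δ : ℝ) < 1 := by exact_mod_cast hδ1
  have hm : MeasurableSet (flatProd n '' C) :=
    hCm.image_of_continuousOn_injOn (continuous_flatProd n).continuousOn ((hA.injOn hn hδ1').mono hCA)
  obtain ⟨Θ, hΘ, hΘi⟩ := hA.approximatesLinearOn hn hδ1 v hCA
  have hup := hδ₂ _ _ (hΘ.mono_num hq₂)
  have hlo := hδ₁ _ _ (hΘ.mono_num hq₁)
  rw [hΘi] at hup hlo
  have hvq := volume_flatProd_le (π := surface Ω) hn hCm hm (surface_slice hCf)
  have hvq' := hA.le_volume_flatProd (π := surface Ω) hn hδ1 hCA hCm hm (surface_slice hCf)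
  set M := ((surface Ω).prod volume) C with hM
  have hbound : ∀ z ∈ C, (h₀ : ℝ≥0∞) ≤ ENNReal.ofReal |normalVelocity Ω z.1 v| + (ε / 2 : ℝ≥0) ∧
      ENNReal.ofReal |normalVelocity Ω z.1 v| ≤ h₀ + (ε / 2 : ℝ≥0) := by
    intro z hz
    have h1 : |normalVelocity Ω z.1 v - inner ℝ v n| < ε / 2 := by
      have := hnear ⟨(hUs (hCA hz).1.2).2, (hCA hz).1.1⟩
      rwa [mem_preimage, Metric.mem_ball, Real.dist_eq] at this
    have e : ENNReal.ofReal |normalVelocity Ω z.1 v| = (‖normalVelocity Ω z.1 v‖₊ : ℝ≥0∞) := by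
      rw [← Real.norm_eq_abs, ofReal_norm]; rfl
    rw [e, ← ENNReal.coe_add, ← ENNReal.coe_add, ENNReal.coe_le_coe, ENNReal.coe_le_coe,
      ← NNReal.coe_le_coe, ← NNReal.coe_le_coe, NNReal.coe_add, NNReal.coe_add, hh₀, coe_nnnorm,
      coe_nnnorm, Real.norm_eq_abs, Real.norm_eq_abs]
    push_cast
    have h2 := abs_sub_abs_le_abs_sub (normalVelocity Ω z.1 v) (inner ℝ v n)
    have h3 := abs_sub_abs_le_abs_sub (inner ℝ v n) (normalVelocity Ω z.1 v)
    rw [abs_sub_comm] at h3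
    constructor <;> linarith
  have hmeas : Measurable fun z : Vec d × ℝ => ENNReal.ofReal |normalVelocity Ω z.1 v| :=
    ((measurable_normalVelocity hΩ hC).comp (measurable_fst.prodMk measurable_const)).abs.ennreal_ofReal
  have hI₁ : h₀ * M ≤ ∫⁻ z in C, ENNReal.ofReal |normalVelocity Ω z.1 v| ∂((surface Ω).prod volume)
      + (ε / 2 : ℝ≥0) * M := by
    rw [hM, ← setLIntegral_const, ← setLIntegral_const, ← lintegral_add_left hmeas]
    exact setLIntegral_mono' hCm fun z hz => (hbound z hz).1
  have hI₂ : ∫⁻ z in C, ENNReal.ofReal |normalVelocity Ω z.1 v| ∂((surface Ω).prod volume) ≤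
      (h₀ + (ε / 2 : ℝ≥0)) * M := by
    rw [hM, ← setLIntegral_const]
    exact setLIntegral_mono' hCm fun z hz => (hbound z hz).2
  have hee : (ε : ℝ≥0∞) = (ε / 2 : ℝ≥0) + (ε / 2 : ℝ≥0) := by rw [← ENNReal.coe_add, add_halves]
  constructor
  · calc volume (transport v '' C) ≤ m₂ * M := hup.trans (by gcongr)
      _ = h₀ * M + (ε / 2 : ℝ≥0) * M := by rw [hm₂, ENNReal.coe_add, add_mul]
      _ ≤ _ := by rw [hee, add_mul, ← add_assoc]; gcongr
  · have h1 : ((m₁ * (1 - δ) ^ (d - 1) : ℝ≥0) : ℝ≥0∞) * M ≤ volume (transport v '' C) := by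
      calc ((m₁ * (1 - δ) ^ (d - 1) : ℝ≥0) : ℝ≥0∞) * M
          ≤ ((m₁ * (1 - δ) ^ (d - 1) : ℝ≥0) : ℝ≥0∞) *
            ((((1 - δ)⁻¹ : ℝ≥0) : ℝ≥0∞) ^ (d - 1) * volume (flatProd n '' C)) := by gcongr
        _ = m₁ * volume (flatProd n '' C) := by
            rw [← mul_assoc, ← ENNReal.coe_pow, ← ENNReal.coe_mul, mul_assoc m₁, ← mul_pow,
              mul_inv_cancel₀ (tsub_pos_of_lt hδ1).ne', one_pow, mul_one]
        _ ≤ _ := hlo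
    calc _ ≤ (h₀ + (ε / 2 : ℝ≥0)) * M := hI₂
      _ ≤ ((m₁ * (1 - δ) ^ (d - 1) : ℝ≥0) + (ε / 2 : ℝ≥0) + (ε / 2 : ℝ≥0)) * M := by
          gcongr
          exact_mod_cast hδ.le
      _ = ((m₁ * (1 - δ) ^ (d - 1) : ℝ≥0) : ℝ≥0∞) * M + ε * M := by rw [hee]; ring
      _ ≤ _ := by gcongr

end LocalTransport

/-! ### Integration over Ω along trajectories from the boundary. -/

section GlobalTransport

variable {d : ℕ} {Ω : Set (Vec d)}

/-- The flux density `|v · n(x)|`. -/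
abbrev fluxDensity (Ω : Set (Vec d)) (v : Vec d) (x : Vec d) : ℝ≥0∞ :=
  ENNReal.ofReal |normalVelocity Ω x v|

lemma measurable_fluxDensity (hΩ : IsOpen Ω) (hC : HasC1Boundary Ω) :
    Measurable fun z : Vec d × Vec d => fluxDensity Ω z.2 z.1 :=
  (measurable_normalVelocity hΩ hC).abs.ennreal_ofReal

lemma measurable_fluxDensity_fst (hΩ : IsOpen Ω) (hC : HasC1Boundary Ω) (v : Vec d) :
    Measurable fun z : Vec d × ℝ => fluxDensity Ω v z.1 :=
  ((measurable_normalVelocity hΩ hC).comp (measurable_fst.prodMk measurable_const)).abs.ennreal_ofReal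

lemma isCompact_frontier_of_bounded (hb : Bornology.IsBounded Ω) : IsCompact (frontier Ω) :=
  Metric.isCompact_of_isClosed_isBounded isClosed_frontier
    (hb.closure.subset frontier_subset_closure)

/-- The change of variables formula for `(x, s) ↦ x - s v` on `C`, up to a multiple of `ε`. -/
def TransportApprox (Ω : Set (Vec d)) (v : Vec d) (ε : ℝ≥0) (C : Set (Vec d × ℝ)) : Prop :=
  volume (transport v '' C) ≤ ∫⁻ z in C, fluxDensity Ω v z.1 ∂((surface Ω).prod volume)
        + ε * ((surface Ω).prod volume) C ∧
      (InjOn (transport v) C → ∫⁻ z in C, fluxDensity Ω v z.1 ∂((surface Ω).prod volume) ≤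
        volume (transport v '' C) + ε * ((surface Ω).prod volume) C)

lemma continuous_transport (v : Vec d) : Continuous (transport v) := by
  unfold transport; fun_prop

/-- The lower bound is additive only if the images are disjoint, which is why it carries
injectivity; the upper bound does not need it. -/
lemma TransportApprox.union {v : Vec d} {ε : ℝ≥0} {C₁ C₂ : Set (Vec d × ℝ)}
    (h₁ : TransportApprox Ω v ε C₁) (h₂ : TransportApprox Ω v ε C₂) (m₂ : MeasurableSet C₂)
    (hd : Disjoint C₁ C₂) : TransportApprox Ω v ε (C₁ ∪ C₂) := by
  have eI := lintegral_union (μ := (surface Ω).prod volume) (f := fun z => fluxDensity Ω v z.1) m₂ hd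
  have eM := measure_union (μ := (surface Ω).prod volume) hd m₂
  rw [TransportApprox, eI, eM, image_union]
  constructor
  · refine (measure_union_le _ _).trans ((add_le_add h₁.1 h₂.1).trans (le_of_eq ?_))
    ring
  · intro hinj
    have i₂ : MeasurableSet (transport v '' C₂) := m₂.image_of_continuousOn_injOn
      (continuous_transport v).continuousOn (hinj.mono subset_union_right)
    have hd' : Disjoint (transport v '' C₁) (transport v '' C₂) := by
      rw [Set.disjoint_left]
      rintro _ ⟨z, hz, rfl⟩ ⟨w, hw, h⟩
      have := hinj (Or.inr hw) (Or.inl hz) h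
      subst this
      exact Set.disjoint_left.1 hd hz hw
    rw [measure_union hd' i₂]
    refine (add_le_add (h₁.2 (hinj.mono subset_union_left))
      (h₂.2 (hinj.mono subset_union_right))).trans (le_of_eq ?_)
    ring

lemma transportApprox (hΩ : IsOpen Ω) (hb : Bornology.IsBounded Ω) (hC : HasC1Boundary Ω)
    (v : Vec d) {ε : ℝ≥0} (hε : 0 < ε) {C : Set (Vec d × ℝ)} (hCm : MeasurableSet C)
    (hCf : C ⊆ frontier Ω ×ˢ univ) : TransportApprox Ω v ε C := by
  have key : ∃ S', frontier Ω ⊆ S' ∧ MeasurableSet S' ∧ ∀ C : Set (Vec d × ℝ), MeasurableSet C →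
      C ⊆ (frontier Ω ∩ S') ×ˢ univ → TransportApprox Ω v ε C := by
    refine (isCompact_frontier_of_bounded hb).induction_on
      (p := fun S => ∃ S', S ⊆ S' ∧ MeasurableSet S' ∧ ∀ C : Set (Vec d × ℝ), MeasurableSet C →
        C ⊆ (frontier Ω ∩ S') ×ˢ univ → TransportApprox Ω v ε C) ?_ ?_ ?_ ?_
    · refine ⟨∅, subset_rfl, MeasurableSet.empty, fun C _ hC => ?_⟩
      rw [inter_empty, empty_prod, subset_empty_iff] at hC
      subst hC
      constructor <;> simp
    · rintro s t hst ⟨S', h1, h2⟩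
      exact ⟨S', hst.trans h1, h2⟩
    · rintro s t ⟨S, hs1, hs2, hs3⟩ ⟨T, ht1, ht2, ht3⟩
      refine ⟨S ∪ T, union_subset_union hs1 ht1, hs2.union ht2, fun C hCm hC => ?_⟩
      have hSm : MeasurableSet (S ×ˢ (univ : Set ℝ)) := hs2.prod MeasurableSet.univ
      rw [← inter_union_sdiff C (S ×ˢ (univ : Set ℝ))]
      refine TransportApprox.union
        (hs3 _ (hCm.inter hSm) fun z hz => ⟨⟨(hC hz.1).1.1, hz.2.1⟩, trivial⟩)
        (ht3 _ (hCm.diff hSm) fun z hz => ⟨⟨(hC hz.1).1.1,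
          ((hC hz.1).1.2).resolve_left fun h => hz.2 ⟨h, trivial⟩⟩, trivial⟩)
        (hCm.diff hSm) disjoint_sdiff_inter.symm
    · intro x hx
      obtain ⟨U, hU, hUo, h⟩ := exists_nhds_volume_transport hΩ hb hC hx v hε
      exact ⟨U, mem_nhdsWithin_of_mem_nhds hU, U, subset_rfl, hUo.measurableSet, fun C h1 h2 =>
        ⟨(h C h1 h2).1, fun _ => (h C h1 h2).2⟩⟩
  obtain ⟨S, hS, -, h⟩ := key
  exact h C hCm fun z hz => ⟨⟨(hCf hz).1, hS (hCf hz).1⟩, trivial⟩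

lemma le_of_forall_le_add_mul {a b M : ℝ≥0∞} (hM : M ≠ ∞)
    (h : ∀ ε : ℝ≥0, 0 < ε → a ≤ b + ε * M) : a ≤ b := by
  refine ENNReal.le_of_forall_pos_le_add fun ε hε _ => ?_
  lift M to ℝ≥0 using hM
  refine (h (ε / (M + 1)) (by positivity)).trans ?_
  gcongr
  rw [← ENNReal.coe_mul, ENNReal.coe_le_coe, div_mul_eq_mul_div, div_le_iff₀ (by positivity)]
  gcongr
  exact le_self_add

/-- Change of variables `(x, s) ↦ x - s v`. -/
lemma volume_transport_le (hΩ : IsOpen Ω) (hb : Bornology.IsBounded Ω) (hC : HasC1Boundary Ω)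
    (v : Vec d) {C : Set (Vec d × ℝ)} (hCm : MeasurableSet C) (hCf : C ⊆ frontier Ω ×ˢ univ)
    (hM : ((surface Ω).prod volume) C ≠ ∞) :
    volume (transport v '' C) ≤ ∫⁻ z in C, fluxDensity Ω v z.1 ∂((surface Ω).prod volume) :=
  le_of_forall_le_add_mul hM fun _ hε => (transportApprox hΩ hb hC v hε hCm hCf).1

lemma volume_transport_eq (hΩ : IsOpen Ω) (hb : Bornology.IsBounded Ω) (hC : HasC1Boundary Ω)
    (v : Vec d) {C : Set (Vec d × ℝ)} (hCm : MeasurableSet C) (hCf : C ⊆ frontier Ω ×ˢ univ)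
    (hM : ((surface Ω).prod volume) C ≠ ∞) (hinj : InjOn (transport v) C) :
    volume (transport v '' C) = ∫⁻ z in C, fluxDensity Ω v z.1 ∂((surface Ω).prod volume) :=
  le_antisymm (volume_transport_le hΩ hb hC v hCm hCf hM) <|
    le_of_forall_le_add_mul hM fun _ hε => (transportApprox hΩ hb hC v hε hCm hCf).2 hinj

/-- The times during which the backward trajectory stays in `Ω`. -/
abbrev flight (Ω : Set (Vec d)) (x v : Vec d) : Set ℝ := {s | 0 < s ∧ ENNReal.ofReal s < tMinus Ω x v}

lemma flight_eq_Ioo {x v : Vec d} (h : tMinus Ω x v ≠ ∞) :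
    flight Ω x v = Ioo 0 (tMinus Ω x v).toReal := by
  ext s
  refine and_congr_right fun hs => ?_
  rw [ENNReal.ofReal_lt_iff_lt_toReal hs.le h]

lemma measurableSet_flight (x v : Vec d) : MeasurableSet (flight Ω x v) :=
  measurableSet_Ioi.inter (measurableSet_lt ENNReal.measurable_ofReal measurable_const)

/-- The pairs of an outgoing boundary point and a time of flight. -/
def flightSet (Ω : Set (Vec d)) (v : Vec d) : Set (Vec d × ℝ) :=
  {z | (z.1 ∈ frontier Ω ∧ 0 < normalVelocity Ω z.1 v) ∧ z.2 ∈ flight Ω z.1 v}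

lemma measurableSet_flightSet (hΩ : IsOpen Ω) (hC : HasC1Boundary Ω) (v : Vec d) :
    MeasurableSet (flightSet Ω v) := by
  have h : Measurable fun z : Vec d × ℝ => (z.1, v) := measurable_fst.prodMk measurable_const
  have h1 := (measurable_normalVelocity hΩ hC).comp h
  have h2 := (measurable_tMinus hΩ).comp h
  have e : flightSet Ω v = (Prod.fst ⁻¹' (frontier Ω) ∩ {z : Vec d × ℝ | 0 < normalVelocity Ω z.1 v}) ∩
    ({z : Vec d × ℝ | 0 < z.2} ∩ {z : Vec d × ℝ | ENNReal.ofReal z.2 < tMinus Ω z.1 v}) := rfl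
  rw [e]
  exact ((measurable_fst isClosed_frontier.measurableSet).inter (measurableSet_lt measurable_const h1)).inter
    ((measurableSet_lt measurable_const measurable_snd).inter
      (measurableSet_lt measurable_snd.ennreal_ofReal h2))

lemma frontier_notMem (hΩ : IsOpen Ω) {x : Vec d} (hx : x ∈ frontier Ω) : x ∉ Ω := by
  rw [hΩ.frontier_eq] at hx; exact hx.2

lemma mem_Ioo_of_mem_flight {x v : Vec d} {s : ℝ} (hs : s ∈ flight Ω x v) (ht : tMinus Ω x v < ∞) :
    0 < s ∧ s < (tMinus Ω x v).toReal := by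
  rw [flight_eq_Ioo ht.ne] at hs; exact hs

/-- The forward exit time of x - sv is s, so the image point determines s and then x. -/
lemma injOn_transport_flightSet (hΩ : IsOpen Ω) (hb : Bornology.IsBounded Ω) {v : Vec d} (hv : v ≠ 0) :
    InjOn (transport v) (flightSet Ω v) := by
  have key : ∀ z ∈ flightSet Ω v, tMinus Ω (transport v z) (-v) = ENNReal.ofReal z.2 := by
    intro z hz
    have ht := tMinus_lt_top hb (frontier_subset_closure hz.1.1) hv
    obtain ⟨h1, h2⟩ := mem_Ioo_of_mem_flight hz.2 ht
    exact tMinus_neg_sub (frontier_notMem hΩ hz.1.1) h1 h2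
  intro z hz w hw h
  have h1 := key z hz
  rw [h, key w hw, ENNReal.ofReal_eq_ofReal_iff hw.2.1.le hz.2.1.le] at h1
  refine Prod.ext ?_ h1.symm
  rw [transport, transport, h1] at h
  exact sub_left_inj.1 h

lemma measure_bounded_time_ne_top (hΩ : IsOpen Ω) (hb : Bornology.IsBounded Ω) (hC : HasC1Boundary Ω)
    {C : Set (Vec d × ℝ)} {R : ℝ} (h : C ⊆ univ ×ˢ Icc 0 R) : ((surface Ω).prod volume) C ≠ ∞ := by
  have := isFiniteMeasure_surface hΩ hb hC
  refine ((measure_mono h).trans_lt ?_).ne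
  rw [Measure.prod_prod]
  exact ENNReal.mul_lt_top (measure_lt_top _ _) (by rw [Real.volume_Icc]; exact ENNReal.ofReal_lt_top)

lemma exists_flightSet_subset (hb : Bornology.IsBounded Ω) {v : Vec d} (hv : v ≠ 0) :
    ∃ R : ℝ, 0 ≤ R ∧ (∀ x ∈ closure Ω, tMinus Ω x v ≤ ENNReal.ofReal R) ∧
      (∀ x ∈ closure Ω, tMinus Ω x (-v) ≤ ENNReal.ofReal R) ∧ flightSet Ω v ⊆ univ ×ˢ Icc 0 R := by
  obtain ⟨D, hD⟩ := exists_tMinus_le hb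
  refine ⟨D * ‖v‖⁻¹, by positivity, fun x hx => hD x hx v hv, fun x hx => ?_, fun z hz => ?_⟩
  · have := hD x hx (-v) (neg_ne_zero.2 hv)
    rwa [norm_neg] at this
  · refine ⟨trivial, hz.2.1.le, ?_⟩
    have h := hz.2.2.trans_le (hD z.1 (frontier_subset_closure hz.1.1) v hv)
    exact ((ENNReal.ofReal_lt_ofReal_iff_of_nonneg hz.2.1.le).1 h).le

/-- Almost every point of `Ω` is reached by the trajectories starting at the boundary. -/
lemma volume_diff_image_flightSet (hΩ : IsOpen Ω) (hb : Bornology.IsBounded Ω) (hC : HasC1Boundary Ω)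
    {v : Vec d} (hv : v ≠ 0) : volume (Ω \ transport v '' flightSet Ω v) = 0 := by
  obtain ⟨R, hR, -, hR', -⟩ := exists_flightSet_subset hb hv
  -- A point of Ω missed by the trajectories leaves Ω, going forward, at a boundary point with v·n =
  -- 0: negative sign is excluded because the trajectory arrives from inside, positive sign because
  -- the point would be reached. The image of such grazing points is null since the density vanishes
  -- on them.
  set Z : Set (Vec d × ℝ) := {z | (z.1 ∈ frontier Ω ∧ normalVelocity Ω z.1 v = 0) ∧ z.2 ∈ Icc 0 R}
    with hZ
  have hZm : MeasurableSet Z :=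
    ((measurable_fst isClosed_frontier.measurableSet).inter (measurableSet_eq_fun
      ((measurable_normalVelocity hΩ hC).comp (measurable_fst.prodMk measurable_const))
      measurable_const)).inter (measurable_snd measurableSet_Icc)
  have hZ0 : volume (transport v '' Z) ≤ 0 := by
    refine (volume_transport_le hΩ hb hC v hZm (fun z hz => ⟨hz.1.1, trivial⟩)
      (measure_bounded_time_ne_top hΩ hb hC (R := R) fun z hz => ⟨trivial, hz.2⟩)).trans ?_
    rw [setLIntegral_congr_fun hZm (g := fun _ => 0) (fun z hz => by
      simp only [fluxDensity, hz.1.2, abs_zero, ENNReal.ofReal_zero])]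
    simp
  refine le_antisymm ((measure_mono fun y hy => ?_).trans hZ0) zero_le
  have hpos := tMinus_pos_of_mem (v := -v) hΩ hy.1
  have hlt := tMinus_lt_top hb (subset_closure hy.1) (neg_ne_zero.2 hv)
  set T := (tMinus Ω y (-v)).toReal with hT
  have hT0 : 0 < T := ENNReal.toReal_pos hpos.ne' hlt.ne
  set x := exitPoint Ω y (-v) with hx
  have hxe : x = y + T • v := by rw [hx, exitPoint, smul_neg, sub_neg_eq_add]
  have hxf : x ∈ frontier Ω := exitPoint_mem_frontier hΩ hpos hlt
  have hback : ∀ r, 0 < r → r < T → x - r • v ∈ Ω := fun r h1 h2 => by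
    have := mem_of_lt_toReal (Ω := Ω) (x := y) (v := -v) (s := T - r) (by linarith) (by linarith)
    rw [hxe]
    convert this using 1
    rw [sub_smul]; module
  have hyx : transport v (x, T) = y := by simp only [transport, hxe, add_sub_cancel_right]
  refine ⟨(x, T), ⟨⟨hxf, ?_⟩, hT0.le, ?_⟩, hyx⟩
  · rcases lt_trichotomy (normalVelocity Ω x v) 0 with h | h | h
    · exfalso
      obtain ⟨s, h1, h2⟩ := (((eventually_sub_smul hΩ hC hxf).2 h).and (Ioo_mem_nhdsGT hT0)).exists
      exact h1 (hback s h2.1 h2.2)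
    · exact h
    · exfalso
      refine hy.2 ⟨(x, T), ⟨⟨hxf, h⟩, hT0, ?_⟩, hyx⟩
      have hc : ContinuousAt (fun s : ℝ => x - s • v) T := by fun_prop
      have hyΩ : x - T • v ∈ Ω := by
        have : transport v (x, T) ∈ Ω := hyx ▸ hy.1
        exact this
      obtain ⟨r, hr, hball⟩ := Metric.eventually_nhds_iff.1 (hc.eventually (hΩ.mem_nhds hyΩ))
      refine lt_of_lt_of_le ((ENNReal.ofReal_lt_ofReal_iff (by linarith : 0 < T + r)).2
        (by linarith)) (le_tMinus fun s hs hsr => ?_)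
      rw [ENNReal.ofReal_lt_ofReal_iff (by linarith)] at hsr
      rcases lt_or_ge s T with h' | h'
      · exact hback s hs h'
      · exact hball (by rw [Real.dist_eq, abs_of_nonneg] <;> linarith)
  · have := hR' y (subset_closure hy.1)
    exact ENNReal.toReal_le_of_le_ofReal hR this

/-- Integration over `Ω` along the trajectories with velocity `v`. -/
lemma lintegral_flightSet (hΩ : IsOpen Ω) (hb : Bornology.IsBounded Ω) (hC : HasC1Boundary Ω)
    {v : Vec d} (hv : v ≠ 0) {F : Vec d → ℝ≥0∞} (hF : Measurable F) :
    ∫⁻ z in flightSet Ω v, fluxDensity Ω v z.1 * F (z.1 - z.2 • v) ∂((surface Ω).prod volume) =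
      ∫⁻ y in Ω, F y := by
  have := isFiniteMeasure_surface hΩ hb hC
  have hcont := continuous_transport v
  have hD := measurableSet_flightSet hΩ hC v
  have hinj := injOn_transport_flightSet hΩ hb hv
  obtain ⟨R, -, -, -, hsub⟩ := exists_flightSet_subset hb hv
  have hh := measurable_fluxDensity_fst hΩ hC v
  have key : Measure.map (transport v) ((((surface Ω).prod volume).restrict (flightSet Ω v)).withDensity
      fun z => fluxDensity Ω v z.1) = volume.restrict Ω := by
    ext B hB
    rw [Measure.map_apply hcont.measurable hB, withDensity_apply _ (hcont.measurable hB),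
      Measure.restrict_restrict (hcont.measurable hB), Measure.restrict_apply hB]
    have hsub' : transport v ⁻¹' B ∩ flightSet Ω v ⊆ flightSet Ω v := inter_subset_right
    rw [← volume_transport_eq hΩ hb hC v ((hcont.measurable hB).inter hD)
      (fun z hz => ⟨hz.2.1.1, trivial⟩)
      (measure_bounded_time_ne_top hΩ hb hC (hsub'.trans hsub)) (hinj.mono hsub')]
    rw [image_preimage_inter]
    refine measure_congr (ae_eq_set.2 ⟨?_, ?_⟩)
    · refine measure_mono_null (t := ∅) ?_ measure_empty
      rintro y ⟨⟨h1, ⟨z, hz, rfl⟩⟩, h2⟩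
      exact h2 ⟨h1, mem_of_lt_tMinus hz.2.1 hz.2.2⟩
    · refine measure_mono_null ?_ (volume_diff_image_flightSet hΩ hb hC hv)
      exact fun y hy => ⟨hy.1.2, fun h => hy.2 ⟨hy.1.1, h⟩⟩
  rw [← key, lintegral_map hF hcont.measurable,
    lintegral_withDensity_eq_lintegral_mul _ hh (g := fun z => F (transport v z))
      (hF.comp hcont.measurable)]
  rfl

end GlobalTransport

/-! ### Integration formulas on phase space; reversal of velocities. -/

section PhaseSpaceMeasures

variable {d : ℕ} {Ω : Set (Vec d)} {m : Measure (Vec d)}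

lemma normalVelocity_neg (x v : Vec d) : normalVelocity Ω x (-v) = -normalVelocity Ω x v := by
  rw [normalVelocity, normalVelocity, inner_neg_left]

lemma ne_zero_of_mem_GammaPlus {z : Vec d × Vec d} (hz : z ∈ GammaPlus Ω m) : z.2 ≠ 0 := by
  intro h
  have := hz.2.2
  rw [h, normalVelocity, inner_zero_left] at this
  exact lt_irrefl _ this

lemma measurableSet_GammaPlus (hP : PhaseSpaceAssumptions Ω m) : MeasurableSet (GammaPlus Ω m) := by
  have e : GammaPlus Ω m = Prod.fst ⁻¹' frontier Ω ∩ (Prod.snd ⁻¹' m.support ∩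
    {z | 0 < normalVelocity Ω z.1 z.2}) := rfl
  rw [e]
  exact (measurable_fst isClosed_frontier.measurableSet).inter
    ((measurable_snd Measure.isClosed_support.measurableSet).inter
      (measurableSet_lt measurable_const (measurable_normalVelocity hP.isOpen hP.c1_boundary)))

lemma measurableSet_GammaMinus (hP : PhaseSpaceAssumptions Ω m) : MeasurableSet (GammaMinus Ω m) := by
  have e : GammaMinus Ω m = Prod.fst ⁻¹' frontier Ω ∩ (Prod.snd ⁻¹' m.support ∩
    {z | normalVelocity Ω z.1 z.2 < 0}) := rfl
  rw [e]
  exact (measurable_fst isClosed_frontier.measurableSet).inter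
    ((measurable_snd Measure.isClosed_support.measurableSet).inter
      (measurableSet_lt (measurable_normalVelocity hP.isOpen hP.c1_boundary) measurable_const))

lemma ae_mem_GammaPlus (hP : PhaseSpaceAssumptions Ω m) : ∀ᵐ z ∂(muPlus Ω m), z ∈ GammaPlus Ω m :=
  ae_restrict_mem (measurableSet_GammaPlus hP)

lemma ae_mem_GammaMinus (hP : PhaseSpaceAssumptions Ω m) : ∀ᵐ z ∂(muMinus Ω m), z ∈ GammaMinus Ω m :=
  ae_restrict_mem (measurableSet_GammaMinus hP)

lemma isFiniteMeasure_surface_of (hP : PhaseSpaceAssumptions Ω m) : IsFiniteMeasure (surface Ω) :=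
  isFiniteMeasure_surface hP.isOpen hP.isBounded hP.c1_boundary

lemma ae_ne_zero (hP : PhaseSpaceAssumptions Ω m) : ∀ᵐ v ∂m, v ≠ 0 := by
  rw [ae_iff]
  simpa using hP.zero_null

variable [SigmaFinite m]

lemma ae_mem_phase (hP : PhaseSpaceAssumptions Ω m) :
    ∀ᵐ z ∂(phaseMeasure Ω m), z.1 ∈ Ω ∧ z.2 ∈ m.support ∧ z.2 ≠ 0 := by
  have h1 : ∀ᵐ z ∂(phaseMeasure Ω m), z ∈ Ω ×ˢ m.support :=
    ae_restrict_mem (hP.isOpen.measurableSet.prod Measure.isClosed_support.measurableSet)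
  have h2 : ∀ᵐ z ∂(phaseMeasure Ω m), z.2 ≠ 0 :=
    ae_restrict_of_ae (Measure.quasiMeasurePreserving_snd.ae (ae_ne_zero hP))
  filter_upwards [h1, h2] with z h1 h2 using ⟨h1.1, h1.2, h2⟩

lemma sigmaFinite_phase : SigmaFinite (phaseMeasure Ω m) := by
  unfold phaseMeasure; infer_instance

lemma sigmaFinite_flux (hP : PhaseSpaceAssumptions Ω m) : SigmaFinite (fluxMeasure Ω m) := by
  have := isFiniteMeasure_surface_of hP
  unfold fluxMeasure
  exact SigmaFinite.withDensity_ofReal _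

lemma sigmaFinite_muPlus (hP : PhaseSpaceAssumptions Ω m) : SigmaFinite (muPlus Ω m) := by
  have := sigmaFinite_flux hP
  unfold muPlus; infer_instance

lemma lintegral_flux_restrict (hP : PhaseSpaceAssumptions Ω m) {S : Set (Vec d × Vec d)}
    (hS : MeasurableSet S) {F : Vec d × Vec d → ℝ≥0∞} (hF : Measurable F) :
    ∫⁻ z, F z ∂((fluxMeasure Ω m).restrict S) =
      ∫⁻ v, ∫⁻ x, S.indicator (fun z => fluxDensity Ω z.2 z.1 * F z) (x, v) ∂(surface Ω) ∂m := by
  have := isFiniteMeasure_surface_of hP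
  have hm := measurable_fluxDensity hP.isOpen hP.c1_boundary
  have h1 : (fluxMeasure Ω m).restrict S =
      (((surface Ω).prod m).restrict S).withDensity (fun z => fluxDensity Ω z.2 z.1) :=
    restrict_withDensity hS _
  rw [h1, lintegral_withDensity_eq_lintegral_mul _ hm hF, ← lintegral_indicator hS]
  exact lintegral_prod_symm' _ ((hm.mul hF).indicator hS)

lemma lintegral_phase (hP : PhaseSpaceAssumptions Ω m) {F : Vec d × Vec d → ℝ≥0∞} (hF : Measurable F) :
    ∫⁻ z, F z ∂(phaseMeasure Ω m) = ∫⁻ v in m.support, ∫⁻ x in Ω, F (x, v) ∂volume ∂m := by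
  rw [phaseMeasure, ← Measure.prod_restrict (μ := volume) (ν := m)]
  exact lintegral_prod_symm' _ hF

/-- The integral of `F` along the backward trajectory. -/
def flightIntegral (Ω : Set (Vec d)) (F : Vec d × Vec d → ℝ≥0∞) (z : Vec d × Vec d) : ℝ≥0∞ :=
  ∫⁻ s in flight Ω z.1 z.2, F (z.1 - s • z.2, z.2)

lemma measurable_move : Measurable fun q : (Vec d × Vec d) × ℝ => (q.1.1 - q.2 • q.1.2, q.1.2) := by
  fun_prop

lemma measurableSet_flight_prod (hΩ : IsOpen Ω) :
    MeasurableSet {q : (Vec d × Vec d) × ℝ | q.2 ∈ flight Ω q.1.1 q.1.2} := by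
  have h1 : Measurable fun q : (Vec d × Vec d) × ℝ => q.1 := measurable_fst
  have h2 := (measurable_tMinus hΩ).comp h1
  have e : {q : (Vec d × Vec d) × ℝ | q.2 ∈ flight Ω q.1.1 q.1.2} =
    {q | 0 < q.2} ∩ {q | ENNReal.ofReal q.2 < tMinus Ω q.1.1 q.1.2} := rfl
  rw [e]
  exact (measurableSet_lt measurable_const measurable_snd).inter
    (measurableSet_lt measurable_snd.ennreal_ofReal h2)

lemma flightIntegral_eq (F : Vec d × Vec d → ℝ≥0∞) (z : Vec d × Vec d) :
    flightIntegral Ω F z = ∫⁻ s, {q : (Vec d × Vec d) × ℝ | q.2 ∈ flight Ω q.1.1 q.1.2}.indicator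
      (fun q => F (q.1.1 - q.2 • q.1.2, q.1.2)) (z, s) := by
  rw [flightIntegral, ← lintegral_indicator (measurableSet_flight _ _)]
  rfl

lemma measurable_flightIntegral (hΩ : IsOpen Ω) {F : Vec d × Vec d → ℝ≥0∞} (hF : Measurable F) :
    Measurable (flightIntegral Ω F) := by
  have h := ((hF.comp measurable_move).indicator (measurableSet_flight_prod hΩ)).lintegral_prod_right'
    (ν := (volume : Measure ℝ))
  have e : flightIntegral Ω F = fun z => ∫⁻ s, {q : (Vec d × Vec d) × ℝ | q.2 ∈ flight Ω q.1.1 q.1.2}.indicator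
      (F ∘ fun q => (q.1.1 - q.2 • q.1.2, q.1.2)) (z, s) := funext fun z => flightIntegral_eq F z
  rw [e]
  exact h

/-- Integration over the phase space along the backward trajectories from the outgoing boundary. -/
lemma lintegral_flightIntegral (hP : PhaseSpaceAssumptions Ω m) {F : Vec d × Vec d → ℝ≥0∞}
    (hF : Measurable F) :
    ∫⁻ z, flightIntegral Ω F z ∂(muPlus Ω m) = ∫⁻ z, F z ∂(phaseMeasure Ω m) := by
  have := isFiniteMeasure_surface_of hP
  rw [muPlus, lintegral_flux_restrict hP (measurableSet_GammaPlus hP)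
    (measurable_flightIntegral hP.isOpen hF), lintegral_phase hP hF,
    ← lintegral_indicator Measure.isClosed_support.measurableSet]
  refine lintegral_congr_ae ?_
  filter_upwards [ae_ne_zero hP] with v hv
  by_cases hvs : v ∈ m.support
  · rw [indicator_of_mem hvs]
    have hFv : Measurable fun x => F (x, v) := hF.comp (measurable_id.prodMk measurable_const)
    rw [← lintegral_flightSet hP.isOpen hP.isBounded hP.c1_boundary hv hFv,
      ← lintegral_indicator (measurableSet_flightSet hP.isOpen hP.c1_boundary v)]
    have hmeas : Measurable fun z : Vec d × ℝ => fluxDensity Ω v z.1 * F (z.1 - z.2 • v, v) :=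
      (measurable_fluxDensity_fst hP.isOpen hP.c1_boundary v).mul
        (hFv.comp (continuous_transport v).measurable)
    rw [lintegral_prod _ (hmeas.indicator (measurableSet_flightSet hP.isOpen hP.c1_boundary v)).aemeasurable]
    refine lintegral_congr fun x => ?_
    by_cases hx : x ∈ frontier Ω ∧ 0 < normalVelocity Ω x v
    · rw [indicator_of_mem (show (x, v) ∈ GammaPlus Ω m from ⟨hx.1, hvs, hx.2⟩), flightIntegral,
        ← lintegral_const_mul' _ _ ENNReal.ofReal_ne_top, ← lintegral_indicator (measurableSet_flight _ _)]
      refine lintegral_congr fun s => ?_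
      by_cases hs : s ∈ flight Ω x v
      · rw [indicator_of_mem hs, indicator_of_mem (show (x, s) ∈ flightSet Ω v from ⟨hx, hs⟩)]
      · rw [indicator_of_notMem hs, indicator_of_notMem (fun h => hs h.2)]
    · rw [indicator_of_notMem (fun h : (x, v) ∈ GammaPlus Ω m => hx ⟨h.1, h.2.2⟩)]
      symm
      rw [lintegral_eq_zero_of_ae_eq_zero]
      exact Eventually.of_forall fun s => indicator_of_notMem (fun h => hx h.1) _
  · rw [indicator_of_notMem hvs]
    rw [lintegral_eq_zero_of_ae_eq_zero]
    exact Eventually.of_forall fun x => indicator_of_notMem (fun h => hvs h.2.1) _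

lemma map_neg_eq (hP : PhaseSpaceAssumptions Ω m) : m.map (fun v => -v) = m :=
  hP.orthogonally_invariant (LinearIsometryEquiv.neg ℝ)

lemma neg_mem_support (hP : PhaseSpaceAssumptions Ω m) {v : Vec d} (hv : v ∈ m.support) :
    -v ∈ m.support := by
  rw [Measure.mem_support_iff_forall] at hv ⊢
  intro U hU
  have h := hv ((fun w => -w) ⁻¹' U) (continuous_neg.continuousAt.preimage_mem_nhds hU)
  have h1 := (Homeomorph.neg (Vec d)).toMeasurableEquiv.map_apply (μ := m) U
  have h2 : m.map (Homeomorph.neg (Vec d)).toMeasurableEquiv = m := map_neg_eq hP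
  rw [h2] at h1
  rw [h1]
  exact h

lemma neg_mem_support_iff (hP : PhaseSpaceAssumptions Ω m) {v : Vec d} :
    -v ∈ m.support ↔ v ∈ m.support :=
  ⟨fun h => by simpa using neg_mem_support hP h, neg_mem_support hP⟩

lemma lintegral_comp_neg (hP : PhaseSpaceAssumptions Ω m) {g : Vec d → ℝ≥0∞} (hg : Measurable g) :
    ∫⁻ v, g (-v) ∂m = ∫⁻ v, g v ∂m := by
  conv_rhs => rw [← map_neg_eq hP]
  rw [lintegral_map hg measurable_neg]

/-- Reversal of velocities. -/
abbrev reverse (z : Vec d × Vec d) : Vec d × Vec d := (z.1, -z.2)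

lemma measurable_reverse : Measurable (reverse (d := d)) := measurable_fst.prodMk measurable_snd.neg

lemma reverse_mem_GammaPlus (hP : PhaseSpaceAssumptions Ω m) {z : Vec d × Vec d} :
    reverse z ∈ GammaPlus Ω m ↔ z ∈ GammaMinus Ω m := by
  simp only [GammaPlus, GammaMinus, mem_ofPred_eq, neg_mem_support_iff hP, normalVelocity_neg, neg_pos]

/-- Invariance of m under v ↦ -v exchanges Γ₋ and Γ₊, so formulas along forward trajectories follow
from the backward ones. -/
lemma lintegral_muMinus_reverse (hP : PhaseSpaceAssumptions Ω m) {F : Vec d × Vec d → ℝ≥0∞}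
    (hF : Measurable F) : ∫⁻ z, F (reverse z) ∂(muMinus Ω m) = ∫⁻ z, F z ∂(muPlus Ω m) := by
  have := isFiniteMeasure_surface_of hP
  have hm := measurable_fluxDensity hP.isOpen hP.c1_boundary
  rw [muPlus, muMinus, lintegral_flux_restrict hP (measurableSet_GammaPlus hP) hF,
    lintegral_flux_restrict hP (measurableSet_GammaMinus hP) (F := fun z => F (reverse z))
      (hF.comp measurable_reverse)]
  have hg : Measurable fun v => ∫⁻ x, (GammaPlus Ω m).indicator
      (fun z => fluxDensity Ω z.2 z.1 * F z) (x, v) ∂(surface Ω) :=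
    ((hm.mul hF).indicator (measurableSet_GammaPlus hP)).lintegral_prod_left'
  rw [← lintegral_comp_neg hP hg]
  refine lintegral_congr fun v => lintegral_congr fun x => ?_
  by_cases h : (x, v) ∈ GammaMinus Ω m
  · rw [indicator_of_mem h, indicator_of_mem ((reverse_mem_GammaPlus hP).2 h)]
    simp only [Pi.mul_apply, fluxDensity, normalVelocity_neg, abs_neg]
  · rw [indicator_of_notMem h, indicator_of_notMem (fun h' => h ((reverse_mem_GammaPlus hP).1 h'))]

lemma lintegral_phase_reverse (hP : PhaseSpaceAssumptions Ω m) {F : Vec d × Vec d → ℝ≥0∞}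
    (hF : Measurable F) : ∫⁻ z, F (reverse z) ∂(phaseMeasure Ω m) = ∫⁻ z, F z ∂(phaseMeasure Ω m) := by
  rw [lintegral_phase hP hF, lintegral_phase hP (F := fun z => F (reverse z)) (hF.comp measurable_reverse),
    ← lintegral_indicator Measure.isClosed_support.measurableSet,
    ← lintegral_indicator Measure.isClosed_support.measurableSet,
    ← lintegral_comp_neg hP (((hF.lintegral_prod_left' (μ := volume.restrict Ω))).indicator
      Measure.isClosed_support.measurableSet)]
  refine lintegral_congr fun v => ?_
  by_cases h : v ∈ m.support
  · rw [indicator_of_mem h, indicator_of_mem (neg_mem_support hP h)]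
  · rw [indicator_of_notMem h, indicator_of_notMem (fun h' => h ((neg_mem_support_iff hP).1 h'))]

/-- Integration over the phase space along the forward trajectories from the incoming boundary. -/
lemma lintegral_flightIntegral_reverse (hP : PhaseSpaceAssumptions Ω m) {F : Vec d × Vec d → ℝ≥0∞}
    (hF : Measurable F) :
    ∫⁻ z, (∫⁻ s in flight Ω z.1 (-z.2), F (z.1 + s • z.2, z.2)) ∂(muMinus Ω m) =
      ∫⁻ z, F z ∂(phaseMeasure Ω m) := by
  have hF' : Measurable fun z => F (reverse z) := hF.comp measurable_reverse
  rw [← lintegral_phase_reverse hP hF, ← lintegral_flightIntegral hP hF',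
    ← lintegral_muMinus_reverse hP (measurable_flightIntegral hP.isOpen hF')]
  refine lintegral_congr fun z => ?_
  simp only [flightIntegral, reverse, smul_neg, sub_neg_eq_add, neg_neg]

end PhaseSpaceMeasures

/-! ### Operators on `L¹` from weighted composition and averaging. -/

section L1Operators

variable {α β γ : Type*} [MeasurableSpace α] [MeasurableSpace β] [MeasurableSpace γ]
  {μ : Measure α} {ν : Measure γ} {κ : Measure β}

lemma enorm_ofReal_nnreal (c : ℝ≥0) : ‖((c : ℝ) : ℂ)‖ₑ = c := by
  rw [← ofReal_norm, Complex.norm_real, Real.norm_of_nonneg c.coe_nonneg, ENNReal.ofReal_coe_nnreal]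

/-- Continuous operators into `L¹` which are given by functions defined up to null sets. -/
lemma exists_L1_clm {X : Type*} [NormedAddCommGroup X] [NormedSpace ℂ X] {A : X → γ → ℂ} {C : ℝ≥0}
    (hm : ∀ f, AEStronglyMeasurable (A f) ν) (hadd : ∀ f g, ∀ᵐ z ∂ν, A (f + g) z = A f z + A g z)
    (hsmul : ∀ (c : ℂ) f, ∀ᵐ z ∂ν, A (c • f) z = c * A f z)
    (hb : ∀ f, ∫⁻ z, ‖A f z‖ₑ ∂ν ≤ C * ‖f‖ₑ) :
    ∃ T : X →L[ℂ] Lp ℂ 1 ν, ∀ f, T f = toL1 ν (A f) ∧ Integrable (A f) ν ∧ T f =ᵐ[ν] A f := by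
  have hi : ∀ f, Integrable (A f) ν := fun f =>
    ⟨hm f, (hb f).trans_lt (ENNReal.mul_lt_top ENNReal.coe_lt_top enorm_lt_top)⟩
  let L : X →ₗ[ℂ] Lp ℂ 1 ν :=
    { toFun := fun f => toL1 ν (A f)
      map_add' := fun f g => by
        apply Lp.ext
        filter_upwards [toL1_coeFn (hi (f + g)), toL1_coeFn (hi f), toL1_coeFn (hi g), hadd f g,
          coeFn_add_ae (toL1 ν (A f)) (toL1 ν (A g))] with z h1 h2 h3 h4 h5
        rw [h1, h5, h2, h3, h4]
      map_smul' := fun c f => by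
        apply Lp.ext
        filter_upwards [toL1_coeFn (hi (c • f)), toL1_coeFn (hi f), hsmul c f,
          coeFn_smul_ae c (toL1 ν (A f))] with z h1 h2 h4 h5
        rw [h1, RingHom.id_apply, h5, h2, h4] }
  have hL : ∀ f, ‖L f‖ ≤ C * ‖f‖ := fun f => by
    have e : L f = (hi f).toL1 (A f) := toL1_eq (hi f)
    have e1 : ∫ z, ‖(hi f).toL1 (A f) z‖ ∂ν = ∫ z, ‖A f z‖ ∂ν :=
      integral_congr_ae ((hi f).coeFn_toL1.fun_comp norm)
    rw [e, L1.norm_eq_integral_norm, e1, integral_norm_eq_lintegral_enorm (hm f)]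
    refine ENNReal.toReal_le_of_le_ofReal (by positivity) ((hb f).trans (le_of_eq ?_))
    rw [ENNReal.ofReal_mul (by positivity), ofReal_norm, ENNReal.ofReal_coe_nnreal]
  exact ⟨L.mkContinuous C hL, fun f => ⟨rfl, hi f, toL1_coeFn (hi f)⟩⟩

/-- Weighted composition operators. -/
lemma exists_pull_clm {X : Type*} [NormedAddCommGroup X] [NormedSpace ℂ X] (H : X →L[ℂ] Lp ℂ 1 μ)
    {pr : γ → α} (hpr : Measure.QuasiMeasurePreserving pr ν μ) {b : γ → ℝ≥0} (hb : Measurable b)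
    {C : ℝ≥0} (hC : ∀ f, ∫⁻ z, b z * ‖H f (pr z)‖ₑ ∂ν ≤ C * ‖f‖ₑ) :
    ∃ T : X →L[ℂ] Lp ℂ 1 ν, ∀ f, ∀ᵐ z ∂ν, T f z = ((b z : ℝ) : ℂ) * H f (pr z) := by
  obtain ⟨T, hT⟩ := exists_L1_clm (ν := ν) (A := fun f z => ((b z : ℝ) : ℂ) * H f (pr z)) (C := C)
    (fun f => (Complex.measurable_ofReal.comp hb.coe_nnreal_real).aestronglyMeasurable.mul
      ((Lp.aestronglyMeasurable (H f)).comp_quasiMeasurePreserving hpr))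
    (fun f g => by
      filter_upwards [hpr.ae (coeFn_add_ae (H f) (H g))] with z hz
      rw [map_add, hz, mul_add])
    (fun c f => by
      filter_upwards [hpr.ae (coeFn_smul_ae c (H f))] with z hz
      rw [map_smul, hz]; ring)
    (fun f => by
      refine le_trans (le_of_eq (lintegral_congr fun z => ?_)) (hC f)
      rw [enorm_mul, enorm_ofReal_nnreal])
  exact ⟨T, fun f => (hT f).2.2⟩

section Average

variable [SFinite ν] [SFinite κ] {dens : γ × β → ℝ≥0} {pr : γ × β → α}

/-- The average of `ψ ∘ pr` over the second variable with weight `dens`. -/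
def average (κ : Measure β) (dens : γ × β → ℝ≥0) (pr : γ × β → α) (ψ : α → ℂ) (z : γ) : ℂ :=
  ∫ w, ((dens (z, w) : ℝ) : ℂ) * ψ (pr (z, w)) ∂κ

/-- H and G are both averages of this kind. The single hypothesis that pr carries dens · (ν ⊗ κ) to
μ yields integrability, independence of representatives and conservation of mass. -/
lemma integrable_average_weight (hd : Measurable dens)
    (hpr : MeasurePreserving pr ((ν.prod κ).withDensity fun q => (dens q : ℝ≥0∞)) μ) {ψ : α → ℂ}
    (hψ : Integrable ψ μ) :
    Integrable (fun q => ((dens q : ℝ) : ℂ) * ψ (pr q)) (ν.prod κ) := by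
  have h := hpr.integrable_comp_of_integrable hψ
  rw [integrable_withDensity_iff_integrable_smul₀ hd.aemeasurable] at h
  exact h.congr (Eventually.of_forall fun q => by
    simp only [Function.comp_apply, NNReal.smul_def, Complex.real_smul])

lemma ae_average (hd : Measurable dens)
    (hpr : MeasurePreserving pr ((ν.prod κ).withDensity fun q => (dens q : ℝ≥0∞)) μ) {P : α → Prop}
    (hP : ∀ᵐ a ∂μ, P a) : ∀ᵐ z ∂ν, ∀ᵐ w ∂κ, dens (z, w) ≠ 0 → P (pr (z, w)) := by
  have h := hpr.quasiMeasurePreserving.ae hP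
  rw [ae_withDensity_iff hd.coe_nnreal_ennreal] at h
  filter_upwards [Measure.ae_ae_of_ae_prod h] with z hz
  filter_upwards [hz] with w hw hne
  exact hw (ENNReal.coe_ne_zero.2 hne)

lemma average_congr (hd : Measurable dens)
    (hpr : MeasurePreserving pr ((ν.prod κ).withDensity fun q => (dens q : ℝ≥0∞)) μ) {ψ χ : α → ℂ}
    (h : ψ =ᵐ[μ] χ) : average κ dens pr ψ =ᵐ[ν] average κ dens pr χ := by
  filter_upwards [ae_average hd hpr h] with z hz
  refine integral_congr_ae ?_
  filter_upwards [hz] with w hw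
  by_cases h0 : dens (z, w) = 0
  · simp [h0]
  · rw [hw h0]

lemma integral_average (hd : Measurable dens)
    (hpr : MeasurePreserving pr ((ν.prod κ).withDensity fun q => (dens q : ℝ≥0∞)) μ) {ψ : α → ℂ}
    (hψ : Integrable ψ μ) : ∫ z, average κ dens pr ψ z ∂ν = ∫ a, ψ a ∂μ := by
  have h1 := integral_prod _ (integrable_average_weight hd hpr hψ)
  have h2 : ∫ a, ψ a ∂μ = ∫ q, ψ (pr q) ∂((ν.prod κ).withDensity fun q => (dens q : ℝ≥0∞)) := by
    have h3 : AEStronglyMeasurable ψ (Measure.map pr ((ν.prod κ).withDensity fun q => (dens q : ℝ≥0∞))) := by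
      rw [hpr.map_eq]; exact hψ.1
    rw [← integral_map hpr.measurable.aemeasurable h3, hpr.map_eq]
  rw [h2, integral_withDensity_eq_integral_smul hd]
  simp only [NNReal.smul_def, Complex.real_smul]
  exact h1.symm

lemma integral_norm_average (hd : Measurable dens)
    (hpr : MeasurePreserving pr ((ν.prod κ).withDensity fun q => (dens q : ℝ≥0∞)) μ) {ψ : α → ℂ}
    (hψ : Integrable ψ μ) : ∫⁻ z, ‖average κ dens pr ψ z‖ₑ ∂ν ≤ ∫⁻ a, ‖ψ a‖ₑ ∂μ := by
  have h3 : AEStronglyMeasurable ψ (Measure.map pr ((ν.prod κ).withDensity fun q => (dens q : ℝ≥0∞))) := by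
    rw [hpr.map_eq]; exact hψ.1
  have hi := integrable_average_weight hd hpr hψ
  calc ∫⁻ z, ‖average κ dens pr ψ z‖ₑ ∂ν
      ≤ ∫⁻ z, ∫⁻ w, ‖((dens (z, w) : ℝ) : ℂ) * ψ (pr (z, w))‖ₑ ∂κ ∂ν :=
        lintegral_mono fun z => enorm_integral_le_lintegral_enorm _
    _ = ∫⁻ q, ‖((dens q : ℝ) : ℂ) * ψ (pr q)‖ₑ ∂(ν.prod κ) := (lintegral_prod _ hi.1.enorm).symm
    _ = ∫⁻ q, dens q * ‖ψ (pr q)‖ₑ ∂(ν.prod κ) := lintegral_congr fun q => by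
        rw [enorm_mul, enorm_ofReal_nnreal]
    _ = ∫⁻ q, ‖ψ (pr q)‖ₑ ∂((ν.prod κ).withDensity fun q => (dens q : ℝ≥0∞)) := by
        rw [lintegral_withDensity_eq_lintegral_mul₀' (g := fun q => ‖ψ (pr q)‖ₑ)
          hd.coe_nnreal_ennreal.aemeasurable
          (h3.comp_measurable hpr.measurable).enorm]
        rfl
    _ = ∫⁻ a, ‖ψ a‖ₑ ∂μ := by
        rw [← hpr.map_eq, lintegral_map' h3.enorm hpr.measurable.aemeasurable]

lemma norm_average_le (z : γ) (ψ : α → ℂ) :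
    ‖average κ dens pr ψ z‖ ≤ ‖average κ dens pr (fun a => ((‖ψ a‖ : ℝ) : ℂ)) z‖ := by
  have e : average κ dens pr (fun a => ((‖ψ a‖ : ℝ) : ℂ)) z =
      ((∫ w, ‖((dens (z, w) : ℝ) : ℂ) * ψ (pr (z, w))‖ ∂κ : ℝ) : ℂ) := by
    rw [average, ← integral_complex_ofReal]
    refine integral_congr_ae (Eventually.of_forall fun w => ?_)
    simp only
    rw [norm_mul, Complex.norm_real, Real.norm_of_nonneg (dens (z, w)).coe_nonneg, Complex.ofReal_mul]
  rw [e, Complex.norm_real, Real.norm_of_nonneg (integral_nonneg fun _ => norm_nonneg _)]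
  exact norm_integral_le_integral_norm _

lemma average_ofReal_norm (z : γ) (ψ : α → ℂ) :
    average κ dens pr (fun a => ((‖ψ a‖ : ℝ) : ℂ)) z =
      ((∫ w, dens (z, w) * ‖ψ (pr (z, w))‖ ∂κ : ℝ) : ℂ) := by
  rw [average, ← integral_complex_ofReal]
  simp only [Complex.ofReal_mul]

/-- Averaging as an operator between `L¹` spaces. -/
lemma exists_average_clm (hd : Measurable dens)
    (hpr : MeasurePreserving pr ((ν.prod κ).withDensity fun q => (dens q : ℝ≥0∞)) μ) :
    ∃ T : Lp ℂ 1 μ →L[ℂ] Lp ℂ 1 ν, ∀ ψ, T ψ = toL1 ν (average κ dens pr ψ) ∧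
      T ψ =ᵐ[ν] average κ dens pr ψ := by
  obtain ⟨T, hT⟩ := exists_L1_clm (ν := ν) (A := fun ψ : Lp ℂ 1 μ => average κ dens pr ψ) (C := 1)
    (fun ψ => (integrable_average_weight hd hpr (Lp_int ψ)).1.integral_prod_right')
    (fun ψ χ => by
      filter_upwards [average_congr hd hpr (Lp.coeFn_add ψ χ),
        (integrable_average_weight hd hpr (Lp_int ψ)).prod_right_ae,
        (integrable_average_weight hd hpr (Lp_int χ)).prod_right_ae] with z h1 h2 h3
      rw [h1, average, average, average, ← integral_add h2 h3]
      simp only [Pi.add_apply, mul_add])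
    (fun c ψ => by
      filter_upwards [average_congr hd hpr (Lp.coeFn_smul c ψ)] with z h1
      rw [h1, average, average, ← integral_const_mul]
      congr 1 with w
      simp only [Pi.smul_apply, smul_eq_mul]; ring)
    (fun ψ => by
      refine (integral_norm_average hd hpr (Lp_int ψ)).trans (le_of_eq ?_)
      rw [ENNReal.coe_one, one_mul, Lp.enorm_def, eLpNorm_one_eq_lintegral_enorm])
  exact ⟨T, fun ψ => ⟨(hT ψ).1, (hT ψ).2.2⟩⟩

end Average

end L1Operators

/-! ### Measure preservation for streaming, the exit map and the boundary kernel. -/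

section MeasurePreservingMaps

variable {d : ℕ} {Ω : Set (Vec d)} {m : Measure (Vec d)} [SigmaFinite m]

lemma sigmaFinite_muMinus (hP : PhaseSpaceAssumptions Ω m) : SigmaFinite (muMinus Ω m) := by
  have := sigmaFinite_flux hP
  unfold muMinus; infer_instance

/-- The indicator of the time of flight. -/
def flightDens (Ω : Set (Vec d)) (q : (Vec d × Vec d) × ℝ) : ℝ≥0 :=
  {q : (Vec d × Vec d) × ℝ | q.2 ∈ flight Ω q.1.1 q.1.2}.indicator 1 q

lemma measurable_flightDens (hΩ : IsOpen Ω) : Measurable (flightDens Ω) :=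
  measurable_one.indicator (measurableSet_flight_prod hΩ)

lemma flightDens_of_mem {q : (Vec d × Vec d) × ℝ} (h : q.2 ∈ flight Ω q.1.1 q.1.2) :
    flightDens Ω q = 1 := by
  rw [flightDens, indicator_of_mem (show q ∈ {q : (Vec d × Vec d) × ℝ | q.2 ∈ flight Ω q.1.1 q.1.2} from h)]
  rfl

lemma flightDens_of_notMem {q : (Vec d × Vec d) × ℝ} (h : q.2 ∉ flight Ω q.1.1 q.1.2) :
    flightDens Ω q = 0 := by
  rw [flightDens, indicator_of_notMem (show q ∉ {q : (Vec d × Vec d) × ℝ | q.2 ∈ flight Ω q.1.1 q.1.2} from h)]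

/-- A criterion for a map to preserve a measure. -/
lemma measurePreserving_of_lintegral {α β : Type*} [MeasurableSpace α] [MeasurableSpace β]
    {μ : Measure α} {ν : Measure β} {f : α → β} (hf : Measurable f)
    (h : ∀ F : β → ℝ≥0∞, Measurable F → ∫⁻ z, F (f z) ∂μ = ∫⁻ y, F y ∂ν) : MeasurePreserving f μ ν := by
  refine ⟨hf, ?_⟩
  ext B hB
  rw [Measure.map_apply hf hB, ← lintegral_indicator_one (hf hB), ← lintegral_indicator_one hB,
    ← h _ (measurable_one.indicator hB)]
  rfl

lemma lintegral_prod_withDensity {α β γ : Type*} [MeasurableSpace α] [MeasurableSpace β]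
    [MeasurableSpace γ] {ν : Measure γ} {κ : Measure β} [SFinite κ] {dens : γ × β → ℝ≥0} (hd : Measurable dens)
    {pr : γ × β → α} (hpr : Measurable pr) {F : α → ℝ≥0∞} (hF : Measurable F) :
    ∫⁻ q, F (pr q) ∂((ν.prod κ).withDensity fun q => (dens q : ℝ≥0∞)) =
      ∫⁻ z, ∫⁻ w, dens (z, w) * F (pr (z, w)) ∂κ ∂ν := by
  rw [lintegral_withDensity_eq_lintegral_mul _ hd.coe_nnreal_ennreal (g := fun q => F (pr q))
    (hF.comp hpr)]
  have hm : Measurable fun q => (dens q : ℝ≥0∞) * F (pr q) := hd.coe_nnreal_ennreal.mul (hF.comp hpr)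
  exact lintegral_prod _ hm.aemeasurable

lemma lintegral_flightDens (g : ℝ → ℝ≥0∞) (z : Vec d × Vec d) :
    ∫⁻ s, flightDens Ω (z, s) * g s = ∫⁻ s in flight Ω z.1 z.2, g s := by
  rw [← lintegral_indicator (measurableSet_flight _ _)]
  refine lintegral_congr fun s => ?_
  by_cases hs : s ∈ flight Ω z.1 z.2
  · rw [indicator_of_mem hs, flightDens_of_mem (q := (z, s)) hs, ENNReal.coe_one, one_mul]
  · rw [indicator_of_notMem hs, flightDens_of_notMem (q := (z, s)) hs, ENNReal.coe_zero, zero_mul]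

lemma integral_flightDens (g : ℝ → ℂ) (z : Vec d × Vec d) :
    ∫ s, ((flightDens Ω (z, s) : ℝ) : ℂ) * g s = ∫ s in flight Ω z.1 z.2, g s := by
  rw [← integral_indicator (measurableSet_flight _ _)]
  refine integral_congr_ae (Eventually.of_forall fun s => ?_)
  by_cases hs : s ∈ flight Ω z.1 z.2
  · simp only [indicator_of_mem hs, flightDens_of_mem (q := (z, s)) hs, NNReal.coe_one, Complex.ofReal_one, one_mul]
  · simp only [indicator_of_notMem hs, flightDens_of_notMem (q := (z, s)) hs, NNReal.coe_zero,
      Complex.ofReal_zero, zero_mul]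

lemma measurePreserving_backward (hP : PhaseSpaceAssumptions Ω m) :
    MeasurePreserving (fun q : (Vec d × Vec d) × ℝ => (q.1.1 - q.2 • q.1.2, q.1.2))
      (((muPlus Ω m).prod volume).withDensity fun q => (flightDens Ω q : ℝ≥0∞)) (phaseMeasure Ω m) := by
  refine measurePreserving_of_lintegral measurable_move fun F hF => ?_
  rw [lintegral_prod_withDensity (measurable_flightDens hP.isOpen) measurable_move hF,
    ← lintegral_flightIntegral hP hF]
  exact lintegral_congr fun z => lintegral_flightDens _ z

lemma measurable_move_forward :
    Measurable fun q : (Vec d × Vec d) × ℝ => (q.1.1 + q.2 • q.1.2, q.1.2) := by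
  fun_prop

/-- The indicator of the time of flight in the forward direction. -/
def forwardDens (Ω : Set (Vec d)) (q : (Vec d × Vec d) × ℝ) : ℝ≥0 := flightDens Ω (reverse q.1, q.2)

lemma measurable_forwardDens (hΩ : IsOpen Ω) : Measurable (forwardDens Ω) :=
  (measurable_flightDens hΩ).comp ((measurable_reverse.comp measurable_fst).prodMk measurable_snd)

lemma measurePreserving_forward (hP : PhaseSpaceAssumptions Ω m) :
    MeasurePreserving (fun q : (Vec d × Vec d) × ℝ => (q.1.1 + q.2 • q.1.2, q.1.2))
      (((muMinus Ω m).prod volume).withDensity fun q => (forwardDens Ω q : ℝ≥0∞)) (phaseMeasure Ω m) := by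
  refine measurePreserving_of_lintegral measurable_move_forward fun F hF => ?_
  rw [lintegral_prod_withDensity (measurable_forwardDens hP.isOpen) measurable_move_forward hF,
    ← lintegral_flightIntegral_reverse hP hF]
  exact lintegral_congr fun z => lintegral_flightDens _ (reverse z)

/-- The map which sends a point of the phase space to the boundary along the backward trajectory. -/
abbrev exitMap (Ω : Set (Vec d)) (z : Vec d × Vec d) : Vec d × Vec d := (exitPoint Ω z.1 z.2, z.2)

/-- Travel times along the trajectory which ends at an outgoing boundary point. -/
lemma flight_outgoing (hP : PhaseSpaceAssumptions Ω m) {z : Vec d × Vec d} (hz : z ∈ GammaPlus Ω m) :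
    0 < (tMinus Ω z.1 z.2).toReal ∧ flight Ω z.1 z.2 = Ioo 0 (tMinus Ω z.1 z.2).toReal ∧
    tMinus Ω (exitPoint Ω z.1 z.2) (-z.2) = tMinus Ω z.1 z.2 ∧
    ∀ s ∈ flight Ω z.1 z.2, exitPoint Ω (z.1 - s • z.2) z.2 = exitPoint Ω z.1 z.2 ∧
      tMinus Ω (z.1 - s • z.2) z.2 = ENNReal.ofReal ((tMinus Ω z.1 z.2).toReal - s) ∧
      tMinus Ω (z.1 - s • z.2) (-z.2) = ENNReal.ofReal s := by
  have hlt := tMinus_lt_top hP.isBounded (frontier_subset_closure hz.1) (ne_zero_of_mem_GammaPlus hz)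
  have hpos := tMinus_pos_of_normalVelocity_pos hP.isOpen hP.c1_boundary hz.1 hz.2.2
  have hn := frontier_notMem hP.isOpen hz.1
  refine ⟨ENNReal.toReal_pos hpos.ne' hlt.ne, flight_eq_Ioo hlt.ne, tMinus_neg_exitPoint hn hpos hlt,
    fun s hs => ?_⟩
  obtain ⟨h1, h2⟩ := mem_Ioo_of_mem_flight hs hlt
  exact ⟨exitPoint_sub hP.isOpen hlt h1 h2, tMinus_sub hP.isOpen hlt h1 h2, tMinus_neg_sub hn h1 h2⟩

/-- Travel times along the trajectory which starts at an incoming boundary point. -/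
lemma flight_incoming (hP : PhaseSpaceAssumptions Ω m) {z : Vec d × Vec d} (hz : z ∈ GammaMinus Ω m) :
    0 < (tMinus Ω z.1 (-z.2)).toReal ∧ flight Ω z.1 (-z.2) = Ioo 0 (tMinus Ω z.1 (-z.2)).toReal ∧
    ∀ s ∈ flight Ω z.1 (-z.2), exitPoint Ω (z.1 + s • z.2) z.2 = z.1 ∧
      tMinus Ω (z.1 + s • z.2) z.2 = ENNReal.ofReal s ∧
      tMinus Ω (z.1 + s • z.2) (-z.2) = ENNReal.ofReal ((tMinus Ω z.1 (-z.2)).toReal - s) := by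
  obtain ⟨h1, h2, h3, h4⟩ := flight_outgoing hP ((reverse_mem_GammaPlus hP).2 hz)
  refine ⟨h1, h2, fun s hs => ?_⟩
  obtain ⟨-, h6, h7⟩ := h4 s hs
  simp only [smul_neg, sub_neg_eq_add, neg_neg] at h6 h7
  refine ⟨?_, h7, h6⟩
  rw [exitPoint, h7, ENNReal.toReal_ofReal hs.1.le, add_sub_cancel_right]

lemma measurable_tMinus_neg (hΩ : IsOpen Ω) :
    Measurable fun y : Vec d × Vec d => tMinus Ω y.1 (-y.2) := by
  have h := (measurable_tMinus hΩ).comp measurable_reverse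
  exact h

/-- The map from the outgoing to the incoming boundary preserves the flux measures. -/
lemma measurePreserving_exitMap (hP : PhaseSpaceAssumptions Ω m) :
    MeasurePreserving (exitMap Ω) (muPlus Ω m) (muMinus Ω m) := by
  have he := measurable_exitPoint hP.isOpen
  refine measurePreserving_of_lintegral he fun φ hφ => ?_
  -- The weight is the inverse of the total travel time of the chord, constant along the chord, so
  -- integrating F over a chord returns φ at its entrance point. Computing the phase space integral
  -- of F from Γ₊ and from Γ₋ then proves the claim.
  set F : Vec d × Vec d → ℝ≥0∞ := fun y =>
    φ (exitMap Ω y) * (tMinus Ω y.1 y.2 + tMinus Ω y.1 (-y.2))⁻¹ with hFdef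
  have htr := measurable_tMinus_neg hP.isOpen
  have hF : Measurable F :=
    (hφ.comp he).mul ((measurable_tMinus hP.isOpen).add htr).inv
  have hconst : ∀ (T : ℝ) (c : ℝ≥0∞), 0 < T → ∫⁻ _ in Ioo 0 T, c * (ENNReal.ofReal T)⁻¹ = c := by
    intro T c hT
    rw [setLIntegral_const, Real.volume_Ioo, sub_zero, mul_assoc,
      ENNReal.inv_mul_cancel (ENNReal.ofReal_pos.2 hT).ne' ENNReal.ofReal_ne_top, mul_one]
  have h1 : ∫⁻ z, φ (exitMap Ω z) ∂(muPlus Ω m) = ∫⁻ z, flightIntegral Ω F z ∂(muPlus Ω m) := by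
    refine lintegral_congr_ae ?_
    filter_upwards [ae_mem_GammaPlus hP] with z hz
    obtain ⟨hT, hfl, -, h⟩ := flight_outgoing hP hz
    rw [flightIntegral, setLIntegral_congr_fun (measurableSet_flight _ _)
      (g := fun _ => φ (exitMap Ω z) * (ENNReal.ofReal (tMinus Ω z.1 z.2).toReal)⁻¹) (fun s hs => ?_),
      hfl, hconst _ _ hT]
    obtain ⟨a, b, c⟩ := h s hs
    rw [hfl] at hs
    simp only [hFdef, exitMap, a, b, c]
    rw [← ENNReal.ofReal_add (by linarith [hs.2]) hs.1.le, sub_add_cancel]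
  have h2 : ∫⁻ z, φ z ∂(muMinus Ω m) =
      ∫⁻ z, (∫⁻ s in flight Ω z.1 (-z.2), F (z.1 + s • z.2, z.2)) ∂(muMinus Ω m) := by
    refine lintegral_congr_ae ?_
    filter_upwards [ae_mem_GammaMinus hP] with z hz
    obtain ⟨hT, hfl, h⟩ := flight_incoming hP hz
    rw [setLIntegral_congr_fun (measurableSet_flight _ _)
      (g := fun _ => φ z * (ENNReal.ofReal (tMinus Ω z.1 (-z.2)).toReal)⁻¹) (fun s hs => ?_),
      hfl, hconst _ _ hT]
    obtain ⟨a, b, c⟩ := h s hs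
    rw [hfl] at hs
    simp only [hFdef, exitMap, a, b, c]
    rw [← ENNReal.ofReal_add hs.1.le (by linarith [hs.2]), add_sub_cancel]
  rw [h1, h2, lintegral_flightIntegral hP hF, lintegral_flightIntegral_reverse hP hF]

/-- Null sets on the incoming boundary are invisible from the interior. -/
lemma quasiMeasurePreserving_exitMap (hP : PhaseSpaceAssumptions Ω m) :
    Measure.QuasiMeasurePreserving (exitMap Ω) (phaseMeasure Ω m) (muMinus Ω m) := by
  have he := measurable_exitPoint hP.isOpen
  refine ⟨he, Measure.AbsolutelyContinuous.mk fun B hB h0 => ?_⟩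
  rw [Measure.map_apply he hB, ← lintegral_indicator_one (he hB),
    ← lintegral_flightIntegral_reverse hP (measurable_one.indicator (he hB))]
  refine lintegral_eq_zero_of_ae_eq_zero ?_
  filter_upwards [ae_mem_GammaMinus hP, measure_eq_zero_iff_ae_notMem.1 h0] with z hz hzB
  obtain ⟨-, -, h⟩ := flight_incoming hP hz
  rw [setLIntegral_congr_fun (measurableSet_flight _ _) (g := fun _ => 0) (fun s hs => ?_)]
  · simp
  · refine indicator_of_notMem (fun hmem => hzB ?_) _
    simp only [mem_preimage, exitMap, (h s hs).1] at hmem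
    exact hmem

/-- The weight of the boundary operator. -/
def kernelDens (Ω : Set (Vec d)) (m : Measure (Vec d)) (k : Vec d → Vec d → Vec d → ℝ≥0)
    (q : (Vec d × Vec d) × Vec d) : ℝ≥0 :=
  {q : (Vec d × Vec d) × Vec d | (q.1.1, q.2) ∈ GammaPlus Ω m}.indicator
    (fun q => k q.1.1 q.1.2 q.2 * Real.toNNReal |normalVelocity Ω q.1.1 q.2|) q

lemma measurable_pair : Measurable fun q : (Vec d × Vec d) × Vec d => (q.1.1, q.2) := by fun_prop

lemma measurable_kernelDens (hP : PhaseSpaceAssumptions Ω m) {k : Vec d → Vec d → Vec d → ℝ≥0}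
    (hk : Measurable fun q : Vec d × Vec d × Vec d => k q.1 q.2.1 q.2.2) :
    Measurable (kernelDens Ω m k) := by
  have h1 : Measurable fun q : (Vec d × Vec d) × Vec d => (q.1.1, q.1.2, q.2) := by fun_prop
  have h2 := hk.comp h1
  have h3 := (measurable_normalVelocity hP.isOpen hP.c1_boundary).comp measurable_pair
  exact (h2.mul h3.abs.real_toNNReal).indicator (measurable_pair (measurableSet_GammaPlus hP))

lemma lintegral_flux_restrict_symm (hP : PhaseSpaceAssumptions Ω m) {S : Set (Vec d × Vec d)}
    (hS : MeasurableSet S) {F : Vec d × Vec d → ℝ≥0∞} (hF : Measurable F) :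
    ∫⁻ z, F z ∂((fluxMeasure Ω m).restrict S) =
      ∫⁻ x, ∫⁻ v, S.indicator (fun z => fluxDensity Ω z.2 z.1 * F z) (x, v) ∂m ∂(surface Ω) := by
  have := isFiniteMeasure_surface_of hP
  have hm := measurable_fluxDensity hP.isOpen hP.c1_boundary
  rw [lintegral_flux_restrict hP hS hF]
  exact (lintegral_prod_symm' _ ((hm.mul hF).indicator hS)).symm.trans
    (lintegral_prod _ ((hm.mul hF).indicator hS).aemeasurable)

/-- By Tonelli one may integrate over the incoming velocity first; there the normalisation of the
kernel gives 1 and leaves the flux |w·n|F(x, w). -/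
lemma measurePreserving_kernel (hP : PhaseSpaceAssumptions Ω m) {k : Vec d → Vec d → Vec d → ℝ≥0}
    (hk : Measurable fun q : Vec d × Vec d × Vec d => k q.1 q.2.1 q.2.2)
    (hst : ∀ᵐ z ∂(muPlus Ω m), ∫⁻ v in {v | v ∈ m.support ∧ normalVelocity Ω z.1 v < 0},
      k z.1 v z.2 * ENNReal.ofReal |normalVelocity Ω z.1 v| ∂m = 1) :
    MeasurePreserving (fun q : (Vec d × Vec d) × Vec d => (q.1.1, q.2))
      (((muMinus Ω m).prod m).withDensity fun q => (kernelDens Ω m k q : ℝ≥0∞)) (muPlus Ω m) := by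
  have := isFiniteMeasure_surface_of hP
  have := sigmaFinite_muMinus hP
  have hfd := measurable_fluxDensity hP.isOpen hP.c1_boundary
  have hkd := measurable_kernelDens hP hk
  refine measurePreserving_of_lintegral measurable_pair fun F hF => ?_
  have hgm : Measurable fun q : (Vec d × Vec d) × Vec d =>
      (kernelDens Ω m k q : ℝ≥0∞) * F (q.1.1, q.2) :=
    hkd.coe_nnreal_ennreal.mul (hF.comp measurable_pair)
  rw [lintegral_prod_withDensity hkd measurable_pair hF, muPlus, muMinus,
    lintegral_flux_restrict_symm hP (measurableSet_GammaMinus hP) hgm.lintegral_prod_right',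
    lintegral_flux_restrict_symm hP (measurableSet_GammaPlus hP) hF]
  have hae : ∀ᵐ x ∂(surface Ω), ∀ᵐ w ∂m, (x, w) ∈ GammaPlus Ω m →
      ∫⁻ v in {v | v ∈ m.support ∧ normalVelocity Ω x v < 0},
        k x v w * ENNReal.ofReal |normalVelocity Ω x v| ∂m = 1 := by
    rw [muPlus, ae_restrict_iff' (measurableSet_GammaPlus hP), fluxMeasure, ae_withDensity_iff hfd] at hst
    filter_upwards [Measure.ae_ae_of_ae_prod hst] with x hx
    filter_upwards [hx] with w hw hmem
    exact hw (ENNReal.ofReal_pos.2 (abs_pos.2 hmem.2.2.ne')).ne' hmem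
  refine lintegral_congr_ae ?_
  filter_upwards [hae, ae_restrict_mem isClosed_frontier.measurableSet] with x hx hxf
  set g : Vec d → Vec d → ℝ≥0∞ := fun v w => (GammaMinus Ω m).indicator
    (fun z => fluxDensity Ω z.2 z.1 * ((kernelDens Ω m k (z, w) : ℝ≥0∞) * F (z.1, w))) (x, v) with hg
  have hgmeas : Measurable (Function.uncurry g) := by
    have e : Function.uncurry g = ({q : (Vec d × Vec d) × Vec d | q.1 ∈ GammaMinus Ω m}.indicator
      fun q => fluxDensity Ω q.1.2 q.1.1 * ((kernelDens Ω m k q : ℝ≥0∞) * F (q.1.1, q.2))) ∘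
        fun p : Vec d × Vec d => ((x, p.1), p.2) := rfl
    rw [e]
    have h1 : Measurable fun p : Vec d × Vec d => ((x, p.1), p.2) := by fun_prop
    exact (((hfd.comp measurable_fst).mul hgm).indicator
      (measurable_fst (measurableSet_GammaMinus hP))).comp h1
  have e1 : ∀ v, (GammaMinus Ω m).indicator (fun z => fluxDensity Ω z.2 z.1 *
      ∫⁻ w, (kernelDens Ω m k (z, w) : ℝ≥0∞) * F (z.1, w) ∂m) (x, v) = ∫⁻ w, g v w ∂m := by
    intro v
    by_cases hv : (x, v) ∈ GammaMinus Ω m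
    · simp only [hg, indicator_of_mem hv]
      rw [lintegral_const_mul' _ _ ENNReal.ofReal_ne_top]
    · simp only [hg, indicator_of_notMem hv, lintegral_zero]
  rw [lintegral_congr e1, lintegral_lintegral_swap hgmeas.aemeasurable]
  refine lintegral_congr_ae ?_
  filter_upwards [hx] with w hw
  by_cases hmem : (x, w) ∈ GammaPlus Ω m
  · have hS : MeasurableSet {v | v ∈ m.support ∧ normalVelocity Ω x v < 0} := by
      have h1 : Measurable fun v : Vec d => (x, v) := measurable_const.prodMk measurable_id
      have e : {v | v ∈ m.support ∧ normalVelocity Ω x v < 0} = (fun v => (x, v)) ⁻¹' GammaMinus Ω m := by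
        ext v; simp [GammaMinus, hxf]
      rw [e]
      exact h1 (measurableSet_GammaMinus hP)
    have e2 : ∀ v, g v w = {v | v ∈ m.support ∧ normalVelocity Ω x v < 0}.indicator
        (fun v => k x v w * ENNReal.ofReal |normalVelocity Ω x v|) v *
          (fluxDensity Ω w x * F (x, w)) := by
      intro v
      by_cases hv : v ∈ m.support ∧ normalVelocity Ω x v < 0
      · simp only [hg]
        rw [indicator_of_mem (show (x, v) ∈ GammaMinus Ω m from ⟨hxf, hv⟩), indicator_of_mem
          (show v ∈ {v | v ∈ m.support ∧ normalVelocity Ω x v < 0} from hv), kernelDens,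
          indicator_of_mem (show ((x, v), w) ∈ {q : (Vec d × Vec d) × Vec d |
            (q.1.1, q.2) ∈ GammaPlus Ω m} from hmem), ENNReal.coe_mul]
        simp only [fluxDensity, ENNReal.ofReal]
        ring
      · simp only [hg]
        rw [indicator_of_notMem (fun h : (x, v) ∈ GammaMinus Ω m => hv h.2), indicator_of_notMem
          (show v ∉ {v | v ∈ m.support ∧ normalVelocity Ω x v < 0} from hv), zero_mul]
    have hkm : Measurable fun v => {v | v ∈ m.support ∧ normalVelocity Ω x v < 0}.indicator
        (fun v => (k x v w : ℝ≥0∞) * ENNReal.ofReal |normalVelocity Ω x v|) v := by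
      have h1 : Measurable fun v : Vec d => (x, v, w) := by fun_prop
      have h2 : Measurable fun v : Vec d => (x, v) := by fun_prop
      have h3 := hk.comp h1
      have h4 := (measurable_normalVelocity hP.isOpen hP.c1_boundary).comp h2
      exact (h3.coe_nnreal_ennreal.mul h4.abs.ennreal_ofReal).indicator hS
    rw [lintegral_congr e2, lintegral_mul_const _ hkm, lintegral_indicator hS, hw hmem, one_mul,
      indicator_of_mem hmem]
  · rw [indicator_of_notMem hmem]
    refine lintegral_eq_zero_of_ae_eq_zero (Eventually.of_forall fun v => ?_)
    simp only [hg, Pi.zero_apply]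
    refine indicator_apply_eq_zero.2 fun _ => ?_
    rw [kernelDens, indicator_of_notMem (show ((x, v), w) ∉ {q : (Vec d × Vec d) × Vec d |
            (q.1.1, q.2) ∈ GammaPlus Ω m} from hmem), ENNReal.coe_zero, zero_mul, mul_zero]

end MeasurePreservingMaps

/-! ### The boundary, streaming and lifting operators with their moments. -/

section Operators

variable {d : ℕ} {Ω : Set (Vec d)} {m : Measure (Vec d)} {k : Vec d → Vec d → Vec d → ℝ≥0} {p : ℕ}

lemma integral_comp_measurePreserving {α β : Type*} [MeasurableSpace α] [MeasurableSpace β]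
    {μ : Measure α} {ν : Measure β} {f : α → β} (hf : MeasurePreserving f μ ν) {g : β → ℂ}
    (hg : AEStronglyMeasurable g ν) : ∫ z, g (f z) ∂μ = ∫ y, g y ∂ν := by
  have h : AEStronglyMeasurable g (Measure.map f μ) := by rw [hf.map_eq]; exact hg
  rw [← integral_map hf.measurable.aemeasurable h, hf.map_eq]

lemma enorm_eq_lintegral {α : Type*} [MeasurableSpace α] {μ : Measure α} (ψ : Lp ℂ 1 μ) :
    ‖ψ‖ₑ = ∫⁻ z, ‖ψ z‖ₑ ∂μ := by
  rw [Lp.enorm_def, eLpNorm_one_eq_lintegral_enorm]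

lemma measurable_Lp_enorm {α : Type*} [MeasurableSpace α] {μ : Measure α} (ψ : Lp ℂ 1 μ) :
    Measurable fun z => ‖ψ z‖ₑ := (Lp.stronglyMeasurable ψ).measurable.enorm

/-- The travel time along the backward trajectory. -/
def backTime (Ω : Set (Vec d)) (z : Vec d × Vec d) : ℝ≥0 := (tMinus Ω z.1 z.2).toNNReal

/-- The travel time along the forward trajectory. -/
def foreTime (Ω : Set (Vec d)) (z : Vec d × Vec d) : ℝ≥0 := (tMinus Ω z.1 (-z.2)).toNNReal

lemma measurable_backTime (hΩ : IsOpen Ω) : Measurable (backTime Ω) :=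
  (measurable_tMinus hΩ).ennreal_toNNReal

lemma measurable_foreTime (hΩ : IsOpen Ω) : Measurable (foreTime Ω) :=
  (measurable_tMinus_neg hΩ).ennreal_toNNReal

lemma coe_backTime (z : Vec d × Vec d) : (backTime Ω z : ℝ) = (tMinus Ω z.1 z.2).toReal := rfl

lemma coe_foreTime (z : Vec d × Vec d) : (foreTime Ω z : ℝ) = (tMinus Ω z.1 (-z.2)).toReal := rfl

lemma coe_backTime_le (z : Vec d × Vec d) : (backTime Ω z : ℝ≥0∞) ≤ tMinus Ω z.1 z.2 :=
  ENNReal.coe_toNNReal_le_self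

lemma coe_foreTime_le (z : Vec d × Vec d) : (foreTime Ω z : ℝ≥0∞) ≤ tMinus Ω z.1 (-z.2) :=
  ENNReal.coe_toNNReal_le_self

lemma pow_inv_norm_le {v : Vec d} (hv : v ≠ 0) {i s : ℕ} (his : i ≤ s) :
    (‖v‖⁻¹) ^ i ≤ max 1 (‖v‖ ^ s)⁻¹ := by
  have hn : 0 < ‖v‖ := norm_pos_iff.2 hv
  rcases le_total 1 ‖v‖ with h | h
  · exact (pow_le_one₀ (inv_nonneg.2 hn.le) (inv_le_one_of_one_le₀ h)).trans (le_max_left _ _)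
  · rw [← inv_pow]
    exact (pow_le_pow_right₀ ((one_le_inv₀ hn).2 h) his).trans (le_max_right _ _)

/-- Moments of the travel times are controlled by the velocity weights. -/
lemma exists_time_pow_le (hb : Bornology.IsBounded Ω) : ∃ D : ℝ≥0, ∀ (i s : ℕ), i ≤ s →
    ∀ z : Vec d × Vec d, z.1 ∈ closure Ω → z.2 ≠ 0 →
      tMinus Ω z.1 z.2 ^ i ≤ (D : ℝ≥0∞) ^ i * velocityWeight s z.2 ∧
      tMinus Ω z.1 (-z.2) ^ i ≤ (D : ℝ≥0∞) ^ i * velocityWeight s z.2 := by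
  obtain ⟨D, hD⟩ := exists_tMinus_le hb
  refine ⟨D, fun i s his z hz hv => ?_⟩
  have key : ENNReal.ofReal (D * ‖z.2‖⁻¹) ^ i ≤ (D : ℝ≥0∞) ^ i * velocityWeight s z.2 := by
    rw [ENNReal.ofReal_mul D.coe_nonneg, mul_pow, ENNReal.ofReal_coe_nnreal, ← ENNReal.ofReal_pow (by positivity)]
    exact mul_le_mul_right (ENNReal.ofReal_le_ofReal (pow_inv_norm_le hv his)) _
  have h2 := hD z.1 hz (-z.2) (neg_ne_zero.2 hv)
  rw [norm_neg] at h2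
  exact ⟨(pow_le_pow_left' (hD z.1 hz z.2 hv) i).trans key, (pow_le_pow_left' h2 i).trans key⟩

lemma measurable_velocityWeight (s : ℕ) : Measurable (velocityWeight (d := d) s) :=
  (measurable_const.max (measurable_norm.pow_const s).inv).ennreal_ofReal

variable [SigmaFinite m]

/-- The boundary operator as a continuous linear operator. -/
lemma exists_boundary_clm (hP : PhaseSpaceAssumptions Ω m) (hH : BoundaryAssumptions Ω m k p) :
    ∃ H : L1Plus Ω m →L[ℂ] L1Minus Ω m, ∀ ψ, H ψ = opH Ω m k ψ ∧
      H ψ =ᵐ[muMinus Ω m] average m (kernelDens Ω m k) (fun q => (q.1.1, q.2)) ψ := by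
  have := sigmaFinite_muMinus hP
  obtain ⟨H, hHe⟩ := exists_average_clm (measurable_kernelDens hP hH.measurable_kernel)
    (measurePreserving_kernel hP hH.measurable_kernel hH.stochastic)
  refine ⟨H, fun ψ => ⟨?_, (hHe ψ).2⟩⟩
  rw [(hHe ψ).1, opH]
  congr 1
  ext1 z
  have hS : MeasurableSet {w | w ∈ m.support ∧ 0 < normalVelocity Ω z.1 w} := by
    have h1 : Continuous fun w => normalVelocity Ω z.1 w := by unfold normalVelocity; fun_prop
    exact Measure.isClosed_support.measurableSet.inter (measurableSet_lt measurable_const h1.measurable)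
  rw [average, ← integral_indicator hS]
  refine integral_congr_ae (Eventually.of_forall fun w => ?_)
  by_cases hw : w ∈ m.support ∧ 0 < normalVelocity Ω z.1 w
  · have hfr : z.1 ∈ frontier Ω := by
      by_contra hn
      have := hw.2
      rw [normalVelocity, outwardNormal_of_notMem hn, inner_zero_right] at this
      exact lt_irrefl _ this
    simp only
    rw [kernelDens, indicator_of_mem (show (z, w) ∈ {q : (Vec d × Vec d) × Vec d |
      (q.1.1, q.2) ∈ GammaPlus Ω m} from ⟨hfr, hw⟩), indicator_of_mem
      (show w ∈ {w | w ∈ m.support ∧ 0 < normalVelocity Ω z.1 w} from hw)]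
    simp only [NNReal.coe_mul, Real.coe_toNNReal _ (abs_nonneg _), Complex.ofReal_mul]
    ring
  · simp only
    rw [kernelDens, indicator_of_notMem (fun h : (z, w) ∈ {q : (Vec d × Vec d) × Vec d |
      (q.1.1, q.2) ∈ GammaPlus Ω m} => hw h.2), indicator_of_notMem
      (show w ∉ {w | w ∈ m.support ∧ 0 < normalVelocity Ω z.1 w} from hw), NNReal.coe_zero,
      Complex.ofReal_zero, zero_mul]

/-- The streaming operator from the incoming to the outgoing boundary. -/
lemma exists_streaming_clm (hP : PhaseSpaceAssumptions Ω m) :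
    ∃ M : L1Minus Ω m →L[ℂ] L1Plus Ω m, ∀ u, ∀ᵐ z ∂(muPlus Ω m), M u z = u (exitMap Ω z) := by
  obtain ⟨M, hM⟩ := exists_pull_clm (ContinuousLinearMap.id ℂ (L1Minus Ω m))
    (measurePreserving_exitMap hP).quasiMeasurePreserving (b := fun _ => 1) measurable_const (C := 1)
    (fun u => by
      simp only [ENNReal.coe_one, one_mul, ContinuousLinearMap.id_apply]
      rw [(measurePreserving_exitMap hP).lintegral_comp (measurable_Lp_enorm u), enorm_eq_lintegral])
  refine ⟨M, fun u => ?_⟩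
  filter_upwards [hM u] with z hz
  simpa using hz

/-- The moments `τⁱ M₀ H`. -/
lemma exists_boundary_moment (hP : PhaseSpaceAssumptions Ω m) (H : L1Plus Ω m →L[ℂ] L1Minus Ω m)
    {s : ℕ} {C : ℝ≥0}
    (hC : ∀ ψ, ∫⁻ z, velocityWeight s z.2 * ‖H ψ z‖ₑ ∂(muMinus Ω m) ≤ C * ‖ψ‖ₑ) {i : ℕ} (hi : i ≤ s) :
    ∃ T : L1Plus Ω m →L[ℂ] L1Plus Ω m, ∀ ψ, ∀ᵐ z ∂(muPlus Ω m),
      T ψ z = ((backTime Ω z : ℝ) : ℂ) ^ i * H ψ (exitMap Ω z) := by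
  obtain ⟨D, hD⟩ := exists_time_pow_le hP.isBounded
  have hmp := measurePreserving_exitMap hP
  obtain ⟨T, hT⟩ := exists_pull_clm H hmp.quasiMeasurePreserving (b := fun z => backTime Ω z ^ i)
    ((measurable_backTime hP.isOpen).pow_const i) (C := D ^ i * C) (fun ψ => by
      calc ∫⁻ z, ((backTime Ω z ^ i : ℝ≥0) : ℝ≥0∞) * ‖H ψ (exitMap Ω z)‖ₑ ∂(muPlus Ω m)
          ≤ ∫⁻ z, (fun y : Vec d × Vec d => (D : ℝ≥0∞) ^ i * (velocityWeight s y.2 * ‖H ψ y‖ₑ)) (exitMap Ω z)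
            ∂(muPlus Ω m) := by
            refine lintegral_mono_ae ?_
            filter_upwards [ae_mem_GammaPlus hP] with z hz
            rw [ENNReal.coe_pow, ← mul_assoc]
            refine mul_le_mul_left ((pow_le_pow_left' (coe_backTime_le z) i).trans ?_) _
            exact (hD i s hi z (frontier_subset_closure hz.1) (ne_zero_of_mem_GammaPlus hz)).1
        _ = ∫⁻ y, (D : ℝ≥0∞) ^ i * (velocityWeight s y.2 * ‖H ψ y‖ₑ) ∂(muMinus Ω m) :=
            hmp.lintegral_comp ((((measurable_velocityWeight s).comp measurable_snd).mul
              (measurable_Lp_enorm (H ψ))).const_mul _)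
        _ = (D : ℝ≥0∞) ^ i * ∫⁻ y, (velocityWeight s y.2 * ‖H ψ y‖ₑ) ∂(muMinus Ω m) :=
            lintegral_const_mul _ (((measurable_velocityWeight s).comp measurable_snd).mul
              (measurable_Lp_enorm (H ψ)))
        _ ≤ (D ^ i * C : ℝ≥0) * ‖ψ‖ₑ := by
            rw [ENNReal.coe_mul, ENNReal.coe_pow, mul_assoc]
            exact mul_le_mul_right (hC ψ) _)
  refine ⟨T, fun ψ => ?_⟩
  filter_upwards [hT ψ] with z hz
  rw [hz]; push_cast; rfl

lemma ne_zero_of_mem_GammaMinus {z : Vec d × Vec d} (hz : z ∈ GammaMinus Ω m) : z.2 ≠ 0 := by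
  intro h
  have := hz.2.2
  rw [h, normalVelocity, inner_zero_left] at this
  exact lt_irrefl _ this

/-- The moments `tⁱ Ξ₀ H`. -/
lemma exists_interior_moment (hP : PhaseSpaceAssumptions Ω m) (H : L1Plus Ω m →L[ℂ] L1Minus Ω m)
    {s : ℕ} {C : ℝ≥0}
    (hC : ∀ ψ, ∫⁻ z, velocityWeight s z.2 * ‖H ψ z‖ₑ ∂(muMinus Ω m) ≤ C * ‖ψ‖ₑ) {i : ℕ} (hi : i + 1 ≤ s) :
    ∃ T : L1Plus Ω m →L[ℂ] X0 Ω m, ∀ ψ, ∀ᵐ z ∂(phaseMeasure Ω m),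
      T ψ z = ((backTime Ω z : ℝ) : ℂ) ^ i * H ψ (exitMap Ω z) := by
  obtain ⟨D, hD⟩ := exists_time_pow_le hP.isBounded
  have he := measurable_exitPoint hP.isOpen
  obtain ⟨T, hT⟩ := exists_pull_clm H (quasiMeasurePreserving_exitMap hP) (b := fun z => backTime Ω z ^ i)
    ((measurable_backTime hP.isOpen).pow_const i) (C := D ^ (i + 1) * C) (fun ψ => by
      have hF : Measurable fun z => ((backTime Ω z ^ i : ℝ≥0) : ℝ≥0∞) * ‖H ψ (exitMap Ω z)‖ₑ :=
        ((measurable_backTime hP.isOpen).pow_const i).coe_nnreal_ennreal.mul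
          ((measurable_Lp_enorm (H ψ)).comp he)
      rw [← lintegral_flightIntegral_reverse hP hF]
      calc ∫⁻ z, (∫⁻ s in flight Ω z.1 (-z.2), ((backTime Ω (z.1 + s • z.2, z.2) ^ i : ℝ≥0) : ℝ≥0∞) *
            ‖H ψ (exitMap Ω (z.1 + s • z.2, z.2))‖ₑ) ∂(muMinus Ω m)
          ≤ ∫⁻ z, (D : ℝ≥0∞) ^ (i + 1) * (velocityWeight s z.2 * ‖H ψ z‖ₑ) ∂(muMinus Ω m) := by
            refine lintegral_mono_ae ?_
            filter_upwards [ae_mem_GammaMinus hP] with z hz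
            obtain ⟨hT0, hfl, h⟩ := flight_incoming hP hz
            have hlt := tMinus_lt_top hP.isBounded (frontier_subset_closure hz.1)
              (neg_ne_zero.2 (ne_zero_of_mem_GammaMinus hz))
            -- Integrating the i-th power of the elapsed time over the chord costs one more power of
            -- the total travel time; hence i + 1 ≤ s here, whereas i ≤ s is enough on the boundary.
            calc ∫⁻ s in flight Ω z.1 (-z.2), ((backTime Ω (z.1 + s • z.2, z.2) ^ i : ℝ≥0) : ℝ≥0∞) *
                  ‖H ψ (exitMap Ω (z.1 + s • z.2, z.2))‖ₑ
                ≤ ∫⁻ _ in flight Ω z.1 (-z.2), tMinus Ω z.1 (-z.2) ^ i * ‖H ψ z‖ₑ := by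
                  refine setLIntegral_mono' (measurableSet_flight _ _) fun r hr => ?_
                  have e : exitMap Ω (z.1 + r • z.2, z.2) = z := Prod.ext (h r hr).1 rfl
                  rw [e, ENNReal.coe_pow]
                  refine mul_le_mul_left (pow_le_pow_left' ((coe_backTime_le _).trans ?_) i) _
                  simp only [(h r hr).2.1]
                  exact hr.2.le
              _ = tMinus Ω z.1 (-z.2) ^ (i + 1) * ‖H ψ z‖ₑ := by
                  rw [setLIntegral_const, hfl, Real.volume_Ioo, sub_zero, ENNReal.ofReal_toReal hlt.ne]
                  ring
              _ ≤ _ := by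
                  rw [← mul_assoc]
                  exact mul_le_mul_left (hD (i + 1) s hi z (frontier_subset_closure hz.1)
                    (ne_zero_of_mem_GammaMinus hz)).2 _
        _ = (D : ℝ≥0∞) ^ (i + 1) * ∫⁻ y, (velocityWeight s y.2 * ‖H ψ y‖ₑ) ∂(muMinus Ω m) :=
            lintegral_const_mul _ (((measurable_velocityWeight s).comp measurable_snd).mul
              (measurable_Lp_enorm (H ψ)))
        _ ≤ (D ^ (i + 1) * C : ℝ≥0) * ‖ψ‖ₑ := by
            rw [ENNReal.coe_mul, ENNReal.coe_pow, mul_assoc]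
            exact mul_le_mul_right (hC ψ) _)
  refine ⟨T, fun ψ => ?_⟩
  filter_upwards [hT ψ] with z hz
  rw [hz]; push_cast; rfl

/-- Integration along the backward trajectories as a continuous linear operator. -/
lemma exists_flight_clm (hP : PhaseSpaceAssumptions Ω m) :
    ∃ G : X0 Ω m →L[ℂ] L1Plus Ω m, ∀ f, G f =ᵐ[muPlus Ω m]
      average volume (flightDens Ω) (fun q => (q.1.1 - q.2 • q.1.2, q.1.2)) f := by
  have := sigmaFinite_muPlus hP
  obtain ⟨G, hG⟩ := exists_average_clm (measurable_flightDens hP.isOpen) (measurePreserving_backward hP)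
  exact ⟨G, fun f => (hG f).2⟩

end Operators

/-! ### Mass balance, identification of the operators, Riemann–Lebesgue lemma. -/

section Realization

variable {d : ℕ} {Ω : Set (Vec d)} {m : Measure (Vec d)} {k : Vec d → Vec d → Vec d → ℝ≥0} {p : ℕ}

lemma toL1_eq_of_ae {α : Type*} [MeasurableSpace α] {μ : Measure α} {ψ : Lp ℂ 1 μ} {g : α → ℂ}
    (h : ψ =ᵐ[μ] g) : toL1 μ g = ψ := by
  apply Lp.ext
  exact (toL1_coeFn ((Lp_int ψ).congr h)).trans h.symm

variable [SigmaFinite m] {H : L1Plus Ω m →L[ℂ] L1Minus Ω m}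

lemma intCLM_boundary (hP : PhaseSpaceAssumptions Ω m) (hH : BoundaryAssumptions Ω m k p)
    (hHa : ∀ ψ, H ψ =ᵐ[muMinus Ω m] average m (kernelDens Ω m k) (fun q => (q.1.1, q.2)) ψ)
    (ψ : L1Plus Ω m) : ∫ z, H ψ z ∂(muMinus Ω m) = ∫ z, ψ z ∂(muPlus Ω m) := by
  have := sigmaFinite_muMinus hP
  rw [integral_congr_ae (hHa ψ)]
  exact integral_average (measurable_kernelDens hP hH.measurable_kernel)
    (measurePreserving_kernel hP hH.measurable_kernel hH.stochastic) (Lp_int ψ)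

lemma isMarkov_boundary (hP : PhaseSpaceAssumptions Ω m) (hH : BoundaryAssumptions Ω m k p)
    (hHa : ∀ ψ, H ψ =ᵐ[muMinus Ω m] average m (kernelDens Ω m k) (fun q => (q.1.1, q.2)) ψ)
    {K : L1Plus Ω m →L[ℂ] L1Plus Ω m}
    (hK : ∀ ψ, ∀ᵐ z ∂(muPlus Ω m), K ψ z = H ψ (exitMap Ω z)) : IsMarkov K := by
  have := sigmaFinite_muMinus hP
  have hmp := measurePreserving_exitMap hP
  have hKa : ∀ ψ, ∀ᵐ z ∂(muPlus Ω m), K (absL ψ) z =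
      average m (kernelDens Ω m k) (fun q => (q.1.1, q.2)) (fun a => ((‖ψ a‖ : ℝ) : ℂ)) (exitMap Ω z) := by
    intro ψ
    have h1 := average_congr (measurable_kernelDens hP hH.measurable_kernel)
      (measurePreserving_kernel hP hH.measurable_kernel hH.stochastic) (absL_coeFn ψ)
    filter_upwards [hK (absL ψ), hmp.quasiMeasurePreserving.ae ((hHa (absL ψ)).trans h1)] with z h2 h3
    rw [h2, h3]
  refine ⟨fun ψ => ?_, fun ψ => ?_, fun ψ => ?_⟩
  · filter_upwards [hK ψ, hmp.quasiMeasurePreserving.ae (hHa ψ), hKa ψ] with z h1 h2 h3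
    rw [h1, h2, h3]
    exact norm_average_le _ _
  · refine absL_eq_of_re_nonneg ?_
    filter_upwards [hKa ψ] with z h1
    rw [h1, average_ofReal_norm]
    refine ⟨?_, Complex.ofReal_im _⟩
    rw [Complex.ofReal_re]
    exact integral_nonneg fun w => by positivity
  · rw [intCLM_apply, intCLM_apply, integral_congr_ae (hK ψ),
      integral_comp_measurePreserving hmp (Lp.aestronglyMeasurable (H ψ)), intCLM_boundary hP hH hHa]

lemma foreTime_exitMap (hP : PhaseSpaceAssumptions Ω m) {z : Vec d × Vec d} (hz : z ∈ GammaPlus Ω m) :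
    foreTime Ω (exitMap Ω z) = backTime Ω z := by
  rw [foreTime, backTime, (flight_outgoing hP hz).2.2.1]

/-- Integration over the phase space of functions which come from the incoming boundary. -/
lemma integral_from_boundary (hP : PhaseSpaceAssumptions Ω m) (lam : ℂ) (u : Vec d × Vec d → ℂ)
    (hi : Integrable (fun z => Complex.exp (-lam * (backTime Ω z : ℝ)) * u (exitMap Ω z))
      (phaseMeasure Ω m)) :
    ∫ z, Complex.exp (-lam * (backTime Ω z : ℝ)) * u (exitMap Ω z) ∂(phaseMeasure Ω m) =
      ∫ z, (∫ s in Ioo (0 : ℝ) (foreTime Ω z), Complex.exp (-lam * s)) * u z ∂(muMinus Ω m) := by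
  have := sigmaFinite_muMinus hP
  rw [← integral_average (measurable_forwardDens hP.isOpen) (measurePreserving_forward hP) hi]
  refine integral_congr_ae ?_
  filter_upwards [ae_mem_GammaMinus hP] with z hz
  obtain ⟨-, hfl, h⟩ := flight_incoming hP hz
  have h1 := integral_flightDens (Ω := Ω) (fun s => Complex.exp (-lam * (backTime Ω (z.1 + s • z.2, z.2) : ℝ)) *
    u (exitMap Ω (z.1 + s • z.2, z.2))) (reverse z)
  refine h1.trans ?_
  have hfl' : flight Ω (reverse z).1 (reverse z).2 = Ioo 0 (foreTime Ω z : ℝ) := hfl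
  rw [← integral_mul_const, ← hfl']
  refine setIntegral_congr_fun (measurableSet_flight _ _) fun s hs => ?_
  have e : exitMap Ω (z.1 + s • z.2, z.2) = z := Prod.ext (h s hs).1 rfl
  simp only [e, coe_backTime, (h s hs).2.1, ENNReal.toReal_ofReal hs.1.le]

lemma mul_integral_exp_neg (lam : ℂ) {T : ℝ} (hT : 0 ≤ T) :
    lam * ∫ s in Ioo (0 : ℝ) T, Complex.exp (-lam * s) = 1 - Complex.exp (-lam * T) := by
  rcases eq_or_ne lam 0 with rfl | h
  · simp
  · rw [← integral_Ioc_eq_integral_Ioo, ← intervalIntegral.integral_of_le hT,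
      integral_exp_mul_complex (neg_ne_zero.2 h)]
    field_simp
    simp

/-- Along the chord started at an incoming point, λ times the integral of exp(-λs) over [0, T] is 1
- exp(-λT), with T the forward time; after the exit map T is the backward time entering K_λ. -/
lemma balance_boundary (hP : PhaseSpaceAssumptions Ω m) (hH : BoundaryAssumptions Ω m k p)
    (hHa : ∀ ψ, H ψ =ᵐ[muMinus Ω m] average m (kernelDens Ω m k) (fun q => (q.1.1, q.2)) ψ)
    {K : L1Plus Ω m →L[ℂ] L1Plus Ω m} {S : L1Plus Ω m →L[ℂ] X0 Ω m}
    (hK : ∀ ψ, ∀ᵐ z ∂(muPlus Ω m), K ψ z = H ψ (exitMap Ω z))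
    (hS : ∀ ψ, ∀ᵐ z ∂(phaseMeasure Ω m), S ψ z = H ψ (exitMap Ω z)) {lam : ℂ} (hl : 0 ≤ lam.re)
    (ψ : L1Plus Ω m) :
    intCLM _ ψ - intCLM _ (Kfam K (backTime Ω) lam ψ) =
      lam * intCLM _ (expMul (phaseMeasure Ω m) (backTime Ω) lam (S ψ)) := by
  have hmp := measurePreserving_exitMap hP
  have hbt := measurable_backTime hP.isOpen
  have hft := measurable_foreTime hP.isOpen
  have eS : expMul (phaseMeasure Ω m) (backTime Ω) lam (S ψ) =ᵐ[phaseMeasure Ω m]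
      fun z => Complex.exp (-lam * (backTime Ω z : ℝ)) * H ψ (exitMap Ω z) := by
    filter_upwards [expMul_coeFn hbt hl (S ψ), hS ψ] with z h1 h2
    rw [h1, h2]
  have eK : Kfam K (backTime Ω) lam ψ =ᵐ[muPlus Ω m]
      fun z => (fun y => Complex.exp (-lam * (foreTime Ω y : ℝ)) * H ψ y) (exitMap Ω z) := by
    filter_upwards [expMul_coeFn hbt hl (K ψ), hK ψ, ae_mem_GammaPlus hP] with z h1 h2 hz
    rw [Kfam, ContinuousLinearMap.comp_apply, h1, h2, foreTime_exitMap hP hz]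
  have hi : Integrable (fun y => Complex.exp (-lam * (foreTime Ω y : ℝ)) * H ψ y) (muMinus Ω m) :=
    (Lp_int (expMul (muMinus Ω m) (foreTime Ω) lam (H ψ))).congr (expMul_coeFn hft hl (H ψ))
  rw [intCLM_apply, intCLM_apply, intCLM_apply, integral_congr_ae eK, integral_congr_ae eS,
    integral_comp_measurePreserving hmp hi.1,
    integral_from_boundary hP lam _ ((Lp_int _).congr eS), ← intCLM_boundary hP hH hHa,
    ← integral_sub (Lp_int (H ψ)) hi, ← integral_const_mul]
  refine integral_congr_ae (Eventually.of_forall fun z => ?_)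
  simp only
  rw [← mul_assoc, mul_integral_exp_neg lam (foreTime Ω z).coe_nonneg]
  ring

lemma mean_time_boundary (hP : PhaseSpaceAssumptions Ω m)
    {K : L1Plus Ω m →L[ℂ] L1Plus Ω m} {S : L1Plus Ω m →L[ℂ] X0 Ω m}
    (hK : ∀ ψ, ∀ᵐ z ∂(muPlus Ω m), K ψ z = ((backTime Ω z : ℝ) : ℂ) * H ψ (exitMap Ω z))
    (hS : ∀ ψ, ∀ᵐ z ∂(phaseMeasure Ω m), S ψ z = H ψ (exitMap Ω z)) (ψ : L1Plus Ω m) :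
    intCLM _ (S ψ) = intCLM _ (K ψ) := by
  have hmp := measurePreserving_exitMap hP
  have eS : S ψ =ᵐ[phaseMeasure Ω m]
      fun z => Complex.exp (-0 * (backTime Ω z : ℝ)) * H ψ (exitMap Ω z) := by
    filter_upwards [hS ψ] with z h2
    rw [h2, neg_zero, zero_mul, Complex.exp_zero, one_mul]
  have eK : K ψ =ᵐ[muPlus Ω m]
      fun z => (fun y => ((foreTime Ω y : ℝ) : ℂ) * H ψ y) (exitMap Ω z) := by
    filter_upwards [hK ψ, ae_mem_GammaPlus hP] with z h2 hz
    rw [h2, foreTime_exitMap hP hz]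
  have hm : AEStronglyMeasurable (fun y => ((foreTime Ω y : ℝ) : ℂ) * H ψ y) (muMinus Ω m) :=
    (Complex.measurable_ofReal.comp (measurable_foreTime hP.isOpen).coe_nnreal_real).aestronglyMeasurable.mul
      (Lp.aestronglyMeasurable _)
  rw [intCLM_apply, intCLM_apply, integral_congr_ae eK, integral_congr_ae eS,
    integral_comp_measurePreserving hmp hm, integral_from_boundary hP 0 _ ((Lp_int _).congr eS)]
  refine integral_congr_ae (Eventually.of_forall fun z => ?_)
  simp

variable {G : X0 Ω m →L[ℂ] L1Plus Ω m}

/-- The point x - sv reached backwards from Γ₊ has forward travel time s, so the factor exp(-λs) in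
G_λ is multiplication by exp(-λ · `foreTime`) on phase space before G. -/
lemma flight_clm_expMul (hP : PhaseSpaceAssumptions Ω m)
    (hG : ∀ f, G f =ᵐ[muPlus Ω m]
      average volume (flightDens Ω) (fun q => (q.1.1 - q.2 • q.1.2, q.1.2)) f)
    {lam : ℂ} (hl : 0 ≤ lam.re) (f : X0 Ω m) :
    G (expMul (phaseMeasure Ω m) (foreTime Ω) lam f) =ᵐ[muPlus Ω m] fun z =>
      ∫ s in flight Ω z.1 z.2, Complex.exp (-lam * s) * f (z.1 - s • z.2, z.2) := by
  have := sigmaFinite_muPlus hP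
  filter_upwards [hG (expMul (phaseMeasure Ω m) (foreTime Ω) lam f),
    average_congr (measurable_flightDens hP.isOpen) (measurePreserving_backward hP)
      (expMul_coeFn (measurable_foreTime hP.isOpen) hl f), ae_mem_GammaPlus hP] with z h1 h2 hz
  obtain ⟨-, -, -, h⟩ := flight_outgoing hP hz
  rw [h1, h2]
  refine (integral_flightDens (Ω := Ω) (fun s => Complex.exp (-lam * (foreTime Ω (z.1 - s • z.2, z.2) : ℝ)) *
    f (z.1 - s • z.2, z.2)) z).trans ?_
  refine setIntegral_congr_fun (measurableSet_flight _ _) fun s hs => ?_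
  simp only [coe_foreTime, (h s hs).2.2, ENNReal.toReal_ofReal hs.1.le]

lemma opG_eq (hP : PhaseSpaceAssumptions Ω m)
    (hG : ∀ f, G f =ᵐ[muPlus Ω m]
      average volume (flightDens Ω) (fun q => (q.1.1 - q.2 • q.1.2, q.1.2)) f)
    {lam : ℂ} (hl : 0 ≤ lam.re) (f : X0 Ω m) :
    opG Ω m lam f = G (expMul (phaseMeasure Ω m) (foreTime Ω) lam f) :=
  toL1_eq_of_ae (flight_clm_expMul hP hG hl f)

lemma opMH_eq (hP : PhaseSpaceAssumptions Ω m) (hHe : ∀ ψ, H ψ = opH Ω m k ψ)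
    {K : L1Plus Ω m →L[ℂ] L1Plus Ω m}
    (hK : ∀ ψ, ∀ᵐ z ∂(muPlus Ω m), K ψ z = H ψ (exitMap Ω z)) {lam : ℂ} (hl : 0 ≤ lam.re)
    (ψ : L1Plus Ω m) : opMH Ω m k lam ψ = Kfam K (backTime Ω) lam ψ := by
  rw [opMH, ← hHe]
  refine toL1_eq_of_ae ?_
  filter_upwards [expMul_coeFn (measurable_backTime hP.isOpen) hl (K ψ), hK ψ] with z h1 h2
  rw [Kfam, ContinuousLinearMap.comp_apply, h1, h2, coe_backTime]

lemma opXi_eq (hP : PhaseSpaceAssumptions Ω m) (hHe : ∀ ψ, H ψ = opH Ω m k ψ)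
    {S : L1Plus Ω m →L[ℂ] X0 Ω m}
    (hS : ∀ ψ, ∀ᵐ z ∂(phaseMeasure Ω m), S ψ z = H ψ (exitMap Ω z)) {lam : ℂ} (hl : 0 ≤ lam.re)
    (ψ : L1Plus Ω m) :
    opXi Ω m lam (opH Ω m k ψ) = expMul (phaseMeasure Ω m) (backTime Ω) lam (S ψ) := by
  rw [← hHe]
  refine toL1_eq_of_ae ?_
  filter_upwards [expMul_coeFn (measurable_backTime hP.isOpen) hl (S ψ), hS ψ, ae_mem_phase hP]
    with z h1 h2 hz
  rw [h1, h2, coe_backTime, indicator_of_mem (show z ∈ {z : Vec d × Vec d | tMinus Ω z.1 z.2 < ∞}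
    from tMinus_lt_top hP.isBounded (subset_closure hz.1) hz.2.2)]

/-- The Riemann–Lebesgue lemma in the form of oscillatory integrals. -/
lemma tendsto_integral_exp_neg (g : ℝ → ℂ) :
    Tendsto (fun η : ℝ => ∫ s : ℝ, Complex.exp (-(η * Complex.I) * s) * g s) (cocompact ℝ) (𝓝 0) := by
  have h := Real.tendsto_integral_exp_smul_cocompact g
  have h2 : Tendsto (fun η : ℝ => (2 * Real.pi)⁻¹ * η) (cocompact ℝ) (cocompact ℝ) :=
    (Homeomorph.mulLeft₀ (2 * Real.pi)⁻¹ (by positivity)).isClosedEmbedding.tendsto_cocompact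
  refine (h.comp h2).congr fun η => ?_
  simp only [Function.comp_apply]
  refine integral_congr_ae (Eventually.of_forall fun s => ?_)
  simp only [Circle.smul_def, Real.fourierChar_apply, smul_eq_mul]
  congr 2
  push_cast
  have : (Real.pi : ℂ) ≠ 0 := by exact_mod_cast Real.pi_ne_zero
  field_simp

/-- The one-dimensional Riemann–Lebesgue lemma on each trajectory, then dominated convergence with
majorant G|f|. -/
lemma riemann_lebesgue_flight (hP : PhaseSpaceAssumptions Ω m)
    (hG : ∀ f, G f =ᵐ[muPlus Ω m]
      average volume (flightDens Ω) (fun q => (q.1.1 - q.2 • q.1.2, q.1.2)) f) (f : X0 Ω m) :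
    Tendsto (fun η : ℝ => G (expMul (phaseMeasure Ω m) (foreTime Ω) (η * Complex.I) f))
      (cocompact ℝ) (𝓝 0) := by
  have := sigmaFinite_muPlus hP
  have hre : ∀ η : ℝ, 0 ≤ ((η : ℂ) * Complex.I).re := fun η => by simp
  have hcg : IsCountablyGenerated (cocompact ℝ) := by
    rw [cocompact_eq_atBot_atTop]; infer_instance
  set A : ℝ → Vec d × Vec d → ℂ := fun η z =>
    ∫ s in flight Ω z.1 z.2, Complex.exp (-(η * Complex.I) * s) * f (z.1 - s • z.2, z.2) with hA
  have hAe : ∀ η : ℝ, G (expMul (phaseMeasure Ω m) (foreTime Ω) (η * Complex.I) f) =ᵐ[muPlus Ω m] A η :=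
    fun η => flight_clm_expMul hP hG (hre η) f
  rw [tendsto_zero_iff_norm_tendsto_zero]
  have e : ∀ η : ℝ, ‖G (expMul (phaseMeasure Ω m) (foreTime Ω) (η * Complex.I) f)‖ =
      ∫ z, ‖A η z‖ ∂(muPlus Ω m) := fun η => by
    rw [Lp_norm]; exact integral_congr_ae ((hAe η).fun_comp norm)
  simp only [e]
  rw [← integral_zero (Vec d × Vec d) ℝ (μ := muPlus Ω m)]
  refine tendsto_integral_filter_of_dominated_convergence
    (fun z => ‖G (absL f) z‖) (Eventually.of_forall fun η => ?_) (Eventually.of_forall fun η => ?_)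
    (Lp_int (G (absL f))).norm ?_
  · exact ((Lp.aestronglyMeasurable _).congr (hAe η)).norm
  · filter_upwards [hAe η, hG (expMul (phaseMeasure Ω m) (foreTime Ω) (η * Complex.I) f), hG (absL f),
      average_congr (measurable_flightDens hP.isOpen) (measurePreserving_backward hP)
        (expMul_coeFn (measurable_foreTime hP.isOpen) (hre η) f),
      average_congr (measurable_flightDens hP.isOpen) (measurePreserving_backward hP)
        (absL_coeFn f)] with z h1 h2 h3 h4 h5
    rw [norm_norm, ← h1, h2, h4, h3, h5]
    refine (norm_average_le _ _).trans (le_of_eq ?_)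
    have e : (fun a => ((‖Complex.exp (-(η * Complex.I) * (foreTime Ω a : ℝ)) * f a‖ : ℝ) : ℂ)) =
        fun a => ((‖f a‖ : ℝ) : ℂ) := by
      ext1 a
      rw [norm_mul, norm_exp_neg_mul]
      simp
    rw [e]
  · refine Eventually.of_forall fun z => ?_
    have h := tendsto_integral_exp_neg ((flight Ω z.1 z.2).indicator fun s => f (z.1 - s • z.2, z.2))
    rw [tendsto_zero_iff_norm_tendsto_zero] at h
    refine h.congr fun η => ?_
    simp only [hA]
    rw [← integral_indicator (measurableSet_flight _ _)]
    congr 2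
    ext1 s
    by_cases hs : s ∈ flight Ω z.1 z.2
    · rw [indicator_of_mem hs, indicator_of_mem hs]
    · rw [indicator_of_notMem hs, indicator_of_notMem hs, mul_zero]

end Realization

/-! ### Assembling the abstract model and its source. -/

section Model

variable {d : ℕ} {Ω : Set (Vec d)} {m : Measure (Vec d)} {k : Vec d → Vec d → Vec d → ℝ≥0} {p : ℕ}

lemma enorm_le_opENorm {X : Type*} [NormedAddCommGroup X] [NormedSpace ℂ X] (T : X →L[ℂ] X) :
    ‖T‖ₑ ≤ opENorm T := by
  rcases eq_or_ne (opENorm T) ∞ with h | h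
  · rw [h]; exact le_top
  · rw [← ofReal_norm, ENNReal.ofReal_le_iff_le_toReal h, ← T.sSup_unitClosedBall_eq_norm]
    refine Real.sSup_le ?_ ENNReal.toReal_nonneg
    rintro _ ⟨u, hu, rfl⟩
    simp only
    rw [← toReal_enorm]
    exact ENNReal.toReal_mono h (le_iSup₂ (f := fun u (_ : u ∈ Metric.closedBall (0 : X) 1) => ‖T u‖ₑ) u hu)

lemma measurable_weight_mul {μ : Measure (Vec d × Vec d)} (s : ℕ) (ψ : Lp ℂ 1 μ) :
    Measurable fun z => velocityWeight s z.2 * ‖ψ z‖ₑ :=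
  ((measurable_velocityWeight s).comp measurable_snd).mul (measurable_Lp_enorm ψ)

/-- A nonempty bounded set of natural numbers contains its supremum. -/
lemma gainsIntegrability_NH (hH : BoundaryAssumptions Ω m k p) :
    GainsIntegrability Ω m k (NH Ω m k + 1) :=
  Nat.sSup_mem hH.gain hH.gain_finite

/-- On a trivial L¹₊ the operator H would vanish and gain every weight, so the set defining N_H
would be unbounded. -/
lemma nontrivial_L1Plus (hH : BoundaryAssumptions Ω m k p) : Nontrivial (L1Plus Ω m) := by
  by_contra hn
  rw [not_nontrivial_iff_subsingleton] at hn
  have hz : ∀ ψ : L1Plus Ω m, ∀ᵐ z ∂(muMinus Ω m), opH Ω m k ψ z = 0 := by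
    obtain ⟨j, C, hC⟩ := hH.gain
    intro ψ
    have h := hC ψ
    rw [Subsingleton.elim ψ 0, enorm_zero, mul_zero, nonpos_iff_eq_zero, lintegral_eq_zero_iff
      (measurable_weight_mul _ _)] at h
    rw [Subsingleton.elim ψ 0]
    filter_upwards [h] with z hz
    rcases mul_eq_zero.1 hz with h0 | h0
    · exact absurd h0 (ENNReal.ofReal_pos.2 (lt_of_lt_of_le one_pos (le_max_left _ _))).ne'
    · exact enorm_eq_zero.1 h0
  obtain ⟨b, hb⟩ := hH.gain_finite
  have : b + 1 ≤ b := hb ⟨0, fun ψ => by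
    rw [lintegral_eq_zero_of_ae_eq_zero]
    · exact zero_le
    · filter_upwards [hz ψ] with z h
      rw [h, enorm_zero, mul_zero, Pi.zero_apply]⟩
  omega

variable [SigmaFinite m]

/-- The compactness condition of the abstract model. -/
lemma exists_weakly_compact (hP : PhaseSpaceAssumptions Ω m) (hH : BoundaryAssumptions Ω m k p)
    {H : L1Plus Ω m →L[ℂ] L1Minus Ω m} (hHe : ∀ ψ, H ψ = opH Ω m k ψ)
    {K : L1Plus Ω m →L[ℂ] L1Plus Ω m}
    (hK : ∀ ψ, ∀ᵐ z ∂(muPlus Ω m), K ψ z = H ψ (exitMap Ω z)) :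
    ∃ C : Set (WeakSpace ℂ (L1Plus Ω m)), IsCompact C ∧
      ∀ ψ, ‖ψ‖ ≤ 1 → toWeakSpace ℂ _ (K (K ψ)) ∈ C := by
  obtain ⟨M, hM⟩ := exists_streaming_clm hP
  -- K² = M₀(HM₀H), and the bounded operator M₀ is weakly continuous, so it maps the weakly compact
  -- set provided for HM₀H to one that serves K².
  refine ⟨WeakSpace.map M '' closure (toWeakSpace ℂ (L1Minus Ω m) ''
    ((fun ψ => opH Ω m k (opMH Ω m k 0 ψ)) '' Metric.closedBall 0 1)),
    hH.weakly_compact.image (WeakSpace.map M).continuous, fun ψ hψ => ?_⟩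
  have hKM : ∀ ψ, K ψ = M (H ψ) := fun ψ => Lp.ext (by
    filter_upwards [hK ψ, hM (H ψ)] with z h1 h2
    rw [h1, h2])
  have h0 : opMH Ω m k 0 ψ = K ψ := by
    rw [opMH_eq hP hHe hK (by simp), Kfam, expMul_zero (measurable_backTime hP.isOpen)]
    rfl
  refine ⟨toWeakSpace ℂ _ (H (K ψ)), subset_closure ⟨_, ⟨ψ, by simpa using hψ, rfl⟩, ?_⟩, ?_⟩
  · simp only [h0, hHe]
  · rw [hKM (K ψ)]; rfl

lemma iterate_opMH (hP : PhaseSpaceAssumptions Ω m)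
    {H : L1Plus Ω m →L[ℂ] L1Minus Ω m} (hHe : ∀ ψ, H ψ = opH Ω m k ψ)
    {K : L1Plus Ω m →L[ℂ] L1Plus Ω m}
    (hK : ∀ ψ, ∀ᵐ z ∂(muPlus Ω m), K ψ z = H ψ (exitMap Ω z)) {lam : ℂ} (hl : 0 ≤ lam.re) (j : ℕ) :
    (opMH Ω m k lam)^[j] = ⇑(Kfam K (backTime Ω) lam ^ j) := by
  have e : opMH Ω m k lam = ⇑(Kfam K (backTime Ω) lam) := funext (opMH_eq hP hHe hK hl)
  rw [e]
  ext1 ψ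
  exact (pow_apply_eq_iterate _ _ _).symm

/-- The transport semigroup is described by the abstract model. -/
lemma exists_transportModel (hP : PhaseSpaceAssumptions Ω m) (hH : BoundaryAssumptions Ω m k p) :
    ∃ (TK : ℕ → L1Plus Ω m →L[ℂ] L1Plus Ω m) (TS : ℕ → L1Plus Ω m →L[ℂ] X0 Ω m)
      (G : X0 Ω m →L[ℂ] L1Plus Ω m),
      TransportModel (muPlus Ω m) (phaseMeasure Ω m) (backTime Ω) (backTime Ω) (foreTime Ω) TK TS G
        (NH Ω m k) p ∧
      ∀ lam : ℂ, 0 ≤ lam.re → ∀ f j, dysonTerm Ω m k lam f j =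
        TransportModel.series (backTime Ω) (backTime Ω) (foreTime Ω) TK TS G f lam j := by
  have := sigmaFinite_muPlus hP
  obtain ⟨C, hC⟩ := gainsIntegrability_NH hH
  obtain ⟨H, hHb⟩ := exists_boundary_clm hP hH
  have hHe : ∀ ψ, H ψ = opH Ω m k ψ := fun ψ => (hHb ψ).1
  have hHa := fun ψ => (hHb ψ).2
  simp only [← hHe] at hC
  set N := NH Ω m k with hN
  have hTKe : ∀ i, ∃ T : L1Plus Ω m →L[ℂ] L1Plus Ω m, i ≤ N + 1 → ∀ ψ, ∀ᵐ z ∂(muPlus Ω m),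
      T ψ z = ((backTime Ω z : ℝ) : ℂ) ^ i * H ψ (exitMap Ω z) := fun i => by
    by_cases hi : i ≤ N + 1
    · obtain ⟨T, hT⟩ := exists_boundary_moment hP H hC hi
      exact ⟨T, fun _ => hT⟩
    · exact ⟨0, fun h => absurd h hi⟩
  have hTSe : ∀ i, ∃ T : L1Plus Ω m →L[ℂ] X0 Ω m, i ≤ N → ∀ ψ, ∀ᵐ z ∂(phaseMeasure Ω m),
      T ψ z = ((backTime Ω z : ℝ) : ℂ) ^ i * H ψ (exitMap Ω z) := fun i => by
    by_cases hi : i ≤ N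
    · obtain ⟨T, hT⟩ := exists_interior_moment hP H hC (Nat.succ_le_succ hi)
      exact ⟨T, fun _ => hT⟩
    · exact ⟨0, fun h => absurd h hi⟩
  choose TK hTK using hTKe
  choose TS hTS using hTSe
  obtain ⟨G, hG⟩ := exists_flight_clm hP
  have hK : ∀ ψ, ∀ᵐ z ∂(muPlus Ω m), TK 0 ψ z = H ψ (exitMap Ω z) := fun ψ => by
    simpa using hTK 0 (Nat.zero_le _) ψ
  have hS : ∀ ψ, ∀ᵐ z ∂(phaseMeasure Ω m), TS 0 ψ z = H ψ (exitMap Ω z) := fun ψ => by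
    simpa using hTS 0 (Nat.zero_le _) ψ
  have hre : ∀ ε : ℝ, 0 ≤ ε → ∀ η : ℝ, 0 ≤ ((ε : ℂ) + η * Complex.I).re := fun ε hε η => by simpa using hε
  refine ⟨TK, TS, G, ?_, fun lam hl f j => ?_⟩
  · exact
    { nontriv := nontrivial_L1Plus hH
      markov := isMarkov_boundary hP hH hHa hK
      meas_τ := measurable_backTime hP.isOpen
      meas_t := measurable_backTime hP.isOpen
      meas_s := measurable_foreTime hP.isOpen
      τ_pos := by
        filter_upwards [ae_mem_GammaPlus hP] with z hz
        exact (flight_outgoing hP hz).1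
      towerK := fun i hi ψ => by
        filter_upwards [hTK (i + 1) hi ψ, hTK i hi.le ψ] with z h1 h2
        rw [h1, h2, pow_succ']; ring
      towerS := fun i hi ψ => by
        filter_upwards [hTS (i + 1) hi ψ, hTS i hi.le ψ] with z h1 h2
        rw [h1, h2, pow_succ']; ring
      compact := exists_weakly_compact hP hH hHe hK
      irreducible := by
        have h := hH.irreducible
        have e : opMH Ω m k 0 = ⇑(TK 0) := by
          have h1 := iterate_opMH hP hHe hK (lam := 0) (by simp) 1
          rw [Kfam, expMul_zero (measurable_backTime hP.isOpen)] at h1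
          simpa using h1
        rwa [e] at h
      mass_G := fun h => by
        rw [intCLM_apply, intCLM_apply, integral_congr_ae (hG h)]
        exact integral_average (measurable_flightDens hP.isOpen) (measurePreserving_backward hP) (Lp_int h)
      balance := fun lam hl ψ => balance_boundary hP hH hHa hK hS hl ψ
      mean_time := fun ψ => mean_time_boundary hP
        (fun ψ => by simpa using hTK 1 (by omega) ψ) hS ψ
      riemann_lebesgue := fun h => riemann_lebesgue_flight hP hG h
      power_integrable := by
        obtain ⟨C', hC'⟩ := hH.power_integrable
        refine ⟨C', fun ε hε => (lintegral_mono fun η => ?_).trans (hC' ε hε)⟩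
        rw [iterate_opMH hP hHe hK (hre ε hε η)]
        exact enorm_le_opENorm _ }
  · rw [dysonTerm, iterate_opMH hP hHe hK hl, opG_eq hP hG hl, opXi_eq hP hHe hS hl,
      TransportModel.series]

/-- The moments of the source. -/
lemma exists_source (hP : PhaseSpaceAssumptions Ω m) {s : ℕ} {f : X0 Ω m} (hf : MemX s f)
    (hmean : ∫ z, f z ∂(phaseMeasure Ω m) = 0) :
    ∃ ft : ℕ → X0 Ω m, ft 0 = f ∧ TransportModel.Source (foreTime Ω) s ft := by
  obtain ⟨D, hD⟩ := exists_time_pow_le hP.isBounded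
  have hint : ∀ i ≤ s, Integrable (fun z => ((foreTime Ω z : ℝ) : ℂ) ^ i * f z) (phaseMeasure Ω m) := by
    intro i hi
    refine ⟨((Complex.measurable_ofReal.comp (measurable_foreTime hP.isOpen).coe_nnreal_real).pow_const i
      ).aestronglyMeasurable.mul (Lp.aestronglyMeasurable f), ?_⟩
    refine lt_of_le_of_lt (b := (D : ℝ≥0∞) ^ i * ∫⁻ z, velocityWeight s z.2 * ‖f z‖ₑ ∂(phaseMeasure Ω m))
      ?_ (ENNReal.mul_lt_top (by finiteness) hf)
    rw [← lintegral_const_mul _ (measurable_weight_mul s f)]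
    refine lintegral_mono_ae ?_
    filter_upwards [ae_mem_phase hP] with z hz
    rw [enorm_mul, enorm_pow, enorm_ofReal_nnreal]
    rw [← mul_assoc]
    exact mul_le_mul_left ((pow_le_pow_left' (coe_foreTime_le z) i).trans
      (hD i s hi z (subset_closure hz.1) hz.2.2).2) _
  have h0 : toL1 (phaseMeasure Ω m) (fun z => ((foreTime Ω z : ℝ) : ℂ) ^ 0 * f z) = f :=
    toL1_eq_of_ae (Eventually.of_forall fun z => by simp)
  refine ⟨fun i => toL1 _ fun z => ((foreTime Ω z : ℝ) : ℂ) ^ i * f z, h0, fun i hi => ?_, ?_⟩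
  · filter_upwards [toL1_coeFn (hint (i + 1) hi), toL1_coeFn (hint i hi.le)] with z h1 h2
    rw [h1, h2, pow_succ']; ring
  · rw [h0, intCLM_apply, hmean]

end Model

lemma TendstoInC0.congr {X : Type*} [NormedAddCommGroup X] [NormedSpace ℝ X] {N : ℕ}
    {h h' : ℝ → ℝ → X} {g : ℝ → X} (hh : TendstoInC0 N h g) (e : ∀ ε > 0, h ε = h' ε) :
    TendstoInC0 N h' g := by
  refine ⟨fun ε hε => e ε hε ▸ hh.1 ε hε, hh.2.1, fun j hj u hu => ?_⟩
  filter_upwards [hh.2.2 j hj u hu, self_mem_nhdsWithin] with ε h1 h2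
  rwa [← e ε h2]

end

end CollisionlessTransport

theorem theorem1p4 {d : ℕ} (Ω : Set (CollisionlessTransport.Vec d))
    (m : Measure (CollisionlessTransport.Vec d)) [SigmaFinite m]
    (k : CollisionlessTransport.Vec d → CollisionlessTransport.Vec d →
      CollisionlessTransport.Vec d → ℝ≥0) (p : ℕ)
    (hΩ : CollisionlessTransport.PhaseSpaceAssumptions Ω m)
    (hH : CollisionlessTransport.BoundaryAssumptions Ω m k p)
    (f : CollisionlessTransport.X0 Ω m)
    (hf : CollisionlessTransport.MemX (CollisionlessTransport.NH Ω m k + 1) f)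
    (hmean : ∫ z, f z ∂(CollisionlessTransport.phaseMeasure Ω m) = 0) (n : ℕ) :
    (∀ lam : ℂ, 0 < lam.re →
      Summable fun j : ℕ => CollisionlessTransport.dysonTerm Ω m k lam f (n + j)) ∧
    ∃ Ψ : ℝ → CollisionlessTransport.X0 Ω m,
      CollisionlessTransport.TendstoInC0 (CollisionlessTransport.NH Ω m k)
        (fun ε η => CollisionlessTransport.Upsilon Ω m k n (ε + η * Complex.I) f) Ψ ∧
      (2 ^ CollisionlessTransport.NH Ω m k * p ≤ n →
        ∀ j ≤ CollisionlessTransport.NH Ω m k, Integrable (iteratedDeriv j Ψ)) := by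
  have := CollisionlessTransport.sigmaFinite_muPlus hΩ
  have := CollisionlessTransport.sigmaFinite_phase (Ω := Ω) (m := m)
  obtain ⟨TK, TS, G, M, hM⟩ := CollisionlessTransport.exists_transportModel hΩ hH
  obtain ⟨ft, hft, hs⟩ := CollisionlessTransport.exists_source hΩ hf hmean
  obtain ⟨h1, Ψ, h2, h3⟩ := M.main hs n
  rw [hft] at h1 h2
  refine ⟨fun lam hl => (h1 lam hl).congr fun j => (hM lam hl.le f (n + j)).symm, Ψ, h2.congr fun ε hε => ?_, h3⟩
  ext1 η
  exact tsum_congr fun j => (hM _ (by simpa using hε.le) f (n + j)).symm
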